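/- **Theorem (Algebraic integrability).** Let $R$ be a reduced irreducible root system in a Euclidean space $V$ with scalar product $(\cdot,\cdot)$, with Weyl group $W$, a choice of positive roots $R_+$, coroots $\alpha^\vee=2\alpha/(\alpha,\alpha)$, weight lattice $P=\{\mu\in V: (\mu,\alpha^\vee)\in\mathbb Z\ \forall\alpha\in R\}$ and coweight lattice $P^\vee=\{\nu\in V: (\nu,\alpha)\in\mathbb Z\ \forall \alpha\in R\}$. Let $m=\{m_\alpha\}_{\alpha\in R}$ be $W$-invariant non-negative integers. Let $q\in\mathbb C^\times$ not be a root of unity, fix a value of $\log q$, and put $q^c=e^{c\log q}$, $[a]=q^a-q^{-a}$. The variables $x,z$ run through $V_{\mathbb C}=V\otimes\mathbb C$, to which $(\cdot,\cdot)$ is extended bilinearly, and $(T^v f)(x)=f(x+v)$. Put $\rho^\vee=\frac12\sum_{\alpha\in R_+}m_\alpha\alpha^\vee$ and $\mathcal N=\{\rho^\vee-\sum_{\alpha\in R_+}l_\alpha\alpha^\vee : l_\alpha\in\mathbb R,\ 0\le l_\alpha\le m_\alpha\}$. There is exactly one function $\psi(x,z)$ (the normalized Baker–Akhiezer function) of the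 form $$\psi(x,z)=q^{2(x,z)}\sum_{\nu\in\mathcal N\cap P^\vee}\psi_\nu(x)\,q^{2(\nu,z)},\qquad \psi_{\rho^\vee}(x)=\prod_{\alpha\in R_+}\prod_{j=1}^{m_\alpha}[j-(\alpha,x)],$$ with coefficients $\psi_\nu$ meromorphic on $V_{\mathbb C}$, such that for all $\alpha\in R$ and $s=1,\dots,m_\alpha$ $$\psi\left(x,z+\tfrac12 s\alpha\right)=\psi\left(x,z-\tfrac12 s\alpha\right)\quad\text{whenever } q^{2(\alpha^\vee,z)}=1 .$$ Let $\mathfrak R^\vee$ be the ring of all finite sums $f(z)=\sum_{\nu\in P^\vee}f_\nu q^{2(\nu,z)}$, $f_\nu\in\mathbb C$, such that for all $\alpha\in R$ and $j=1,\dots,m_\alpha$ $$f\left(z+\tfrac12 j\alpha\right)=f\left(z-\tfrac12 j\alpha\right)\quad\text{whenever } q^{2(\alpha^\vee,z)}=1 .$$ By a difference operator in $x$ on the lattice $P^\vee$ we mean a finite sum $\sum_{\nu\in P^\vee}d_\nu(x)T^\nu$ whose coefficients are quotients of finite $\mathbb C$-linear combinations of the functions $q^{2(\mu,x)}$, $\mu\in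 P$. Then: 1. For each $f\in\mathfrak R^\vee$ there is one and only one difference operator $D_f$ in $x$ on the lattice $P^\vee$ such that $D_f\psi=f(z)\psi$. 2. All the operators $D_f$, $f\in\mathfrak R^\vee$, commute. 3. Let $\pi\in P^\vee$ be minuscule ($-1\le(\pi,\alpha)\le1$ for all $\alpha\in R$) or quasiminuscule ($\pi=\beta^\vee$ for some $\beta\in R$, and $-1\le(\pi,\alpha)\le 1$ for all $\alpha\in R\setminus\{\pm\beta\}$). Then $\mathfrak m_\pi(z)=\sum_{\tau\in W\pi}q^{2(\tau,z)}$ belongs to $\mathfrak R^\vee$, and $D_{\mathfrak m_\pi}$ is the Macdonald operator $D^\pi$ with $t_\alpha=q^{k_\alpha}$, $k_\alpha=-m_\alpha$. That is, for minuscule $\pi$ $$D^\pi=\sum_{\tau\in W\pi}a_\tau T^\tau,\qquad a_\tau(x)=\prod_{\alpha\in R:\,(\alpha,\tau)>0}\frac{[k_\alpha+(\alpha,x)]}{[(\alpha,x)]},$$ and for quasiminuscule $\pi$, with $\rho_k=\frac12\sum_{\alpha\in R_+}k_\alpha\alpha$, $$D^\pi=\sum_{\tau\in W\pi}a_\tau\,(T^\tau-1)+\sum_{\tau\in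 W\pi}q^{-2(\rho_k,\tau)},\qquad a_\tau(x)=\prod_{\alpha\in R:\,(\alpha,\tau)>0}\frac{[k_\alpha+(\alpha,x)]}{[(\alpha,x)]}\prod_{\alpha\in R:\,(\alpha,\tau)=2}\frac{[k_\alpha+1+(\alpha,x)]}{[1+(\alpha,x)]}.$$ -/

import Mathlib

/-! Throughout, a reduced irreducible root system is given over `ℂ`, i.e. as a root pairing between
the complexified spaces `M ⊇ R` and `N ⊇ Rᵛ`.  The variable `x` runs through `N`, the variable `z`
through `M`, and `(x, z)` is the value `P.toLinearMap z x` of the pairing (if `M` and `N` are both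
identified with a complexified Euclidean space by an invariant scalar product, this is the bilinear
extension of that scalar product).  Complex powers of `q` are `q ^ c = exp (c * log q)` for a
fixed value `logq` of the logarithm of `q`. -/

noncomputable section

namespace BakerAkhiezer

open Module

section Meromorphic

/-- The ring of entire functions on a complex vector space. -/
def Entire (E : Type*) [NormedAddCommGroup E] [NormedSpace ℂ E] : Subalgebra ℂ (E → ℂ) where
  carrier := {f | Differentiable ℂ f}
  mul_mem' hf hg := Differentiable.mul hf hg
  add_mem' hf hg := Differentiable.add hf hg
  algebraMap_mem' c := differentiable_const c

variable {E : Type*} [NormedAddCommGroup E] [NormedSpace ℂ E]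

theorem Entire.eq_zero_or_eq_zero (f g : Entire E) (h : f * g = 0) : f = 0 ∨ g = 0 := by
  by_contra! hne
  obtain ⟨hf, hg⟩ := hne
  have hf' : ∃ a, f.1 a ≠ 0 := by
    by_contra! hc
    exact hf (Subtype.ext (funext hc))
  have hg' : ∃ a, g.1 a ≠ 0 := by
    by_contra! hc
    exact hg (Subtype.ext (funext hc))
  obtain ⟨a, ha⟩ := hf'
  obtain ⟨c, hc⟩ := hg'
  have hl : Differentiable ℂ (fun t : ℂ => a + t • (c - a)) := by fun_prop
  have h1 : Differentiable ℂ (fun t : ℂ => f.1 (a + t • (c - a))) := f.2.comp hl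
  have h2 : Differentiable ℂ (fun t : ℂ => g.1 (a + t • (c - a))) := g.2.comp hl
  have h3 := AnalyticOnNhd.eq_zero_or_eq_zero_of_mul_eq_zero (U := Set.univ)
    (fun t _ => h1.analyticAt t) (fun t _ => h2.analyticAt t)
    (fun t _ => congrFun (congrArg Subtype.val h) (a + t • (c - a))) isPreconnected_univ
  rcases h3 with h3 | h3
  · exact ha (by simpa using h3 0 trivial)
  · exact hc (by simpa using h3 1 trivial)

instance : IsDomain (Entire E) :=
  haveI : NoZeroDivisors (Entire E) := ⟨fun {f g} h => Entire.eq_zero_or_eq_zero f g h⟩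
  NoZeroDivisors.to_isDomain _

variable (E) in
/-- The field of meromorphic functions on a finite-dimensional complex vector space (every such
function is a quotient of two entire functions). -/
abbrev Mero := FractionRing (Entire E)

/-- Translation `(T^v f)(x) = f(x + v)` of entire functions. -/
def shiftEntire (v : E) : Entire E ≃ₐ[ℂ] Entire E where
  toFun f := ⟨fun x => f.1 (x + v), f.2.comp (differentiable_id.add_const v)⟩
  invFun f := ⟨fun x => f.1 (x + -v), f.2.comp (differentiable_id.add_const (-v))⟩
  left_inv f := Subtype.ext (funext fun x => by simp)
  right_inv f := Subtype.ext (funext fun x => by simp)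
  map_mul' _ _ := rfl
  map_add' _ _ := rfl
  commutes' _ := rfl

/-- The shift operator `T^v`, `(T^v f)(x) = f(x + v)`, on meromorphic functions. -/
def shift (v : E) : Mero E ≃ₐ[ℂ] Mero E :=
  IsFractionRing.algEquivOfAlgEquiv (shiftEntire v)

variable [FiniteDimensional ℂ E]

/-- The function `x ↦ q ^ (c + ℓ x)`. -/
def qExp (logq c : ℂ) (ℓ : Dual ℂ E) : Mero E :=
  algebraMap (Entire E) (Mero E)
    ⟨fun x => Complex.exp ((c + ℓ x) * logq), by
      have : Differentiable ℂ (fun x => ℓ x) := (LinearMap.toContinuousLinearMap ℓ).differentiable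
      exact ((this.const_add c).mul_const logq).cexp⟩

/-- The function `[c + ℓ x]` of `x`, where `[a] = q ^ a - q ^ (-a)`. -/
def qBracket (logq c : ℂ) (ℓ : Dual ℂ E) : Mero E :=
  qExp logq c ℓ - qExp logq (-c) (-ℓ)

end Meromorphic

/-- The number `q ^ c`. -/
def qPow (logq c : ℂ) : ℂ := Complex.exp (c * logq)

section RootSystem

variable {ι M N : Type*} [AddCommGroup M] [Module ℂ M] [AddCommGroup N] [Module ℂ N]
  (P : RootPairing ι ℂ M N)

/-- The weight lattice `P`. -/
def weightLattice : AddSubgroup M where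
  carrier := {μ | ∀ i, ∃ n : ℤ, P.toLinearMap μ (P.coroot i) = n}
  zero_mem' i := ⟨0, by simp⟩
  add_mem' {μ μ'} h h' i := by
    obtain ⟨n, hn⟩ := h i
    obtain ⟨n', hn'⟩ := h' i
    exact ⟨n + n', by simp [hn, hn']⟩
  neg_mem' {μ} h i := by
    obtain ⟨n, hn⟩ := h i
    exact ⟨-n, by simp [hn]⟩

/-- The coweight lattice `Pᵛ`. -/
def coweightLattice : AddSubgroup N where
  carrier := {ν | ∀ i, ∃ n : ℤ, P.toLinearMap (P.root i) ν = n}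
  zero_mem' i := ⟨0, by simp⟩
  add_mem' {ν ν'} h h' i := by
    obtain ⟨n, hn⟩ := h i
    obtain ⟨n', hn'⟩ := h' i
    exact ⟨n + n', by simp [hn, hn']⟩
  neg_mem' {ν} h i := by
    obtain ⟨n, hn⟩ := h i
    exact ⟨-n, by simp [hn]⟩

/-- A coweight `π` is minuscule if `-1 ≤ (π, α) ≤ 1` for all roots `α`. -/
def IsMinuscule (π : N) : Prop :=
  ∀ i, ∃ n : ℤ, P.toLinearMap (P.root i) π = n ∧ -1 ≤ n ∧ n ≤ 1

/-- A coweight `π` is quasiminuscule if it is the coroot of some root `β` and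
`-1 ≤ (π, α) ≤ 1` for all roots `α ≠ ±β`. -/
def IsQuasiminuscule (π : N) : Prop :=
  ∃ j, π = P.coroot j ∧ ∀ i, P.root i ≠ P.root j → P.root i ≠ -P.root j →
    ∃ n : ℤ, P.toLinearMap (P.root i) π = n ∧ -1 ≤ n ∧ n ≤ 1

/-- The Weyl group acting on the space `N` of the coroots. -/
def coWeyl : Subgroup (N ≃ₗ[ℂ] N) := Subgroup.closure (Set.range P.coreflection)

theorem finite_coWeyl [Finite ι] [P.IsRootSystem] : Finite (coWeyl P) := by
  have hmaps : ∀ w ∈ coWeyl P, ∀ i, w (P.coroot i) ∈ Set.range P.coroot := by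
    intro w hw
    induction hw using Subgroup.closure_induction'' with
    | one => exact fun i => ⟨i, rfl⟩
    | mem w hw =>
      obtain ⟨j, rfl⟩ := hw
      exact fun i => ⟨P.reflectionPerm j i, P.coroot_reflectionPerm j i⟩
    | inv_mem w hw =>
      obtain ⟨j, rfl⟩ := hw
      exact fun i => ⟨P.reflectionPerm j i, P.coroot_reflectionPerm j i⟩
    | mul u v _ _ hu hv =>
      intro i
      obtain ⟨k, hk⟩ := hv i
      obtain ⟨l, hl⟩ := hu k
      exact ⟨l, by rw [hl, hk]; rfl⟩
  let φ : coWeyl P → ι → Set.range P.coroot := fun w i => ⟨w.1 (P.coroot i), hmaps w.1 w.2 i⟩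
  refine Finite.of_injective φ fun u v huv => Subtype.ext ?_
  apply LinearEquiv.toLinearMap_injective
  refine LinearMap.ext_on_range (v := P.coroot) RootPairing.IsRootSystem.span_coroot_eq_top ?_
  intro i
  exact congrArg Subtype.val (congrFun huv i)

theorem finite_orbit [Finite ι] [P.IsRootSystem] (π : N) :
    (MulAction.orbit (coWeyl P) π).Finite :=
  haveI := finite_coWeyl P
  Set.finite_range _

/-- The Weyl group orbit `Wπ` of `π`. -/
def weylOrbit [Finite ι] [P.IsRootSystem] (π : N) : Finset N := (finite_orbit P π).toFinset

/-- The function `z ↦ q ^ (2 (ν, z))`. -/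
def zExp (logq : ℂ) (ν : N) : M → ℂ := fun z => qPow logq (2 * P.toLinearMap z ν)

/-- The polynomials in `z`: the finite sums `∑ f_ν q ^ (2 (ν, z))` over coweights `ν`. -/
def zPolynomials (logq : ℂ) : Submodule ℂ (M → ℂ) :=
  Submodule.span ℂ (zExp P logq '' (coweightLattice P : Set N))

theorem zExp_zero (logq : ℂ) : zExp P logq 0 = 1 := by
  funext z; simp [zExp, qPow]

theorem zExp_add (logq : ℂ) (ν ν' : N) : zExp P logq (ν + ν') = zExp P logq ν * zExp P logq ν' := by
  funext z
  simp only [zExp, qPow, Pi.mul_apply, ← Complex.exp_add, map_add]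
  congr 1
  ring

/-- The ring of the polynomials `f` in `z` such that
`f (z + j α / 2) = f (z - j α / 2)` whenever `q ^ (2 (αᵛ, z)) = 1`, for all roots `α` and
`j = 1, …, m_α`. -/
def quasiInvariants (logq : ℂ) (m : ι → ℕ) : Subalgebra ℂ (M → ℂ) where
  carrier := {f | f ∈ zPolynomials P logq ∧
    ∀ i, ∀ j : ℕ, 1 ≤ j → j ≤ m i → ∀ z : M,
      qPow logq (2 * P.toLinearMap z (P.coroot i)) = 1 →
        f (z + ((j : ℂ) / 2) • P.root i) = f (z - ((j : ℂ) / 2) • P.root i)}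
  mul_mem' {f g} hf hg := by
    refine ⟨?_, fun i j h1 h2 z hz => by
      simp only [Pi.mul_apply, hf.2 i j h1 h2 z hz, hg.2 i j h1 h2 z hz]⟩
    have h := Submodule.mul_mem_mul hf.1 hg.1
    rw [zPolynomials, Submodule.span_mul_span] at h
    refine Submodule.span_mono ?_ h
    rintro _ ⟨_, ⟨ν, hν, rfl⟩, _, ⟨ν', hν', rfl⟩, rfl⟩
    exact ⟨ν + ν', add_mem hν hν', zExp_add P logq ν ν'⟩
  add_mem' {f g} hf hg := ⟨add_mem hf.1 hg.1, fun i j h1 h2 z hz => by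
      simp only [Pi.add_apply, hf.2 i j h1 h2 z hz, hg.2 i j h1 h2 z hz]⟩
  algebraMap_mem' c := by
    refine ⟨?_, fun i j h1 h2 z hz => rfl⟩
    rw [Algebra.algebraMap_eq_smul_one, ← zExp_zero P logq]
    exact Submodule.smul_mem _ _ (Submodule.subset_span ⟨0, zero_mem _, rfl⟩)

/-- The orbit sum `𝔪_π(z) = ∑_{τ ∈ Wπ} q ^ (2 (τ, z))`. -/
def orbitSum [Finite ι] [P.IsRootSystem] (logq : ℂ) (π : N) : M → ℂ :=
  ∑ τ ∈ weylOrbit P π, zExp P logq τ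

end RootSystem

section Main

open Classical in
/-- The indices of the positive roots. -/
def posRoots {ι M N : Type*} [Fintype ι] [AddCommGroup M] [Module ℂ M] [AddCommGroup N]
    [Module ℂ N] {P : RootPairing ι ℂ M N} [P.IsReduced] (b : P.Base) : Finset ι :=
  Finset.univ.filter fun i => b.IsPos i

variable {ι M N : Type*} [Fintype ι] [AddCommGroup M] [Module ℂ M]
  [NormedAddCommGroup N] [NormedSpace ℂ N] [FiniteDimensional ℂ N]
  (P : RootPairing ι ℂ M N)

/-- The polynomials in `x`: the finite sums `∑ f_μ q ^ (2 (μ, x))` over weights `μ`. -/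
def xPolynomials (logq : ℂ) : Submodule ℂ (Mero N) :=
  Submodule.span ℂ ((fun μ => qExp logq 0 (2 • P.toLinearMap μ)) '' (weightLattice P : Set M))

/-- Quotients of two polynomials in `x`. -/
def IsRational (logq : ℂ) (r : Mero N) : Prop :=
  ∃ g ∈ xPolynomials P logq, ∃ h ∈ xPolynomials P logq, h ≠ 0 ∧ r = g / h

/-- The operator `a T^v`, `(a T^v f)(x) = a(x) f(x + v)`. -/
def term (a : Mero N) (v : N) : Module.End ℂ (Mero N) :=
  LinearMap.mulLeft ℂ a ∘ₗ (shift v).toLinearMap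

/-- Difference operators in `x` on the lattice `Pᵛ`: finite sums `∑_{ν ∈ Pᵛ} d_ν T^ν` with rational
coefficients `d_ν`. -/
def IsDifferenceOperator (logq : ℂ) (D : Module.End ℂ (Mero N)) : Prop :=
  ∃ d : N →₀ Mero N, (∀ ν ∈ d.support, ν ∈ coweightLattice P ∧ IsRational P logq (d ν)) ∧
    D = d.sum fun ν c => term c ν

variable {P} [P.IsReduced] (b : P.Base)

/-- The vector `½ ∑_{α > 0} k_α α`. -/
def rho (k : ι → ℂ) : M := (1 / 2 : ℂ) • ∑ i ∈ posRoots b, k i • P.root i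

/-- The vector `½ ∑_{α > 0} m_α αᵛ`. -/
def rhoCheck (m : ι → ℕ) : N := (1 / 2 : ℂ) • ∑ i ∈ posRoots b, (m i : ℂ) • P.coroot i

/-- The polytope of the vectors `ρᵛ - ∑_{α > 0} l_α αᵛ` with real `0 ≤ l_α ≤ m_α`. -/
def polytope (m : ι → ℕ) : Set N :=
  {ν | ∃ l : ι → ℝ, (∀ i, 0 ≤ l i ∧ l i ≤ m i) ∧
    ν = rhoCheck b m - ∑ i ∈ posRoots b, (l i : ℂ) • P.coroot i}

/-- `ψ` is the normalized Baker–Akhiezer function: for each `z`, `ψ z` is a meromorphic function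
of `x`; it has the form `ψ(x, z) = q ^ (2 (x, z)) ∑_ν c_ν(x) q ^ (2 (ν, z))`, summed over the
coweights `ν` in the polytope, it satisfies
`ψ(x, z + s α / 2) = ψ(x, z - s α / 2)` if `q ^ (2 (αᵛ, z)) = 1`, for all roots `α` and
`s = 1, …, m_α`, and the coefficient at `ν = ρᵛ` is
`∏_{α > 0} ∏_{j = 1}^{m_α} [j - (α, x)]`. -/
def IsNormalizedBakerAkhiezer (logq : ℂ) (m : ι → ℕ) (ψ : M → Mero N) : Prop :=
  (∃ c : N →₀ Mero N,
    (∀ ν ∈ c.support, ν ∈ coweightLattice P ∧ ν ∈ polytope b m) ∧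
    (∀ z, ψ z = qExp logq 0 (2 • P.toLinearMap z) * c.sum fun ν a => zExp P logq ν z • a) ∧
    c (rhoCheck b m) =
      ∏ i ∈ posRoots b, ∏ j ∈ Finset.Icc 1 (m i), qBracket logq (j : ℂ) (-P.root' i)) ∧
  ∀ i, ∀ s : ℕ, 1 ≤ s → s ≤ m i → ∀ z : M,
    qPow logq (2 * P.toLinearMap z (P.coroot i)) = 1 →
      ψ (z + ((s : ℂ) / 2) • P.root i) = ψ (z - ((s : ℂ) / 2) • P.root i)

variable (P) in
open Classical in
/-- The coefficient
`∏_{(α, τ) > 0} [k_α + (α, x)] / [(α, x)]`, where `t_α = q ^ k_α`. -/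
def coeffMinuscule (logq : ℂ) (k : ι → ℂ) (τ : N) : Mero N :=
  ∏ i with ∃ n : ℕ, 0 < n ∧ P.root' i τ = n,
    qBracket logq (k i) (P.root' i) / qBracket logq 0 (P.root' i)

variable (P) in
open Classical in
/-- The coefficient
`∏_{(α, τ) > 0} [k_α + (α, x)] / [(α, x)] ∏_{(α, τ) = 2} [k_α + 1 + (α, x)] / [1 + (α, x)]`. -/
def coeffQuasiminuscule (logq : ℂ) (k : ι → ℂ) (τ : N) : Mero N :=
  coeffMinuscule P logq k τ * ∏ i with P.root' i τ = 2,
    qBracket logq (k i + 1) (P.root' i) / qBracket logq 1 (P.root' i)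

variable (P) in
/-- The Macdonald operator `∑_{τ ∈ Wπ} a_τ T^τ` of a minuscule coweight `π`. -/
def macdonaldMinuscule [P.IsRootSystem] (logq : ℂ) (k : ι → ℂ) (π : N) : Module.End ℂ (Mero N) :=
  ∑ τ ∈ weylOrbit P π, term (coeffMinuscule P logq k τ) τ

/-- The Macdonald operator
`∑_{τ ∈ Wπ} a_τ (T^τ - 1) + ∑_{τ ∈ Wπ} q ^ (-2 (ρ_k, τ))` of a quasiminuscule coweight `π`. -/
def macdonaldQuasiminuscule [P.IsRootSystem] (logq : ℂ) (k : ι → ℂ) (π : N) :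
    Module.End ℂ (Mero N) :=
  ∑ τ ∈ weylOrbit P π,
      (term (coeffQuasiminuscule P logq k τ) τ - term (coeffQuasiminuscule P logq k τ) 0) +
    (∑ τ ∈ weylOrbit P π, qPow logq (-2 * P.toLinearMap (rho b k) τ)) • 1

end Main

end BakerAkhiezer

end

set_option linter.unusedSectionVars false

noncomputable section

namespace BakerAkhiezer

open Module

/-! ### Finitely supported measures with vanishing moments. -/

section Moments

variable {κ k : Type*} [Field k]

/-! The variable x is hidden in a field L on which characters, translations and reflections live
(`CharacterField`), so that a function of z is just a finitely supported vector of coefficients ψ_ν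
in L. Dedekind's independence of characters, applied on the hypersurface q^(2(αᵛ,z)) = 1, turns the
condition for the root α into linear relations on each string of exponents in the direction αᵛ.
These relations say that the first m_α moments of a weighted measure on the string vanish, so every
nonempty string has more than m_α points. Rotating a linear functional and adding up the strings
that it meets shows that the support of a nonzero quasi-invariant function is at least as wide as
the polytope in every direction that is nonnegative on the positive coroots (`exists_width_le`).

This width estimate carries most of the theorem. A function supported in the polytope whose
coefficient at ρᵛ vanishes is too narrow, hence zero: this is uniqueness. It also makes a division
algorithm work: the terms of maximal height of a quasi-invariant function are cancelled by a
difference operator in x applied to ψ, without creating lower terms than before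
(`IsBakerAkhiezer.exists_diffOp_eq`). Applied to f(z)ψ this gives D_f. A difference operator is
determined by its action on ψ, so the D_f are unique and commute; their coefficients are rational
because a linear projection onto the field of rational functions preserves all the defining linear
relations.

Existence uses a Macdonald-type operator in the dual variable z, built from shifts by short roots,
which preserves quasi-invariance (`exists_operator`). On leading terms in any regular direction g it
acts by explicit eigenvalues. A quasi-invariant function with the fewest terms at the smallest
possible maximal height, under a fixed lower bound, must be an eigenfunction. Equality of the
eigenvalues then fixes its extreme exponent in every regular direction, and the support lies in a
translate of the polytope (`exists_bakerAkhiezer`).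

For the Macdonald operators, the coefficients along the edges of the polytope at ρᵛ are computed
from the moments. This gives the invariance of ψ under the simultaneous action of W on x and z. The
difference of D^π and D_f has lower order, and its support is W-stable. There is no room for it if π
is minuscule, and only multiplication by a function is left if π is quasiminuscule. That function is
found at z = ρ, the half-sum of the m_α α: ψ(x,ρ) is nonzero and invariant under translations by
coroots, so both operators act on it by the same constant. The invariance expresses that ψ(x,ρ),
restricted to lines in the direction of the half-sum of coroots, has no poles even at the ends;
algebraically, it lies in every valuation ring that contains the functions invariant in this
direction (`IsBakerAkhiezer.ev_rho_mem_shiftInvariants`). -/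

theorem sum_mul_eval_eq_zero {T : Finset κ} {γ u : κ → k} {m : ℕ}
    (h : ∀ j < m, ∑ μ ∈ T, γ μ * u μ ^ j = 0) (p : Polynomial k) (hp : p.natDegree < m) :
    ∑ μ ∈ T, γ μ * p.eval (u μ) = 0 := by
  simp_rw [Polynomial.eval_eq_sum_range, Finset.mul_sum]
  rw [Finset.sum_comm]
  refine Finset.sum_eq_zero fun j hj => ?_
  have := h j (by have := Finset.mem_range.1 hj; omega)
  calc ∑ μ ∈ T, γ μ * (p.coeff j * u μ ^ j) = p.coeff j * ∑ μ ∈ T, γ μ * u μ ^ j := by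
        rw [Finset.mul_sum]; exact Finset.sum_congr rfl fun _ _ => by ring
    _ = 0 := by rw [this, mul_zero]

open Classical in
/-- If the moments of order less than `m` of a nonzero measure vanish, its support has more than
`m` points. -/
theorem lt_card_of_moments {T : Finset κ} {γ u : κ → k} {m : ℕ}
    (h : ∀ j < m, ∑ μ ∈ T, γ μ * u μ ^ j = 0)
    (hu : Set.InjOn u T) {μ : κ} (hμ : μ ∈ T) (hγ : γ μ ≠ 0) :
    m < (T.filter fun μ => γ μ ≠ 0).card := by
  by_contra! hc
  set T' := T.filter fun μ => γ μ ≠ 0 with hT'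
  have hμ' : μ ∈ T' := by simp [hT', hμ, hγ]
  have h' : ∀ j < m, ∑ μ ∈ T', γ μ * u μ ^ j = 0 := by
    intro j hj
    rw [← h j hj]
    refine Finset.sum_subset (Finset.filter_subset _ _) fun x hx hx' => ?_
    have : γ x = 0 := by simpa [hT', hx] using hx'
    rw [this, zero_mul]
  -- This polynomial has degree one less than the size of the support and vanishes at all nodes of
  -- the support except u μ, so pairing it with the measure isolates γ μ.
  let p : Polynomial k := ∏ ν ∈ T'.erase μ, (Polynomial.X - Polynomial.C (u ν))
  have hp : p.natDegree < m := by
    rw [Polynomial.natDegree_prod_of_monic _ _ (fun _ _ => Polynomial.monic_X_sub_C _)]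
    have := Finset.card_erase_lt_of_mem hμ'
    simp only [Polynomial.natDegree_X_sub_C, Finset.sum_const, smul_eq_mul, mul_one]
    omega
  have hs := sum_mul_eval_eq_zero h' p hp
  rw [Finset.sum_eq_single_of_mem μ hμ'] at hs
  · rcases mul_eq_zero.1 hs with hs | hs
    · exact hγ hs
    · rw [Polynomial.eval_prod, Finset.prod_eq_zero_iff] at hs
      obtain ⟨ν, hν, h0⟩ := hs
      simp only [Polynomial.eval_sub, Polynomial.eval_X, Polynomial.eval_C, sub_eq_zero] at h0
      have hν' := Finset.mem_erase.1 hν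
      exact hν'.1 (hu (Finset.mem_filter.1 hν'.2).1 hμ h0.symm)
  · intro ν hν hne
    have : p.eval (u ν) = 0 := by
      rw [Polynomial.eval_prod]
      exact Finset.prod_eq_zero (Finset.mem_erase.2 ⟨hne, hν⟩) (by simp)
    rw [this, mul_zero]

open Classical in
-- With at most m + 1 nodes, the polynomial that vanishes at all nodes but two has degree less than
-- m. Its pairing with the measure is a relation between two weights; this later gives the
-- coefficients along an edge.
theorem moments_two_term {T : Finset κ} {γ u : κ → k} {m : ℕ}
    (h : ∀ j < m, ∑ μ ∈ T, γ μ * u μ ^ j = 0) {μ μ' : κ} (hμ : μ ∈ T) (hμ' : μ' ∈ T)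
    (hne : μ ≠ μ') (hT : T.card ≤ m + 1) :
    γ μ * ∏ ν ∈ (T.erase μ).erase μ', (u μ - u ν) +
      γ μ' * ∏ ν ∈ (T.erase μ).erase μ', (u μ' - u ν) = 0 := by
  let p : Polynomial k := ∏ ν ∈ (T.erase μ).erase μ', (Polynomial.X - Polynomial.C (u ν))
  have hm' : μ' ∈ T.erase μ := Finset.mem_erase.2 ⟨hne.symm, hμ'⟩
  have hp : p.natDegree < m := by
    rw [Polynomial.natDegree_prod_of_monic _ _ (fun _ _ => Polynomial.monic_X_sub_C _)]
    have h1 := Finset.card_erase_add_one hμ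
    have h2 := Finset.card_erase_add_one hm'
    simp only [Polynomial.natDegree_X_sub_C, Finset.sum_const, smul_eq_mul, mul_one]
    omega
  have hs := sum_mul_eval_eq_zero h p hp
  have hz : ∀ ν ∈ (T.erase μ).erase μ', γ ν * p.eval (u ν) = 0 := by
    intro ν hν
    have : p.eval (u ν) = 0 := by
      rw [Polynomial.eval_prod]
      exact Finset.prod_eq_zero hν (by simp)
    rw [this, mul_zero]
  rw [← Finset.add_sum_erase _ _ hμ, ← Finset.add_sum_erase _ _ hm',
    Finset.sum_eq_zero hz, add_zero] at hs
  simpa [p, Polynomial.eval_prod] using hs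

/-- The functions Yˢ - Y⁻ˢ with 1 ≤ s ≤ m span the same space as (Y - Y⁻¹)(Y + Y⁻¹)ʲ with j < m.
Antisymmetric relations are therefore moment relations in the node Y + Y⁻¹. -/
theorem moments_of_brackets {T : Finset κ} {γ Y : κ → k} {m : ℕ} (hY : ∀ μ, Y μ ≠ 0)
    (h : ∀ s, 1 ≤ s → s ≤ m → ∑ μ ∈ T, γ μ * (Y μ ^ s - (Y μ)⁻¹ ^ s) = 0) :
    ∀ j < m, ∑ μ ∈ T, (γ μ * (Y μ - (Y μ)⁻¹)) * (Y μ + (Y μ)⁻¹) ^ j = 0 := by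
  -- The induction on j needs all s at once, since multiplication by Y + Y⁻¹ replaces s by s ± 1;
  -- the range s + j ≤ m leaves room for this.
  have key : ∀ j s, 1 ≤ s → s + j ≤ m →
      ∑ μ ∈ T, γ μ * ((Y μ ^ s - (Y μ)⁻¹ ^ s) * (Y μ + (Y μ)⁻¹) ^ j) = 0 := by
    intro j
    induction j with
    | zero => intro s h1 h2; simpa using h s h1 (by omega)
    | succ j ih =>
      intro s h1 h2
      obtain ⟨s, rfl⟩ : ∃ t, s = t + 1 := ⟨s - 1, by omega⟩
      have e : ∀ μ, (Y μ ^ (s + 1) - (Y μ)⁻¹ ^ (s + 1)) * (Y μ + (Y μ)⁻¹) ^ (j + 1) =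
          (Y μ ^ (s + 2) - (Y μ)⁻¹ ^ (s + 2)) * (Y μ + (Y μ)⁻¹) ^ j +
          (Y μ ^ s - (Y μ)⁻¹ ^ s) * (Y μ + (Y μ)⁻¹) ^ j := by
        intro μ
        have h0 : Y μ * (Y μ)⁻¹ = 1 := mul_inv_cancel₀ (hY μ)
        generalize (Y μ)⁻¹ = Z at *
        generalize Y μ = W at *
        linear_combination (W + Z) ^ j * (W ^ s - Z ^ s) * h0
      simp_rw [e, mul_add, Finset.sum_add_distrib]
      rw [ih (s + 2) (by omega) (by omega), zero_add]
      rcases Nat.eq_zero_or_pos s with rfl | hs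
      · simp
      · exact ih s hs (by omega)
  intro j hj
  simpa [mul_assoc] using key j 1 le_rfl (by omega)

end Moments

/-! ### Width of a finite set with long strings. -/

section Width

open Classical in
theorem exists_string_ends {V : Type*} [AddCommGroup V] (h : V →+ ℝ) {S : Finset V} {a p : V}
    {n : ℕ} (ha : 0 < h a)
    (hstr : n < (S.filter fun p' => p' - p ∈ AddSubgroup.zmultiples a).card) :
    ∃ k l : ℤ, p + k • a ∈ S ∧ p + l • a ∈ S ∧ (n : ℝ) * h a ≤ h (p + l • a) - h (p + k • a) := by
  set T := S.filter fun p' => p' - p ∈ AddSubgroup.zmultiples a with hT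
  have hex : ∀ p' ∈ T, ∃ k : ℤ, p' = p + k • a := by
    intro p' hp'
    obtain ⟨k, hk⟩ := AddSubgroup.mem_zmultiples_iff.1 (Finset.mem_filter.1 hp').2
    exact ⟨k, by rw [hk]; abel⟩
  choose! f hf using hex
  have hinj : Set.InjOn f T := fun x hx y hy hxy => by rw [hf x hx, hf y hy, hxy]
  have hcard : n < (T.image f).card := by rwa [Finset.card_image_of_injOn hinj]
  have hne : (T.image f).Nonempty := Finset.card_pos.1 (by omega)
  obtain ⟨x, hx, hxk⟩ := Finset.mem_image.1 (Finset.min'_mem _ hne)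
  obtain ⟨y, hy, hyl⟩ := Finset.mem_image.1 (Finset.max'_mem _ hne)
  refine ⟨f x, f y, ?_, ?_, ?_⟩
  · rw [← hf x hx]; exact (Finset.mem_filter.1 hx).1
  · rw [← hf y hy]; exact (Finset.mem_filter.1 hy).1
  · have hsub : T.image f ⊆ Finset.Icc (f x) (f y) := by
      intro k hk
      rw [Finset.mem_Icc, hxk, hyl]
      exact ⟨Finset.min'_le _ _ hk, Finset.le_max' _ _ hk⟩
    have hc := Finset.card_le_card hsub
    rw [Int.card_Icc] at hc
    have : (n : ℤ) ≤ f y - f x := by omega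
    have h3 : (n : ℝ) ≤ f y - f x := by exact_mod_cast this
    rw [map_add, map_add, map_zsmul, map_zsmul, zsmul_eq_mul, zsmul_eq_mul]
    nlinarith

open Classical in
/-- If every string in direction `a j` that meets the finite set `S` has more than `n j` points,
then the width of `S` is at least that of the zonotope with the edges `n j • a j`. -/
theorem width_le {V κ : Type*} [AddCommGroup V] (h g : V →+ ℝ) {S : Finset V} (hS : S.Nonempty)
    (J : Finset κ) (a : κ → V) (n : κ → ℕ) (ha : ∀ j ∈ J, 0 < h (a j))
    (hinj : ∀ i ∈ J, ∀ j ∈ J, i ≠ j → g (a i) * h (a j) ≠ g (a j) * h (a i))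
    (hstr : ∀ j ∈ J, ∀ p ∈ S,
      n j < (S.filter fun p' => p' - p ∈ AddSubgroup.zmultiples (a j)).card) :
    ∃ p₀ ∈ S, ∃ p ∈ S, ∑ j ∈ J, n j * h (a j) ≤ h p - h p₀ := by
  -- The slope at which s h + g is constant along the direction a j.
  let t : κ → ℝ := fun j => -(g (a j) / h (a j))
  -- The h-value of a maximizer of s h + g does not decrease as the slope s grows.
  have hmono : ∀ t₁ t₂ : ℝ, t₁ < t₂ → ∀ p q : V, t₁ * h q + g q ≤ t₁ * h p + g p →
      t₂ * h p + g p ≤ t₂ * h q + g q → h p ≤ h q := by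
    intro t₁ t₂ ht p q h1 h2
    nlinarith
  -- The slope s sweeps past the critical values in increasing order. The point p records the height
  -- already gained: every maximizer at a later slope is at least as high as p.
  suffices H : ∀ J' : Finset κ, J' ⊆ J → ∃ p₀ ∈ S, ∃ p ∈ S, ∑ j ∈ J', n j * h (a j) ≤ h p - h p₀ ∧
      ∀ s : ℝ, (∀ j ∈ J', t j < s) → ∀ q ∈ S, (∀ q' ∈ S, s * h q' + g q' ≤ s * h q + g q) →
        h p ≤ h q by
    obtain ⟨p₀, h0, p, hp, h1, -⟩ := H J subset_rfl
    exact ⟨p₀, h0, p, hp, h1⟩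
  intro J'
  induction J' using Finset.induction_on_max_value t with
  | empty =>
    intro _
    obtain ⟨p, hp, hmin⟩ := Finset.exists_min_image S h hS
    exact ⟨p, hp, p, hp, by simp, fun s _ q hq _ => hmin q hq⟩
  | insert j J' hj hmax ih =>
    intro hJ
    have hjJ : j ∈ J := hJ (Finset.mem_insert_self _ _)
    obtain ⟨p₀, h0, p, hp, h1, h2⟩ := ih fun i hi => hJ (Finset.mem_insert_of_mem hi)
    have hlt : ∀ i ∈ J', t i < t j := by
      intro i hi
      refine lt_of_le_of_ne (hmax i hi) fun he => ?_
      have hiJ : i ∈ J := hJ (Finset.mem_insert_of_mem hi)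
      refine hinj i hiJ j hjJ (fun hij => hj (hij ▸ hi)) ?_
      have h3 := (ha i hiJ).ne'
      have h4 := (ha j hjJ).ne'
      simp only [t, neg_inj] at he
      field_simp at he
      linarith
    obtain ⟨q, hq, hqm⟩ := Finset.exists_max_image S (fun v => t j * h v + g v) hS
    have hzero : t j * h (a j) + g (a j) = 0 := by
      have h4 := (ha j hjJ).ne'
      simp only [t]
      field_simp
      ring
    have hstr' : ∀ k : ℤ, t j * h (q + k • a j) + g (q + k • a j) = t j * h q + g q := by
      intro k
      simp only [map_add, map_zsmul, zsmul_eq_mul]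
      linear_combination (k : ℝ) * hzero
    -- At the critical slope the whole string through a maximizer consists of maximizers. Its lower
    -- end is compared with the old p, and its upper end is the new p.
    obtain ⟨k, l, hk, hl, hkl⟩ := exists_string_ends h (ha j hjJ) (hstr j hjJ q hq)
    refine ⟨p₀, h0, q + l • a j, hl, ?_, ?_⟩
    · rw [Finset.sum_insert hj]
      have := h2 (t j) hlt (q + k • a j) hk fun q' hq' => by rw [hstr']; exact hqm q' hq'
      linarith
    · intro s hs q' hq' hmax'
      exact hmono (t j) s (hs j (Finset.mem_insert_self _ _)) _ _
        (by rw [hstr']; exact hqm q' hq') (hmax' _ hl)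

end Width

end BakerAkhiezer

end

noncomputable section

namespace BakerAkhiezer

open Module

/-! ### Powers of q and the exponentials in z. -/

section QPow

variable (logq : ℂ)

theorem qPow_zero : qPow logq 0 = 1 := by simp [qPow]

theorem qPow_add (a c : ℂ) : qPow logq (a + c) = qPow logq a * qPow logq c := by
  simp [qPow, add_mul, Complex.exp_add]

theorem qPow_ne_zero (a : ℂ) : qPow logq a ≠ 0 := Complex.exp_ne_zero _

theorem qPow_neg (a : ℂ) : qPow logq (-a) = (qPow logq a)⁻¹ := by
  simp [qPow, Complex.exp_neg]

theorem qPow_natCast_mul (n : ℕ) (a : ℂ) : qPow logq (n * a) = qPow logq a ^ n := by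
  simp [qPow, ← Complex.exp_nat_mul, mul_assoc]

theorem qPow_intCast_mul (n : ℤ) (a : ℂ) : qPow logq (n * a) = qPow logq a ^ n := by
  simp [qPow, ← Complex.exp_int_mul, mul_assoc]

variable {logq}

theorem logq_ne_zero (hq : ∀ n : ℤ, qPow logq n = 1 → n = 0) : logq ≠ 0 := by
  rintro rfl
  exact one_ne_zero (hq 1 (by simp [qPow]))

theorem exists_qPow_ne_one (hq : ∀ n : ℤ, qPow logq n = 1 → n = 0) {a : ℂ} (ha : a ≠ 0) :
    ∃ t : ℂ, qPow logq (t * a) ≠ 1 := by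
  refine ⟨a⁻¹, fun h => one_ne_zero (hq 1 ?_)⟩
  simpa [inv_mul_cancel₀ ha] using h

theorem countable_setOf_qPow_eq (hq : ∀ n : ℤ, qPow logq n = 1 → n = 0) {a : ℂ} (ha : a ≠ 0)
    (c c' : ℂ) : {t : ℂ | qPow logq (c + t * a) = c'}.Countable := by
  have hl := logq_ne_zero hq
  by_cases h : ∃ t₀, qPow logq (c + t₀ * a) = c'
  · obtain ⟨t₀, h0⟩ := h
    refine (Set.countable_range fun n : ℤ => t₀ + n * (2 * Real.pi * Complex.I) / (a * logq)).mono ?_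
    intro t ht
    rw [Set.mem_ofPred_eq, ← h0, qPow, qPow, Complex.exp_eq_exp_iff_exists_int] at ht
    obtain ⟨n, hn⟩ := ht
    refine ⟨n, ?_⟩
    field_simp
    linear_combination -hn
  · push Not at h
    have : {t : ℂ | qPow logq (c + t * a) = c'} = ∅ := Set.eq_empty_of_forall_notMem h
    rw [this]
    exact Set.countable_empty

end QPow

section ZExp

variable {ι M N : Type*} [AddCommGroup M] [Module ℂ M] [AddCommGroup N] [Module ℂ N]
  (P : RootPairing ι ℂ M N) (logq : ℂ)

theorem zExp_apply_zero (ν : N) : zExp P logq ν 0 = 1 := by simp [zExp, qPow]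

theorem zExp_apply_add (ν : N) (z w : M) :
    zExp P logq ν (z + w) = zExp P logq ν z * zExp P logq ν w := by
  simp [zExp, ← qPow_add, mul_add]

theorem zExp_ne_zero (ν : N) (z : M) : zExp P logq ν z ≠ 0 := qPow_ne_zero _ _

theorem zExp_apply_neg (ν : N) (z : M) : zExp P logq ν (-z) = (zExp P logq ν z)⁻¹ := by
  refine eq_inv_of_mul_eq_one_left ?_
  rw [← zExp_apply_add, neg_add_cancel,
    zExp_apply_zero]

theorem zExp_apply_sub (ν : N) (z w : M) :
    zExp P logq ν (z - w) = zExp P logq ν z * (zExp P logq ν w)⁻¹ := by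
  rw [sub_eq_add_neg, zExp_apply_add, zExp_apply_neg]

theorem zExp_add_apply (ν ν' : N) (z : M) :
    zExp P logq (ν + ν') z = zExp P logq ν z * zExp P logq ν' z := by
  rw [zExp_add]; rfl

theorem zExp_neg (ν : N) (z : M) : zExp P logq (-ν) z = (zExp P logq ν z)⁻¹ := by
  refine eq_inv_of_mul_eq_one_left ?_
  rw [← zExp_add_apply, neg_add_cancel,
    zExp_zero, Pi.one_apply]

theorem zExp_sub (ν ν' : N) (z : M) :
    zExp P logq (ν - ν') z = zExp P logq ν z * (zExp P logq ν' z)⁻¹ := by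
  rw [sub_eq_add_neg, zExp_add_apply, zExp_neg]

theorem zExp_zsmul (k : ℤ) (ν : N) (z : M) :
    zExp P logq (k • ν) z = zExp P logq ν z ^ k := by
  rw [zExp, zExp, ← qPow_intCast_mul, ← Int.cast_smul_eq_zsmul ℂ k ν, map_smul, smul_eq_mul]
  congr 1
  ring

theorem zExp_half_smul_root (ν : N) (i : ι) (s : ℕ) :
    zExp P logq ν (((s : ℂ) / 2) • P.root i) = qPow logq (P.toLinearMap (P.root i) ν) ^ s := by
  rw [zExp, ← qPow_natCast_mul, map_smul, LinearMap.smul_apply, smul_eq_mul]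
  congr 1
  ring

variable {logq}

theorem eq_zero_of_zExp_eq_one (hq : ∀ n : ℤ, qPow logq n = 1 → n = 0) {ν : N}
    (h : ∀ z, zExp P logq ν z = 1) : ν = 0 := by
  by_contra hν
  have : ∃ z, P.toLinearMap z ν ≠ 0 := by
    by_contra! hc
    refine hν (P.toLinearMap.flip.toPerfPair.injective ?_)
    ext z
    simpa using hc z
  obtain ⟨z, hz⟩ := this
  obtain ⟨t, ht⟩ := exists_qPow_ne_one hq (a := 2 * P.toLinearMap z ν) (by simpa using hz)
  refine ht ?_
  have := h (t • z)
  rw [zExp, map_smul, LinearMap.smul_apply, smul_eq_mul] at this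
  rw [← this]
  congr 1
  ring

/-- A coweight whose character is trivial on the kernel of the character of a coroot is a multiple
of this coroot. -/
theorem mem_zmultiples_of_zExp_eq_one (hq : ∀ n : ℤ, qPow logq n = 1 → n = 0) {i : ι} {κ : N}
    (h : ∀ z, zExp P logq (P.coroot i) z = 1 → zExp P logq κ z = 1) :
    κ ∈ AddSubgroup.zmultiples (P.coroot i) := by
  have hl := logq_ne_zero hq
  have h2 := P.root_coroot_two i
  set c : ℂ := P.toLinearMap (P.root i) κ / 2 with hc
  have hker : ∀ z, P.toLinearMap z (P.coroot i) = 0 → P.toLinearMap z κ = 0 := by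
    intro z hz
    by_contra hne
    obtain ⟨t, ht⟩ := exists_qPow_ne_one hq (a := 2 * P.toLinearMap z κ) (by simpa using hne)
    refine ht ?_
    have := h (t • z) (by simp [zExp, hz, qPow])
    rw [zExp, map_smul, LinearMap.smul_apply, smul_eq_mul] at this
    rw [← this]
    congr 1
    ring
  have hκ : κ = c • P.coroot i := by
    refine P.toLinearMap.flip.toPerfPair.injective ?_
    ext z
    have := hker (z - (P.toLinearMap z (P.coroot i) / 2) • P.root i) (by simp [h2])
    simp only [map_sub, map_smul, LinearMap.sub_apply, LinearMap.smul_apply, smul_eq_mul] at this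
    simp [hc]
    linear_combination this
  -- At this point (αᵛ, z) = πi / log q, so q^(2(αᵛ,z)) = exp(2πi) = 1. The hypothesis on κ = c αᵛ
  -- then reads exp(2πi c) = 1 and makes c an integer.
  have hz := h ((Real.pi * Complex.I / (2 * logq)) • P.root i) (by
    simp only [zExp, qPow, map_smul, LinearMap.smul_apply, smul_eq_mul, h2]
    rw [← Complex.exp_two_pi_mul_I]
    congr 1
    field_simp)
  rw [hκ] at hz
  simp only [zExp, qPow, map_smul, LinearMap.smul_apply, smul_eq_mul, h2] at hz
  rw [Complex.exp_eq_one_iff] at hz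
  obtain ⟨n, hn⟩ := hz
  have hcn : c = n := by
    have hpi : (Real.pi : ℂ) ≠ 0 := by exact_mod_cast Real.pi_ne_zero
    have e : 2 * (c * (Real.pi * Complex.I / (2 * logq) * 2)) * logq =
      c * (2 * Real.pi * Complex.I) := by field_simp
    rw [e] at hn
    exact mul_right_cancel₀ Complex.two_pi_I_ne_zero hn
  refine AddSubgroup.mem_zmultiples_iff.2 ⟨n, ?_⟩
  rw [hκ, hcn, Int.cast_smul_eq_zsmul]

theorem zExp_eq_one_of_mem_zmultiples {i : ι} {κ : N}
    (h : κ ∈ AddSubgroup.zmultiples (P.coroot i)) {z : M}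
    (hz : zExp P logq (P.coroot i) z = 1) : zExp P logq κ z = 1 := by
  obtain ⟨k, rfl⟩ := AddSubgroup.mem_zmultiples_iff.1 h
  rw [zExp_zsmul, hz, one_zpow]

end ZExp

/-! ### Abstract fields of functions of x and independence of characters. -/

section CharacterField

/-- A field of functions of `x` that contains the characters `X v = q ^ (2 (v, x))` and on which
the translations and the reflections of `N` act. -/
structure CharacterField {ι M N : Type*} [AddCommGroup M] [Module ℂ M] [AddCommGroup N]
    [Module ℂ N] (P : RootPairing ι ℂ M N) (logq : ℂ) (L : Type*) [Field L] [Algebra ℂ L] where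
  /-- The character `q ^ (2 (v, x))`. -/
  X : M → L
  X_zero : X 0 = 1
  X_add : ∀ u v, X (u + v) = X u * X v
  /-- The translations. -/
  T : N → L ≃ₐ[ℂ] L
  T_zero : ∀ f, T 0 f = f
  T_add : ∀ u v f, T (u + v) f = T u (T v f)
  T_X : ∀ v u, T v (X u) = zExp P logq v u • X u
  /-- The reflections. -/
  σ : ι → L ≃ₐ[ℂ] L
  σ_X : ∀ i v, σ i (X v) = X (P.reflection i v)
  σ_T : ∀ i v f, σ i (T v f) = T (P.coreflection i v) (σ i f)
  σ_σ : ∀ i f, σ i (σ i f) = f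

variable {ι M N L : Type*} [AddCommGroup M] [Module ℂ M] [AddCommGroup N] [Module ℂ N]
  {P : RootPairing ι ℂ M N} {logq : ℂ} [Field L] [Algebra ℂ L]
  (F : CharacterField P logq L)

namespace CharacterField

theorem X_ne_zero (v : M) : F.X v ≠ 0 := by
  intro h
  have := F.X_add v (-v)
  rw [add_neg_cancel, F.X_zero, h, zero_mul] at this
  exact one_ne_zero this

theorem X_neg (v : M) : F.X (-v) = (F.X v)⁻¹ := by
  refine eq_inv_of_mul_eq_one_left ?_
  rw [← F.X_add, neg_add_cancel, F.X_zero]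

theorem X_sub (u v : M) : F.X (u - v) = F.X u * (F.X v)⁻¹ := by
  rw [sub_eq_add_neg, F.X_add, F.X_neg]

theorem X_nsmul (n : ℕ) (v : M) : F.X (n • v) = F.X v ^ n := by
  induction n with
  | zero => simp [F.X_zero]
  | succ n ih => rw [succ_nsmul, F.X_add, ih, pow_succ]

theorem X_zsmul (n : ℤ) (v : M) : F.X (n • v) = F.X v ^ n := by
  obtain ⟨n, rfl | rfl⟩ := n.eq_nat_or_neg
  · simp [F.X_nsmul]
  · simp [F.X_neg, F.X_nsmul]

theorem X_half_smul (s : ℕ) (v : M) : F.X (((s : ℂ) / 2) • v) = F.X ((1 / 2 : ℂ) • v) ^ s := by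
  rw [← F.X_nsmul, ← Nat.cast_smul_eq_nsmul ℂ, smul_smul]
  congr 2
  ring

/-- A suitable translation multiplies X v by a number other than 1, but it fixes the constants. -/
theorem X_ne_algebraMap (hq : ∀ n : ℤ, qPow logq n = 1 → n = 0) {v : M} (hv : v ≠ 0) (a : ℂ) :
    F.X v ≠ algebraMap ℂ L a := by
  intro h
  have : ∃ n, P.toLinearMap v n ≠ 0 := by
    by_contra! hc
    refine hv (P.toLinearMap.toPerfPair.injective ?_)
    ext n
    simpa using hc n
  obtain ⟨n, hn⟩ := this
  obtain ⟨t, ht⟩ := exists_qPow_ne_one hq (a := 2 * P.toLinearMap v n) (by simpa using hn)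
  have h1 := F.T_X (t • n) v
  have h2 : F.T (t • n) (F.X v) = F.X v := by rw [h]; exact (F.T (t • n)).commutes a
  rw [h2, Algebra.smul_def] at h1
  have h3 : algebraMap ℂ L (zExp P logq (t • n) v) = 1 :=
    mul_right_cancel₀ (F.X_ne_zero v) (by rw [← h1, one_mul])
  have h4 : zExp P logq (t • n) v = 1 :=
    (algebraMap ℂ L).injective (by rw [h3, map_one])
  refine ht ?_
  rw [zExp, map_smul, smul_eq_mul] at h4
  rw [← h4]
  congr 1
  ring

/-- The function `z ↦ q ^ (2 (x, z)) ∑ c_ν q ^ (2 (ν, z))`. -/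
def ev (c : N →₀ L) (z : M) : L := F.X z * c.sum fun ν a => zExp P logq ν z • a

theorem ev_eq_sum {c : N →₀ L} {S : Finset N} (hS : c.support ⊆ S) (z : M) :
    F.ev c z = F.X z * ∑ ν ∈ S, zExp P logq ν z • c ν := by
  rw [ev, Finsupp.sum]
  congr 1
  refine Finset.sum_subset hS fun ν _ hν => ?_
  rw [Finsupp.notMem_support_iff.1 hν, smul_zero]

theorem ev_add (c d : N →₀ L) : F.ev (c + d) = F.ev c + F.ev d := by
  funext z
  rw [Pi.add_apply, ev, ev, ev, Finsupp.sum_add_index' (by simp) (by simp), mul_add]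

theorem ev_smul (a : L) (c : N →₀ L) (z : M) : F.ev (a • c) z = a * F.ev c z := by
  rw [ev, ev, Finsupp.sum_smul_index' (by simp), Finsupp.sum, Finsupp.sum, Finset.mul_sum,
    Finset.mul_sum, Finset.mul_sum]
  refine Finset.sum_congr rfl fun _ _ => ?_
  simp only [Algebra.smul_def, Algebra.algebraMap_self, RingHom.id_apply]
  ring

/-- `ev` as a linear map. -/
def evLin : (N →₀ L) →ₗ[L] (M → L) where
  toFun := F.ev
  map_add' := F.ev_add
  map_smul' a c := funext fun z => by simp [F.ev_smul]

@[simp] theorem evLin_apply (c : N →₀ L) : F.evLin c = F.ev c := rfl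

theorem ev_sub (c d : N →₀ L) : F.ev (c - d) = F.ev c - F.ev d := F.evLin.map_sub c d

theorem ev_zero : F.ev 0 = 0 := F.evLin.map_zero

theorem ev_single (ν : N) (a : L) (z : M) :
    F.ev (Finsupp.single ν a) z = F.X z * zExp P logq ν z • a := by
  rw [ev, Finsupp.sum_single_index (by simp)]

/-- The functions of the form `q ^ (2 (x, z)) ∑ c_ν q ^ (2 (ν, z))` with `ν ∈ S`. -/
def funs (S : Set N) : Submodule L (M → L) := (Finsupp.supported L L S).map F.evLin

theorem mem_funs {S : Set N} {f : M → L} :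
    f ∈ F.funs S ↔ ∃ c : N →₀ L, (∀ ν ∈ c.support, ν ∈ S) ∧ F.ev c = f := by
  rw [funs, Submodule.mem_map]
  rfl

section Strings

open Classical

/-- Independence of the characters `q ^ (2 (ν, z))` on the subgroup `q ^ (2 (αᵛ, z)) = 1`. -/
theorem string_sums_iff (hq : ∀ n : ℤ, qPow logq n = 1 → n = 0) (i : ι) (S : Finset N)
    (d : N → L) :
    (∀ w, zExp P logq (P.coroot i) w = 1 → ∑ μ ∈ S, zExp P logq μ w • d μ = 0) ↔
      ∀ ν, ∑ μ ∈ S.filter (fun μ => μ - ν ∈ AddSubgroup.zmultiples (P.coroot i)), d μ = 0 := by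
  let H : AddSubgroup M :=
    { carrier := {w | zExp P logq (P.coroot i) w = 1}
      zero_mem' := zExp_apply_zero P logq _
      add_mem' := fun {a c} ha hc => by
        rw [Set.mem_ofPred_eq] at *
        rw [zExp_apply_add, ha, hc, one_mul]
      neg_mem' := fun {a} ha => by
        rw [Set.mem_ofPred_eq] at *
        rw [zExp_apply_neg, ha, inv_one] }
  -- Exponents are regarded as characters of the subgroup with values in L. By
  -- `mem_zmultiples_of_zExp_eq_one` two of them coincide exactly when the exponents lie on one
  -- string, so Dedekind's theorem separates the strings.
  let θ : N → (Multiplicative H →* L) := fun μ =>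
    { toFun := fun w => algebraMap ℂ L (zExp P logq μ w.toAdd.1)
      map_one' := by simp [zExp_apply_zero]
      map_mul' := fun a c => by simp [zExp_apply_add] }
  have hθ : ∀ μ ν, θ μ = θ ν ↔ μ - ν ∈ AddSubgroup.zmultiples (P.coroot i) := by
    intro μ ν
    constructor
    · intro h
      refine mem_zmultiples_of_zExp_eq_one P hq fun z hz => ?_
      have := DFunLike.congr_fun h (Multiplicative.ofAdd ⟨z, hz⟩)
      have h2 : zExp P logq μ z = zExp P logq ν z := (algebraMap ℂ L).injective this
      rw [zExp_sub, h2, mul_inv_cancel₀ (zExp_ne_zero P logq ν z)]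
    · intro h
      refine MonoidHom.ext fun w => ?_
      change algebraMap ℂ L _ = algebraMap ℂ L _
      have := zExp_eq_one_of_mem_zmultiples P h w.toAdd.2
      rw [zExp_sub, mul_inv_eq_one₀ (zExp_ne_zero P logq _ _)] at this
      rw [this]
  have key : ∀ w (hw : zExp P logq (P.coroot i) w = 1), ∑ μ ∈ S, zExp P logq μ w • d μ =
      ∑ χ ∈ S.image θ, (∑ μ ∈ S with θ μ = χ, d μ) * χ (Multiplicative.ofAdd ⟨w, hw⟩) := by
    intro w hw
    rw [← Finset.sum_fiberwise_of_maps_to (fun μ hμ => Finset.mem_image_of_mem θ hμ)]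
    refine Finset.sum_congr rfl fun χ _ => ?_
    rw [Finset.sum_mul]
    refine Finset.sum_congr rfl fun μ hμ => ?_
    rw [← (Finset.mem_filter.1 hμ).2, Algebra.smul_def, mul_comm]
    rfl
  constructor
  · intro h ν
    have hli := linearIndependent_iff'.1 (linearIndependent_monoidHom (Multiplicative H) L)
      (S.image θ) (fun χ => ∑ μ ∈ S with θ μ = χ, d μ) (by
        funext w
        have := h w.toAdd.1 w.toAdd.2
        rw [key _ w.toAdd.2] at this
        simpa using this)
    simp_rw [← hθ]
    by_cases hν : θ ν ∈ S.image θ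
    · exact hli _ hν
    · refine Finset.sum_eq_zero fun μ hμ => ?_
      rw [Finset.mem_filter] at hμ
      exact absurd (hμ.2 ▸ Finset.mem_image_of_mem θ hμ.1) hν
  · intro h w hw
    rw [key w hw]
    refine Finset.sum_eq_zero fun χ hχ => ?_
    obtain ⟨ν, -, rfl⟩ := Finset.mem_image.1 hχ
    simp_rw [hθ]
    rw [h ν, zero_mul]

end Strings

/-- Dedekind's theorem for the characters of the whole of M: distinct exponents give distinct
characters because q is not a root of unity. -/
theorem ev_injective (hq : ∀ n : ℤ, qPow logq n = 1 → n = 0) : Function.Injective F.ev := by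
  classical
  intro c d hcd
  let θ : N → (Multiplicative M →* L) := fun μ =>
    { toFun := fun w => algebraMap ℂ L (zExp P logq μ w.toAdd)
      map_one' := by simp [zExp_apply_zero]
      map_mul' := fun a c => by simp [zExp_apply_add] }
  have hθ : Function.Injective θ := by
    intro μ ν h
    rw [← sub_eq_zero]
    refine eq_zero_of_zExp_eq_one P hq fun z => ?_
    have h2 : zExp P logq μ z = zExp P logq ν z :=
      (algebraMap ℂ L).injective (DFunLike.congr_fun h (Multiplicative.ofAdd z))
    rw [zExp_sub, h2, mul_inv_cancel₀ (zExp_ne_zero P logq ν z)]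
  have hli := linearIndependent_iff'.1
    ((linearIndependent_monoidHom (Multiplicative M) L).comp θ hθ)
    (c.support ∪ d.support) (fun μ => c μ - d μ) (by
      funext w
      have := congrFun hcd w.toAdd
      rw [F.ev_eq_sum Finset.subset_union_left, F.ev_eq_sum Finset.subset_union_right] at this
      have h3 := mul_left_cancel₀ (F.X_ne_zero _) this
      rw [← sub_eq_zero, ← Finset.sum_sub_distrib] at h3
      simp only [Finset.sum_apply, Pi.smul_apply, Function.comp_apply, Pi.zero_apply, smul_eq_mul]
      rw [← h3]
      refine Finset.sum_congr rfl fun μ _ => ?_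
      rw [← smul_sub, Algebra.smul_def, mul_comm]
      rfl)
  ext μ
  by_cases hμ : μ ∈ c.support ∪ d.support
  · exact sub_eq_zero.1 (hli μ hμ)
  · rw [Finset.notMem_union, Finsupp.notMem_support_iff, Finsupp.notMem_support_iff] at hμ
    rw [hμ.1, hμ.2]

/-- A function that vanishes at all but countably many points of a line vanishes on it. -/
theorem ev_eq_zero_of_countable (c : N →₀ L) (w v : M) {A : Set ℂ} (hA : A.Countable)
    (h : ∀ t ∉ A, F.ev c (w + t • v) = 0) : F.ev c w = 0 := by
  rw [ev, mul_eq_zero]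
  right
  -- L has no topology, so continuity in t is used after applying an arbitrary ℂ-linear functional
  -- on L.
  rw [← Module.forall_dual_apply_eq_zero_iff ℂ]
  intro φ
  let G : ℂ → ℂ := fun t => ∑ ν ∈ c.support, zExp P logq ν (w + t • v) * φ (c ν)
  have hG : Continuous G := by
    refine continuous_finsetSum _ fun ν _ => Continuous.mul ?_ continuous_const
    simp only [zExp, qPow, map_add, map_smul, LinearMap.add_apply, LinearMap.smul_apply]
    fun_prop
  have hG0 : G = fun _ => 0 := by
    refine Continuous.ext_on (hA.dense_compl ℂ) hG continuous_const fun t ht => ?_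
    have h1 := h t ht
    rw [ev, mul_eq_zero, or_iff_right (F.X_ne_zero _)] at h1
    have h2 := congrArg φ h1
    rw [Finsupp.sum, map_sum, map_zero] at h2
    simpa [G] using h2
  have := congrFun hG0 0
  rw [Finsupp.sum, map_sum]
  simpa [G] using this

end CharacterField

end CharacterField

end BakerAkhiezer

end

/-! ### Positive roots and the vector ρᵛ. -/

noncomputable section

namespace BakerAkhiezer

open Module

section Pairing

variable {ι M N : Type*} [AddCommGroup M] [Module ℂ M] [AddCommGroup N] [Module ℂ N]
  {P : RootPairing ι ℂ M N}

theorem root_reflectionPerm_self (i : ι) : P.root (P.reflectionPerm i i) = -P.root i := by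
  rw [P.root_reflectionPerm, P.reflection_apply_self]

theorem coroot_reflectionPerm_self (i : ι) : P.coroot (P.reflectionPerm i i) = -P.coroot i := by
  rw [P.coroot_reflectionPerm, P.coreflection_apply_self]

theorem reflectionPerm_self_reflectionPerm_self (i : ι) :
    P.reflectionPerm (P.reflectionPerm i i) (P.reflectionPerm i i) = i := by
  apply P.root.injective
  rw [root_reflectionPerm_self, root_reflectionPerm_self, neg_neg]

theorem coroot_eq_neg_coroot_iff {i j : ι} :
    P.coroot i = -P.coroot j ↔ P.root i = -P.root j := by
  rw [← coroot_reflectionPerm_self, ← root_reflectionPerm_self, P.root.injective.eq_iff,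
    P.coroot.injective.eq_iff]

variable [P.IsCrystallographic]

theorem toLinearMap_root_coroot (i j : ι) :
    P.toLinearMap (P.root i) (P.coroot j) = (P.pairingIn ℤ i j : ℂ) := by
  rw [P.root_coroot_eq_pairing, ← P.algebraMap_pairingIn ℤ]; rfl

theorem coroot_mem_coweightLattice (i : ι) : P.coroot i ∈ coweightLattice P := fun j =>
  ⟨P.pairingIn ℤ j i, by
    rw [P.root_coroot_eq_pairing, ← P.algebraMap_pairingIn ℤ]; rfl⟩

end Pairing

section PositiveRoots

variable {ι M N : Type*} [Fintype ι] [AddCommGroup M] [Module ℂ M] [NormedAddCommGroup N]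
  [NormedSpace ℂ N] {P : RootPairing ι ℂ M N} [P.IsCrystallographic] [P.IsReduced] (b : P.Base)

theorem mem_posRoots {i : ι} : i ∈ posRoots b ↔ b.IsPos i := by simp [posRoots]

theorem mem_posRoots_of_mem_support {i : ι} (hi : i ∈ b.support) : i ∈ posRoots b :=
  (mem_posRoots b).2 (b.isPos_of_mem_support hi)

theorem reflectionPerm_self_notMem_posRoots {i : ι} (hi : i ∈ posRoots b) :
    P.reflectionPerm i i ∉ posRoots b := by
  rw [mem_posRoots] at *
  exact fun h => (RootPairing.Base.IsPos.neg_iff_not b i).1 h hi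

theorem mem_posRoots_or (i : ι) : i ∈ posRoots b ∨ P.reflectionPerm i i ∈ posRoots b := by
  rw [mem_posRoots, mem_posRoots]
  exact RootPairing.Base.IsPos.or_neg b i

theorem root_ne_neg_of_mem_posRoots {i j : ι} (hi : i ∈ posRoots b) (hj : j ∈ posRoots b) :
    P.root i ≠ -P.root j := by
  intro h
  rw [← root_reflectionPerm_self] at h
  exact reflectionPerm_self_notMem_posRoots b hj (P.root.injective h ▸ hi)

theorem linearIndependent_coroot {i j : ι} (h : i ≠ j) (h' : P.root i ≠ -P.root j) :
    LinearIndependent ℂ ![P.coroot i, P.coroot j] :=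
  RootPairing.IsReduced.linearIndependent P.flip h fun h2 => h' (coroot_eq_neg_coroot_iff.1 h2)

theorem reflectionPerm_mem_posRoots_erase [DecidableEq ι] {i j : ι} (hi : i ∈ b.support)
    (hj : j ∈ (posRoots b).erase i) : P.reflectionPerm i j ∈ (posRoots b).erase i := by
  rw [Finset.mem_erase, mem_posRoots] at *
  refine ⟨fun h => ?_, hj.2.reflectionPerm hi hj.1⟩
  have h1 : j = P.reflectionPerm i i := by
    rw [← P.reflectionPerm_self i j, h]
  have := (mem_posRoots b).2 hj.2
  rw [h1] at this
  exact reflectionPerm_self_notMem_posRoots b (mem_posRoots_of_mem_support b hi) this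

theorem prod_posRoots_erase_reflectionPerm [DecidableEq ι] {R : Type*} [CommMonoid R] {i : ι}
    (hi : i ∈ b.support) (f : ι → R) :
    ∏ j ∈ (posRoots b).erase i, f (P.reflectionPerm i j) = ∏ j ∈ (posRoots b).erase i, f j :=
  Finset.prod_bij (fun j _ => P.reflectionPerm i j)
    (fun _ hj => reflectionPerm_mem_posRoots_erase b hi hj)
    (fun _ _ _ _ h => (P.reflectionPerm i).injective h)
    (fun j hj => ⟨_, reflectionPerm_mem_posRoots_erase b hi hj, P.reflectionPerm_self i j⟩)
    (fun _ _ => rfl)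

theorem sum_posRoots_erase_reflectionPerm [DecidableEq ι] {R : Type*} [AddCommMonoid R] {i : ι}
    (hi : i ∈ b.support) (f : ι → R) :
    ∑ j ∈ (posRoots b).erase i, f (P.reflectionPerm i j) = ∑ j ∈ (posRoots b).erase i, f j :=
  Finset.sum_bij (fun j _ => P.reflectionPerm i j)
    (fun _ hj => reflectionPerm_mem_posRoots_erase b hi hj)
    (fun _ _ _ _ h => (P.reflectionPerm i).injective h)
    (fun j hj => ⟨_, reflectionPerm_mem_posRoots_erase b hi hj, P.reflectionPerm_self i j⟩)
    (fun _ _ => rfl)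

theorem prod_univ_eq_prod_posRoots {R : Type*} [CommMonoid R] (f : ι → R) :
    ∏ i, f i = ∏ i ∈ posRoots b, f i * f (P.reflectionPerm i i) := by
  classical
  rw [Finset.prod_mul_distrib, ← Finset.prod_mul_prod_compl (posRoots b) f]
  congr 1
  symm
  refine Finset.prod_bij (fun j _ => P.reflectionPerm j j) ?_ ?_ ?_ (fun _ _ => rfl)
  · intro j hj
    exact Finset.mem_compl.2 (reflectionPerm_self_notMem_posRoots b hj)
  · intro i _ j _ h
    rw [← reflectionPerm_self_reflectionPerm_self (P := P) i, h,
      reflectionPerm_self_reflectionPerm_self]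
  · intro j hj
    refine ⟨P.reflectionPerm j j, ?_, reflectionPerm_self_reflectionPerm_self j⟩
    exact (mem_posRoots_or b j).resolve_left (Finset.mem_compl.1 hj)

variable {m : ι → ℕ}

/-- A simple reflection permutes the positive coroots other than its own and preserves the m_α; only
the term of the simple coroot changes, by its sign. -/
theorem coreflection_rhoCheck (hm : ∀ i j, m (P.reflectionPerm i j) = m j) {i : ι}
    (hi : i ∈ b.support) :
    P.coreflection i (rhoCheck b m) = rhoCheck b m - (m i : ℂ) • P.coroot i := by
  classical
  have hip := mem_posRoots_of_mem_support b hi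
  have key : P.coreflection i (∑ j ∈ posRoots b, (m j : ℂ) • P.coroot j) =
      ∑ j ∈ posRoots b, (m j : ℂ) • P.coroot j - (2 * (m i : ℂ)) • P.coroot i := by
    rw [← Finset.add_sum_erase _ _ hip, map_add, map_sum, map_smul, P.coreflection_apply_self]
    have : ∑ j ∈ (posRoots b).erase i, P.coreflection i ((m j : ℂ) • P.coroot j) =
        ∑ j ∈ (posRoots b).erase i, (m j : ℂ) • P.coroot j := by
      rw [← sum_posRoots_erase_reflectionPerm b hi]
      refine Finset.sum_congr rfl fun j _ => ?_
      rw [map_smul, ← P.coroot_reflectionPerm, P.reflectionPerm_self, hm]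
    rw [this]
    module
  rw [rhoCheck, map_smul, key]
  module

theorem root_rhoCheck (hm : ∀ i j, m (P.reflectionPerm i j) = m j) {i : ι} (hi : i ∈ b.support) :
    P.toLinearMap (P.root i) (rhoCheck b m) = m i := by
  have h := coreflection_rhoCheck b hm hi
  rw [P.coreflection_apply, sub_right_inj] at h
  exact smul_left_injective ℂ (P.ne_zero' i) h

theorem rhoCheck_mem_coweightLattice (hm : ∀ i j, m (P.reflectionPerm i j) = m j) :
    rhoCheck b m ∈ coweightLattice P := by
  intro i
  have h := b.root_mem_span_int i
  generalize P.root i = y at h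
  induction h using Submodule.span_induction with
  | mem x hx =>
    obtain ⟨j, hj, rfl⟩ := hx
    exact ⟨m j, by rw [root_rhoCheck b hm hj]; simp⟩
  | zero => exact ⟨0, by simp⟩
  | add x y _ _ hx hy =>
    obtain ⟨n, hn⟩ := hx
    obtain ⟨n', hn'⟩ := hy
    exact ⟨n + n', by simp [hn, hn']⟩
  | smul a x _ hx =>
    obtain ⟨n, hn⟩ := hx
    refine ⟨a * n, ?_⟩
    rw [map_zsmul, LinearMap.smul_apply, hn]
    simp

variable (m) in
theorem map_rhoCheck (h : N →ₗ[ℝ] ℝ) :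
    2 * h (rhoCheck b m) = ∑ i ∈ posRoots b, m i * h (P.coroot i) := by
  have : (2 : ℝ) • rhoCheck b m = ∑ i ∈ posRoots b, (m i : ℝ) • P.coroot i := by
    have e : ∀ (x : N) (n : ℕ), (n : ℝ) • x = (n : ℂ) • x := fun x n => by
      rw [Nat.cast_smul_eq_nsmul, Nat.cast_smul_eq_nsmul]
    have e2 : (2 : ℝ) • rhoCheck b m = (2 : ℂ) • rhoCheck b m := e _ 2
    simp_rw [e]
    rw [e2, rhoCheck]
    module
  rw [← smul_eq_mul, ← map_smul, this, map_sum]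
  simp

end PositiveRoots

/-! ### String conditions and the width of the support. -/

section Strings

variable {ι M N : Type*} [AddCommGroup M] [Module ℂ M] [NormedAddCommGroup N] [NormedSpace ℂ N]
  (P : RootPairing ι ℂ M N)

open Classical in
/-- On each string in the direction of a coroot, the moments of order less than `n` of `γ` vanish
for suitable nonzero weights and pairwise distinct nodes. -/
def StringCondition {k : Type*} [Field k] (n : ℕ) (i : ι) (γ : N →₀ k) : Prop :=
  ∃ a u : N → k, (∀ μ, a μ ≠ 0) ∧
    (∀ μ μ', μ - μ' ∈ AddSubgroup.zmultiples (P.coroot i) → u μ = u μ' → μ = μ') ∧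
    ∀ ν, ∀ j < n, ∑ μ ∈ γ.support.filter (fun μ => μ - ν ∈ AddSubgroup.zmultiples (P.coroot i)),
      (γ μ * a μ) * u μ ^ j = 0

variable {P}

open Classical in
theorem StringCondition.lt_card {k : Type*} [Field k] {n : ℕ} {i : ι} {γ : N →₀ k}
    (h : StringCondition P n i γ) {p : N} (hp : p ∈ γ.support) :
    n < (γ.support.filter fun μ => μ - p ∈ AddSubgroup.zmultiples (P.coroot i)).card := by
  obtain ⟨a, u, ha, hu, hs⟩ := h
  refine lt_of_lt_of_le (lt_card_of_moments (μ := p) (γ := fun μ => γ μ * a μ) (hs p) ?_ ?_ ?_)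
    (Finset.card_filter_le _ _)
  · intro x hx y hy hxy
    rw [Finset.mem_coe, Finset.mem_filter] at hx hy
    refine hu x y ?_ hxy
    have := sub_mem hx.2 hy.2
    rwa [sub_sub_sub_cancel_right] at this
  · simpa using hp
  · exact mul_ne_zero (Finsupp.mem_support_iff.1 hp) (ha p)

variable [Fintype ι] [P.IsCrystallographic] [P.IsReduced] (b : P.Base)

/-- The width of the support of a nonzero function that satisfies the string conditions. -/
theorem exists_width_le {k : Type*} [Field k] (m : ι → ℕ) (h : N →ₗ[ℝ] ℝ)
    (hpos : ∀ i ∈ posRoots b, 0 ≤ h (P.coroot i)) {γ : N →₀ k} (hγ : γ ≠ 0)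
    (hstr : ∀ i ∈ posRoots b, 0 < h (P.coroot i) → StringCondition P (m i) i γ) :
    ∃ p₀ ∈ γ.support, ∃ p ∈ γ.support, 2 * h (rhoCheck b m) ≤ h p - h p₀ := by
  classical
  -- The sweep needs directions on which h is positive; the coroots on which h vanishes contribute
  -- nothing to h(ρᵛ).
  set J := (posRoots b).filter fun i => 0 < h (P.coroot i) with hJ
  -- A functional g that vanishes on none of these vectors gives distinct critical slopes to
  -- distinct coroots. The vectors are nonzero since different positive coroots of a reduced system
  -- are not proportional.
  let v : {x : J × J // x.1 ≠ x.2} → N := fun x =>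
    h (P.coroot x.1.2) • P.coroot x.1.1 - h (P.coroot x.1.1) • P.coroot x.1.2
  have hv : ∀ x, v x ≠ 0 := by
    rintro ⟨⟨⟨i, hi⟩, ⟨j, hj⟩⟩, hij⟩ h0
    rw [hJ, Finset.mem_filter] at hi hj
    have hij' : i ≠ j := fun e => hij (Subtype.ext e)
    have hli := linearIndependent_coroot hij' (root_ne_neg_of_mem_posRoots b hi.1 hj.1)
    rw [LinearIndependent.pair_iff] at hli
    have h1 : ((h (P.coroot j) : ℝ) : ℂ) • P.coroot i + (-(h (P.coroot i) : ℝ) : ℂ) • P.coroot j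
        = 0 := by
      rw [neg_smul, ← sub_eq_add_neg, Complex.coe_smul, Complex.coe_smul]
      exact h0
    have := (hli _ _ h1).1
    rw [Complex.ofReal_eq_zero] at this
    exact hj.2.ne' this
  obtain ⟨g, hg⟩ := Module.exists_dual_forall_apply_ne_zero (K := ℝ) v hv
  obtain ⟨p₀, h0, p, hp, hle⟩ := width_le h.toAddMonoidHom g.toAddMonoidHom
    (S := γ.support) (Finsupp.support_nonempty_iff.2 hγ) J P.coroot m
    (fun j hj => (Finset.mem_filter.1 hj).2)
    (fun i hi j hj hij => by
      have := hg ⟨⟨⟨i, hi⟩, ⟨j, hj⟩⟩, fun e => hij (congrArg Subtype.val e)⟩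
      simp only [v, map_sub, map_smul, smul_eq_mul] at this
      change g (P.coroot i) * h (P.coroot j) ≠ g (P.coroot j) * h (P.coroot i)
      intro e
      apply this
      linarith)
    (fun j hj p hp => (hstr j (Finset.mem_filter.1 hj).1 (Finset.mem_filter.1 hj).2).lt_card hp)
  refine ⟨p₀, h0, p, hp, ?_⟩
  rw [map_rhoCheck]
  refine le_trans (le_of_eq ?_) hle
  symm
  refine Finset.sum_subset (Finset.filter_subset _ _) fun i hi hi' => ?_
  have h1 := hpos i hi
  have h2 : h (P.coroot i) = 0 := by
    by_contra hne
    exact hi' (Finset.mem_filter.2 ⟨hi, lt_of_le_of_ne h1 (Ne.symm hne)⟩)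
  change (m i : ℝ) * h (P.coroot i) = 0
  rw [h2, mul_zero]

end Strings

/-! ### Quasi-invariance as a system of relations on strings. -/

section QuasiInvariant

variable {ι M N L : Type*} [AddCommGroup M] [Module ℂ M] [NormedAddCommGroup N] [NormedSpace ℂ N]
  (P : RootPairing ι ℂ M N) (logq : ℂ)

/-- The condition `φ (z + s α / 2) = φ (z - s α / 2)` if `q ^ (2 (αᵛ, z)) = 1`. -/
def QuasiInvariant (m : ι → ℕ) (φ : M → L) : Prop :=
  ∀ i, ∀ s : ℕ, 1 ≤ s → s ≤ m i → ∀ z : M, qPow logq (2 * P.toLinearMap z (P.coroot i)) = 1 →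
    φ (z + ((s : ℂ) / 2) • P.root i) = φ (z - ((s : ℂ) / 2) • P.root i)

variable {P logq} [Field L] [Algebra ℂ L] (F : CharacterField P logq L)

namespace CharacterField

/-- The element `q ^ (α, x + μ)`. -/
def Y (i : ι) (μ : N) : L := qPow logq (P.toLinearMap (P.root i) μ) • F.X ((1 / 2 : ℂ) • P.root i)

theorem Y_ne_zero (i : ι) (μ : N) : F.Y i μ ≠ 0 :=
  smul_ne_zero (qPow_ne_zero _ _) (F.X_ne_zero _)

theorem X_half_root_sq (i : ι) : F.X ((1 / 2 : ℂ) • P.root i) ^ 2 = F.X (P.root i) := by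
  rw [← F.X_nsmul, ← Nat.cast_smul_eq_nsmul ℂ, smul_smul]
  norm_num

theorem Y_sq (i : ι) (μ : N) :
    F.Y i μ ^ 2 = qPow logq (2 * P.toLinearMap (P.root i) μ) • F.X (P.root i) := by
  rw [Y, smul_pow, F.X_half_root_sq, ← qPow_natCast_mul]
  simp

theorem Y_add_zsmul (i : ι) (μ : N) (k : ℤ) :
    F.Y i (μ + k • P.coroot i) = qPow logq ((2 * k : ℤ) : ℂ) • F.Y i μ := by
  rw [Y, Y, smul_smul, ← qPow_add, map_add, map_zsmul, P.root_coroot_two]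
  congr 2
  simp
  ring

theorem ev_shift_add (c : N →₀ L) (i : ι) (s : ℕ) (w : M) :
    F.ev c (w + ((s : ℂ) / 2) • P.root i) =
      F.X w * ∑ μ ∈ c.support, zExp P logq μ w • (c μ * F.Y i μ ^ s) := by
  rw [ev, F.X_add, F.X_half_smul, Finsupp.sum, mul_assoc, Finset.mul_sum]
  congr 1
  refine Finset.sum_congr rfl fun μ _ => ?_
  rw [zExp_apply_add, zExp_half_smul_root, Y, smul_pow]
  simp only [Algebra.smul_def, map_mul]
  ring

theorem ev_shift_sub (c : N →₀ L) (i : ι) (s : ℕ) (w : M) :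
    F.ev c (w - ((s : ℂ) / 2) • P.root i) =
      F.X w * ∑ μ ∈ c.support, zExp P logq μ w • (c μ * (F.Y i μ)⁻¹ ^ s) := by
  rw [ev, F.X_sub, F.X_half_smul, Finsupp.sum, mul_assoc, Finset.mul_sum]
  congr 1
  refine Finset.sum_congr rfl fun μ _ => ?_
  rw [zExp_apply_sub, zExp_half_smul_root, Y, inv_pow, smul_pow]
  simp only [Algebra.smul_def, map_mul, map_inv₀, mul_inv]
  ring

open Classical in
-- A shift of z by ±sα/2 multiplies the coefficient at μ by `F.Y i μ` to the power ±s. By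
-- `string_sums_iff`, vanishing of the difference on the hypersurface means vanishing of the sum
-- over each string.
theorem quasiInvariant_ev_iff (hq : ∀ n : ℤ, qPow logq n = 1 → n = 0) (m : ι → ℕ) (c : N →₀ L) :
    QuasiInvariant P logq m (F.ev c) ↔ ∀ i s, 1 ≤ s → s ≤ m i → ∀ ν,
      ∑ μ ∈ c.support.filter (fun μ => μ - ν ∈ AddSubgroup.zmultiples (P.coroot i)),
        c μ * (F.Y i μ ^ s - (F.Y i μ)⁻¹ ^ s) = 0 := by
  refine forall_congr' fun i => forall_congr' fun s => forall_congr' fun _ => forall_congr' fun _ =>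
    ?_
  rw [← string_sums_iff (P := P) hq i c.support fun μ => c μ * (F.Y i μ ^ s - (F.Y i μ)⁻¹ ^ s)]
  refine forall_congr' fun w => forall_congr' fun _ => ?_
  rw [F.ev_shift_add, F.ev_shift_sub, mul_right_inj' (F.X_ne_zero w), ← sub_eq_zero,
    ← Finset.sum_sub_distrib]
  simp only [mul_sub, smul_sub]

theorem Y_sq_ne_one (hq : ∀ n : ℤ, qPow logq n = 1 → n = 0) (i : ι) (μ : N) :
    F.Y i μ ^ 2 ≠ 1 := by
  have h0 : P.root i ≠ 0 := P.ne_zero i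
  rw [F.Y_sq]
  intro h
  refine F.X_ne_algebraMap hq h0 (qPow logq (2 * P.toLinearMap (P.root i) μ))⁻¹ ?_
  rw [map_inv₀]
  rw [Algebra.smul_def] at h
  exact eq_inv_of_mul_eq_one_right h

theorem stringCondition_of_quasiInvariant (hq : ∀ n : ℤ, qPow logq n = 1 → n = 0) {m : ι → ℕ}
    {c : N →₀ L} (h : QuasiInvariant P logq m (F.ev c)) (i : ι) :
    StringCondition P (m i) i c := by
  classical
  refine ⟨fun μ => F.Y i μ - (F.Y i μ)⁻¹, fun μ => F.Y i μ + (F.Y i μ)⁻¹, fun μ => ?_, ?_, ?_⟩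
  · intro h0
    refine F.Y_sq_ne_one hq i μ ?_
    rw [sub_eq_zero] at h0
    rw [sq]
    nth_rewrite 2 [h0]
    exact mul_inv_cancel₀ (F.Y_ne_zero i μ)
  · intro μ μ' hμ hu
    obtain ⟨k, hk⟩ := AddSubgroup.mem_zmultiples_iff.1 hμ
    have e : μ = μ' + k • P.coroot i := by rw [hk]; abel
    simp only [e, F.Y_add_zsmul] at hu
    set y := F.Y i μ' with hy
    have hy0 : y ≠ 0 := F.Y_ne_zero i μ'
    set a := algebraMap ℂ L (qPow logq ((2 * k : ℤ) : ℂ)) with ha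
    have ha0 : a ≠ 0 := by simp [ha, qPow_ne_zero]
    rw [Algebra.smul_def, ← ha] at hu
    -- Equality of two nodes ay + (ay)⁻¹ and y + y⁻¹ with a = q^(2k) means a = 1, which gives k = 0,
    -- or a y² = 1, which would make the character X(α) constant.
    have h1 : (a - 1) * (a * y ^ 2 - 1) = 0 := by
      field_simp at hu
      linear_combination hu
    rcases mul_eq_zero.1 h1 with h1 | h1
    · rw [sub_eq_zero, ha, ← map_one (algebraMap ℂ L)] at h1
      have := hq _ ((algebraMap ℂ L).injective h1)
      have hk0 : k = 0 := by omega
      rw [e, hk0, zero_smul, add_zero]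
    · exfalso
      rw [sub_eq_zero, hy, F.Y_sq, Algebra.smul_def, ← mul_assoc, ha, ← map_mul] at h1
      have h2 := eq_inv_of_mul_eq_one_right h1
      rw [← map_inv₀] at h2
      exact F.X_ne_algebraMap hq (P.ne_zero i) _ h2
  · intro ν
    exact moments_of_brackets (fun μ => F.Y_ne_zero i μ)
      fun s h1 h2 => (F.quasiInvariant_ev_iff hq m c).1 h i s h1 h2 ν

end CharacterField

end QuasiInvariant

end BakerAkhiezer

end

/-! ### Spaces of functions of z, divisibility, generic points. -/

noncomputable section

namespace BakerAkhiezer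

open Module

variable {ι M N L : Type*} [AddCommGroup M] [Module ℂ M] [NormedAddCommGroup N] [NormedSpace ℂ N]
  {P : RootPairing ι ℂ M N} {logq : ℂ} [Field L] [Algebra ℂ L] (F : CharacterField P logq L)

theorem zExp_int_half_smul_root (ν : N) (i : ι) (t : ℤ) :
    zExp P logq ν (((t : ℂ) / 2) • P.root i) = qPow logq (P.toLinearMap (P.root i) ν) ^ t := by
  rw [zExp, ← qPow_intCast_mul, map_smul, LinearMap.smul_apply, smul_eq_mul]
  congr 1
  ring

theorem zExp_coroot_add_half [P.IsCrystallographic] (i j : ι) (t : ℤ) (w : M) :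
    zExp P logq (P.coroot j) (w + ((t : ℂ) / 2) • P.root i) =
      zExp P logq (P.coroot j) w * qPow logq ((t * P.pairingIn ℤ i j : ℤ) : ℂ) := by
  rw [zExp_apply_add, zExp_int_half_smul_root, toLinearMap_root_coroot, ← qPow_intCast_mul]
  push_cast
  rfl

theorem zExp_coroot_self_add_half [P.IsCrystallographic] (i : ι) (t : ℤ) (w : M) :
    zExp P logq (P.coroot i) (w + ((t : ℂ) / 2) • P.root i) =
      zExp P logq (P.coroot i) w * qPow logq ((2 * t : ℤ) : ℂ) := by
  rw [zExp_coroot_add_half, P.pairingIn_same, mul_comm t]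

theorem zExp_coroot_neg (i : ι) (w : M) :
    zExp P logq (P.coroot (P.reflectionPerm i i)) w = (zExp P logq (P.coroot i) w)⁻¹ := by
  rw [coroot_reflectionPerm_self, zExp_neg]

/-- The reflection sends w + tα/2 to w - tα/2 up to the shift by (w, αᵛ)α. This shift changes a
coroot character by an integral power of q^(2(αᵛ,w)) = 1. -/
theorem zExp_coroot_reflectionPerm [P.IsCrystallographic] {i : ι} {w : M}
    (hw : zExp P logq (P.coroot i) w = 1) (j : ι) (t : ℤ) :
    zExp P logq (P.coroot (P.reflectionPerm i j)) (w - ((t : ℂ) / 2) • P.root i) =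
      zExp P logq (P.coroot j) (w + ((t : ℂ) / 2) • P.root i) := by
  have e : w - ((t : ℂ) / 2) • P.root i = w + (((-t : ℤ) : ℂ) / 2) • P.root i := by
    push_cast
    module
  rw [e, P.coroot_reflectionPerm, P.coreflection_apply, toLinearMap_root_coroot,
    Int.cast_smul_eq_zsmul, zExp_sub, zExp_zsmul, zExp_coroot_self_add_half, hw, one_mul,
    zExp_coroot_add_half, zExp_coroot_add_half, ← qPow_intCast_mul, ← qPow_neg, mul_assoc,
    ← qPow_add]
  congr 2
  push_cast
  ring

namespace CharacterField

section Funs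

theorem translate_mem_funs {S : Set N} {f : M → L} (hf : f ∈ F.funs S) (v : M) :
    (fun z => f (z + v)) ∈ F.funs S := by
  classical
  obtain ⟨c, hc, rfl⟩ := F.mem_funs.1 hf
  refine F.mem_funs.2 ⟨c.sum fun ν a =>
    Finsupp.single ν (F.X v * zExp P logq ν v • a), ?_, ?_⟩
  · intro ν hν
    obtain ⟨μ, hμ, h⟩ := Finset.mem_biUnion.1 (Finsupp.support_sum hν)
    have := Finsupp.support_single_subset h
    rw [Finset.mem_singleton] at this
    rw [this]
    exact hc μ hμ
  · funext z
    change F.evLin _ z = _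
    rw [Finsupp.sum, map_sum, Finset.sum_apply]
    simp only [evLin_apply, ev_single]
    rw [ev, F.X_add, Finsupp.sum, Finset.mul_sum]
    refine Finset.sum_congr rfl fun ν _ => ?_
    rw [zExp_apply_add]
    simp only [Algebra.smul_def, map_mul]
    ring

theorem zExp_mul_mem_funs {S S' : Set N} {κ : N} (hS : ∀ μ ∈ S, μ + κ ∈ S') {f : M → L}
    (hf : f ∈ F.funs S) : (fun z => zExp P logq κ z • f z) ∈ F.funs S' := by
  classical
  obtain ⟨c, hc, rfl⟩ := F.mem_funs.1 hf
  refine F.mem_funs.2 ⟨c.mapDomain (· + κ), ?_, ?_⟩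
  · intro ν hν
    obtain ⟨μ, hμ, rfl⟩ := Finset.mem_image.1 (Finsupp.mapDomain_support hν)
    exact hS μ (hc μ hμ)
  · funext z
    rw [ev, Finsupp.sum_mapDomain_index (by simp) (by simp), ev, Finsupp.sum, Finsupp.sum,
      ← mul_smul_comm, Finset.smul_sum]
    congr 1
    refine Finset.sum_congr rfl fun ν _ => ?_
    rw [zExp_add_apply, smul_smul, mul_comm]

theorem csmul_mem_funs {S : Set N} {f : M → L} (hf : f ∈ F.funs S) (a : ℂ) :
    (fun z => a • f z) ∈ F.funs S := by
  have := (F.funs S).smul_mem (algebraMap ℂ L a) hf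
  convert this using 1
  funext z
  simp [Algebra.smul_def]

theorem affine_smul_mem_funs {S : Set N} {κ : N} (hS : ∀ μ ∈ S, μ + κ ∈ S) {f : M → L}
    (hf : f ∈ F.funs S) (a c : ℂ) :
    (fun z => (a * zExp P logq κ z - c) • f z) ∈ F.funs S := by
  have h1 := F.csmul_mem_funs (F.zExp_mul_mem_funs hS hf) a
  have h2 := F.csmul_mem_funs hf c
  convert (F.funs S).sub_mem h1 h2 using 1
  funext z
  simp [sub_smul, smul_smul]

theorem prod_affine_smul_mem_funs {S : Set N} {J : Finset ι}
    (hS : ∀ j ∈ J, ∀ μ ∈ S, μ + P.coroot j ∈ S) {f : M → L} (hf : f ∈ F.funs S) (a c : ι → ℂ) :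
    (fun z => (∏ j ∈ J, (a j * zExp P logq (P.coroot j) z - c j)) • f z) ∈ F.funs S := by
  classical
  induction J using Finset.induction_on with
  | empty => simpa using hf
  | insert j J hj ih =>
    have h1 := F.affine_smul_mem_funs (hS j (Finset.mem_insert_self _ _))
      (ih fun i hi => hS i (Finset.mem_insert_of_mem hi)) (a j) (c j)
    convert h1 using 1
    funext z
    rw [Finset.prod_insert hj, smul_smul]

/-- A function that vanishes where `q ^ (2 (αᵛ, z)) = 1` is divisible by `q ^ (2 (αᵛ, z)) - 1`. -/
theorem exists_eq_sub_one_smul (hq : ∀ n : ℤ, qPow logq n = 1 → n = 0) {S : Set N} {i : ι}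
    (hS : ∀ μ ∈ S, ∀ k : ℤ, μ + k • P.coroot i ∈ S) {f : M → L} (hf : f ∈ F.funs S)
    (h0 : ∀ w, zExp P logq (P.coroot i) w = 1 → f w = 0) :
    ∃ g ∈ F.funs S, ∀ z, f z = (zExp P logq (P.coroot i) z - 1) • g z := by
  classical
  obtain ⟨c, hc, rfl⟩ := F.mem_funs.1 hf
  let A := AddSubgroup.zmultiples (P.coroot i)
  -- Modulo q^(2(αᵛ,z)) - 1 every exponent may be moved along its string to a chosen representative.
  -- The coefficients of the result are the string sums, and they vanish by hypothesis.
  let rep : N → N := fun μ => (QuotientAddGroup.mk (s := A) μ).out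
  have hrep : ∀ μ, ∃ k : ℤ, rep μ = μ + k • P.coroot i := by
    intro μ
    have : (QuotientAddGroup.mk (s := A) μ) = QuotientAddGroup.mk (rep μ) :=
      (QuotientAddGroup.out_eq' _).symm
    rw [QuotientAddGroup.eq] at this
    obtain ⟨k, hk⟩ := AddSubgroup.mem_zmultiples_iff.1 this
    exact ⟨k, by rw [hk]; abel⟩
  have hrep' : ∀ μ ν, rep μ = rep ν ↔ μ - ν ∈ A := by
    intro μ ν
    constructor
    · intro h
      obtain ⟨k, hk⟩ := hrep μ
      obtain ⟨l, hl⟩ := hrep ν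
      refine AddSubgroup.mem_zmultiples_iff.2 ⟨l - k, ?_⟩
      rw [hk, hl] at h
      rw [sub_smul, sub_eq_sub_iff_add_eq_add, add_comm, ← h]
    · intro h
      have : (QuotientAddGroup.mk (s := A) ν) = QuotientAddGroup.mk μ := by
        rw [QuotientAddGroup.eq]
        rwa [neg_add_eq_sub]
      simp only [rep, this]
  have hsingle : ∀ (k : ℤ) (μ : N) (a : L), μ ∈ S → ∃ g ∈ F.funs S, ∀ z,
      F.ev (Finsupp.single μ a) z - F.ev (Finsupp.single (μ + k • P.coroot i) a) z =
        (zExp P logq (P.coroot i) z - 1) • g z := by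
    intro k
    have hmem : ∀ (l : ℤ) μ (a : L), μ ∈ S →
        F.ev (Finsupp.single (μ + l • P.coroot i) a) ∈ F.funs S := fun l μ a hμ =>
      F.mem_funs.2 ⟨_, fun ν hν => by
        have := Finsupp.support_single_subset hν
        rw [Finset.mem_singleton] at this
        rw [this]
        exact hS μ hμ l, rfl⟩
    induction k using Int.induction_on with
    | zero => exact fun μ a _ => ⟨0, Submodule.zero_mem _, fun z => by simp⟩
    | succ k ih =>
      intro μ a hμ
      obtain ⟨g, hg, h⟩ := ih μ a hμ
      refine ⟨g - F.ev (Finsupp.single (μ + (k : ℤ) • P.coroot i) a),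
        Submodule.sub_mem _ hg (hmem k μ a hμ), fun z => ?_⟩
      rw [Pi.sub_apply, smul_sub, ← h z, ev_single, ev_single, ev_single, add_smul (k : ℤ) 1,
        one_smul, ← add_assoc, zExp_add_apply _ _ (μ + _)]
      simp only [Algebra.smul_def, map_mul, map_sub, map_one]
      ring
    | pred k ih =>
      intro μ a hμ
      obtain ⟨g, hg, h⟩ := ih μ a hμ
      refine ⟨g + F.ev (Finsupp.single (μ + (-(k : ℤ) - 1) • P.coroot i) a),
        Submodule.add_mem _ hg (hmem _ μ a hμ), fun z => ?_⟩
      have e : μ + (-(k : ℤ)) • P.coroot i = μ + (-(k : ℤ) - 1) • P.coroot i + P.coroot i := by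
        module
      rw [Pi.add_apply, smul_add, ← h z, ev_single, ev_single, ev_single, e,
        zExp_add_apply _ _ (μ + _)]
      simp only [Algebra.smul_def, map_mul, map_sub, map_one]
      ring
  have hgen : ∀ c : N →₀ L, (∀ ν ∈ c.support, ν ∈ S) → ∃ g ∈ F.funs S, ∀ z,
      F.ev c z - F.ev (c.mapDomain rep) z = (zExp P logq (P.coroot i) z - 1) • g z := by
    intro c
    induction c using Finsupp.induction with
    | zero => exact fun _ => ⟨0, Submodule.zero_mem _, fun z => by simp [F.ev_zero]⟩
    | single_add μ a c hμ ha ih =>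
      intro hc
      have hsupp := Finsupp.support_single_add hμ ha
      rw [hsupp] at hc
      obtain ⟨g, hg, h⟩ := ih fun ν hν => hc ν (Finset.mem_cons_of_mem hν)
      obtain ⟨k, hk⟩ := hrep μ
      obtain ⟨g', hg', h'⟩ := hsingle k μ a (hc μ (Finset.mem_cons_self _ _))
      refine ⟨g' + g, Submodule.add_mem _ hg' hg, fun z => ?_⟩
      rw [Finsupp.mapDomain_add, Finsupp.mapDomain_single, F.ev_add, F.ev_add, Pi.add_apply,
        Pi.add_apply, Pi.add_apply, smul_add, ← h, ← h', hk]
      ring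
  obtain ⟨g, hg, h⟩ := hgen c hc
  refine ⟨g, hg, fun z => ?_⟩
  have hstr := (string_sums_iff hq i c.support c).1 fun w hw => by
    have := h0 w hw
    rwa [ev, mul_eq_zero, or_iff_right (F.X_ne_zero w)] at this
  have hz : c.mapDomain rep = 0 := by
    ext ν
    rw [Finsupp.mapDomain, Finsupp.sum_apply, Finsupp.sum, Finsupp.zero_apply]
    simp only [Finsupp.single_apply]
    rw [← Finset.sum_filter]
    by_cases hν : ∃ μ, rep μ = ν
    · obtain ⟨μ, rfl⟩ := hν
      simp_rw [hrep']
      exact hstr μ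
    · push Not at hν
      rw [Finset.filter_false_of_mem fun μ _ => hν μ, Finset.sum_empty]
  rw [← h z, hz, F.ev_zero, Pi.zero_apply, sub_zero]

end Funs

section Density

variable [Finite ι]

/-- On a line transversal to the coroots of J each excluded equation has countably many solutions,
and there are countably many equations. -/
theorem eq_zero_of_line (hq : ∀ n : ℤ, qPow logq n = 1 → n = 0) {S : Set N} {f : M → L}
    (hf : f ∈ F.funs S) (J : Set ι) {v : M} (hv : ∀ j ∈ J, P.toLinearMap v (P.coroot j) ≠ 0)
    (w : M) (h : ∀ t : ℂ, (∀ j ∈ J, ∀ n : ℤ, zExp P logq (P.coroot j) (w + t • v) ≠ qPow logq n) →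
      f (w + t • v) = 0) : f w = 0 := by
  obtain ⟨c, -, rfl⟩ := F.mem_funs.1 hf
  refine F.ev_eq_zero_of_countable c w v
    (A := ⋃ j ∈ J, ⋃ n : ℤ, {t | zExp P logq (P.coroot j) (w + t • v) = qPow logq n}) ?_ ?_
  · refine Set.Countable.biUnion (Set.to_countable J) fun j hj => Set.countable_iUnion fun n => ?_
    have := countable_setOf_qPow_eq hq (a := 2 * P.toLinearMap v (P.coroot j))
      (by simpa using hv j hj) (2 * P.toLinearMap w (P.coroot j)) (qPow logq n)
    convert this using 3
    rw [zExp, map_add, map_smul, LinearMap.add_apply, LinearMap.smul_apply, smul_eq_mul]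
    ring_nf
  · intro t ht
    refine h t fun j hj n hn => ht ?_
    simp only [Set.mem_iUnion]
    exact ⟨j, hj, n, hn⟩

/-- The points of the hypersurface `q ^ (2 (αᵛ, z)) = 1` that are generic with respect to the other
roots. -/
def IsGeneric (P : RootPairing ι ℂ M N) (logq : ℂ) (i : ι) (w : M) : Prop :=
  zExp P logq (P.coroot i) w = 1 ∧ ∀ j, P.root j ≠ P.root i → P.root j ≠ -P.root i →
    ∀ n : ℤ, zExp P logq (P.coroot j) w ≠ qPow logq n

variable [P.IsCrystallographic] [P.IsReduced]

theorem eq_zero_of_isGeneric (hq : ∀ n : ℤ, qPow logq n = 1 → n = 0) {S : Set N} {f : M → L}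
    (hf : f ∈ F.funs S) {i : ι} (h : ∀ w, IsGeneric P logq i w → f w = 0) {w : M}
    (hw : zExp P logq (P.coroot i) w = 1) : f w = 0 := by
  obtain ⟨v, hv0, hv⟩ := Module.Dual.exists_forall_mem_ne_zero_of_forall_exists
    (LinearMap.ker (P.coroot' i))
    (fun j : {j // P.root j ≠ P.root i ∧ P.root j ≠ -P.root i} => P.coroot' j) (by
      rintro ⟨j, hj⟩
      -- The projection of β = root j to the kernel of αᵛ pairs with βᵛ to 2 - (β,αᵛ)(α,βᵛ)/2. This
      -- is nonzero because the product of the two pairings is at most 3 for non-proportional roots.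
      refine ⟨P.root j - ((P.pairingIn ℤ j i : ℂ) / 2) • P.root i, ?_, ?_⟩
      · rw [LinearMap.mem_ker, map_sub, map_smul, P.root_coroot'_eq_pairing,
          P.root_coroot'_eq_pairing, P.pairing_same, ← P.algebraMap_pairingIn ℤ]
        simp
      · rw [map_sub, map_smul, P.root_coroot'_eq_pairing,
          P.root_coroot'_eq_pairing, P.pairing_same, ← P.algebraMap_pairingIn ℤ]
        have := P.pairingIn_pairingIn_mem_set_of_isCrystal_of_isRed' i j (Ne.symm hj.1)
          (fun h => hj.2 (by rw [h, neg_neg]))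
        simp only [Set.mem_insert_iff, Set.mem_singleton_iff, Prod.mk.injEq] at this
        rcases this with h | h | h | h | h | h | h | h | h | h | h <;>
          (rw [h.1, h.2]; norm_num))
  refine F.eq_zero_of_line hq hf {j | P.root j ≠ P.root i ∧ P.root j ≠ -P.root i}
    (fun j hj => hv ⟨j, hj⟩) w fun t ht => h _ ⟨?_, fun j h1 h2 => ht j ⟨h1, h2⟩⟩
  have h0 : P.toLinearMap v (P.coroot i) = 0 := hv0
  rw [zExp_apply_add, hw, one_mul, zExp, map_smul, LinearMap.smul_apply, h0, smul_zero, mul_zero,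
    qPow_zero]

theorem eq_zero_of_forall_generic (hq : ∀ n : ℤ, qPow logq n = 1 → n = 0) {S : Set N} {f : M → L}
    (hf : f ∈ F.funs S)
    (h : ∀ w, (∀ j, ∀ n : ℤ, zExp P logq (P.coroot j) w ≠ qPow logq n) → f w = 0) : f = 0 := by
  obtain ⟨v, hv⟩ := Module.Dual.exists_forall_ne_zero_of_forall_exists P.coroot'
    fun i => ⟨P.root i, by rw [P.root_coroot'_eq_pairing, P.pairing_same]; norm_num⟩
  funext w
  exact F.eq_zero_of_line hq hf Set.univ (fun j _ => hv j) w
    fun t ht => h _ fun j n => ht j trivial n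

end Density

end CharacterField

end BakerAkhiezer

end

/-! ### The coefficients of a difference operator in z. -/

noncomputable section

namespace BakerAkhiezer

open Module

variable {ι M N L : Type*} [AddCommGroup M] [Module ℂ M] [NormedAddCommGroup N] [NormedSpace ℂ N]
  {P : RootPairing ι ℂ M N} {logq : ℂ} [Field L] [Algebra ℂ L] (F : CharacterField P logq L)

theorem qPow_int_add (a c : ℤ) :
    qPow logq ((a + c : ℤ) : ℂ) = qPow logq (a : ℂ) * qPow logq (c : ℂ) := by
  rw [Int.cast_add, qPow_add]

theorem qPow_int_neg (a : ℤ) : qPow logq ((-a : ℤ) : ℂ) = (qPow logq (a : ℂ))⁻¹ := by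
  rw [Int.cast_neg, qPow_neg]

theorem QuasiInvariant.apply_int {m : ι → ℕ} {φ : M → L} (h : QuasiInvariant P logq m φ) {i : ι}
    {w : M} (hw : zExp P logq (P.coroot i) w = 1) {t : ℤ} (ht : |t| ≤ m i) :
    φ (w + ((t : ℂ) / 2) • P.root i) = φ (w - ((t : ℂ) / 2) • P.root i) := by
  obtain ⟨n, rfl | rfl⟩ := t.eq_nat_or_neg
  · rcases Nat.eq_zero_or_pos n with rfl | hn
    · simp
    · rw [Nat.abs_cast] at ht
      simpa using h i n hn (by exact_mod_cast ht) w hw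
  · rcases Nat.eq_zero_or_pos n with rfl | hn
    · simp
    · rw [abs_neg, Nat.abs_cast] at ht
      have := h i n hn (by exact_mod_cast ht) w hw
      push_cast
      rw [neg_div, neg_smul, ← sub_eq_add_neg, sub_neg_eq_add]
      exact this.symm

section Operator

variable [P.IsCrystallographic] (m : ι → ℕ)

theorem pairingIn_reflectionPerm_reflectionPerm (k i j : ι) :
    P.pairingIn ℤ (P.reflectionPerm k i) (P.reflectionPerm k j) = P.pairingIn ℤ i j := by
  apply Int.cast_injective (α := ℂ)
  have h := P.pairing_reflectionPerm k i (P.reflectionPerm k j)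
  rw [P.reflectionPerm_self, ← P.algebraMap_pairingIn ℤ, ← P.algebraMap_pairingIn ℤ] at h
  exact h.symm

theorem pairingIn_reflectionPerm_self_left (i j : ι) :
    P.pairingIn ℤ (P.reflectionPerm i i) j = -P.pairingIn ℤ i j := by
  apply Int.cast_injective (α := ℂ)
  rw [← toLinearMap_root_coroot, root_reflectionPerm_self, Int.cast_neg,
    ← toLinearMap_root_coroot, map_neg, LinearMap.neg_apply]

theorem pairingIn_reflectionPerm_self_right (i j : ι) :
    P.pairingIn ℤ i (P.reflectionPerm j j) = -P.pairingIn ℤ i j := by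
  apply Int.cast_injective (α := ℂ)
  rw [← toLinearMap_root_coroot, coroot_reflectionPerm_self, Int.cast_neg,
    ← toLinearMap_root_coroot, map_neg]

/-- The quotient `(q⁻ᵐ E - qᵐ) / (E - 1)`, `E = q ^ (2 (γᵛ, z))`, if `(β, γᵛ) > 0`, and `1`
otherwise. -/
def ratio (P : RootPairing ι ℂ M N) [P.IsCrystallographic] (logq : ℂ) (m : ι → ℕ) (β γ : ι)
    (z : M) : ℂ :=
  if 0 < P.pairingIn ℤ β γ then
    (qPow logq ((-(m γ : ℤ) : ℤ) : ℂ) * zExp P logq (P.coroot γ) z - qPow logq ((m γ : ℤ) : ℂ)) /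
      (zExp P logq (P.coroot γ) z - 1)
  else 1

/-- The factor `q^{-ε m} E - q^{ε m}`, `E = q ^ (2 (γᵛ, z))`, where `ε` is the sign of
`(β, γᵛ)`. -/
def numerator (P : RootPairing ι ℂ M N) [P.IsCrystallographic] (logq : ℂ) (m : ι → ℕ) (β γ : ι)
    (z : M) : ℂ :=
  qPow logq ((-(P.pairingIn ℤ β γ).sign * m γ : ℤ) : ℂ) * zExp P logq (P.coroot γ) z -
    qPow logq (((P.pairingIn ℤ β γ).sign * m γ : ℤ) : ℂ)

variable {m} (hm : ∀ i j, m (P.reflectionPerm i j) = m j)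
include hm

theorem ratio_reflectionPerm {α : ι} {w : M} (hw : zExp P logq (P.coroot α) w = 1) (t : ℤ)
    (β γ : ι) :
    ratio P logq m (P.reflectionPerm α β) (P.reflectionPerm α γ)
      (w - ((t : ℂ) / 2) • P.root α) = ratio P logq m β γ (w + ((t : ℂ) / 2) • P.root α) := by
  rw [ratio, ratio, pairingIn_reflectionPerm_reflectionPerm, hm, zExp_coroot_reflectionPerm hw]

/-- Of γ and -γ at most one pairs positively with β, so the two ratios together contribute one
fraction, which can be written over the common denominator E - 1. -/
theorem numerator_eq {β γ : ι} {z : M} (hz : zExp P logq (P.coroot γ) z ≠ 1) :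
    numerator P logq m β γ z = (zExp P logq (P.coroot γ) z - 1) *
      (ratio P logq m β γ z * ratio P logq m β (P.reflectionPerm γ γ) z) := by
  have h1 : zExp P logq (P.coroot γ) z - 1 ≠ 0 := sub_ne_zero.2 hz
  have h0 := zExp_ne_zero P logq (P.coroot γ) z
  rw [numerator, ratio, ratio, hm, pairingIn_reflectionPerm_self_right, zExp_coroot_neg]
  rcases lt_trichotomy (P.pairingIn ℤ β γ) 0 with h | h | h
  · rw [Int.sign_eq_neg_one_of_neg h, if_neg (by omega), if_pos (by omega), neg_neg, one_mul,
      neg_one_mul, one_mul]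
    have h2 : (zExp P logq (P.coroot γ) z)⁻¹ - 1 ≠ 0 := by
      rw [sub_ne_zero]
      exact fun h => hz (inv_eq_one.1 h)
    have h3 : 1 - zExp P logq (P.coroot γ) z ≠ 0 := fun h => h1 (by linear_combination -h)
    field_simp
    ring
  · simp [h, qPow_zero]
  · rw [Int.sign_eq_one_of_pos h, if_pos h, if_neg (by omega), one_mul, mul_one, neg_one_mul]
    field_simp

variable [Fintype ι] [P.IsReduced] (b : P.Base)

theorem prod_numerator_eq {β : ι} {z : M} (hz : ∀ γ, zExp P logq (P.coroot γ) z ≠ 1) :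
    ∏ γ ∈ posRoots b, numerator P logq m β γ z =
      (∏ γ ∈ posRoots b, (zExp P logq (P.coroot γ) z - 1)) * ∏ γ, ratio P logq m β γ z := by
  rw [prod_univ_eq_prod_posRoots b, ← Finset.prod_mul_distrib]
  exact Finset.prod_congr rfl fun γ _ => numerator_eq hm (hz γ)

theorem prod_ratio_reflectionPerm {α : ι} {w : M} (hw : zExp P logq (P.coroot α) w = 1) (t : ℤ)
    (β : ι) :
    ∏ γ, ratio P logq m (P.reflectionPerm α β) γ (w - ((t : ℂ) / 2) • P.root α) =
      ∏ γ, ratio P logq m β γ (w + ((t : ℂ) / 2) • P.root α) := by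
  rw [← Equiv.prod_comp (P.reflectionPerm α)]
  exact Finset.prod_congr rfl fun γ _ => ratio_reflectionPerm hm hw t β γ

/-- At a generic point of the hypersurface of α the reflection permutes the ratios of the roots
other than ±α. The remaining factor is q^(-εm) - q^(εm), with ε the sign of (β, αᵛ), and this sign
changes under the reflection. -/
theorem prod_numerator_reflectionPerm
    {α : ι} (hα : α ∈ posRoots b) {w : M} (hw : CharacterField.IsGeneric P logq α w) (β : ι) :
    ∏ γ ∈ posRoots b, numerator P logq m (P.reflectionPerm α β) γ w =
      -∏ γ ∈ posRoots b, numerator P logq m β γ w := by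
  classical
  have hne : ∀ γ ∈ (posRoots b).erase α, zExp P logq (P.coroot γ) w ≠ 1 := by
    intro γ hγ
    rw [Finset.mem_erase] at hγ
    have := hw.2 γ (fun h => hγ.1 (P.root.injective h))
      (root_ne_neg_of_mem_posRoots b hγ.2 hα) 0
    simpa [qPow_zero] using this
  have hprod : ∀ β, ∏ γ ∈ (posRoots b).erase α, numerator P logq m β γ w =
      (∏ γ ∈ (posRoots b).erase α, (zExp P logq (P.coroot γ) w - 1)) *
        ∏ γ ∈ (Finset.univ.erase α).erase (P.reflectionPerm α α), ratio P logq m β γ w := by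
    intro β
    have : ∏ γ ∈ (Finset.univ.erase α).erase (P.reflectionPerm α α), ratio P logq m β γ w =
        ∏ γ ∈ (posRoots b).erase α,
          (ratio P logq m β γ w * ratio P logq m β (P.reflectionPerm γ γ) w) := by
      have h1 := prod_univ_eq_prod_posRoots b
        (fun γ => if γ = α ∨ γ = P.reflectionPerm α α then 1 else ratio P logq m β γ w)
      rw [← Finset.mul_prod_erase _ _ hα] at h1
      simp only [true_or, or_true, if_true, one_mul] at h1
      rw [← Finset.prod_erase (a := α) _ (by simp),
        ← Finset.prod_erase (a := P.reflectionPerm α α) _ (by simp)] at h1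
      refine Eq.trans (Finset.prod_congr rfl fun γ hγ => ?_) (h1.trans
        (Finset.prod_congr rfl fun γ hγ => ?_))
      · simp only [Finset.mem_erase] at hγ
        rw [if_neg (by tauto)]
      · rw [Finset.mem_erase] at hγ
        have h2 : γ ≠ P.reflectionPerm α α := fun h =>
          reflectionPerm_self_notMem_posRoots b hα (h ▸ hγ.2)
        have h3 : P.reflectionPerm γ γ ≠ α := fun h =>
          reflectionPerm_self_notMem_posRoots b hγ.2 (h ▸ hα)
        have h4 : P.reflectionPerm γ γ ≠ P.reflectionPerm α α := by
          intro h
          apply hγ.1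
          rw [← reflectionPerm_self_reflectionPerm_self (P := P) γ, h,
            reflectionPerm_self_reflectionPerm_self]
        rw [if_neg (by tauto), if_neg (by tauto)]
    rw [this, ← Finset.prod_mul_distrib]
    exact Finset.prod_congr rfl fun γ hγ => numerator_eq hm (hne γ hγ)
  have hinv : ∏ γ ∈ (Finset.univ.erase α).erase (P.reflectionPerm α α),
        ratio P logq m (P.reflectionPerm α β) γ w =
      ∏ γ ∈ (Finset.univ.erase α).erase (P.reflectionPerm α α), ratio P logq m β γ w := by
    symm
    refine Finset.prod_bij (fun γ _ => P.reflectionPerm α γ) ?_ ?_ ?_ ?_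
    · intro γ hγ
      simp only [Finset.mem_erase, Finset.mem_univ, and_true, ne_eq] at hγ ⊢
      refine ⟨fun h => hγ.2 ((P.reflectionPerm α).injective h), fun h => hγ.1 ((P.reflectionPerm α).injective ?_)⟩
      rw [h, P.reflectionPerm_self]
    · exact fun γ _ γ' _ h => (P.reflectionPerm α).injective h
    · intro γ hγ
      refine ⟨P.reflectionPerm α γ, ?_, P.reflectionPerm_self α γ⟩
      simp only [Finset.mem_erase, Finset.mem_univ, and_true, ne_eq] at hγ ⊢
      refine ⟨fun h => hγ.2 ((P.reflectionPerm α).injective h), fun h => hγ.1 ((P.reflectionPerm α).injective ?_)⟩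
      rw [h, P.reflectionPerm_self]
    · intro γ _
      have := ratio_reflectionPerm hm hw.1 0 β γ
      simpa using this.symm
  rw [← Finset.mul_prod_erase _ _ hα, ← Finset.mul_prod_erase (posRoots b) _ hα, hprod, hprod, hinv,
    ← neg_mul]
  congr 1
  have hp : P.pairingIn ℤ (P.reflectionPerm α β) α = -P.pairingIn ℤ β α := by
    rw [← neg_neg (P.pairingIn ℤ _ α), ← pairingIn_reflectionPerm_self_right,
      pairingIn_reflectionPerm_reflectionPerm]
  rw [numerator, numerator, hp, hw.1, Int.sign_neg]
  simp

end Operator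

end BakerAkhiezer

end

/-! ### A difference operator in z that preserves quasi-invariance. -/

noncomputable section

namespace BakerAkhiezer

open Module

variable {ι M N L : Type*} [AddCommGroup M] [Module ℂ M] [NormedAddCommGroup N] [NormedSpace ℂ N]
  {P : RootPairing ι ℂ M N} {logq : ℂ} [Field L] [Algebra ℂ L] (F : CharacterField P logq L)

/-- The root `β` satisfies `|(β, αᵛ)| ≤ 1` for all roots `α ≠ ±β`. -/
def IsShort (P : RootPairing ι ℂ M N) [P.IsCrystallographic] (β : ι) : Prop :=
  ∀ α, P.root α ≠ P.root β → P.root α ≠ -P.root β → |P.pairingIn ℤ β α| ≤ 1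

variable [P.IsCrystallographic]

theorem IsShort.reflectionPerm {β : ι} (h : IsShort P β) (α : ι) :
    IsShort P (P.reflectionPerm α β) := by
  intro γ h1 h2
  have := h (P.reflectionPerm α γ) ?_ ?_
  · rwa [← pairingIn_reflectionPerm_reflectionPerm α, P.reflectionPerm_self]
  · intro e
    rw [← P.root.injective e, P.reflectionPerm_self] at h1
    exact h1 rfl
  · intro e
    apply h2
    rw [P.root_reflectionPerm] at e ⊢
    rw [← map_neg, ← e, P.reflection_same]

namespace CharacterField

section Quotients

variable {m : ι → ℕ}

/-- The functions `h β` and `k β` that are used to define the difference operator in `z`. -/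
structure DifferenceQuotients (S : Set N) (logq : ℂ) (m : ι → ℕ) (F : CharacterField P logq L)
    (φ : M → L) where
  h : ι → M → L
  h_mem : ∀ β, h β ∈ F.funs S
  h_eq : ∀ β, 1 ≤ m β → ∀ z, φ (z + ((1 : ℤ) / 2 : ℂ) • P.root β) -
    φ (z - ((1 : ℤ) / 2 : ℂ) • P.root β) = (zExp P logq (P.coroot β) z - 1) • h β z

theorem exists_differenceQuotients (hq : ∀ n : ℤ, qPow logq n = 1 → n = 0) {S : Set N}
    (hS : ∀ i, ∀ μ ∈ S, ∀ k : ℤ, μ + k • P.coroot i ∈ S) {φ : M → L} (hφ : φ ∈ F.funs S)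
    (hQ : QuasiInvariant P logq m φ) : Nonempty (DifferenceQuotients S logq m F φ) := by
  have : ∀ β, ∃ g ∈ F.funs S, 1 ≤ m β → ∀ z, φ (z + ((1 : ℤ) / 2 : ℂ) • P.root β) -
      φ (z - ((1 : ℤ) / 2 : ℂ) • P.root β) = (zExp P logq (P.coroot β) z - 1) • g z := by
    intro β
    by_cases hβ : 1 ≤ m β
    · have hmem : (fun z => φ (z + ((1 : ℤ) / 2 : ℂ) • P.root β) -
          φ (z - ((1 : ℤ) / 2 : ℂ) • P.root β)) ∈ F.funs S := by
        simp_rw [sub_eq_add_neg _ (((1 : ℤ) / 2 : ℂ) • P.root β)]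
        exact (F.funs S).sub_mem (F.translate_mem_funs hφ _) (F.translate_mem_funs hφ _)
      obtain ⟨g, hg, h⟩ := F.exists_eq_sub_one_smul hq (hS β) hmem fun w hw => by
        rw [sub_eq_zero]
        exact hQ.apply_int hw (by simpa using hβ)
      exact ⟨g, hg, fun _ => h⟩
    · exact ⟨0, Submodule.zero_mem _, fun h => absurd h hβ⟩
  choose g hg h using this
  exact ⟨⟨g, hg, h⟩⟩

variable {F} {S : Set N} {φ : M → L} (d : DifferenceQuotients S logq m F φ)

namespace DifferenceQuotients

/-- The quotient of `(q^{2-m} E - q^m) (φ(z + β) - φ(z))` by `q² E - 1`, `E = q ^ (2 (βᵛ, z))`. -/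
def k (β : ι) (z : M) : L :=
  if m β = 0 then φ (z + P.root β) - φ z else
    (qPow logq ((2 - m β : ℤ) : ℂ) * zExp P logq (P.coroot β) z - qPow logq ((m β : ℤ) : ℂ)) •
      d.h β (z + ((1 : ℤ) / 2 : ℂ) • P.root β)

theorem k_mem (hS : ∀ i, ∀ μ ∈ S, ∀ k : ℤ, μ + k • P.coroot i ∈ S) (hφ : φ ∈ F.funs S) (β : ι) :
    d.k β ∈ F.funs S := by
  by_cases h : m β = 0
  · have : d.k β = (fun z => φ (z + P.root β)) - φ := by
      funext z
      simp [k, h]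
    rw [this]
    exact (F.funs S).sub_mem (F.translate_mem_funs hφ _) hφ
  · have := F.affine_smul_mem_funs (κ := P.coroot β)
      (fun μ hμ => by simpa using hS β μ hμ 1) (F.translate_mem_funs (d.h_mem β)
        (((1 : ℤ) / 2 : ℂ) • P.root β)) (qPow logq ((2 - m β : ℤ) : ℂ)) (qPow logq ((m β : ℤ) : ℂ))
    convert this using 1
    funext z
    rw [k, if_neg h]

theorem k_eq (β : ι) (z : M) :
    (qPow logq ((2 : ℤ) : ℂ) * zExp P logq (P.coroot β) z - 1) • d.k β z =
      (qPow logq ((2 - m β : ℤ) : ℂ) * zExp P logq (P.coroot β) z - qPow logq ((m β : ℤ) : ℂ)) •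
        (φ (z + P.root β) - φ z) := by
  by_cases h : m β = 0
  · rw [k, if_pos h, h]
    simp [qPow_zero]
  · have h1 := d.h_eq β (Nat.one_le_iff_ne_zero.2 h) (z + ((1 : ℤ) / 2 : ℂ) • P.root β)
    rw [zExp_coroot_self_add_half, mul_one, add_sub_cancel_right, add_assoc, ← add_smul] at h1
    norm_num at h1
    rw [k, if_neg h, h1, smul_smul, smul_smul]
    congr 1
    · push_cast
      ring
    · norm_num

variable (hq : ∀ n : ℤ, qPow logq n = 1 → n = 0)
include hq

theorem qPow_mul_ne_one {t : ℤ} (ht : t ≠ 0) : qPow logq ((2 * t : ℤ) : ℂ) - 1 ≠ 0 := by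
  rw [sub_ne_zero]
  intro h
  have := hq _ h
  omega

variable [Finite ι] [P.IsReduced] (hm : ∀ i j, m (P.reflectionPerm i j) = m j)
include hm

theorem h_neg (hS : ∀ i, ∀ μ ∈ S, ∀ k : ℤ, μ + k • P.coroot i ∈ S) {α : ι} (hα : 1 ≤ m α) (z : M) :
    d.h (P.reflectionPerm α α) z = zExp P logq (P.coroot α) z • d.h α z := by
  have hmem := (F.funs S).sub_mem (d.h_mem (P.reflectionPerm α α))
    (F.zExp_mul_mem_funs (κ := P.coroot α) (fun μ hμ => by simpa using hS α μ hμ 1) (d.h_mem α))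
  have h0 := F.eq_zero_of_forall_generic hq hmem fun w hw => by
    have h1 := d.h_eq α hα w
    have h2 := d.h_eq (P.reflectionPerm α α) (by rwa [hm]) w
    have hE : zExp P logq (P.coroot α) w - 1 ≠ 0 := by
      have := hw α 0
      rw [Int.cast_zero, qPow_zero] at this
      exact sub_ne_zero.2 this
    have h0 := zExp_ne_zero P logq (P.coroot α) w
    rw [root_reflectionPerm_self, smul_neg, sub_neg_eq_add, ← sub_eq_add_neg, ← neg_sub, h1,
      zExp_coroot_neg, ← neg_smul] at h2
    rw [Pi.sub_apply, sub_eq_zero]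
    have h3 : ((zExp P logq (P.coroot α) w)⁻¹ - 1) ≠ 0 := by
      intro h
      apply hE
      field_simp at h
      linear_combination -h
    refine smul_right_injective L h3 ?_
    simp only
    rw [← h2, smul_smul]
    congr 1
    field_simp
    ring
  exact sub_eq_zero.1 (congrFun h0 z)

/-- For t ≠ 0 both denominators equal q^(2t) - 1, and the numerators agree by quasi-invariance for t
+ 1 and t - 1. For t = 0 the denominators vanish, and `h_neg` is used instead. -/
theorem h_reflection (hS : ∀ i, ∀ μ ∈ S, ∀ k : ℤ, μ + k • P.coroot i ∈ S)
    (hQ : QuasiInvariant P logq m φ) {α : ι} (hα : 1 ≤ m α) {w : M}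
    (hw : zExp P logq (P.coroot α) w = 1) {t : ℤ} (h1 : |t + 1| ≤ m α) (h2 : |t - 1| ≤ m α) :
    d.h α (w + ((t : ℂ) / 2) • P.root α) =
      d.h (P.reflectionPerm α α) (w - ((t : ℂ) / 2) • P.root α) := by
  rcases eq_or_ne t 0 with rfl | ht
  · simp [d.h_neg hq hm hS hα, hw]
  · refine smul_right_injective L (qPow_mul_ne_one hq ht) ?_
    have e1 := d.h_eq α hα (w + ((t : ℂ) / 2) • P.root α)
    have e2 := d.h_eq (P.reflectionPerm α α) (by rwa [hm]) (w - ((t : ℂ) / 2) • P.root α)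
    rw [zExp_coroot_reflectionPerm hw, zExp_coroot_self_add_half, hw, one_mul,
      root_reflectionPerm_self] at e2
    rw [zExp_coroot_self_add_half, hw, one_mul] at e1
    simp only
    rw [← e1, ← e2]
    have q1 := hQ.apply_int hw h1
    have q2 := hQ.apply_int hw h2
    push_cast at q1 q2 ⊢
    congr 1
    · convert q1 using 2 <;> module
    · convert q2 using 2 <;> module

/-- The symmetry of the functions `k β` on the hypersurface `q ^ (2 (αᵛ, z)) = 1`. -/
theorem k_reflection (hS : ∀ i, ∀ μ ∈ S, ∀ k : ℤ, μ + k • P.coroot i ∈ S)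
    (hQ : QuasiInvariant P logq m φ) {β : ι} (hβ : IsShort P β) {α : ι} {w : M}
    (hw : IsGeneric P logq α w) {s : ℕ} (hs : s ≤ m α)
    (hs' : (s : ℤ) ≠ (P.pairingIn ℤ β α).sign * m α) :
    d.k β (w + ((s : ℤ) / 2 : ℂ) • P.root α) =
      d.k (P.reflectionPerm α β) (w - ((s : ℤ) / 2 : ℂ) • P.root α) := by
  by_cases h1 : P.root α = P.root β
  · obtain rfl := P.root.injective h1
    rw [P.pairingIn_same, Int.sign_eq_one_of_pos two_pos, one_mul] at hs'
    have hs2 : s < m α := lt_of_le_of_ne hs (by exact_mod_cast hs')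
    rw [k, k, if_neg (by omega), if_neg (by rw [hm]; omega), hm, zExp_coroot_reflectionPerm hw.1,
      zExp_coroot_self_add_half, hw.1, one_mul]
    -- For s = m_α - 1 quasi-invariance does not reach s + 2, but then the factor q^(2-m+2s) - q^m
    -- in front of the quotient is zero.
    rcases eq_or_ne (s + 1) (m α) with h2 | h2
    · have : qPow logq ((2 - m α : ℤ) : ℂ) * qPow logq ((2 * s : ℤ) : ℂ) -
          qPow logq ((m α : ℤ) : ℂ) = 0 := by
        rw [← qPow_int_add, sub_eq_zero]
        congr 2
        omega
      rw [this, zero_smul, zero_smul]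
    · congr 1
      have := d.h_reflection hq hm hS hQ (by omega) hw.1 (t := s + 1)
        (by rw [abs_of_nonneg (by positivity)]; omega)
        (by rw [abs_of_nonneg (by omega)]; omega)
      convert this using 2
      · push_cast; module
      · rw [root_reflectionPerm_self]; push_cast; module
  by_cases h2 : P.root α = -P.root β
  · obtain rfl : β = P.reflectionPerm α α := by
      apply P.root.injective
      rw [root_reflectionPerm_self, h2, neg_neg]
    rw [pairingIn_reflectionPerm_self_left, P.pairingIn_same, Int.sign_eq_neg_one_of_neg (by omega),
      neg_one_mul] at hs'
    rw [P.reflectionPerm_self]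
    have hα : 1 ≤ m α := by omega
    rw [k, k, if_neg (by rw [hm]; omega), if_neg (by omega), hm]
    have e := zExp_coroot_reflectionPerm hw.1 (P.reflectionPerm α α) s
    rw [P.reflectionPerm_self] at e
    rw [e]
    have e2 : zExp P logq (P.coroot (P.reflectionPerm α α))
        (w + ((s : ℤ) / 2 : ℂ) • P.root α) = qPow logq ((-(2 * s) : ℤ) : ℂ) := by
      rw [zExp_coroot_neg, zExp_coroot_self_add_half, hw.1, one_mul, ← qPow_int_neg]
    rw [e2]
    -- This bound fails only for s = 0 and m_α = 1, where the factor q^(2-m-2s) - q^m in front of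
    -- the quotient is zero.
    by_cases h3 : 2 - s ≤ m α
    · congr 1
      have := d.h_reflection hq hm hS hQ hα hw.1 (t := 1 - s)
        (by rw [abs_le]; omega) (by rw [abs_le]; omega)
      convert this.symm using 2
      · rw [root_reflectionPerm_self]; push_cast; module
      · push_cast; module
    · have : qPow logq ((2 - m α : ℤ) : ℂ) * qPow logq ((-(2 * s) : ℤ) : ℂ) -
          qPow logq ((m α : ℤ) : ℂ) = 0 := by
        rw [← qPow_int_add, sub_eq_zero]
        congr 2
        omega
      rw [this, zero_smul, zero_smul]
  have hn := hβ α h1 h2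
  have hne : qPow logq ((2 : ℤ) : ℂ) * zExp P logq (P.coroot β)
      (w + ((s : ℤ) / 2 : ℂ) • P.root α) - 1 ≠ 0 := by
    have := hw.2 β (Ne.symm h1) (fun h => h2 (by rw [h, neg_neg]))
      (-(2 + s * P.pairingIn ℤ α β))
    rw [zExp_coroot_add_half, sub_ne_zero]
    intro h
    apply this
    rw [qPow_int_neg, qPow_int_add]
    refine eq_inv_of_mul_eq_one_left ?_
    rw [← h]
    ring
  refine smul_right_injective L hne ?_
  simp only
  have e1 := d.k_eq β (w + ((s : ℤ) / 2 : ℂ) • P.root α)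
  have e2 := d.k_eq (P.reflectionPerm α β) (w - ((s : ℤ) / 2 : ℂ) • P.root α)
  rw [zExp_coroot_reflectionPerm hw.1, hm] at e2
  rw [e1, e2]
  congr 1
  set n := P.pairingIn ℤ β α with hnn
  have q1 := hQ.apply_int (t := s) hw.1 (by simpa using hs)
  have hw' : zExp P logq (P.coroot α) (w + P.root β - ((n : ℂ) / 2) • P.root α) = 1 := by
    rw [zExp_apply_sub, zExp_apply_add, hw.1, one_mul, zExp_int_half_smul_root, zExp,
      toLinearMap_root_coroot, toLinearMap_root_coroot, P.pairingIn_same, ← hnn,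
      ← qPow_intCast_mul, mul_comm (n : ℂ)]
    push_cast
    exact mul_inv_cancel₀ (qPow_ne_zero _ _)
  -- With n = (β, αᵛ), the points w + sα/2 + β and w - sα/2 + s_α(β) are symmetric about w + β -
  -- nα/2 with parameter s + n. As |n| ≤ 1, this parameter stays in the admissible range except in
  -- the two cases excluded by `hs'`.
  have q2 := hQ.apply_int (t := s + n) hw' (by
    rw [abs_le] at hn ⊢
    obtain h | h | h : n = -1 ∨ n = 0 ∨ n = 1 := by omega
    all_goals simp [h] at hs' ⊢
    all_goals omega)
  congr 1
  · rw [P.root_reflectionPerm, P.reflection_apply, LinearMap.flip_apply, toLinearMap_root_coroot,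
      ← hnn]
    convert q2 using 2
    · push_cast; module
    · push_cast; module

end DifferenceQuotients

end Quotients

section Operator

variable [Fintype ι] [P.IsReduced] {m : ι → ℕ} (b : P.Base)

/-- The factors are divided out one at a time: at a point generic for one root the factors of the
other positive roots do not vanish, so the remaining quotient still vanishes there. -/
theorem exists_eq_prod_smul (hq : ∀ n : ℤ, qPow logq n = 1 → n = 0) {S : Set N}
    (hS : ∀ i, ∀ μ ∈ S, ∀ k : ℤ, μ + k • P.coroot i ∈ S) {f : M → L} (hf : f ∈ F.funs S)
    (J : Finset ι) (hJ : J ⊆ posRoots b) (h0 : ∀ j ∈ J, ∀ w, IsGeneric P logq j w → f w = 0) :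
    ∃ g ∈ F.funs S, ∀ z, f z = (∏ j ∈ J, (zExp P logq (P.coroot j) z - 1)) • g z := by
  classical
  induction J using Finset.induction_on with
  | empty => exact ⟨f, hf, fun z => by simp⟩
  | insert i J hi ih =>
    obtain ⟨g, hg, h⟩ := ih (fun j hj => hJ (Finset.mem_insert_of_mem hj))
      fun j hj => h0 j (Finset.mem_insert_of_mem hj)
    obtain ⟨g', hg', h'⟩ := F.exists_eq_sub_one_smul hq (hS i) hg fun w hw =>
      F.eq_zero_of_isGeneric hq hg (fun w hw => by
        have h1 := h0 i (Finset.mem_insert_self _ _) w hw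
        rw [h w, smul_eq_zero] at h1
        refine h1.resolve_left (Finset.prod_ne_zero_iff.2 fun j hj => ?_)
        have := hw.2 j (fun e => hi (P.root.injective e ▸ hj))
          (root_ne_neg_of_mem_posRoots b (hJ (Finset.mem_insert_of_mem hj))
            (hJ (Finset.mem_insert_self _ _))) 0
        rw [Int.cast_zero, qPow_zero] at this
        exact sub_ne_zero.2 this) hw
    refine ⟨g', hg', fun z => ?_⟩
    rw [h z, h' z, smul_smul, Finset.prod_insert hi, mul_comm]

open Classical in
/-- The indices of the short roots in the sense of `IsShort`. -/
def shortRoots (P : RootPairing ι ℂ M N) [P.IsCrystallographic] : Finset ι :=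
  Finset.univ.filter (IsShort P)

theorem mem_shortRoots {β : ι} : β ∈ shortRoots P ↔ IsShort P β := by simp [shortRoots]

theorem sum_shortRoots_reflectionPerm {R : Type*} [AddCommMonoid R] (α : ι) (f : ι → R) :
    ∑ β ∈ shortRoots P, f (P.reflectionPerm α β) = ∑ β ∈ shortRoots P, f β :=
  Finset.sum_bij (fun j _ => P.reflectionPerm α j)
    (fun _ hj => mem_shortRoots.2 ((mem_shortRoots.1 hj).reflectionPerm α))
    (fun _ _ _ _ h => (P.reflectionPerm α).injective h)
    (fun j hj => ⟨_, mem_shortRoots.2 ((mem_shortRoots.1 hj).reflectionPerm α),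
      P.reflectionPerm_self α j⟩)
    (fun _ _ => rfl)

theorem IsGeneric.zExp_ne_one (hq : ∀ n : ℤ, qPow logq n = 1 → n = 0) {α : ι} {w : M}
    (hw : IsGeneric P logq α w) {s : ℤ} (hs : s ≠ 0) (γ : ι) :
    zExp P logq (P.coroot γ) (w + ((s : ℂ) / 2) • P.root α) ≠ 1 := by
  by_cases h1 : P.root γ = P.root α
  · obtain rfl := P.root.injective h1
    rw [zExp_coroot_self_add_half, hw.1, one_mul]
    intro h
    have := hq _ h
    omega
  by_cases h2 : P.root γ = -P.root α
  · obtain rfl : γ = P.reflectionPerm α α := by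
      apply P.root.injective
      rw [root_reflectionPerm_self, h2]
    rw [zExp_coroot_neg, zExp_coroot_self_add_half, hw.1, one_mul]
    intro h
    have := hq _ (inv_eq_one.1 h)
    omega
  have := hw.2 γ h1 h2 (-(s * P.pairingIn ℤ α γ))
  rw [zExp_coroot_add_half]
  intro h
  apply this
  rw [qPow_int_neg]
  exact eq_inv_of_mul_eq_one_left h

/-- A difference operator in `z` that acts on the quasi-invariant functions. -/
theorem exists_operator (hq : ∀ n : ℤ, qPow logq n = 1 → n = 0)
    (hm : ∀ i j, m (P.reflectionPerm i j) = m j) {S : Set N}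
    (hS : ∀ i, ∀ μ ∈ S, ∀ k : ℤ, μ + k • P.coroot i ∈ S) {φ : M → L} (hφ : φ ∈ F.funs S)
    (hQ : QuasiInvariant P logq m φ) :
    ∃ Φ ∈ F.funs S, QuasiInvariant P logq m Φ ∧ ∃ k : ι → M → L, (∀ β, k β ∈ F.funs S) ∧
      (∀ β z, (qPow logq ((2 : ℤ) : ℂ) * zExp P logq (P.coroot β) z - 1) • k β z =
        (qPow logq ((2 - m β : ℤ) : ℂ) * zExp P logq (P.coroot β) z - qPow logq ((m β : ℤ) : ℂ)) •
          (φ (z + P.root β) - φ z)) ∧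
      ∀ z, (∏ γ ∈ posRoots b, (zExp P logq (P.coroot γ) z - 1)) • Φ z =
        ∑ β ∈ shortRoots P, (∏ γ ∈ posRoots b, numerator P logq m β γ z) • k β z := by
  classical
  obtain ⟨d⟩ := F.exists_differenceQuotients (m := m) hq hS hφ hQ
  have hmemterm : ∀ β, (fun z => (∏ γ ∈ posRoots b, numerator P logq m β γ z) • d.k β z) ∈
      F.funs S := fun β =>
    F.prod_affine_smul_mem_funs (fun j _ μ hμ => by simpa using hS j μ hμ 1)
      (d.k_mem hS hφ β) _ _
  have hmem : (fun z => ∑ β ∈ shortRoots P, (∏ γ ∈ posRoots b, numerator P logq m β γ z) •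
      d.k β z) ∈ F.funs S := by
    convert Submodule.sum_mem (F.funs S) fun β (_ : β ∈ shortRoots P) => hmemterm β using 1
    funext z
    simp
  obtain ⟨Φ, hΦ, h⟩ := F.exists_eq_prod_smul b hq hS hmem (posRoots b) subset_rfl (by
    intro α hα w hw
    -- On the hypersurface of α the summand of s_α(β) is the negative of that of β. The whole sum
    -- therefore vanishes there and is divisible by the product of the E - 1.
    have h2 : ∀ β ∈ shortRoots P,
        (∏ γ ∈ posRoots b, numerator P logq m (P.reflectionPerm α β) γ w) •
          d.k (P.reflectionPerm α β) w =
        -((∏ γ ∈ posRoots b, numerator P logq m β γ w) • d.k β w) := by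
      intro β hβ
      rw [prod_numerator_reflectionPerm hm b hα hw, neg_smul]
      -- The case not covered by `k_reflection` at s = 0 is m_α = 0 or (β, αᵛ) = 0; the factor of α
      -- in the numerator is then 1 - 1.
      by_cases h3 : (0 : ℤ) = (P.pairingIn ℤ β α).sign * m α
      · have : ∏ γ ∈ posRoots b, numerator P logq m β γ w = 0 := by
          refine Finset.prod_eq_zero hα ?_
          rw [numerator, neg_mul, ← h3, hw.1]
          simp
        rw [this, zero_smul, zero_smul]
      · have := d.k_reflection hq hm hS hQ (mem_shortRoots.1 hβ) hw (Nat.zero_le _)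
          (by exact_mod_cast h3)
        norm_num at this
        rw [this]
    have h3 : ∑ β ∈ shortRoots P, (∏ γ ∈ posRoots b, numerator P logq m β γ w) • d.k β w =
        -∑ β ∈ shortRoots P, (∏ γ ∈ posRoots b, numerator P logq m β γ w) • d.k β w := by
      rw [← Finset.sum_neg_distrib, ← Finset.sum_congr rfl h2]
      exact (sum_shortRoots_reflectionPerm α
        fun β => (∏ γ ∈ posRoots b, numerator P logq m β γ w) • d.k β w).symm
    have h4 := add_eq_zero_iff_eq_neg.2 h3
    rw [← two_smul ℂ] at h4
    exact (smul_eq_zero.1 h4).resolve_left two_ne_zero)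
  refine ⟨Φ, hΦ, ?_, d.k, d.k_mem hS hφ, d.k_eq, fun z => (h z).symm⟩
  have hΦC : ∀ z, (∀ γ, zExp P logq (P.coroot γ) z ≠ 1) →
      Φ z = ∑ β ∈ shortRoots P, (∏ γ, ratio P logq m β γ z) • d.k β z := by
    intro z hz
    refine smul_right_injective L (Finset.prod_ne_zero_iff.2 fun γ _ => sub_ne_zero.2 (hz γ) :
      ∏ γ ∈ posRoots b, (zExp P logq (P.coroot γ) z - 1) ≠ 0) ?_
    simp only
    rw [← h z, Finset.smul_sum]
    refine Finset.sum_congr rfl fun β _ => ?_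
    rw [smul_smul, prod_numerator_eq hm b hz]
  intro α s hs1 hs2 w hw
  rw [← sub_eq_zero]
  have hmem2 : (fun w => Φ (w + ((s : ℂ) / 2) • P.root α) - Φ (w - ((s : ℂ) / 2) • P.root α)) ∈
      F.funs S := by
    simp_rw [sub_eq_add_neg _ (((s : ℂ) / 2) • P.root α)]
    exact (F.funs S).sub_mem (F.translate_mem_funs hΦ _) (F.translate_mem_funs hΦ _)
  refine F.eq_zero_of_isGeneric hq hmem2 (i := α) (fun w hw => ?_) hw
  rw [sub_eq_zero]
  have hz1 := hw.zExp_ne_one hq (s := s) (by omega)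
  have hz2 := hw.zExp_ne_one hq (s := -s) (by omega)
  push_cast at hz1 hz2
  simp only [neg_div, neg_smul, ← sub_eq_add_neg] at hz2
  rw [hΦC _ hz1, hΦC _ hz2, ← sum_shortRoots_reflectionPerm α
    fun β => (∏ γ, ratio P logq m β γ (w - ((s : ℂ) / 2) • P.root α)) •
      d.k β (w - ((s : ℂ) / 2) • P.root α)]
  refine Finset.sum_congr rfl fun β hβ => ?_
  have hr := prod_ratio_reflectionPerm hm hw.1 s β
  push_cast at hr
  rw [hr]
  -- In the case not covered by `k_reflection`, (β, αᵛ) > 0 and s = m_α. Then E = q^(2m) at the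
  -- shifted point and the ratio of α has the zero numerator q^(-m+2m) - q^m.
  by_cases h3 : (s : ℤ) = (P.pairingIn ℤ β α).sign * m α
  · have : ∏ γ, ratio P logq m β γ (w + ((s : ℂ) / 2) • P.root α) = 0 := by
      refine Finset.prod_eq_zero (Finset.mem_univ α) ?_
      have hpos : 0 < P.pairingIn ℤ β α := by
        rw [← Int.sign_eq_one_iff_pos]
        rcases Int.sign_trichotomy (P.pairingIn ℤ β α) with h | h | h
        · exact h
        · rw [h] at h3; omega
        · rw [h] at h3; omega
      rw [Int.sign_eq_one_of_pos hpos, one_mul] at h3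
      have e := zExp_coroot_self_add_half (P := P) (logq := logq) α s w
      rw [hw.1, one_mul] at e
      rw [ratio, if_pos hpos]
      push_cast at e ⊢
      rw [e, ← qPow_add]
      rw [div_eq_zero_iff]
      left
      rw [sub_eq_zero]
      congr 1
      have : (s : ℂ) = m α := by exact_mod_cast h3
      rw [this]
      ring
    rw [this, zero_smul, zero_smul]
  · have := d.k_reflection hq hm hS hQ (mem_shortRoots.1 hβ) hw hs2 h3
    push_cast at this
    rw [this]

end Operator

end CharacterField

end BakerAkhiezer

end

/-! ### Heights and short roots. -/

noncomputable section

namespace BakerAkhiezer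

open Module

section RootSystem

variable {ι M N : Type*} [Fintype ι] [AddCommGroup M] [Module ℂ M] [NormedAddCommGroup N]
  [NormedSpace ℂ N] {P : RootPairing ι ℂ M N} [P.IsCrystallographic] [P.IsReduced] (b : P.Base)

theorem reflection_rho {k : ι → ℂ} (hk : ∀ i j, k (P.reflectionPerm i j) = k j) {i : ι}
    (hi : i ∈ b.support) : P.reflection i (rho b k) = rho b k - k i • P.root i := by
  classical
  have hip := mem_posRoots_of_mem_support b hi
  have key : P.reflection i (∑ j ∈ posRoots b, k j • P.root j) =
      ∑ j ∈ posRoots b, k j • P.root j - (2 * k i) • P.root i := by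
    rw [← Finset.add_sum_erase _ _ hip, map_add, map_sum, map_smul, P.reflection_apply_self]
    have : ∑ j ∈ (posRoots b).erase i, P.reflection i (k j • P.root j) =
        ∑ j ∈ (posRoots b).erase i, k j • P.root j := by
      rw [← sum_posRoots_erase_reflectionPerm b hi]
      refine Finset.sum_congr rfl fun j _ => ?_
      rw [map_smul, ← P.root_reflectionPerm, P.reflectionPerm_self, hk]
    rw [this]
    module
  rw [rho, map_smul, key]
  module

theorem rho_coroot {k : ι → ℂ} (hk : ∀ i j, k (P.reflectionPerm i j) = k j) {i : ι}
    (hi : i ∈ b.support) : P.toLinearMap (rho b k) (P.coroot i) = k i := by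
  have h := reflection_rho b hk hi
  rw [P.reflection_apply, sub_right_inj] at h
  exact smul_left_injective ℂ (P.ne_zero i) h

/-- The height of a coweight, as a real linear function. -/
def height : N →ₗ[ℝ] ℝ :=
  Complex.reLm ∘ₗ (P.toLinearMap (rho b fun _ => 1)).restrictScalars ℝ

theorem height_apply (ν : N) : height b ν = (P.toLinearMap (rho b fun _ => 1) ν).re := rfl

theorem height_coroot_of_mem_support {i : ι} (hi : i ∈ b.support) : height b (P.coroot i) = 1 := by
  rw [height_apply, rho_coroot b (fun _ _ => rfl) hi, Complex.one_re]

/-- Each coroot is a positive multiple of the image of its root under the polarization. The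
expansion of a positive root in simple roots therefore becomes, after weighting by root lengths, an
expansion of the coroot in simple coroots with nonnegative coefficients. -/
theorem height_coroot_pos {i : ι} (hi : i ∈ posRoots b) : 0 < height b (P.coroot i) := by
  obtain ⟨f, hf, hpos, he⟩ := b.exists_root_eq_sum_int i
  have hsum := b.height_eq_sum he
  rw [mem_posRoots, b.isPos_iff, hsum] at hi
  have hf0 : 0 < f := hpos.resolve_right fun h =>
    absurd hi (not_lt.2 (Finset.sum_nonpos fun j _ => h.le j))
  have hℓ := fun j => (P.posRootForm ℤ).rootLength_pos j
  have hc : ∀ j, (((P.posRootForm ℤ).rootLength j : ℤ) : ℂ) • P.coroot j =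
      (2 : ℂ) • P.Polarization (P.root j) := by
    intro j
    have h1 := P.rootForm_self_smul_coroot j
    have h2 := (P.posRootForm ℤ).algebraMap_rootLength j
    change ((P.posRootForm ℤ).rootLength j : ℂ) = P.RootForm (P.root j) (P.root j) at h2
    rw [h2, h1]
    exact (Nat.cast_smul_eq_nsmul ℂ 2 _).symm
  have h3 : (((P.posRootForm ℤ).rootLength i : ℤ) : ℂ) • P.coroot i =
      ∑ j ∈ b.support, (f j : ℂ) • ((P.posRootForm ℤ).rootLength j : ℂ) • P.coroot j := by
    simp_rw [hc]
    rw [he, map_sum, Finset.smul_sum]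
    refine Finset.sum_congr rfl fun j _ => ?_
    rw [map_zsmul, Int.cast_smul_eq_zsmul, smul_comm]
  have h4 := congrArg (height b) h3
  simp_rw [Int.cast_smul_eq_zsmul, map_sum, map_zsmul] at h4
  have h5 : ∑ j ∈ b.support, f j • (P.posRootForm ℤ).rootLength j • height b (P.coroot j) =
      ((∑ j ∈ b.support, f j * (P.posRootForm ℤ).rootLength j : ℤ) : ℝ) := by
    push_cast
    refine Finset.sum_congr rfl fun j hj => ?_
    rw [height_coroot_of_mem_support b hj]
    simp
  have h6 : 0 < ∑ j ∈ b.support, f j * (P.posRootForm ℤ).rootLength j := by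
    refine lt_of_lt_of_le hi (Finset.sum_le_sum fun j _ => ?_)
    exact le_mul_of_one_le_right (hf0.le j) (hℓ j)
  rw [h5] at h4
  have h7 : (0 : ℝ) < ((∑ j ∈ b.support, f j * (P.posRootForm ℤ).rootLength j : ℤ) : ℝ) := by
    exact_mod_cast h6
  rw [← h4, zsmul_eq_mul] at h7
  exact (pos_iff_pos_of_mul_pos h7).1 (by exact_mod_cast hℓ i)

theorem coroot_mem_closure {i : ι} (hi : i ∈ posRoots b) :
    P.coroot i ∈ AddSubmonoid.closure (P.coroot '' b.support) := by
  refine (b.coroot_mem_or_neg_mem i).resolve_right fun h => ?_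
  have h1 : ∀ x ∈ AddSubmonoid.closure (P.coroot '' b.support), 0 ≤ height b x := by
    intro x hx
    induction hx using AddSubmonoid.closure_induction with
    | mem x hx =>
      obtain ⟨j, hj, rfl⟩ := hx
      rw [height_coroot_of_mem_support b hj]
      exact zero_le_one
    | zero => rw [map_zero]
    | add x y _ _ hx hy => rw [map_add]; exact add_nonneg hx hy
  have h2 := h1 _ h
  rw [map_neg] at h2
  linarith [height_coroot_pos b hi]

theorem exists_two_mul_height_eq {ν : N} (hν : ν ∈ coweightLattice P) :
    ∃ n : ℤ, 2 * height b ν = n := by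
  choose n hn using hν
  refine ⟨∑ i ∈ posRoots b, n i, ?_⟩
  have h : (2 : ℂ) * P.toLinearMap (rho b fun _ => 1) ν = ((∑ i ∈ posRoots b, n i : ℤ) : ℂ) := by
    rw [rho, map_smul, LinearMap.smul_apply, smul_eq_mul, map_sum, LinearMap.sum_apply]
    simp [hn]
  have := congrArg Complex.re h
  rw [height_apply]
  rw [Complex.intCast_re] at this
  rw [← this]
  simp

/-- A root β of minimal length works: (β, αᵛ) is at most (α, βᵛ) in absolute value, and for
non-proportional roots one of the two is at most 1 in absolute value. -/
theorem exists_isShort [Nonempty ι] : ∃ β, IsShort P β := by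
  obtain ⟨β, hβ⟩ := Finite.exists_min (P.posRootForm ℤ).rootLength
  refine ⟨β, fun α h1 h2 => ?_⟩
  have h3 := P.pairingIn_pairingIn_mem_set_of_isCrystal_of_isRed' β α h1.symm
    (fun h => h2 (by rw [h, neg_neg]))
  have h4 := (P.posRootForm ℤ).pairingIn_mul_eq_pairingIn_mul_swap α β
  have h5 := hβ α
  have h6 := (P.posRootForm ℤ).rootLength_pos β
  simp only [Set.mem_insert_iff, Set.mem_singleton_iff, Prod.mk.injEq] at h3
  rcases h3 with h | h | h | h | h | h | h | h | h | h | h <;>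
    (rw [h.1, h.2] at h4; rw [h.1]; first | (norm_num; done) | (exfalso; omega))

/-- The span is nonzero and stable under all reflections, so irreducibility applies. -/
theorem span_shortRoots_eq_top [P.IsIrreducible] [Nonempty ι] :
    Submodule.span ℂ (P.root '' {β | IsShort P β}) = ⊤ := by
  refine RootPairing.IsIrreducible.eq_top_of_invtSubmodule_reflection (P := P) _ (fun i => ?_) ?_
  · rw [Module.End.mem_invtSubmodule, Submodule.span_le]
    rintro _ ⟨β, hβ, rfl⟩
    refine Submodule.subset_span ⟨P.reflectionPerm i β, IsShort.reflectionPerm hβ i, ?_⟩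
    rw [P.root_reflectionPerm]
    rfl
  · obtain ⟨β, hβ⟩ := exists_isShort (P := P)
    intro h
    rw [Submodule.span_eq_bot] at h
    exact P.ne_zero β (h _ ⟨β, hβ, rfl⟩)

end RootSystem

end BakerAkhiezer

end

/-! ### Leading coefficients in a direction. -/

noncomputable section

namespace BakerAkhiezer

open Module

variable {ι M N L : Type*} [AddCommGroup M] [Module ℂ M] [NormedAddCommGroup N] [NormedSpace ℂ N]
  {P : RootPairing ι ℂ M N} {logq : ℂ} [Field L] [Algebra ℂ L] (F : CharacterField P logq L)
  (g : N →ₗ[ℝ] ℝ)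

namespace CharacterField

/-- The coefficients of `f` vanish at the height above `T`, and they are given by `e` at the
height `T`. -/
def HasTop (T : ℝ) (f : M → L) (e : N → L) : Prop :=
  ∃ c : N →₀ L, F.ev c = f ∧ (∀ ν, T < g ν → c ν = 0) ∧ ∀ ν, g ν = T → c ν = e ν

variable {F g}

theorem HasTop.congr {T : ℝ} {f : M → L} {e e' : N → L} (h : F.HasTop g T f e)
    (he : ∀ ν, g ν = T → e ν = e' ν) : F.HasTop g T f e' := by
  obtain ⟨c, h1, h2, h3⟩ := h
  exact ⟨c, h1, h2, fun ν hν => (h3 ν hν).trans (he ν hν)⟩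

theorem HasTop.zero (T : ℝ) : F.HasTop g T 0 0 := ⟨0, F.ev_zero, by simp, by simp⟩

theorem HasTop.add {T : ℝ} {f f' : M → L} {e e' : N → L} (h : F.HasTop g T f e)
    (h' : F.HasTop g T f' e') : F.HasTop g T (f + f') (e + e') := by
  obtain ⟨c, rfl, h2, h3⟩ := h
  obtain ⟨c', rfl, h2', h3'⟩ := h'
  exact ⟨c + c', F.ev_add c c', fun ν hν => by simp [h2 ν hν, h2' ν hν],
    fun ν hν => by simp [h3 ν hν, h3' ν hν]⟩

theorem HasTop.const_smul {T : ℝ} {f : M → L} {e : N → L} (h : F.HasTop g T f e) (a : L) :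
    F.HasTop g T (a • f) (a • e) := by
  obtain ⟨c, rfl, h2, h3⟩ := h
  exact ⟨a • c, F.evLin.map_smul a c, fun ν hν => by simp [h2 ν hν],
    fun ν hν => by simp [h3 ν hν]⟩

theorem HasTop.sub {T : ℝ} {f f' : M → L} {e e' : N → L} (h : F.HasTop g T f e)
    (h' : F.HasTop g T f' e') : F.HasTop g T (f - f') (e - e') := by
  rw [sub_eq_add_neg, sub_eq_add_neg, ← neg_one_smul L f', ← neg_one_smul L e']
  exact h.add (h'.const_smul (-1))

theorem HasTop.sum {α : Type*} {T : ℝ} (s : Finset α) {f : α → M → L} {e : α → N → L}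
    (h : ∀ i ∈ s, F.HasTop g T (f i) (e i)) :
    F.HasTop g T (∑ i ∈ s, f i) (∑ i ∈ s, e i) := by
  classical
  induction s using Finset.induction_on with
  | empty => simpa using HasTop.zero T
  | insert i s hi ih =>
    rw [Finset.sum_insert hi, Finset.sum_insert hi]
    exact (h i (Finset.mem_insert_self _ _)).add
      (ih fun j hj => h j (Finset.mem_insert_of_mem hj))

theorem HasTop.translate {T : ℝ} {f : M → L} {e : N → L} (h : F.HasTop g T f e) (v : M) :
    F.HasTop g T (fun z => f (z + v)) (fun ν => F.X v * zExp P logq ν v • e ν) := by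
  classical
  obtain ⟨c, rfl, h2, h3⟩ := h
  refine ⟨Finsupp.onFinset c.support (fun ν => F.X v * zExp P logq ν v • c ν) ?_, ?_, ?_, ?_⟩
  · intro ν hν
    rw [Finsupp.mem_support_iff]
    rintro h
    rw [h, smul_zero, mul_zero] at hν
    exact hν rfl
  · funext z
    rw [F.ev_eq_sum Finsupp.support_onFinset_subset, F.ev_eq_sum subset_rfl, F.X_add, mul_assoc]
    congr 1
    rw [Finset.mul_sum]
    refine Finset.sum_congr rfl fun ν _ => ?_
    rw [zExp_apply_add, Finsupp.onFinset_apply]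
    simp only [Algebra.smul_def, map_mul]
    ring
  · intro ν hν
    rw [Finsupp.onFinset_apply, h2 ν hν, smul_zero, mul_zero]
  · intro ν hν
    rw [Finsupp.onFinset_apply, h3 ν hν]

variable (F) in
theorem exists_ev_eq_affine_smul (κ : N) (a d : ℂ) (c : N →₀ L) :
    ∃ c' : N →₀ L, F.ev c' = (fun z => (a * zExp P logq κ z - d) • F.ev c z) ∧
      ∀ ν, c' ν = a • c (ν - κ) - d • c ν := by
  classical
  refine ⟨algebraMap ℂ L a • c.mapDomain (· + κ) - algebraMap ℂ L d • c, ?_, ?_⟩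
  · funext z
    rw [F.ev_sub, Pi.sub_apply, F.ev_smul, F.ev_smul, sub_smul]
    congr 1
    · rw [ev, Finsupp.sum_mapDomain_index (by simp) (by simp [smul_add]), ev, Finsupp.sum,
        Finsupp.sum, ← mul_smul_comm, Finset.smul_sum, ← mul_assoc, mul_comm _ (F.X z), mul_assoc,
        Finset.mul_sum]
      congr 1
      refine Finset.sum_congr rfl fun ν _ => ?_
      rw [zExp_add_apply]
      simp only [Algebra.smul_def, map_mul]
      ring
    · rw [Algebra.smul_def]
  · intro ν
    have : c.mapDomain (· + κ) ν = c (ν - κ) := by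
      have := Finsupp.mapDomain_apply (add_left_injective κ) c (ν - κ)
      rwa [sub_add_cancel] at this
    rw [Finsupp.sub_apply, Finsupp.smul_apply, Finsupp.smul_apply, this, smul_eq_mul, smul_eq_mul,
      Algebra.smul_def, Algebra.smul_def]

variable (F g) in
/-- Multiplication by `p` shifts the leading coefficients by `K` and multiplies them by `l`. -/
def IsMultiplier (p : M → ℂ) (K : N) (l : ℂ) : Prop :=
  ∀ T f e, F.HasTop g T f e →
    F.HasTop g (T + g K) (fun z => p z • f z) (fun ν => l • e (ν - K))

open Classical in
-- Of the two terms of a E - d the first is the leading one if g(κ) > 0 and the second if g(κ) < 0.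
theorem isMultiplier_affine {κ : N} (hκ : g κ ≠ 0) (a d : ℂ) :
    F.IsMultiplier g (fun z => a * zExp P logq κ z - d) (if 0 < g κ then κ else 0)
      (if 0 < g κ then a else -d) := by
  rintro T f e ⟨c, rfl, h2, h3⟩
  obtain ⟨c', h, h'⟩ := F.exists_ev_eq_affine_smul κ a d c
  refine ⟨c', h, ?_, ?_⟩
  · intro ν hν
    rw [h']
    split_ifs at hν with hpos
    · rw [h2 (ν - κ) (by rw [map_sub]; linarith), h2 ν (by linarith), smul_zero, smul_zero,
        sub_zero]
    · have : g κ < 0 := lt_of_le_of_ne (not_lt.1 hpos) hκ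
      rw [map_zero, add_zero] at hν
      rw [h2 (ν - κ) (by rw [map_sub]; linarith), h2 ν hν, smul_zero, smul_zero, sub_zero]
  · intro ν hν
    rw [h']
    split_ifs at hν ⊢ with hpos
    · rw [h3 (ν - κ) (by rw [map_sub]; linarith), h2 ν (by linarith), smul_zero, sub_zero]
    · have : g κ < 0 := lt_of_le_of_ne (not_lt.1 hpos) hκ
      rw [map_zero, add_zero] at hν
      rw [h2 (ν - κ) (by rw [map_sub]; linarith), h3 ν hν, smul_zero, zero_sub, ← neg_smul]
      simp only [sub_zero]

theorem isMultiplier_prod {J : Finset ι} {p : ι → M → ℂ} {K : ι → N} {l : ι → ℂ}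
    (h : ∀ j ∈ J, F.IsMultiplier g (p j) (K j) (l j)) :
    F.IsMultiplier g (fun z => ∏ j ∈ J, p j z) (∑ j ∈ J, K j) (∏ j ∈ J, l j) := by
  classical
  induction J using Finset.induction_on with
  | empty => intro T f e hf; simpa using hf
  | insert i J hi ih =>
    intro T f e hf
    have h1 := h i (Finset.mem_insert_self _ _) _ _ _
      (ih (fun j hj => h j (Finset.mem_insert_of_mem hj)) T f e hf)
    rw [Finset.sum_insert hi, Finset.prod_insert hi, map_add, add_comm (g (K i)), ← add_assoc]
    convert h1 using 1
    · funext z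
      simp only [Finset.prod_insert hi, smul_smul]
    · funext ν
      simp only [smul_smul, sub_sub]

/-- The leading coefficients of a quotient. -/
theorem IsMultiplier.hasTop_of_smul (hq : ∀ n : ℤ, qPow logq n = 1 → n = 0) {p : M → ℂ} {K : N}
    {l : ℂ} (hp : F.IsMultiplier g p K l) (hl : l ≠ 0) {S : Set N} {f : M → L} (hf : f ∈ F.funs S)
    {T : ℝ} {e : N → L} (h : F.HasTop g (T + g K) (fun z => p z • f z) e) :
    F.HasTop g T f (fun ν => l⁻¹ • e (ν + K)) := by
  obtain ⟨c, -, rfl⟩ := F.mem_funs.1 hf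
  obtain ⟨c', h1, h2, h3⟩ := h
  -- An exponent of maximal g-value above T would give a nonzero leading coefficient of the product
  -- at a g-value above T + g K.
  have hb : ∀ ν, T < g ν → c ν = 0 := by
    by_contra! hc
    obtain ⟨ν₁, hν₁, hc₁⟩ := hc
    obtain ⟨ν₀, hν₀, hmax⟩ := Finset.exists_max_image c.support g
      ⟨ν₁, Finsupp.mem_support_iff.2 hc₁⟩
    have hT : T < g ν₀ := lt_of_lt_of_le hν₁ (hmax ν₁ (Finsupp.mem_support_iff.2 hc₁))
    obtain ⟨d, d1, d2, d3⟩ := hp (g ν₀) (F.ev c) c ⟨c, rfl, fun ν hν => by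
      by_contra hne
      exact absurd (hmax ν (Finsupp.mem_support_iff.2 hne)) (not_le.2 hν), fun _ _ => rfl⟩
    have hd : d = c' := F.ev_injective hq (d1.trans h1.symm)
    have e1 := d3 (ν₀ + K) (by rw [map_add])
    simp only [hd, h2 _ (show T + g K < g (ν₀ + K) by rw [map_add]; linarith),
      add_sub_cancel_right] at e1
    exact smul_ne_zero hl (Finsupp.mem_support_iff.1 hν₀) e1.symm
  refine ⟨c, rfl, hb, fun ν hν => ?_⟩
  obtain ⟨d, d1, d2, d3⟩ := hp T (F.ev c) c ⟨c, rfl, hb, fun _ _ => rfl⟩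
  have hd : d = c' := F.ev_injective hq (d1.trans h1.symm)
  have e1 := d3 (ν + K) (by rw [map_add, hν])
  simp only [hd, h3 _ (show g (ν + K) = T + g K by rw [map_add, hν]), add_sub_cancel_right] at e1
  simp only
  rw [e1, smul_smul, inv_mul_cancel₀ hl, one_smul]

end CharacterField

section Leading

open CharacterField

variable [Fintype ι] [P.IsCrystallographic] [P.IsReduced] (b : P.Base) (m : ι → ℕ)

/-- The sign of the value of `g` at a coroot. -/
def corootSign (P : RootPairing ι ℂ M N) (g : N →ₗ[ℝ] ℝ) (i : ι) : ℤ :=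
  if 0 < g (P.coroot i) then 1 else -1

/-- The vector `½ ∑_{α > 0} sgn (g αᵛ) m_α αᵛ`. -/
def signedRho (g : N →ₗ[ℝ] ℝ) : N :=
  (1 / 2 : ℂ) • ∑ i ∈ posRoots b, ((corootSign P g i * m i : ℤ) : ℂ) • P.coroot i

theorem zExp_signedRho (β : ι) : zExp P logq (signedRho b m g) (P.root β) =
    qPow logq ((∑ γ ∈ posRoots b, corootSign P g γ * m γ * P.pairingIn ℤ β γ : ℤ) : ℂ) := by
  rw [zExp, signedRho, map_smul, map_sum, smul_eq_mul]
  congr 1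
  push_cast
  rw [← mul_assoc]
  norm_num
  refine Finset.sum_congr rfl fun γ _ => ?_
  rw [← toLinearMap_root_coroot, P.root_coroot_eq_pairing]

variable {m g} (hm : ∀ i j, m (P.reflectionPerm i j) = m j) (hg : ∀ i, g (P.coroot i) ≠ 0)

include hg in
theorem corootSign_neg (i : ι) :
    corootSign P g (P.reflectionPerm i i) = -corootSign P g i := by
  rw [corootSign, corootSign, coroot_reflectionPerm_self, map_neg]
  rcases lt_or_gt_of_ne (hg i) with h | h
  · rw [if_pos (by linarith), if_neg (by linarith), neg_neg]
  · rw [if_neg (by linarith), if_pos h]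

include hm hg in
-- For short β the pairing (β, γᵛ) equals its own sign unless γ = ±β; there it is ±2 and contributes
-- one extra term.
theorem sum_sign_eq {β : ι} (hβ : IsShort P β) :
    ∑ γ ∈ posRoots b, corootSign P g γ * m γ * P.pairingIn ℤ β γ =
      ∑ γ ∈ posRoots b, corootSign P g γ * ((P.pairingIn ℤ β γ).sign * m γ) +
        corootSign P g β * m β := by
  classical
  rw [← sub_eq_iff_eq_add', ← Finset.sum_sub_distrib]
  have key : ∀ γ, P.root γ ≠ P.root β → P.root γ ≠ -P.root β →
      corootSign P g γ * m γ * P.pairingIn ℤ β γ -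
        corootSign P g γ * ((P.pairingIn ℤ β γ).sign * m γ) = 0 := by
    intro γ h1 h2
    have h := hβ γ h1 h2
    rw [abs_le] at h
    obtain h | h | h : P.pairingIn ℤ β γ = -1 ∨ P.pairingIn ℤ β γ = 0 ∨ P.pairingIn ℤ β γ = 1 := by
      omega
    all_goals rw [h]; simp
  rcases mem_posRoots_or b β with hp | hp
  · rw [Finset.sum_eq_single_of_mem β hp]
    · rw [P.pairingIn_same, Int.sign_eq_one_of_pos two_pos]
      ring
    · exact fun γ hγ hne => key γ (fun h => hne (P.root.injective h))
        (root_ne_neg_of_mem_posRoots b hγ hp)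
  · rw [Finset.sum_eq_single_of_mem _ hp]
    · rw [pairingIn_reflectionPerm_self_right, P.pairingIn_same, hm, corootSign_neg hg,
        Int.sign_eq_neg_one_of_neg (by omega)]
      ring
    · refine fun γ hγ hne => key γ (fun h => ?_) (fun h => hne (P.root.injective ?_))
      · apply root_ne_neg_of_mem_posRoots b hγ hp
        rw [root_reflectionPerm_self, neg_neg, h]
      · rw [root_reflectionPerm_self, h]

/-- The eigenvalue of the leading part of the difference operator. -/
def eigenvalue (F : CharacterField P logq L) (b : P.Base) (m : ι → ℕ) (g : N →ₗ[ℝ] ℝ) (ν : N) : L :=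
  ∑ β ∈ shortRoots P, zExp P logq (-signedRho b m g) (P.root β) •
    (zExp P logq ν (P.root β) • F.X (P.root β) - 1)

include hm hg in
open Classical in
/-- The leading part of the difference operator. -/
theorem hasTop_operator (hq : ∀ n : ℤ, qPow logq n = 1 → n = 0) {S : Set N} {φ Φ : M → L}
    {k : ι → M → L} (hΦ : Φ ∈ F.funs S) (hk : ∀ β, k β ∈ F.funs S)
    (hk' : ∀ β z, (qPow logq ((2 : ℤ) : ℂ) * zExp P logq (P.coroot β) z - 1) • k β z =
      (qPow logq ((2 - m β : ℤ) : ℂ) * zExp P logq (P.coroot β) z - qPow logq ((m β : ℤ) : ℂ)) •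
        (φ (z + P.root β) - φ z))
    (hΦk : ∀ z, (∏ γ ∈ posRoots b, (zExp P logq (P.coroot γ) z - 1)) • Φ z =
        ∑ β ∈ shortRoots P, (∏ γ ∈ posRoots b, numerator P logq m β γ z) • k β z)
    {T : ℝ} {e : N → L} (hφ : F.HasTop g T φ e) :
    F.HasTop g T Φ (fun ν => eigenvalue F b m g ν * e ν) := by
  set K : N := ∑ γ ∈ posRoots b, if 0 < g (P.coroot γ) then P.coroot γ else 0 with hK
  have htk : ∀ β, F.HasTop g T (k β) (fun ν => qPow logq ((-(corootSign P g β * m β) : ℤ) : ℂ) •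
      (F.X (P.root β) * zExp P logq ν (P.root β) • e ν - e ν)) := by
    intro β
    have h1 := isMultiplier_affine (F := F) (logq := logq) (hg β) (qPow logq ((2 - m β : ℤ) : ℂ))
      (qPow logq ((m β : ℤ) : ℂ)) T _ _ ((hφ.translate (P.root β)).sub hφ)
    have h2 := isMultiplier_affine (F := F) (logq := logq) (hg β) (qPow logq ((2 : ℤ) : ℂ)) 1
    simp only [Pi.sub_apply] at h1
    simp_rw [← hk' β] at h1
    have h3 := h2.hasTop_of_smul hq (by
      split_ifs
      · exact qPow_ne_zero _ _
      · simp) (hk β) h1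
    refine h3.congr fun ν _ => ?_
    rw [add_sub_cancel_right, smul_smul]
    congr 1
    rw [corootSign]
    split_ifs
    · rw [← qPow_int_neg, ← qPow_int_add]
      congr 2
      ring
    · rw [neg_one_mul, neg_neg]
      norm_num
  have hnum : ∀ β, F.IsMultiplier g (fun z => ∏ γ ∈ posRoots b, numerator P logq m β γ z) K
      (∏ γ ∈ posRoots b, if 0 < g (P.coroot γ) then
        qPow logq ((-(P.pairingIn ℤ β γ).sign * m γ : ℤ) : ℂ) else
        -qPow logq (((P.pairingIn ℤ β γ).sign * m γ : ℤ) : ℂ)) :=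
    fun β => isMultiplier_prod fun γ _ => isMultiplier_affine (hg γ) _ _
  have hden : F.IsMultiplier g (fun z => ∏ γ ∈ posRoots b, (zExp P logq (P.coroot γ) z - 1)) K
      (∏ γ ∈ posRoots b, if 0 < g (P.coroot γ) then 1 else -1) :=
    isMultiplier_prod fun γ _ => by
      have := isMultiplier_affine (F := F) (logq := logq) (hg γ) 1 1
      simpa using this
  have hsum := HasTop.sum (shortRoots P) fun β _ => hnum β T _ _ (htk β)
  have hΦ2 : (fun z => (∏ γ ∈ posRoots b, (zExp P logq (P.coroot γ) z - 1)) • Φ z) =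
      ∑ β ∈ shortRoots P, fun z => (∏ γ ∈ posRoots b, numerator P logq m β γ z) • k β z := by
    funext z
    rw [hΦk z, Finset.sum_apply]
  rw [← hΦ2] at hsum
  refine (hden.hasTop_of_smul hq (Finset.prod_ne_zero_iff.2 fun γ _ => by
    split_ifs <;> simp) hΦ hsum).congr fun ν _ => ?_
  rw [Finset.sum_apply, Finset.smul_sum, eigenvalue, Finset.sum_mul]
  refine Finset.sum_congr rfl fun β hβ => ?_
  -- The leading constants of the denominators, the numerators and k β are powers of q up to signs
  -- that cancel; `sum_sign_eq` adds up the exponents to -2(signedRho, β).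
  have hc : (∏ γ ∈ posRoots b, if 0 < g (P.coroot γ) then (1 : ℂ) else -1)⁻¹ *
      ((∏ γ ∈ posRoots b, if 0 < g (P.coroot γ) then
        qPow logq ((-(P.pairingIn ℤ β γ).sign * m γ : ℤ) : ℂ) else
        -qPow logq (((P.pairingIn ℤ β γ).sign * m γ : ℤ) : ℂ)) *
        qPow logq ((-(corootSign P g β * m β) : ℤ) : ℂ)) =
      zExp P logq (-signedRho b m g) (P.root β) := by
    rw [zExp_neg, zExp_signedRho, sum_sign_eq b hm hg (mem_shortRoots.1 hβ), ← qPow_int_neg,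
      neg_add, qPow_int_add, ← mul_assoc]
    congr 1
    rw [← Finset.prod_inv_distrib, ← Finset.prod_mul_distrib, ← Finset.sum_neg_distrib]
    have hps : ∀ J : Finset ι, ∀ f : ι → ℤ, qPow logq ((∑ γ ∈ J, f γ : ℤ) : ℂ) =
        ∏ γ ∈ J, qPow logq ((f γ : ℤ) : ℂ) := by
      intro J f
      induction J using Finset.induction_on with
      | empty => simp [qPow_zero]
      | insert i J hi ih => rw [Finset.sum_insert hi, qPow_int_add, Finset.prod_insert hi, ih]
    rw [hps]
    refine Finset.prod_congr rfl fun γ _ => ?_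
    rw [corootSign]
    split_ifs
    · rw [inv_one, one_mul, one_mul, neg_mul]
    · norm_num
  rw [add_sub_cancel_right, ← hc]
  simp only [Algebra.smul_def, map_mul]
  ring

end Leading

end BakerAkhiezer

end

/-! ### The support function of the polytope and the existence of ψ. -/

noncomputable section

namespace BakerAkhiezer

open Module

section Polytope

variable {ι M N : Type*} [Fintype ι] [AddCommGroup M] [Module ℂ M] [NormedAddCommGroup N]
  [NormedSpace ℂ N] {P : RootPairing ι ℂ M N} [P.IsCrystallographic] [P.IsReduced] (b : P.Base)
  (m : ι → ℕ)

/-- The lattice spanned by the coroots. -/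
def corootLattice (P : RootPairing ι ℂ M N) : AddSubgroup N :=
  AddSubgroup.closure (Set.range P.coroot)

theorem coroot_mem_corootLattice (i : ι) : P.coroot i ∈ corootLattice P :=
  AddSubgroup.subset_closure ⟨i, rfl⟩

theorem corootLattice_le : corootLattice P ≤ coweightLattice P := by
  rw [corootLattice, AddSubgroup.closure_le]
  rintro _ ⟨i, rfl⟩
  exact coroot_mem_coweightLattice i

theorem height_coroot_ne_zero (i : ι) : height b (P.coroot i) ≠ 0 := by
  rcases mem_posRoots_or b i with h | h
  · exact (height_coroot_pos b h).ne'
  · have := height_coroot_pos b h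
    rw [coroot_reflectionPerm_self, map_neg] at this
    linarith

theorem signedRho_height : signedRho b m (height b) = rhoCheck b m := by
  rw [signedRho, rhoCheck]
  congr 1
  refine Finset.sum_congr rfl fun i hi => ?_
  rw [corootSign, if_pos (height_coroot_pos b hi)]
  simp

theorem two_mul_map_signedRho (g : N →ₗ[ℝ] ℝ) :
    2 * g (signedRho b m g) = ∑ i ∈ posRoots b, m i * |g (P.coroot i)| := by
  have : (2 : ℕ) • signedRho b m g =
      ∑ i ∈ posRoots b, (corootSign P g i * m i) • P.coroot i := by
    simp_rw [← Int.cast_smul_eq_zsmul ℂ]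
    rw [← Nat.cast_smul_eq_nsmul ℂ, signedRho]
    module
  have h2 := congrArg g this
  rw [map_nsmul, map_sum, nsmul_eq_mul] at h2
  rw [Nat.cast_two] at h2
  rw [h2]
  refine Finset.sum_congr rfl fun i _ => ?_
  rw [map_zsmul, zsmul_eq_mul, corootSign]
  split_ifs with h
  · rw [abs_of_pos h]; simp
  · rw [abs_of_nonpos (not_lt.1 h)]; push_cast; ring

theorem polytope_eq_image : polytope b m =
    (fun l : ι → ℝ => rhoCheck b m - ∑ i ∈ posRoots b, l i • P.coroot i) ''
      Set.Icc 0 (fun i => (m i : ℝ)) := by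
  ext ν
  simp only [polytope, Set.mem_image, Set.mem_Icc, Pi.le_def, Pi.zero_apply]
  constructor
  · rintro ⟨l, hl, rfl⟩
    exact ⟨l, ⟨fun i => (hl i).1, fun i => (hl i).2⟩, by simp⟩
  · rintro ⟨l, hl, rfl⟩
    exact ⟨l, fun i => ⟨hl.1 i, hl.2 i⟩, by simp⟩

theorem isCompact_polytope : IsCompact (polytope b m) := by
  rw [polytope_eq_image]
  refine isCompact_Icc.image ?_
  fun_prop

theorem convex_polytope : Convex ℝ (polytope b m) := by
  rw [polytope_eq_image]
  rintro _ ⟨l, hl, rfl⟩ _ ⟨l', hl', rfl⟩ s t hs ht hst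
  refine ⟨s • l + t • l', convex_Icc _ _ hl hl' hs ht hst, ?_⟩
  have : rhoCheck b m = s • rhoCheck b m + t • rhoCheck b m := by
    rw [← add_smul, hst, one_smul]
  nth_rewrite 1 [this]
  simp only [smul_sub, Pi.add_apply, Pi.smul_apply, smul_eq_mul, add_smul, mul_smul,
    Finset.sum_add_distrib, Finset.smul_sum]
  abel

/-- Choose l_α = m_α where g(αᵛ) is negative and l_α = 0 elsewhere. This point of the polytope has
the g-value of `signedRho`, so separation from the polytope gives a strict inequality with that
value. -/
theorem exists_mem_polytope_map_eq (g : N →ₗ[ℝ] ℝ) :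
    ∃ p ∈ polytope b m, g p = g (signedRho b m g) := by
  classical
  rw [polytope_eq_image]
  refine ⟨_, ⟨fun i => if g (P.coroot i) < 0 then m i else 0, ?_, rfl⟩, ?_⟩
  · refine ⟨fun i => ?_, fun i => ?_⟩ <;> simp only [Pi.zero_apply] <;> split_ifs <;> simp
  · have h1 := two_mul_map_signedRho b m g
    have h2 := map_rhoCheck b m g
    simp only [map_sub, map_sum, map_smul, smul_eq_mul]
    have h3 : ∑ i ∈ posRoots b, (m i * |g (P.coroot i)|) = ∑ i ∈ posRoots b, m i * g (P.coroot i) -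
        2 * ∑ i ∈ posRoots b, (if g (P.coroot i) < 0 then (m i : ℝ) else 0) * g (P.coroot i) := by
      rw [Finset.mul_sum, ← Finset.sum_sub_distrib]
      refine Finset.sum_congr rfl fun i _ => ?_
      split_ifs with h
      · rw [abs_of_neg h]; ring
      · rw [abs_of_nonneg (not_lt.1 h)]; ring
    linarith

variable {m}

/-- A point outside the closed convex polytope is separated from it by some functional f, which may
vanish on coroots. The functional f + t·height is regular for all but countably many t, so the
inequality assumed for regular functionals passes to the limit t = 0 and contradicts the separation.
-/
theorem mem_polytope_of_forall {ν : N}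
    (h : ∀ g : N →ₗ[ℝ] ℝ, (∀ i, g (P.coroot i) ≠ 0) → g ν ≤ g (signedRho b m g)) :
    ν ∈ polytope b m := by
  by_contra hν
  obtain ⟨f, u, hfu, huf⟩ := geometric_hahn_banach_closed_point (convex_polytope b m)
    (isCompact_polytope b m).isClosed hν
  obtain ⟨p, hp, hfp⟩ := exists_mem_polytope_map_eq b m f.toLinearMap
  have hlt : f.toLinearMap (signedRho b m f.toLinearMap) < f ν := by
    rw [← hfp]
    exact (hfu p hp).trans huf
  let G : ℝ → ℝ := fun t => 2 * (f ν + t * height b ν) -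
    ∑ i ∈ posRoots b, m i * |f (P.coroot i) + t * height b (P.coroot i)|
  have hG : Continuous G := by fun_prop
  have hle : ∀ t ∈ {t : ℝ | ∃ i, f (P.coroot i) + t * height b (P.coroot i) = 0}ᶜ, G t ≤ 0 := by
    intro t ht
    have h1 := h (f.toLinearMap + t • height b) fun i hi => ht ⟨i, hi⟩
    have h2 := two_mul_map_signedRho b m (f.toLinearMap + t • height b)
    have h3 : (f.toLinearMap + t • height b) ν = f ν + t * height b ν := rfl
    have h4 : ∀ i, (f.toLinearMap + t • height b) (P.coroot i) =
      f (P.coroot i) + t * height b (P.coroot i) := fun i => rfl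
    simp_rw [h4] at h2
    simp only [G]
    linarith
  have hcount : {t : ℝ | ∃ i, f (P.coroot i) + t * height b (P.coroot i) = 0}.Countable := by
    refine (Set.countable_range fun i => -f (P.coroot i) / height b (P.coroot i)).mono ?_
    rintro t ⟨i, hi⟩
    refine ⟨i, ?_⟩
    have := height_coroot_ne_zero b i
    field_simp
    linarith
  have hcl : IsClosed {t | G t ≤ 0} := isClosed_le hG continuous_const
  have h0 : (0 : ℝ) ∈ {t | G t ≤ 0} := by
    have := hcl.closure_subset_iff.2 hle
    rw [(hcount.dense_compl ℝ).closure_eq] at this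
    exact this trivial
  have h2 := two_mul_map_signedRho b m f.toLinearMap
  simp only [G, Set.mem_ofPred_eq, zero_mul, add_zero] at h0
  change 2 * f.toLinearMap _ = ∑ i ∈ posRoots b, m i * |f (P.coroot i)| at h2
  linarith

end Polytope

variable {ι M N L : Type*} [AddCommGroup M] [Module ℂ M] [NormedAddCommGroup N] [NormedSpace ℂ N]
  {P : RootPairing ι ℂ M N} {logq : ℂ} [Field L] [Algebra ℂ L] (F : CharacterField P logq L)

namespace CharacterField

theorem exists_qPow_toLinearMap_ne_one (hq : ∀ n : ℤ, qPow logq n = 1 → n = 0) {v : M}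
    (hv : v ≠ 0) : ∃ u : N, zExp P logq u v ≠ 1 := by
  have : ∃ n, P.toLinearMap v n ≠ 0 := by
    by_contra! hc
    refine hv (P.toLinearMap.toPerfPair.injective ?_)
    ext n
    simpa using hc n
  obtain ⟨n, hn⟩ := this
  obtain ⟨t, ht⟩ := exists_qPow_ne_one hq (a := 2 * P.toLinearMap v n) (by simpa using hn)
  refine ⟨t • n, fun h => ht ?_⟩
  rw [zExp, map_smul, smul_eq_mul] at h
  rw [← h]
  congr 1
  ring

/-- Translations turn a linear relation into one between the characters u ↦ q^(2(v,u)) of N, and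
Dedekind's theorem applies. -/
theorem linearIndependent_X (hq : ∀ n : ℤ, qPow logq n = 1 → n = 0) :
    LinearIndependent ℂ F.X := by
  classical
  rw [linearIndependent_iff']
  intro s a h v hv
  let θ : M → (Multiplicative N →* L) := fun w =>
    { toFun := fun u => algebraMap ℂ L (zExp P logq u.toAdd w)
      map_one' := by simp [zExp_zero]
      map_mul' := fun a c => by simp [zExp_add_apply] }
  have hθ : Function.Injective θ := by
    intro v w hvw
    by_contra hne
    obtain ⟨u, hu⟩ := exists_qPow_toLinearMap_ne_one (P := P) hq (sub_ne_zero.2 hne)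
    apply hu
    have h2 : zExp P logq u v = zExp P logq u w :=
      (algebraMap ℂ L).injective (DFunLike.congr_fun hvw (Multiplicative.ofAdd u))
    rw [zExp_apply_sub, h2, mul_inv_cancel₀ (zExp_ne_zero P logq u w)]
  have hli := linearIndependent_iff'.1
    ((linearIndependent_monoidHom (Multiplicative N) L).comp θ hθ) s (fun w => a w • F.X w) (by
      funext u
      have := congrArg (F.T u.toAdd) h
      rw [map_sum, map_zero] at this
      rw [Finset.sum_apply, Pi.zero_apply, ← this]
      refine Finset.sum_congr rfl fun w _ => ?_
      rw [map_smul, F.T_X]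
      simp only [Pi.smul_apply, smul_eq_mul, Algebra.smul_def, Function.comp_apply]
      simp only [θ, MonoidHom.coe_mk, OneHom.coe_mk]
      ring) v hv
  exact (smul_eq_zero.1 hli).resolve_right (F.X_ne_zero v)

theorem exists_ev_eq_shift (κ : N) (c : N →₀ L) :
    ∃ c' : N →₀ L, F.ev c' = (fun z => F.T κ (F.ev c z)) ∧ ∀ ν, c' ν = F.T κ (c (ν - κ)) := by
  classical
  refine ⟨(c.mapRange (F.T κ) (map_zero _)).mapDomain (· + κ), ?_, ?_⟩
  · funext z
    rw [ev, Finsupp.sum_mapDomain_index (by simp) (by simp [smul_add]),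
      Finsupp.sum_mapRange_index (by simp), ev, map_mul, F.T_X, Finsupp.sum, Finsupp.sum, map_sum,
      smul_mul_assoc, ← mul_smul_comm, Finset.smul_sum]
    congr 1
    refine Finset.sum_congr rfl fun ν _ => ?_
    rw [map_smul, smul_smul, zExp_add_apply, mul_comm]
  · intro ν
    have := Finsupp.mapDomain_apply (add_left_injective κ) (c.mapRange (F.T κ) (map_zero _)) (ν - κ)
    rwa [sub_add_cancel] at this

end CharacterField

section Existence

open CharacterField

variable [Fintype ι] [P.IsCrystallographic] [P.IsReduced] (b : P.Base) {m : ι → ℕ}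

/-- Comparing the coefficients of the independent characters X(β) gives q^(2(δ,β)) = 1 for the
difference δ of the two sides and every short root β. The exponents 2(δ,β) are integers, so they
vanish, and the short roots span. -/
theorem eigenvalue_eq_iff (hq : ∀ n : ℤ, qPow logq n = 1 → n = 0) [P.IsIrreducible] [Nonempty ι]
    {g g' : N →ₗ[ℝ] ℝ} {ν ν' : N} (hν : ν ∈ coweightLattice P) (hν' : ν' ∈ coweightLattice P)
    (h : eigenvalue F b m g ν = eigenvalue F b m g' ν') :
    ν - signedRho b m g = ν' - signedRho b m g' := by
  classical
  have hinj : Function.Injective (fun o : Option ι => o.elim 0 P.root) := by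
    rintro (_ | i) (_ | j) hij
    · rfl
    · exact absurd hij.symm (P.ne_zero j)
    · exact absurd hij (P.ne_zero i)
    · rw [P.root.injective hij]
  have hexp : ∀ (g : N →ₗ[ℝ] ℝ) ν, eigenvalue F b m g ν =
      (-∑ β ∈ shortRoots P, zExp P logq (-signedRho b m g) (P.root β)) • F.X 0 +
        ∑ β ∈ shortRoots P, zExp P logq (ν - signedRho b m g) (P.root β) • F.X (P.root β) := by
    intro g ν
    rw [F.X_zero, neg_smul, Finset.sum_smul, neg_add_eq_sub, ← Finset.sum_sub_distrib, eigenvalue]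
    refine Finset.sum_congr rfl fun β _ => ?_
    rw [smul_sub, smul_smul, sub_eq_neg_add ν, zExp_add_apply]
  have hli := linearIndependent_iff'.1 ((F.linearIndependent_X hq).comp _ hinj)
    (Finset.insertNone (shortRoots P)) (fun o => o.elim
      ((-∑ β ∈ shortRoots P, zExp P logq (-signedRho b m g) (P.root β)) -
        (-∑ β ∈ shortRoots P, zExp P logq (-signedRho b m g') (P.root β)))
      fun β => zExp P logq (ν - signedRho b m g) (P.root β) -
        zExp P logq (ν' - signedRho b m g') (P.root β)) (by
      rw [hexp, hexp, ← sub_eq_zero] at h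
      rw [Finset.sum_insertNone, ← h]
      simp only [Option.elim, Function.comp_apply, sub_smul, Finset.sum_sub_distrib]
      abel)
  rw [← sub_eq_zero]
  set δ := ν - signedRho b m g - (ν' - signedRho b m g') with hδ
  have hβ : ∀ β ∈ {β | IsShort P β}, P.toLinearMap (P.root β) δ = 0 := by
    intro β hβ
    have h1 := hli (some β) (by simpa using mem_shortRoots.2 hβ)
    simp only [Option.elim, sub_eq_zero] at h1
    have h2 : zExp P logq δ (P.root β) = 1 := by
      rw [hδ, zExp_sub, h1, mul_inv_cancel₀ (zExp_ne_zero P logq _ _)]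
    obtain ⟨n, hn⟩ := hν β
    obtain ⟨n', hn'⟩ := hν' β
    have h3 : ∀ g : N →ₗ[ℝ] ℝ, ∃ k : ℤ, 2 * P.toLinearMap (P.root β) (signedRho b m g) = k := by
      intro g
      refine ⟨∑ γ ∈ posRoots b, corootSign P g γ * m γ * P.pairingIn ℤ β γ, ?_⟩
      rw [signedRho, map_smul, map_sum, smul_eq_mul, ← mul_assoc]
      norm_num
      refine Finset.sum_congr rfl fun γ _ => ?_
      rw [← toLinearMap_root_coroot, P.root_coroot_eq_pairing]
    obtain ⟨k, hk⟩ := h3 g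
    obtain ⟨k', hk'⟩ := h3 g'
    have h4 : 2 * P.toLinearMap (P.root β) δ = ((2 * n - k - (2 * n' - k') : ℤ) : ℂ) := by
      rw [hδ, map_sub, map_sub, map_sub, hn, hn']
      push_cast
      linear_combination hk' - hk
    rw [zExp, h4] at h2
    rw [hq _ h2] at h4
    simpa using h4
  refine P.toLinearMap.flip.toPerfPair.injective ?_
  rw [map_zero]
  refine LinearMap.ext_on (span_shortRoots_eq_top (P := P)) ?_
  rintro _ ⟨β, hβ', rfl⟩
  simpa using hβ β hβ'

/-- A product over all roots that contains the zeros E = q^(2s), 1 ≤ s ≤ m_α, vanishes at both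
points z ± sα/2 of every condition, so multiplying any function by it gives a quasi-invariant one.
-/
theorem exists_quasiInvariant (hq : ∀ n : ℤ, qPow logq n = 1 → n = 0)
    (hm : ∀ i j, m (P.reflectionPerm i j) = m j) :
    ∃ φ ∈ F.funs (corootLattice P : Set N), φ ≠ 0 ∧ QuasiInvariant P logq m φ := by
  classical
  obtain ⟨B, hB⟩ := Finite.bddAbove_range m
  -- The index s starts at 0 and runs up to a common bound of the m_α. For s ≥ m_α the factor is 0·E
  -- + 1 = 1, so only the factors E - q^(2(s+1)) with s < m_α matter.
  let a : ℕ → ι → ℂ := fun s i => if s < m i then 1 else 0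
  let d : ℕ → ι → ℂ := fun s i => if s < m i then qPow logq ((2 * (s + 1) : ℤ) : ℂ) else -1
  let p : M → ℂ := fun z => ∏ s ∈ Finset.range B, ∏ i, (a s i * zExp P logq (P.coroot i) z - d s i)
  have h0 : F.X ∈ F.funs (corootLattice P : Set N) := F.mem_funs.2
    ⟨Finsupp.single 0 1, fun ν hν => by
      have := Finsupp.support_single_subset hν
      rw [Finset.mem_singleton] at this
      rw [this]
      exact zero_mem _, by
      funext z
      rw [ev_single, zExp_zero, Pi.one_apply, one_smul, mul_one]⟩
  have hp : ∀ n, (fun z => (∏ s ∈ Finset.range n,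
      ∏ i, (a s i * zExp P logq (P.coroot i) z - d s i)) • F.X z) ∈
        F.funs (corootLattice P : Set N) := by
    intro n
    induction n with
    | zero => simpa using h0
    | succ n ih =>
      convert F.prod_affine_smul_mem_funs (J := Finset.univ)
        (fun j _ μ hμ => add_mem hμ (coroot_mem_corootLattice j)) ih (a n) (d n) using 1
      funext z
      rw [Finset.prod_range_succ, smul_smul, mul_comm]
  refine ⟨fun z => p z • F.X z, hp B, fun h => ?_, ?_⟩
  · have hX : F.X = 0 := by
      refine F.eq_zero_of_forall_generic hq h0 fun w hw => ?_
      have h1 := congrFun h w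
      refine (smul_eq_zero.1 h1).resolve_left (Finset.prod_ne_zero_iff.2 fun s _ =>
        Finset.prod_ne_zero_iff.2 fun i _ => ?_)
      simp only [a, d]
      split_ifs
      · rw [one_mul]
        exact sub_ne_zero.2 (hw i _)
      · simp
    exact F.X_ne_zero 0 (congrFun hX 0)
  · intro i s hs1 hs2 w hw
    have hsB : s - 1 ∈ Finset.range B := by
      have := hB ⟨i, rfl⟩
      rw [Finset.mem_range]
      omega
    have hlt : s - 1 < m i := by omega
    have hcast : ((s - 1 : ℕ) : ℤ) + 1 = s := by omega
    have e1 : zExp P logq (P.coroot i) (w + ((s : ℂ) / 2) • P.root i) =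
        qPow logq ((2 * s : ℤ) : ℂ) := by
      have := zExp_coroot_self_add_half (P := P) (logq := logq) i s w
      rw [show zExp P logq (P.coroot i) w = 1 from hw, one_mul] at this
      simpa using this
    have e2 : zExp P logq (P.coroot (P.reflectionPerm i i)) (w - ((s : ℂ) / 2) • P.root i) =
        qPow logq ((2 * s : ℤ) : ℂ) := by
      have := zExp_coroot_reflectionPerm (P := P) (logq := logq) hw i s
      push_cast at this
      rw [this, e1]
    have z1 : p (w + ((s : ℂ) / 2) • P.root i) = 0 := by
      refine Finset.prod_eq_zero hsB (Finset.prod_eq_zero (Finset.mem_univ i) ?_)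
      simp only [a, d, if_pos hlt, hcast]
      rw [e1, one_mul, sub_self]
    have z2 : p (w - ((s : ℂ) / 2) • P.root i) = 0 := by
      refine Finset.prod_eq_zero hsB
        (Finset.prod_eq_zero (Finset.mem_univ (P.reflectionPerm i i)) ?_)
      simp only [a, d, hm, if_pos hlt, hcast]
      rw [e2, one_mul, sub_self]
    simp only [z1, z2, zero_smul]

/-- A quasi-invariant function with support in the polytope. -/
theorem exists_bakerAkhiezer (hq : ∀ n : ℤ, qPow logq n = 1 → n = 0)
    (hm : ∀ i j, m (P.reflectionPerm i j) = m j) [P.IsIrreducible] [Nonempty ι] (a : L) :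
    ∃ c : N →₀ L, (∀ ν ∈ c.support, ν - rhoCheck b m ∈ corootLattice P ∧ ν ∈ polytope b m) ∧
      QuasiInvariant P logq m (F.ev c) ∧ c (rhoCheck b m) = a := by
  classical
  set h := height b with hh
  have hreg : ∀ i, h (P.coroot i) ≠ 0 := height_coroot_ne_zero b
  have hreg' : ∀ i, (-h) (P.coroot i) ≠ 0 := fun i => neg_ne_zero.2 (hreg i)
  have hS : ∀ i, ∀ μ ∈ (corootLattice P : Set N), ∀ k : ℤ,
      μ + k • P.coroot i ∈ (corootLattice P : Set N) := fun i μ hμ k =>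
    add_mem hμ (zsmul_mem (coroot_mem_corootLattice i) k)
  let Good : ℝ → (N →₀ L) → Prop := fun B c => c ≠ 0 ∧ (∀ ν ∈ c.support, ν ∈ corootLattice P) ∧
    QuasiInvariant P logq m (F.ev c) ∧ ∀ ν ∈ c.support, B ≤ h ν
  have hint : ∀ ν ∈ corootLattice P, ∃ n : ℤ, 2 * h ν = n := fun ν hν =>
    exists_two_mul_height_eq b (corootLattice_le hν)
  obtain ⟨B, hBint, c₀, hc₀⟩ : ∃ B : ℝ, (∃ n : ℤ, 2 * B = n) ∧ ∃ c, Good B c := by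
    obtain ⟨φ, hφ, hne, hQ⟩ := exists_quasiInvariant F hq hm
    obtain ⟨c, hc, rfl⟩ := F.mem_funs.1 hφ
    have hc0 : c ≠ 0 := fun h => hne (by rw [h, F.ev_zero])
    obtain ⟨ν, hν, hmin⟩ := Finset.exists_min_image c.support h (Finsupp.support_nonempty_iff.2 hc0)
    exact ⟨h ν, hint ν (hc ν hν), c, hc0, hc, hQ, hmin⟩
  -- Among the admissible functions above the fixed level B the maximal height is made minimal, in
  -- half-integral steps, and `hC` then minimizes the number of terms at that height.
  have hA : ∃ n : ℕ, ∃ c, Good B c ∧ ∀ ν ∈ c.support, 2 * h ν ≤ 2 * B + n := by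
    obtain ⟨ν, hν, hmax⟩ := Finset.exists_max_image c₀.support h
      (Finsupp.support_nonempty_iff.2 hc₀.1)
    obtain ⟨n, hn⟩ := exists_nat_ge (2 * h ν - 2 * B)
    exact ⟨n, c₀, hc₀, fun μ hμ => by linarith [hmax μ hμ]⟩
  let n := Nat.find hA
  have hC : ∃ k : ℕ, ∃ c, (Good B c ∧ ∀ ν ∈ c.support, 2 * h ν ≤ 2 * B + n) ∧
      (c.support.filter fun ν => 2 * h ν = 2 * B + n).card = k := by
    obtain ⟨c, hc⟩ := Nat.find_spec hA
    exact ⟨_, c, hc, rfl⟩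
  obtain ⟨c, ⟨⟨hc0, hcS, hcQ, hcB⟩, hctop⟩, hcard⟩ := Nat.find_spec hC
  obtain ⟨ν₀, hν₀, hν₀top⟩ : ∃ ν₀ ∈ c.support, 2 * h ν₀ = 2 * B + n := by
    by_contra! hcon
    obtain ⟨ν₁, hν₁⟩ := Finsupp.support_nonempty_iff.2 hc0
    have hn : n ≠ 0 := by
      intro hn
      have h1 := hctop ν₁ hν₁
      have h2 := hcB ν₁ hν₁
      have h3 := hcon ν₁ hν₁
      rw [hn, Nat.cast_zero, add_zero] at h1 h3
      exact h3 (le_antisymm h1 (by linarith))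
    refine Nat.find_min hA (m := n - 1) (by change n - 1 < n; omega)
      ⟨c, ⟨hc0, hcS, hcQ, hcB⟩, fun ν hν => ?_⟩
    obtain ⟨k, hk⟩ := hint ν (hcS ν hν)
    obtain ⟨l, hl⟩ := hBint
    have h1 := hctop ν hν
    have h2 := hcon ν hν
    rw [hk, hl] at h1 h2 ⊢
    have h3 : k ≤ l + n := by exact_mod_cast h1
    have h4 : k ≠ l + n := by exact_mod_cast h2
    have : k ≤ l + (n - 1 : ℕ) := by omega
    exact_mod_cast this
  set T := h ν₀ with hT
  have htop : F.HasTop h T (F.ev c) c := ⟨c, rfl, fun ν hν => by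
    by_contra hne
    have := hctop ν (Finsupp.mem_support_iff.2 hne)
    linarith, fun _ _ => rfl⟩
  have hbot : F.HasTop (-h) (-B) (F.ev c) c := ⟨c, rfl, fun ν hν => by
    by_contra hne
    have := hcB ν (Finsupp.mem_support_iff.2 hne)
    rw [LinearMap.neg_apply] at hν
    linarith, fun _ _ => rfl⟩
  have hcmem : F.ev c ∈ F.funs (corootLattice P : Set N) := F.mem_funs.2 ⟨c, hcS, rfl⟩
  obtain ⟨Φ, hΦ, hΦQ, k, hk, hk', hΦk⟩ := F.exists_operator b hq hm hS hcmem hcQ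
  have hlead : ∀ g : N →ₗ[ℝ] ℝ, (∀ i, g (P.coroot i) ≠ 0) → ∀ T e, F.HasTop g T (F.ev c) e →
      F.HasTop g T Φ fun ν => eigenvalue F b m g ν * e ν := fun g hg T e he =>
    hasTop_operator F b hm hg hq hΦ hk hk' hΦk he
  set lam := eigenvalue F b m h ν₀ with hlam
  -- The function Φ - λφ is again admissible, with the same bounds. It has lost the term ν₀ at the
  -- top and gained none there, so minimality forces it to be zero.
  have heig : Φ = lam • F.ev c := by
    obtain ⟨c', hc', hcc'⟩ := F.mem_funs.1 ((F.funs _).sub_mem hΦ ((F.funs _).smul_mem lam hcmem))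
    have htop' := (hlead h hreg T c htop).sub (htop.const_smul lam)
    have hbot' := (hlead (-h) hreg' (-B) c hbot).sub (hbot.const_smul lam)
    rw [← hcc'] at htop' hbot'
    obtain ⟨d, hd, hd1, hd2⟩ := htop'
    obtain ⟨d', hd', hd1', -⟩ := hbot'
    obtain rfl := F.ev_injective hq hd
    obtain rfl := F.ev_injective hq hd'
    by_contra hne
    have hd0 : d' ≠ 0 := by
      rintro rfl
      rw [F.ev_zero] at hcc'
      exact hne (sub_eq_zero.1 hcc'.symm)
    have hdtop : ∀ ν ∈ d'.support, 2 * h ν ≤ 2 * B + n := by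
      intro ν hν
      by_contra! hlt
      exact Finsupp.mem_support_iff.1 hν (hd1 ν (by linarith))
    have hgood : Good B d' := by
      refine ⟨hd0, hc', ?_, fun ν hν => ?_⟩
      · rw [hcc']
        intro i s h1 h2 z hz
        simp only [Pi.sub_apply, Pi.smul_apply]
        rw [hΦQ i s h1 h2 z hz, hcQ i s h1 h2 z hz]
      · by_contra! hlt
        exact Finsupp.mem_support_iff.1 hν (hd1' ν (by rw [LinearMap.neg_apply]; linarith))
    refine Nat.find_min hC (m := (d'.support.filter fun ν => 2 * h ν = 2 * B + n).card) ?_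
      ⟨d', ⟨hgood, hdtop⟩, rfl⟩
    refine lt_of_lt_of_eq (Finset.card_lt_card ?_) hcard
    have hval : ∀ ν, 2 * h ν = 2 * B + n →
        d' ν = eigenvalue F b m h ν * c ν - lam * c ν := fun ν hν =>
      hd2 ν (by linarith)
    rw [Finset.ssubset_iff_of_subset]
    · refine ⟨ν₀, Finset.mem_filter.2 ⟨hν₀, hν₀top⟩, fun hmem => ?_⟩
      rw [Finset.mem_filter, Finsupp.mem_support_iff] at hmem
      exact hmem.1 (by rw [hval ν₀ hν₀top, sub_self])
    · intro ν hν
      rw [Finset.mem_filter, Finsupp.mem_support_iff] at hν ⊢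
      refine ⟨fun h0 => hν.1 ?_, hν.2⟩
      rw [hval ν hν.2, h0, mul_zero, mul_zero, sub_zero]
  -- Translating x by κ shifts all exponents by κ and moves ν₀ to the vertex ρᵛ.
  set κ := rhoCheck b m - ν₀ with hκ
  -- In any regular direction g the extreme exponent must have the eigenvalue λ as well. By
  -- `eigenvalue_eq_iff` its translate is `signedRho b m g`, and this bounds the translated support
  -- in the direction g.
  have hmain : ∀ g : N →ₗ[ℝ] ℝ, (∀ i, g (P.coroot i) ≠ 0) → ∀ ν ∈ c.support,
      g (ν + κ) ≤ g (signedRho b m g) := by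
    intro g hg ν hν
    obtain ⟨ν₁, hν₁, hmax⟩ := Finset.exists_max_image c.support g ⟨ν, hν⟩
    have ht : F.HasTop g (g ν₁) (F.ev c) c := ⟨c, rfl, fun μ hμ => by
      by_contra hne
      exact absurd (hmax μ (Finsupp.mem_support_iff.2 hne)) (not_le.2 hμ), fun _ _ => rfl⟩
    obtain ⟨d, hd, hd1, hd2⟩ := (hlead g hg _ c ht).sub (ht.const_smul lam)
    have hd0 : d = 0 := F.ev_injective hq (by rw [hd, heig, sub_self, F.ev_zero])
    have h1 := hd2 ν₁ rfl
    rw [hd0] at h1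
    have h2 : eigenvalue F b m g ν₁ = lam := by
      have : (eigenvalue F b m g ν₁ - lam) * c ν₁ = 0 := by
        rw [sub_mul]
        exact h1.symm
      exact sub_eq_zero.1 ((mul_eq_zero.1 this).resolve_right (Finsupp.mem_support_iff.1 hν₁))
    have h3 := eigenvalue_eq_iff F b hq (corootLattice_le (hcS ν₁ hν₁))
      (corootLattice_le (hcS ν₀ hν₀)) h2
    rw [hh, signedRho_height] at h3
    have h4 : ν₁ + κ = signedRho b m g := by
      rw [hκ, eq_add_of_sub_eq h3]
      abel
    rw [← h4, map_add, map_add]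
    linarith [hmax ν hν]
  obtain ⟨c', hc', hcc'⟩ := F.exists_ev_eq_shift κ c
  have hcρ : c' (rhoCheck b m) ≠ 0 := by
    rw [hcc', hκ, sub_sub_cancel]
    exact (map_ne_zero (F.T _)).2 (Finsupp.mem_support_iff.1 hν₀)
  refine ⟨(a / c' (rhoCheck b m)) • c', fun ν hν => ?_, fun i s h1 h2 z hz => ?_, ?_⟩
  · have h1 := Finsupp.support_smul hν
    rw [Finsupp.mem_support_iff, hcc'] at h1
    have h2 : ν - κ ∈ c.support := by
      rw [Finsupp.mem_support_iff]
      intro h0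
      rw [h0, map_zero] at h1
      exact h1 rfl
    constructor
    · have := sub_mem (hcS _ h2) (hcS _ hν₀)
      rw [hκ] at this
      convert this using 1
      abel
    · refine mem_polytope_of_forall b fun g hg => ?_
      have := hmain g hg _ h2
      rwa [sub_add_cancel] at this
  · rw [F.ev_smul, F.ev_smul, hc']
    simp only
    rw [hcQ i s h1 h2 z hz]
  · rw [Finsupp.smul_apply, smul_eq_mul, div_mul_cancel₀ _ hcρ]

end Existence

end BakerAkhiezer

end

/-! ### Uniqueness of ψ and division by difference operators in x. -/

noncomputable section

namespace BakerAkhiezer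

open Module

variable {ι M N L : Type*} [AddCommGroup M] [Module ℂ M] [NormedAddCommGroup N] [NormedSpace ℂ N]
  {P : RootPairing ι ℂ M N} {logq : ℂ} [Field L] [Algebra ℂ L] (F : CharacterField P logq L)

open CharacterField

section Uniqueness

variable [Fintype ι] [P.IsCrystallographic] [P.IsReduced] {b : P.Base} {m : ι → ℕ}

theorem height_le_of_mem_polytope {ν : N} (h : ν ∈ polytope b m) :
    height b ν ≤ height b (rhoCheck b m) := by
  obtain ⟨l, hl, rfl⟩ := h
  simp only [map_sub, map_sum, Complex.coe_smul, map_smul, smul_eq_mul, sub_le_self_iff]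
  exact Finset.sum_nonneg fun i hi => mul_nonneg (hl i).1 (height_coroot_pos b hi).le

theorem eq_rhoCheck_of_mem_polytope {ν : N} (h : ν ∈ polytope b m)
    (h' : height b (rhoCheck b m) ≤ height b ν) : ν = rhoCheck b m := by
  obtain ⟨l, hl, rfl⟩ := h
  simp only [map_sub, map_sum, Complex.coe_smul, map_smul, smul_eq_mul, le_sub_self_iff] at h'
  have h0 := (Finset.sum_eq_zero_iff_of_nonneg fun i hi =>
    mul_nonneg (hl i).1 (height_coroot_pos b hi).le).1 (le_antisymm h' (Finset.sum_nonneg fun i hi =>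
      mul_nonneg (hl i).1 (height_coroot_pos b hi).le))
  rw [sub_eq_self]
  refine Finset.sum_eq_zero fun i hi => ?_
  rw [(mul_eq_zero.1 (h0 i hi)).resolve_right (height_coroot_pos b hi).ne']
  simp

theorem neg_height_le_of_mem_polytope {ν : N} (h : ν ∈ polytope b m) :
    -height b (rhoCheck b m) ≤ height b ν := by
  obtain ⟨l, hl, rfl⟩ := h
  have h1 := map_rhoCheck b m (height b)
  simp only [map_sub, map_sum, Complex.coe_smul, map_smul, smul_eq_mul]
  have : ∑ i ∈ posRoots b, l i * height b (P.coroot i) ≤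
      ∑ i ∈ posRoots b, m i * height b (P.coroot i) :=
    Finset.sum_le_sum fun i hi => mul_le_mul_of_nonneg_right (hl i).2 (height_coroot_pos b hi).le
  linarith

/-- `c` is the coefficient function of a multiple of the Baker–Akhiezer function. -/
structure IsBakerAkhiezer (F : CharacterField P logq L) (b : P.Base) (m : ι → ℕ) (c : N →₀ L) :
    Prop where
  supp : ∀ ν ∈ c.support, ν ∈ coweightLattice P ∧ ν ∈ polytope b m
  quasiInvariant : QuasiInvariant P logq m (F.ev c)

variable {F}

theorem QuasiInvariant.sub {φ φ' : M → L} (h : QuasiInvariant P logq m φ)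
    (h' : QuasiInvariant P logq m φ') : QuasiInvariant P logq m (φ - φ') :=
  fun i s h1 h2 z hz => by
    simp only [Pi.sub_apply]
    rw [h i s h1 h2 z hz, h' i s h1 h2 z hz]

/-- The polytope has height exactly twice that of ρᵛ and reaches its top only at ρᵛ. By the width
estimate a nonzero function has to use this vertex. -/
theorem IsBakerAkhiezer.eq_zero (hq : ∀ n : ℤ, qPow logq n = 1 → n = 0) {c : N →₀ L}
    (hc : IsBakerAkhiezer F b m c) (h : c (rhoCheck b m) = 0) : c = 0 := by
  by_contra hne
  obtain ⟨p₀, h0, p, hp, hle⟩ := exists_width_le b m (height b)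
    (fun i hi => (height_coroot_pos b hi).le) hne
    fun i _ _ => F.stringCondition_of_quasiInvariant hq hc.quasiInvariant i
  have h1 := neg_height_le_of_mem_polytope (hc.supp _ h0).2
  have h2 := eq_rhoCheck_of_mem_polytope (hc.supp _ hp).2 (by linarith)
  exact Finsupp.mem_support_iff.1 (h2 ▸ hp) h

theorem IsBakerAkhiezer.sub {c c' : N →₀ L} (hc : IsBakerAkhiezer F b m c)
    (hc' : IsBakerAkhiezer F b m c') : IsBakerAkhiezer F b m (c - c') where
  supp ν hν := by
    classical
    rcases Finset.mem_union.1 (Finsupp.support_sub hν) with h | h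
    · exact hc.supp ν h
    · exact hc'.supp ν h
  quasiInvariant := by
    rw [F.ev_sub]
    exact hc.quasiInvariant.sub hc'.quasiInvariant

theorem IsBakerAkhiezer.eq (hq : ∀ n : ℤ, qPow logq n = 1 → n = 0) {c c' : N →₀ L}
    (hc : IsBakerAkhiezer F b m c) (hc' : IsBakerAkhiezer F b m c')
    (h : c (rhoCheck b m) = c' (rhoCheck b m)) : c = c' :=
  sub_eq_zero.1 ((hc.sub hc').eq_zero hq (by rw [Finsupp.sub_apply, h, sub_self]))

/-- Uniqueness identifies c with the constructed function, whose exponents lie in one coset of the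
coroot lattice. -/
theorem IsBakerAkhiezer.sub_rhoCheck_mem (hq : ∀ n : ℤ, qPow logq n = 1 → n = 0)
    (hm : ∀ i j, m (P.reflectionPerm i j) = m j) [P.IsIrreducible] [Nonempty ι] {c : N →₀ L}
    (hc : IsBakerAkhiezer F b m c) {ν : N} (hν : ν ∈ c.support) :
    ν - rhoCheck b m ∈ corootLattice P := by
  obtain ⟨c', hc', hQ, h⟩ := exists_bakerAkhiezer F b hq hm (c (rhoCheck b m))
  have : IsBakerAkhiezer F b m c' := ⟨fun ν hν => ⟨by
    have := add_mem (corootLattice_le (hc' ν hν).1) (rhoCheck_mem_coweightLattice b hm)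
    rwa [sub_add_cancel] at this, (hc' ν hν).2⟩, hQ⟩
  rw [hc.eq hq this h.symm] at hν
  exact (hc' ν hν).1

end Uniqueness

namespace CharacterField

/-- The operator `∑ d_ν T^ν`. -/
def diffOp (d : N →₀ L) : Module.End ℂ L :=
  d.sum fun ν a => LinearMap.mulLeft ℂ a ∘ₗ (F.T ν).toLinearMap

theorem diffOp_apply (d : N →₀ L) (f : L) : F.diffOp d f = d.sum fun ν a => a * F.T ν f := by
  rw [diffOp, Finsupp.sum, LinearMap.sum_apply]
  rfl

theorem diffOp_zero : F.diffOp 0 = 0 := Finsupp.sum_zero_index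

theorem diffOp_single (ν : N) (a : L) :
    F.diffOp (Finsupp.single ν a) = LinearMap.mulLeft ℂ a ∘ₗ (F.T ν).toLinearMap :=
  Finsupp.sum_single_index (by ext; simp)

theorem diffOp_add (d d' : N →₀ L) : F.diffOp (d + d') = F.diffOp d + F.diffOp d' :=
  Finsupp.sum_add_index' (fun _ => by ext; simp) fun _ _ _ => by ext; simp [add_mul]

theorem diffOp_sub (d d' : N →₀ L) : F.diffOp (d - d') = F.diffOp d - F.diffOp d' := by
  rw [eq_sub_iff_add_eq, ← diffOp_add, sub_add_cancel]

theorem diffOp_sum {κ : Type*} (s : Finset κ) (d : κ → N →₀ L) :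
    F.diffOp (∑ i ∈ s, d i) = ∑ i ∈ s, F.diffOp (d i) := by
  classical
  induction s using Finset.induction_on with
  | empty => simp [diffOp_zero]
  | insert i s hi ih => rw [Finset.sum_insert hi, Finset.sum_insert hi, diffOp_add, ih]

theorem exists_diffOp_eq_mul (d d' : N →₀ L) : ∃ e, F.diffOp e = F.diffOp d * F.diffOp d' := by
  induction d using Finsupp.induction_linear with
  | zero => exact ⟨0, by rw [diffOp_zero, zero_mul]⟩
  | add d₁ d₂ h₁ h₂ =>
    obtain ⟨e₁, h₁⟩ := h₁
    obtain ⟨e₂, h₂⟩ := h₂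
    exact ⟨e₁ + e₂, by rw [diffOp_add, h₁, h₂, diffOp_add, add_mul]⟩
  | single ν a =>
    induction d' using Finsupp.induction_linear with
    | zero => exact ⟨0, by rw [diffOp_zero, mul_zero]⟩
    | add d₁ d₂ h₁ h₂ =>
      obtain ⟨e₁, h₁⟩ := h₁
      obtain ⟨e₂, h₂⟩ := h₂
      exact ⟨e₁ + e₂, by rw [diffOp_add, h₁, h₂, diffOp_add, mul_add]⟩
    | single μ a' =>
      refine ⟨Finsupp.single (ν + μ) (a * F.T ν a'), ?_⟩
      rw [diffOp_single, diffOp_single, diffOp_single]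
      ext f
      simp [F.T_add]

/-- The function `∑ d_ν T^ν ψ`, in terms of its coefficients. -/
theorem exists_ev_eq_diffOp (c d : N →₀ L) :
    ∃ c' : N →₀ L, F.ev c' = (fun z => F.diffOp d (F.ev c z)) ∧
      ∀ μ, c' μ = d.sum fun ν a => a * F.T ν (c (μ - ν)) := by
  induction d using Finsupp.induction_linear with
  | zero => exact ⟨0, by rw [ev_zero, diffOp_zero]; rfl, fun μ => by simp⟩
  | add d₁ d₂ h₁ h₂ =>
    obtain ⟨c₁, h₁, h₁'⟩ := h₁
    obtain ⟨c₂, h₂, h₂'⟩ := h₂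
    refine ⟨c₁ + c₂, by rw [ev_add, h₁, h₂, diffOp_add]; rfl, fun μ => ?_⟩
    rw [Finsupp.sum_add_index' (by simp) (by simp [add_mul]), Finsupp.add_apply, h₁', h₂']
  | single ν a =>
    obtain ⟨c', h, h'⟩ := F.exists_ev_eq_shift ν c
    refine ⟨a • c', ?_, fun μ => ?_⟩
    · funext z
      rw [F.ev_smul, h, diffOp_single]
      rfl
    · rw [Finsupp.sum_single_index (by simp), Finsupp.smul_apply, h', smul_eq_mul]

end CharacterField

section Algorithm

variable [Fintype ι] [P.IsCrystallographic] [P.IsReduced] {b : P.Base} {m : ι → ℕ} {F}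

theorem QuasiInvariant.diffOp {φ : M → L} (h : QuasiInvariant P logq m φ) (d : N →₀ L) :
    QuasiInvariant P logq m fun z => F.diffOp d (φ z) := fun i s h1 h2 z hz =>
  congrArg (F.diffOp d) (h i s h1 h2 z hz)

/-- A difference operator that annihilates the Baker–Akhiezer function is zero. -/
theorem IsBakerAkhiezer.diffOp_injective (hq : ∀ n : ℤ, qPow logq n = 1 → n = 0) {c : N →₀ L}
    (hc : IsBakerAkhiezer F b m c) (hne : c ≠ 0) {d : N →₀ L}
    (h : ∀ z, F.diffOp d (F.ev c z) = 0) : d = 0 := by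
  classical
  obtain ⟨c', h1, h2⟩ := F.exists_ev_eq_diffOp c d
  have h0 : c' = 0 := F.ev_injective hq (by rw [h1, F.ev_zero]; exact funext h)
  by_contra hd
  obtain ⟨ν, hν, hmax⟩ := Finset.exists_max_image d.support (height b)
    (Finsupp.support_nonempty_iff.2 hd)
  -- For ν of maximal height no other shift reaches this exponent, so the coefficient of Dψ here is
  -- d_ν T^ν(ψ_ρᵛ), which is nonzero.
  have h3 := h2 (ν + rhoCheck b m)
  rw [h0, Finsupp.zero_apply, Finsupp.sum, Finset.sum_eq_single_of_mem ν hν] at h3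
  · rw [add_sub_cancel_left] at h3
    refine mul_ne_zero (Finsupp.mem_support_iff.1 hν) ?_ h3.symm
    exact (map_ne_zero (F.T ν)).2 fun h => hne (hc.eq_zero hq h)
  · intro μ hμ hμν
    have : c (ν + rhoCheck b m - μ) = 0 := by
      by_contra hcon
      have h4 := (hc.supp _ (Finsupp.mem_support_iff.2 hcon)).2
      have h5 := eq_rhoCheck_of_mem_polytope h4 (by
        rw [map_sub, map_add]
        linarith [hmax μ hμ])
      apply hμν
      rw [sub_eq_iff_eq_add, add_comm, add_right_inj] at h5
      exact h5.symm
    rw [this, map_zero, mul_zero]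

/-- Every quasi-invariant function is obtained from the Baker–Akhiezer function by a difference
operator in `x`. -/
theorem IsBakerAkhiezer.exists_diffOp_eq (hq : ∀ n : ℤ, qPow logq n = 1 → n = 0)
    (hm : ∀ i j, m (P.reflectionPerm i j) = m j) [P.IsIrreducible] [Nonempty ι] {c : N →₀ L}
    (hc : IsBakerAkhiezer F b m c) (hne : c ≠ 0) {S : Set N} (hS : S ⊆ coweightLattice P)
    (hS' : ∀ μ ∈ S, ∀ κ ∈ corootLattice P, μ + κ ∈ S) {γ : N →₀ L}
    (hγ : ∀ μ ∈ γ.support, μ - rhoCheck b m ∈ S) (hQ : QuasiInvariant P logq m (F.ev γ)) {t : ℝ}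
    (ht : ∀ μ ∈ γ.support, height b μ ≤ t + height b (rhoCheck b m)) :
    ∃ d : N →₀ L, (∀ ν ∈ d.support, ν ∈ S ∧ height b ν ≤ t) ∧
      ∀ z, F.diffOp d (F.ev c z) = F.ev γ z := by
  classical
  have hρ := rhoCheck_mem_coweightLattice b hm
  have hcρ : c (rhoCheck b m) ≠ 0 := fun h => hne (hc.eq_zero hq h)
  rcases eq_or_ne γ 0 with rfl | hγ0
  · exact ⟨0, by simp, fun z => by rw [diffOp_zero, ev_zero]; rfl⟩
  obtain ⟨μ₀, hμ₀, hmin⟩ := Finset.exists_min_image γ.support (height b)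
    (Finsupp.support_nonempty_iff.2 hγ0)
  have hint : ∀ μ, μ - rhoCheck b m ∈ S → ∃ n : ℤ, 2 * height b μ = n := fun μ hμ => by
    have := add_mem (hS hμ) hρ
    rw [sub_add_cancel] at this
    exact exists_two_mul_height_eq b this
  obtain ⟨l, hl⟩ := hint μ₀ (hγ μ₀ hμ₀)
  -- Induction on the maximal height, measured in half-integral steps above the fixed lowest level
  -- l/2. The membership in S is carried along to control the lattice coset of the shifts.
  have key : ∀ n : ℕ, ∀ γ : N →₀ L, (∀ μ ∈ γ.support, μ - rhoCheck b m ∈ S) →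
      QuasiInvariant P logq m (F.ev γ) → (∀ μ ∈ γ.support, (l : ℝ) ≤ 2 * height b μ) →
      (∀ μ ∈ γ.support, 2 * height b μ < l + n) →
      (∀ μ ∈ γ.support, height b μ ≤ t + height b (rhoCheck b m)) →
      ∃ d : N →₀ L, (∀ ν ∈ d.support, ν ∈ S ∧ height b ν ≤ t) ∧
        ∀ z, F.diffOp d (F.ev c z) = F.ev γ z := by
    intro n
    induction n with
    | zero =>
      intro γ _ _ h1 h2 _
      obtain rfl : γ = 0 := by
        rw [← Finsupp.support_eq_empty, Finset.eq_empty_iff_forall_notMem]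
        intro μ hμ
        have := h1 μ hμ
        have := h2 μ hμ
        rw [Nat.cast_zero, add_zero] at this
        linarith
      exact ⟨0, by simp, fun z => by rw [diffOp_zero, ev_zero]; rfl⟩
    | succ n ih =>
      intro γ hγ hQ h1 h2 ht
      set A := γ.support.filter fun μ => 2 * height b μ = l + n with hA
      by_cases hAe : A = ∅
      · refine ih γ hγ hQ h1 (fun μ hμ => ?_) ht
        have h3 := h2 μ hμ
        have h4 : 2 * height b μ ≠ l + n := fun h =>
          (Finset.eq_empty_iff_forall_notMem.1 hAe μ) (Finset.mem_filter.2 ⟨hμ, h⟩)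
        obtain ⟨k, hk⟩ := hint μ (hγ μ hμ)
        rw [hk] at h3 h4 ⊢
        have h5 : k < l + (n + 1 : ℕ) := by exact_mod_cast h3
        have h6 : k ≠ l + n := by exact_mod_cast h4
        have : k < l + n := by push_cast at h5; omega
        exact_mod_cast this
      obtain ⟨a₀, ha₀⟩ := Finset.nonempty_iff_ne_empty.2 hAe
      have ha₀' := Finset.mem_filter.1 ha₀
      -- By the width estimate the top is at least twice the height of ρᵛ above the lowest level, so
      -- subtracting a translate of ψ placed at the top does not go below that level.
      have hwidth : (l : ℝ) ≤ l + n - 4 * height b (rhoCheck b m) := by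
        obtain ⟨p₀, hp₀, p, hp, hle⟩ := exists_width_le b m (height b)
          (fun i hi => (height_coroot_pos b hi).le)
          (show γ ≠ 0 by rintro rfl; simp at ha₀')
          fun i _ _ => F.stringCondition_of_quasiInvariant hq hQ i
        have e1 := h1 p₀ hp₀
        have e2 : 2 * height b p ≤ l + n := by
          have e2 := h2 p hp
          obtain ⟨k, hk⟩ := hint p (hγ p hp)
          rw [hk] at e2 ⊢
          have h5 : k < l + (n + 1 : ℕ) := by exact_mod_cast e2
          have : k ≤ l + n := by push_cast at h5; omega
          exact_mod_cast this
        linarith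
      -- The shift by μ - ρᵛ moves the vertex of ψ to μ; the coefficient is chosen to reproduce γ μ
      -- there. All terms of the top height are removed at once.
      let d₀ : N →₀ L := ∑ μ ∈ A, Finsupp.single (μ - rhoCheck b m)
        (γ μ / F.T (μ - rhoCheck b m) (c (rhoCheck b m)))
      have hd₀ : ∀ ν ∈ d₀.support, ν + rhoCheck b m ∈ A := by
        intro ν hν
        obtain ⟨μ, hμ, h⟩ := Finset.mem_biUnion.1 (Finsupp.support_finsetSum hν)
        have := Finsupp.support_single_subset h
        rw [Finset.mem_singleton] at this
        rwa [this, sub_add_cancel]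
      obtain ⟨c', hc1, hc2⟩ := F.exists_ev_eq_diffOp c d₀
      have hc3 : ∀ ν, c' ν = ∑ μ ∈ A, γ μ / F.T (μ - rhoCheck b m) (c (rhoCheck b m)) *
          F.T (μ - rhoCheck b m) (c (ν - (μ - rhoCheck b m))) := by
        intro ν
        rw [hc2, ← Finsupp.sum_finsetSum_index (by simp) (by simp [add_mul])]
        exact Finset.sum_congr rfl fun μ _ => Finsupp.sum_single_index (by simp)
      have hcsupp : ∀ ν ∈ c'.support, ∃ μ ∈ A, ν - (μ - rhoCheck b m) ∈ c.support := by
        intro ν hν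
        by_contra! hcon
        refine Finsupp.mem_support_iff.1 hν ?_
        rw [hc3]
        refine Finset.sum_eq_zero fun μ hμ => ?_
        rw [Finsupp.notMem_support_iff.1 (hcon μ hμ), map_zero, mul_zero]
      have htop : ∀ ν ∈ A, c' ν = γ ν := by
        intro ν hν
        rw [hc3, Finset.sum_eq_single_of_mem ν hν]
        · rw [sub_sub_cancel, div_mul_cancel₀ _ ((map_ne_zero (F.T _)).2 hcρ)]
        · intro μ hμ hμν
          have : c (ν - (μ - rhoCheck b m)) = 0 := by
            by_contra hcon
            have h4 := (hc.supp _ (Finsupp.mem_support_iff.2 hcon)).2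
            have h5 := eq_rhoCheck_of_mem_polytope h4 (by
              have e1 := (Finset.mem_filter.1 hν).2
              have e2 := (Finset.mem_filter.1 hμ).2
              rw [map_sub, map_sub]
              linarith)
            apply hμν
            rw [sub_eq_iff_eq_add, add_sub_cancel] at h5
            exact h5.symm
          rw [this, map_zero, mul_zero]
      have hγ' : ∀ μ ∈ (γ - c').support, μ ∈ γ.support ∨ μ ∈ c'.support := fun μ hμ =>
        Finset.mem_union.1 (Finsupp.support_sub hμ)
      have a1 : ∀ μ ∈ (γ - c').support, μ - rhoCheck b m ∈ S := by
        intro μ hμ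
        rcases hγ' μ hμ with h | h
        · exact hγ μ h
        · obtain ⟨μ', hμ', h'⟩ := hcsupp μ h
          have := hS' _ (hγ μ' (Finset.mem_filter.1 hμ').1) _ (hc.sub_rhoCheck_mem hq hm h')
          convert this using 1
          abel
      have a2 : QuasiInvariant P logq m (F.ev (γ - c')) := by
        rw [F.ev_sub, hc1]
        exact hQ.sub (hc.quasiInvariant.diffOp d₀)
      have a3 : ∀ μ ∈ (γ - c').support, (l : ℝ) ≤ 2 * height b μ := by
        intro μ hμ
        rcases hγ' μ hμ with h | h
        · exact h1 μ h
        · obtain ⟨μ', hμ', h'⟩ := hcsupp μ h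
          have e1 := neg_height_le_of_mem_polytope (hc.supp _ h').2
          have e2 := (Finset.mem_filter.1 hμ').2
          rw [map_sub, map_sub] at e1
          linarith
      have a4 : ∀ μ ∈ (γ - c').support, 2 * height b μ < l + n := by
        intro μ hμ
        have hle : 2 * height b μ ≤ l + n := by
          rcases hγ' μ hμ with h | h
          · have e2 := h2 μ h
            obtain ⟨k, hk⟩ := hint μ (hγ μ h)
            rw [hk] at e2 ⊢
            have h5 : k < l + (n + 1 : ℕ) := by exact_mod_cast e2
            have : k ≤ l + n := by push_cast at h5; omega
            exact_mod_cast this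
          · obtain ⟨μ', hμ', h'⟩ := hcsupp μ h
            have e1 := height_le_of_mem_polytope (hc.supp _ h').2
            have e2 := (Finset.mem_filter.1 hμ').2
            rw [map_sub, map_sub] at e1
            linarith
        refine lt_of_le_of_ne hle fun heq => Finsupp.mem_support_iff.1 hμ ?_
        rw [Finsupp.sub_apply, sub_eq_zero]
        by_cases hμA : μ ∈ A
        · rw [htop μ hμA]
        · have e0 : γ μ = 0 := by
            by_contra hne
            exact hμA (Finset.mem_filter.2 ⟨Finsupp.mem_support_iff.2 hne, heq⟩)
          rw [e0]
          by_contra hne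
          obtain ⟨μ', hμ', h'⟩ := hcsupp μ (Finsupp.mem_support_iff.2 (Ne.symm hne))
          have e2 := (Finset.mem_filter.1 hμ').2
          have h5 := eq_rhoCheck_of_mem_polytope (hc.supp _ h').2 (by
            rw [map_sub, map_sub]
            linarith)
          rw [sub_eq_iff_eq_add, add_sub_cancel] at h5
          exact hμA (h5 ▸ hμ')
      have a5 : ∀ μ ∈ (γ - c').support, height b μ ≤ t + height b (rhoCheck b m) := by
        intro μ hμ
        rcases hγ' μ hμ with h | h
        · exact ht μ h
        · obtain ⟨μ', hμ', h'⟩ := hcsupp μ h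
          have e1 := height_le_of_mem_polytope (hc.supp _ h').2
          have e2 := ht μ' (Finset.mem_filter.1 hμ').1
          rw [map_sub, map_sub] at e1
          linarith
      obtain ⟨d, hd, hd'⟩ := ih (γ - c') a1 a2 a3 a4 a5
      refine ⟨d₀ + d, fun ν hν => ?_, fun z => ?_⟩
      · rcases Finset.mem_union.1 (Finsupp.support_add hν) with h | h
        · have h3 := (Finset.mem_filter.1 (hd₀ ν h)).1
          refine ⟨by simpa using hγ _ h3, ?_⟩
          have := ht _ h3
          rw [map_add] at this
          linarith
        · exact hd ν h
      · rw [diffOp_add, LinearMap.add_apply, hd', F.ev_sub, hc1, Pi.sub_apply, add_sub_cancel]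
  obtain ⟨n, hn⟩ := exists_nat_gt (2 * (t + height b (rhoCheck b m)) - l)
  exact key n γ hγ hQ (fun μ hμ => by linarith [hmin μ hμ]) (fun μ hμ => by linarith [ht μ hμ]) ht

end Algorithm

end BakerAkhiezer

end

/-! ### Brackets and rationality of the coefficients. -/

noncomputable section

namespace BakerAkhiezer

open Module

variable {ι M N L : Type*} [AddCommGroup M] [Module ℂ M] [NormedAddCommGroup N] [NormedSpace ℂ N]
  {P : RootPairing ι ℂ M N} {logq : ℂ} [Field L] [Algebra ℂ L] (F : CharacterField P logq L)

namespace CharacterField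

/-- The rational functions of the characters of the weight lattice. -/
def rationals : IntermediateField ℂ L :=
  IntermediateField.adjoin ℂ (F.X '' (weightLattice P : Set M))

variable {F} in
theorem X_mem_rationals {μ : M} (h : μ ∈ weightLattice P) : F.X μ ∈ F.rationals :=
  IntermediateField.subset_adjoin _ _ ⟨μ, h, rfl⟩

variable {F} in
theorem smul_mem_rationals (a : ℂ) {f : L} (h : f ∈ F.rationals) : a • f ∈ F.rationals :=
  IntermediateField.smul_mem _ h

variable {F} in
theorem T_mem_rationals (u : N) {f : L} (h : f ∈ F.rationals) : F.T u f ∈ F.rationals := by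
  have : F.rationals ≤ F.rationals.comap (F.T u).toAlgHom := by
    rw [rationals, IntermediateField.adjoin_le_iff]
    rintro _ ⟨μ, hμ, rfl⟩
    change F.T u (F.X μ) ∈ F.rationals
    rw [F.T_X]
    exact smul_mem_rationals _ (X_mem_rationals hμ)
  exact this h

/-- Splitting of vector spaces over the subfield. The projection commutes with linear relations
whose coefficients are rational, and uniqueness then shows that a solution is fixed by it. -/
theorem exists_projection : ∃ p : L →ₗ[F.rationals] L, (∀ x, p x ∈ F.rationals) ∧
    ∀ x ∈ F.rationals, p x = x := by
  obtain ⟨p, hp⟩ := (Algebra.linearMap F.rationals L).exists_leftInverse_of_injective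
    (LinearMap.ker_eq_bot.2 (algebraMap F.rationals L).injective)
  refine ⟨Algebra.linearMap F.rationals L ∘ₗ p, fun x => (p x).2, fun x hx => ?_⟩
  have := LinearMap.congr_fun hp ⟨x, hx⟩
  exact congrArg Subtype.val this

/-- The function `[c + (α, x)]`. -/
def bracket (i : ι) (c : ℂ) : L :=
  qPow logq c • F.X ((1 / 2 : ℂ) • P.root i) - qPow logq (-c) • F.X (-((1 / 2 : ℂ) • P.root i))

theorem bracket_eq (i : ι) (c : ℂ) : F.bracket i c =
    F.X (-((1 / 2 : ℂ) • P.root i)) * (qPow logq c • F.X (P.root i) - qPow logq (-c) • 1) := by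
  have : F.X ((1 / 2 : ℂ) • P.root i) = F.X (-((1 / 2 : ℂ) • P.root i)) * F.X (P.root i) := by
    rw [← F.X_add]
    congr 1
    module
  rw [bracket, this, mul_sub, mul_smul_comm, mul_smul_comm, mul_one]

theorem bracket_neg (i : ι) (c : ℂ) : F.bracket (P.reflectionPerm i i) c = -F.bracket i (-c) := by
  rw [bracket, bracket, root_reflectionPerm_self, smul_neg, neg_neg, neg_neg, neg_sub]

theorem bracket_ne_zero (hq : ∀ n : ℤ, qPow logq n = 1 → n = 0) (i : ι) (c : ℂ) :
    F.bracket i c ≠ 0 := by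
  rw [bracket_eq]
  refine mul_ne_zero (F.X_ne_zero _) fun h => ?_
  refine F.X_ne_algebraMap hq (P.ne_zero i) (qPow logq (-c) * qPow logq (-c)) ?_
  rw [sub_eq_zero] at h
  have h2 := congrArg (fun f => qPow logq (-c) • f) h
  simp only [smul_smul] at h2
  rwa [qPow_neg, inv_mul_cancel₀ (qPow_ne_zero _ _), one_smul, ← qPow_neg,
    ← Algebra.algebraMap_eq_smul_one] at h2

theorem T_bracket (u : N) (i : ι) (c : ℂ) :
    F.T u (F.bracket i c) = F.bracket i (c + P.toLinearMap (P.root i) u) := by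
  have e : ∀ v : M, zExp P logq u ((1 / 2 : ℂ) • v) = qPow logq (P.toLinearMap v u) := by
    intro v
    rw [zExp, map_smul, LinearMap.smul_apply, smul_eq_mul]
    congr 1
    ring
  rw [bracket, bracket, map_sub, map_smul, map_smul, F.T_X, F.T_X, smul_smul, smul_smul,
    zExp_apply_neg, e, ← qPow_neg, ← qPow_add, ← qPow_add, neg_add]

theorem σ_bracket (k i : ι) (c : ℂ) :
    F.σ k (F.bracket i c) = F.bracket (P.reflectionPerm k i) c := by
  rw [bracket, bracket, map_sub, map_smul, map_smul, F.σ_X, F.σ_X, P.root_reflectionPerm, map_neg,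
    map_smul]

/-- Half-roots need not be weights, but X(α/2)⁻ˢ is a factor common to the whole relation on a
string; what remains has rational coefficients. -/
theorem Y_pow_sub (i : ι) (s : ℕ) (μ : N) :
    F.Y i μ ^ s - (F.Y i μ)⁻¹ ^ s = (F.X ((1 / 2 : ℂ) • P.root i) ^ s)⁻¹ *
      (qPow logq (P.toLinearMap (P.root i) μ) ^ s • F.X (P.root i) ^ s -
        (qPow logq (P.toLinearMap (P.root i) μ) ^ s)⁻¹ • 1) := by
  have hX := F.X_ne_zero ((1 / 2 : ℂ) • P.root i)
  have hq0 := qPow_ne_zero logq (P.toLinearMap (P.root i) μ)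
  rw [← F.X_half_root_sq, Y]
  simp only [Algebra.smul_def, map_inv₀, map_pow]
  have hq1 : algebraMap ℂ L (qPow logq (P.toLinearMap (P.root i) μ)) ≠ 0 := by simpa using hq0
  rw [inv_pow, mul_pow, ← pow_mul, mul_comm 2 s, pow_mul]
  have h7 := pow_ne_zero s hX
  have h8 := pow_ne_zero s hq1
  generalize F.X ((1 / 2 : ℂ) • P.root i) ^ s = x at *
  generalize algebraMap ℂ L (qPow logq (P.toLinearMap (P.root i) μ)) ^ s = y at *
  field_simp

variable [Fintype ι] [P.IsReduced] (b : P.Base) (m : ι → ℕ)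

/-- The product `∏_{α > 0} ∏_{j = 1}^{m_α} [j - (α, x)]`. -/
def leadingCoeff : L :=
  ∏ i ∈ posRoots b, ∏ j ∈ Finset.Icc 1 (m i), F.bracket (P.reflectionPerm i i) (j : ℂ)

theorem leadingCoeff_ne_zero (hq : ∀ n : ℤ, qPow logq n = 1 → n = 0) :
    F.leadingCoeff b m ≠ 0 :=
  Finset.prod_ne_zero_iff.2 fun _ _ => Finset.prod_ne_zero_iff.2 fun _ _ =>
    F.bracket_ne_zero hq _ _

theorem X_sum (J : Finset ι) (f : ι → M) : F.X (∑ i ∈ J, f i) = ∏ i ∈ J, F.X (f i) := by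
  classical
  induction J using Finset.induction_on with
  | empty => simp [F.X_zero]
  | insert i J hi ih => rw [Finset.sum_insert hi, F.X_add, Finset.prod_insert hi, ih]

theorem X_rho : F.X (rho b fun i => (m i : ℂ)) =
    ∏ i ∈ posRoots b, F.X ((1 / 2 : ℂ) • P.root i) ^ m i := by
  rw [rho, Finset.smul_sum, X_sum]
  refine Finset.prod_congr rfl fun i _ => ?_
  rw [smul_comm, Nat.cast_smul_eq_nsmul, F.X_nsmul]

/-- The half-root characters of all brackets combine to X(ρ), and ρ is a weight when m is invariant.
-/
theorem leadingCoeff_eq : F.leadingCoeff b m = F.X (rho b fun i => (m i : ℂ)) *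
    ∏ i ∈ posRoots b, ∏ j ∈ Finset.Icc 1 (m i),
      (qPow logq (j : ℂ) • F.X (-P.root i) - qPow logq (-(j : ℂ)) • 1) := by
  rw [X_rho, ← Finset.prod_mul_distrib, leadingCoeff]
  refine Finset.prod_congr rfl fun i _ => ?_
  nth_rewrite 2 [← Nat.add_sub_cancel (m i) 1]
  rw [← Nat.card_Icc, ← Finset.prod_const, ← Finset.prod_mul_distrib]
  refine Finset.prod_congr rfl fun j _ => ?_
  rw [bracket_eq, root_reflectionPerm_self, smul_neg, neg_neg]

variable [P.IsCrystallographic]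

theorem root_mem_weightLattice (i : ι) : P.root i ∈ weightLattice P := fun j =>
  ⟨P.pairingIn ℤ i j, toLinearMap_root_coroot i j⟩

variable {m}

theorem rho_mem_weightLattice (hm : ∀ i j, m (P.reflectionPerm i j) = m j) :
    rho b (fun i => (m i : ℂ)) ∈ weightLattice P := by
  intro i
  have h := b.coroot_mem_span_int i
  generalize P.coroot i = y at h
  induction h using Submodule.span_induction with
  | mem x hx =>
    obtain ⟨j, hj, rfl⟩ := hx
    exact ⟨m j, by rw [rho_coroot b (fun i j => by rw [hm]) hj]; simp⟩
  | zero => exact ⟨0, by simp⟩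
  | add x y _ _ hx hy =>
    obtain ⟨n, hn⟩ := hx
    obtain ⟨n', hn'⟩ := hy
    exact ⟨n + n', by simp [hn, hn']⟩
  | smul a x _ hx =>
    obtain ⟨n, hn⟩ := hx
    refine ⟨a * n, ?_⟩
    rw [map_zsmul, hn]
    simp

theorem leadingCoeff_mem_rationals (hm : ∀ i j, m (P.reflectionPerm i j) = m j) :
    F.leadingCoeff b m ∈ F.rationals := by
  rw [leadingCoeff_eq]
  refine mul_mem (X_mem_rationals (rho_mem_weightLattice b hm)) (prod_mem fun i _ =>
    prod_mem fun j _ => sub_mem (smul_mem_rationals _ (X_mem_rationals ?_))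
      (smul_mem_rationals _ (one_mem _)))
  exact neg_mem (root_mem_weightLattice i)

end CharacterField

open CharacterField

section Rationality

variable [Fintype ι] [P.IsCrystallographic] [P.IsReduced] {b : P.Base} {m : ι → ℕ} {F}

/-- The coefficientwise projection of c satisfies the same string relations, has its support in the
polytope and has the same coefficient at ρᵛ, so it equals c. -/
theorem IsBakerAkhiezer.mem_rationals (hq : ∀ n : ℤ, qPow logq n = 1 → n = 0) {c : N →₀ L}
    (hc : IsBakerAkhiezer F b m c) (h : c (rhoCheck b m) ∈ F.rationals) (ν : N) :
    c ν ∈ F.rationals := by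
  classical
  obtain ⟨p, hp, hp'⟩ := F.exists_projection
  have hBA : IsBakerAkhiezer F b m (c.mapRange p (map_zero p)) := by
    refine ⟨fun ν hν => hc.supp ν (Finsupp.support_mapRange hν), ?_⟩
    rw [F.quasiInvariant_ev_iff hq]
    intro i s h1 h2 ν
    have h3 := (F.quasiInvariant_ev_iff hq m c).1 hc.quasiInvariant i s h1 h2 ν
    have hk : ∀ μ, qPow logq (P.toLinearMap (P.root i) μ) ^ s • F.X (P.root i) ^ s -
        (qPow logq (P.toLinearMap (P.root i) μ) ^ s)⁻¹ • 1 ∈ F.rationals := fun μ =>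
      sub_mem (smul_mem_rationals _ (pow_mem (X_mem_rationals (root_mem_weightLattice i)) s))
        (smul_mem_rationals _ (one_mem _))
    simp_rw [Y_pow_sub, mul_left_comm (_ : L) (F.X ((1 / 2 : ℂ) • P.root i) ^ s)⁻¹, ← Finset.mul_sum,
      mul_eq_zero] at h3 ⊢
    right
    replace h3 := h3.resolve_left (inv_ne_zero (pow_ne_zero _ (F.X_ne_zero _)))
    have h5 := congrArg p h3
    rw [map_sum, map_zero] at h5
    have h6 : (c.mapRange p (map_zero p)).support.filter
        (fun μ => μ - ν ∈ AddSubgroup.zmultiples (P.coroot i)) ⊆ c.support.filter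
        (fun μ => μ - ν ∈ AddSubgroup.zmultiples (P.coroot i)) :=
      Finset.filter_subset_filter _ Finsupp.support_mapRange
    rw [← h5]
    refine (Finset.sum_subset h6 fun μ hμ hμ' => ?_).trans (Finset.sum_congr rfl fun μ _ => ?_)
    · rw [Finset.mem_filter] at hμ hμ'
      rw [Finsupp.notMem_support_iff.1 fun h => hμ' ⟨h, hμ.2⟩, zero_mul]
    · have := p.map_smul ⟨_, hk μ⟩ (c μ)
      rw [Finsupp.mapRange_apply, mul_comm (c μ), mul_comm (p (c μ))]
      exact this.symm
  have := hBA.eq hq hc (by rw [Finsupp.mapRange_apply, hp' _ h])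
  rw [← this, Finsupp.mapRange_apply]
  exact hp _

/-- Projecting the coefficients of d leaves the resulting function unchanged because ψ and γ are
rational, and an operator is determined by its action on ψ. -/
theorem IsBakerAkhiezer.diffOp_mem_rationals (hq : ∀ n : ℤ, qPow logq n = 1 → n = 0) {c : N →₀ L}
    (hc : IsBakerAkhiezer F b m c) (hne : c ≠ 0) (hrat : ∀ ν, c ν ∈ F.rationals) {d γ : N →₀ L}
    (hγ : ∀ ν, γ ν ∈ F.rationals) (h : ∀ z, F.diffOp d (F.ev c z) = F.ev γ z) (ν : N) :
    d ν ∈ F.rationals := by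
  classical
  obtain ⟨p, hp, hp'⟩ := F.exists_projection
  obtain ⟨c₁, h1, h2⟩ := F.exists_ev_eq_diffOp c d
  obtain ⟨c₂, h3, h4⟩ := F.exists_ev_eq_diffOp c (d.mapRange p (map_zero p))
  have hc₁ : c₁ = γ := F.ev_injective hq (by rw [h1]; exact funext h)
  have hc₂ : c₂ = c₁ := by
    ext μ
    rw [h4, Finsupp.sum_mapRange_index (by simp)]
    have : c₁ μ ∈ F.rationals := by rw [hc₁]; exact hγ μ
    rw [← hp' _ this, h2, Finsupp.sum, Finsupp.sum, map_sum]
    refine Finset.sum_congr rfl fun κ _ => ?_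
    have := p.map_smul ⟨_, T_mem_rationals κ (hrat (μ - κ))⟩ (d κ)
    rw [mul_comm, mul_comm (d κ)]
    exact this.symm
  have h5 : d.mapRange p (map_zero p) - d = 0 := hc.diffOp_injective hq hne fun z => by
    have e1 := congrFun h1 z
    have e2 := congrFun h3 z
    rw [diffOp_sub, LinearMap.sub_apply, ← e1, ← e2, hc₂, sub_self]
  rw [← sub_eq_zero.1 h5, Finsupp.mapRange_apply]
  exact hp _

theorem exists_ev_eq_smul {c : N →₀ L} (hc : ∀ ν, c ν ∈ F.rationals)
    (hsupp : ∀ ν ∈ c.support, ν ∈ coweightLattice P) {f : M → ℂ} (hf : f ∈ zPolynomials P logq) :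
    ∃ γ : N →₀ L, F.ev γ = (fun z => f z • F.ev c z) ∧ (∀ ν, γ ν ∈ F.rationals) ∧
      ∀ ν ∈ γ.support, ν ∈ coweightLattice P := by
  classical
  induction hf using Submodule.span_induction with
  | mem f hf =>
    obtain ⟨κ, hκ, rfl⟩ := hf
    obtain ⟨γ, h1, h2⟩ := F.exists_ev_eq_affine_smul κ 1 0 c
    refine ⟨γ, by simpa using h1, fun ν => ?_, fun ν hν => ?_⟩
    · rw [h2]
      simpa using hc _
    · rw [Finsupp.mem_support_iff, h2, one_smul, zero_smul, sub_zero] at hν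
      have := add_mem (hsupp _ (Finsupp.mem_support_iff.2 hν)) hκ
      rwa [sub_add_cancel] at this
  | zero =>
    exact ⟨0, by rw [ev_zero]; funext z; simp, fun ν => zero_mem _, by simp⟩
  | add f g _ _ hf hg =>
    obtain ⟨γ, h1, h2, h3⟩ := hf
    obtain ⟨γ', h1', h2', h3'⟩ := hg
    refine ⟨γ + γ', ?_, fun ν => add_mem (h2 ν) (h2' ν), fun ν hν => ?_⟩
    · funext z
      rw [ev_add, h1, h1']
      simp [add_smul]
    · rcases Finset.mem_union.1 (Finsupp.support_add hν) with h | h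
      · exact h3 ν h
      · exact h3' ν h
  | smul a f _ hf =>
    obtain ⟨γ, h1, h2, h3⟩ := hf
    refine ⟨algebraMap ℂ L a • γ, ?_, fun ν => ?_, fun ν hν => h3 ν (Finsupp.support_smul hν)⟩
    · funext z
      rw [ev_smul, h1]
      simp [Algebra.smul_def, mul_assoc]
    · rw [Finsupp.smul_apply, smul_eq_mul, ← Algebra.smul_def]
      exact smul_mem_rationals a (h2 ν)

/-- The operators `D_f`. -/
theorem IsBakerAkhiezer.exists_diffOp (hq : ∀ n : ℤ, qPow logq n = 1 → n = 0)
    (hm : ∀ i j, m (P.reflectionPerm i j) = m j) [P.IsIrreducible] [Nonempty ι] {c : N →₀ L}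
    (hc : IsBakerAkhiezer F b m c) (hcρ : c (rhoCheck b m) = F.leadingCoeff b m) {f : M → ℂ}
    (hf : f ∈ quasiInvariants P logq m) :
    ∃ d : N →₀ L, (∀ ν ∈ d.support, ν ∈ coweightLattice P ∧ d ν ∈ F.rationals) ∧
      ∀ z, F.diffOp d (F.ev c z) = f z • F.ev c z := by
  have hne : c ≠ 0 := by
    rintro rfl
    exact F.leadingCoeff_ne_zero b m hq hcρ.symm
  have hrat := hc.mem_rationals hq (by rw [hcρ]; exact F.leadingCoeff_mem_rationals b hm)
  obtain ⟨γ, h1, h2, h3⟩ := exists_ev_eq_smul hrat (fun ν hν => (hc.supp ν hν).1) hf.1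
  have hQ : QuasiInvariant P logq m (F.ev γ) := by
    intro i s hs1 hs2 z hz
    rw [h1]
    simp only
    rw [hf.2 i s hs1 hs2 z hz, hc.quasiInvariant i s hs1 hs2 z hz]
  obtain ⟨t, ht⟩ : ∃ t, ∀ μ ∈ γ.support, height b μ ≤ t + height b (rhoCheck b m) := by
    obtain ⟨B, hB⟩ := (γ.support.image (height b)).finite_toSet.bddAbove
    exact ⟨B - height b (rhoCheck b m), fun μ hμ => by
      rw [sub_add_cancel]
      exact hB (by simpa using ⟨μ, by simpa using hμ, rfl⟩)⟩
  obtain ⟨d, hd, hd'⟩ := hc.exists_diffOp_eq hq hm hne (S := coweightLattice P) subset_rfl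
    (fun μ hμ κ hκ => add_mem hμ (corootLattice_le hκ))
    (fun μ hμ => sub_mem (h3 μ hμ) (rhoCheck_mem_coweightLattice b hm)) hQ ht
  refine ⟨d, fun ν hν => ⟨(hd ν hν).1, hc.diffOp_mem_rationals hq hne hrat h2 hd' ν⟩, fun z => ?_⟩
  rw [hd', h1]

end Rationality

end BakerAkhiezer

end

/-! ### Edges of the polytope and the Weyl symmetry of ψ. -/

noncomputable section

namespace BakerAkhiezer

open Module

variable {ι M N L : Type*} [AddCommGroup M] [Module ℂ M] [NormedAddCommGroup N] [NormedSpace ℂ N]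
  {P : RootPairing ι ℂ M N} {logq : ℂ} [Field L] [Algebra ℂ L] (F : CharacterField P logq L)

open CharacterField

section Polytope

variable [Fintype ι] [P.IsCrystallographic] [P.IsReduced] {b : P.Base} {m : ι → ℕ}

theorem neg_map_le_of_mem_polytope {g : N →ₗ[ℝ] ℝ} (hg : ∀ i ∈ posRoots b, 0 ≤ g (P.coroot i))
    {ν : N} (h : ν ∈ polytope b m) : -g (rhoCheck b m) ≤ g ν := by
  obtain ⟨l, hl, rfl⟩ := h
  have h1 := map_rhoCheck b m g
  simp only [map_sub, map_sum, Complex.coe_smul, map_smul, smul_eq_mul]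
  have : ∑ i ∈ posRoots b, l i * g (P.coroot i) ≤ ∑ i ∈ posRoots b, m i * g (P.coroot i) :=
    Finset.sum_le_sum fun i hi => mul_le_mul_of_nonneg_right (hl i).2 (hg i hi)
  linarith

variable (b) in
/-- A functional that vanishes on the coroot `i` only, among the positive ones, if `i` is simple. -/
def edgeHeight (i : ι) : N →ₗ[ℝ] ℝ :=
  height b + height b ∘ₗ (P.coreflection i).toLinearMap.restrictScalars ℝ

theorem edgeHeight_coroot (i j : ι) : edgeHeight b i (P.coroot j) =
    height b (P.coroot j) + height b (P.coroot (P.reflectionPerm i j)) := by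
  rw [P.coroot_reflectionPerm]
  rfl

theorem edgeHeight_self (i : ι) : edgeHeight b i (P.coroot i) = 0 := by
  rw [edgeHeight_coroot, coroot_reflectionPerm_self, map_neg, add_neg_cancel]

theorem edgeHeight_pos {i j : ι} (hi : i ∈ b.support) (hj : j ∈ posRoots b) (hij : j ≠ i) :
    0 < edgeHeight b i (P.coroot j) := by
  classical
  have := reflectionPerm_mem_posRoots_erase b hi (Finset.mem_erase.2 ⟨hij, hj⟩)
  rw [edgeHeight_coroot]
  exact add_pos (height_coroot_pos b hj) (height_coroot_pos b (Finset.mem_erase.1 this).2)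

theorem edgeHeight_nonneg {i j : ι} (hi : i ∈ b.support) (hj : j ∈ posRoots b) :
    0 ≤ edgeHeight b i (P.coroot j) := by
  rcases eq_or_ne j i with rfl | h
  · exact (edgeHeight_self _).ge
  · exact (edgeHeight_pos hi hj h).le

/-- The edge of the polytope in the direction of a simple coroot. -/
theorem eq_sub_smul_of_mem_polytope {i : ι} (hi : i ∈ b.support) {ν : N} (h : ν ∈ polytope b m)
    (h' : edgeHeight b i (rhoCheck b m) ≤ edgeHeight b i ν) :
    ∃ t : ℝ, 0 ≤ t ∧ t ≤ m i ∧ ν = rhoCheck b m - (t : ℂ) • P.coroot i := by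
  classical
  obtain ⟨l, hl, rfl⟩ := h
  refine ⟨l i, (hl i).1, (hl i).2, ?_⟩
  simp only [map_sub, map_sum, Complex.coe_smul, map_smul, smul_eq_mul, le_sub_self_iff] at h'
  have hnn : ∀ j ∈ posRoots b, 0 ≤ l j * edgeHeight b i (P.coroot j) := fun j hj =>
    mul_nonneg (hl j).1 (edgeHeight_nonneg hi hj)
  have h0 := (Finset.sum_eq_zero_iff_of_nonneg hnn).1 (le_antisymm h' (Finset.sum_nonneg hnn))
  rw [← Finset.add_sum_erase _ _ (mem_posRoots_of_mem_support b hi), add_eq_left.2]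
  refine Finset.sum_eq_zero fun j hj => ?_
  rw [Finset.mem_erase] at hj
  rw [(mul_eq_zero.1 (h0 j hj.2)).resolve_right (edgeHeight_pos hi hj.2 hj.1).ne']
  simp

theorem exists_height_eq_of_mem_corootLattice {κ : N} (h : κ ∈ corootLattice P) :
    ∃ n : ℤ, height b κ = n := by
  induction h using AddSubgroup.closure_induction with
  | mem x hx =>
    obtain ⟨i, rfl⟩ := hx
    have h := b.coroot_mem_span_int i
    generalize P.coroot i = y at h
    induction h using Submodule.span_induction with
    | mem x hx =>
      obtain ⟨j, hj, rfl⟩ := hx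
      exact ⟨1, by rw [height_coroot_of_mem_support b hj]; simp⟩
    | zero => exact ⟨0, by simp⟩
    | add x y _ _ hx hy =>
      obtain ⟨n, hn⟩ := hx
      obtain ⟨n', hn'⟩ := hy
      exact ⟨n + n', by simp [hn, hn']⟩
    | smul a x _ hx =>
      obtain ⟨n, hn⟩ := hx
      exact ⟨a * n, by rw [map_zsmul, hn]; simp⟩
  | zero => exact ⟨0, by simp⟩
  | add x y _ _ hx hy =>
    obtain ⟨n, hn⟩ := hx
    obtain ⟨n', hn'⟩ := hy
    exact ⟨n + n', by simp [hn, hn']⟩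
  | neg x _ hx =>
    obtain ⟨n, hn⟩ := hx
    exact ⟨-n, by simp [hn]⟩

theorem eq_sub_nsmul_of_mem_polytope {i : ι} (hi : i ∈ b.support) {ν : N} (h : ν ∈ polytope b m)
    (h' : edgeHeight b i (rhoCheck b m) ≤ edgeHeight b i ν)
    (hν : ν - rhoCheck b m ∈ corootLattice P) :
    ∃ k : ℕ, k ≤ m i ∧ ν = rhoCheck b m - k • P.coroot i := by
  obtain ⟨t, h0, h1, rfl⟩ := eq_sub_smul_of_mem_polytope hi h h'
  obtain ⟨n, hn⟩ := exists_height_eq_of_mem_corootLattice (b := b) hν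
  rw [sub_sub_cancel_left, map_neg, Complex.coe_smul, map_smul, height_coroot_of_mem_support b hi,
    smul_eq_mul, mul_one] at hn
  obtain ⟨k, hk⟩ : ∃ k : ℕ, -n = k := Int.eq_ofNat_of_zero_le (by
    have : (0 : ℝ) ≤ ((-n : ℤ) : ℝ) := by push_cast; linarith
    exact_mod_cast this)
  have ht : t = k := by
    have : ((-n : ℤ) : ℝ) = k := by rw [hk]; simp
    push_cast at this
    linarith
  subst ht
  refine ⟨k, by exact_mod_cast h1, ?_⟩
  rw [← Nat.cast_smul_eq_nsmul ℂ]
  simp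

theorem coreflection_mem_polytope (hm : ∀ i j, m (P.reflectionPerm i j) = m j) {i : ι}
    (hi : i ∈ b.support) {ν : N} (h : ν ∈ polytope b m) : P.coreflection i ν ∈ polytope b m := by
  classical
  obtain ⟨l, hl, rfl⟩ := h
  have hip := mem_posRoots_of_mem_support b hi
  -- The simple coroot changes sign, so its parameter l is replaced by m - l; the other parameters
  -- are permuted.
  refine ⟨fun j => if j = i then m i - l i else l (P.reflectionPerm i j), fun j => ?_, ?_⟩
  · simp only
    split_ifs with hj
    · subst hj
      exact ⟨sub_nonneg.2 (hl j).2, sub_le_self _ (hl j).1⟩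
    · rw [← hm i j]
      exact hl _
  · simp only
    rw [map_sub, coreflection_rhoCheck b hm hi, map_sum, ← Finset.add_sum_erase _ _ hip,
      ← Finset.add_sum_erase _ _ hip, map_smul, P.coreflection_apply_self, if_pos rfl]
    have : ∑ j ∈ (posRoots b).erase i, P.coreflection i ((l j : ℂ) • P.coroot j) =
        ∑ j ∈ (posRoots b).erase i,
          ((if j = i then m i - l i else l (P.reflectionPerm i j) : ℝ) : ℂ) • P.coroot j := by
      rw [← sum_posRoots_erase_reflectionPerm b hi]
      refine Finset.sum_congr rfl fun j hj => ?_
      rw [map_smul, ← P.coroot_reflectionPerm, P.reflectionPerm_self,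
        if_neg (Finset.mem_erase.1 hj).1]
    rw [this]
    push_cast
    module

end Polytope

namespace CharacterField

theorem bracket_sub_inv (i : ι) (μ : N) :
    F.Y i μ - (F.Y i μ)⁻¹ = F.bracket i (P.toLinearMap (P.root i) μ) := by
  rw [bracket, Y, F.X_neg, qPow_neg]
  simp only [Algebra.smul_def, map_inv₀, mul_inv]

/-- The factorization (A + A⁻¹) - (B + B⁻¹) = (A - B)(1 - A⁻¹B⁻¹), in the form needed for
differences of nodes on an edge. -/
theorem qPow_mul_inv_eq_bracket_mul (i : ι) (a c : ℂ) :
    F.bracket i (a + c) * algebraMap ℂ L (qPow logq (a - c) - qPow logq (-(a - c))) =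
      (qPow logq (2 * a) • F.X ((1 / 2 : ℂ) • P.root i) +
        (qPow logq (2 * a) • F.X ((1 / 2 : ℂ) • P.root i))⁻¹) -
      (qPow logq (2 * c) • F.X ((1 / 2 : ℂ) • P.root i) +
        (qPow logq (2 * c) • F.X ((1 / 2 : ℂ) • P.root i))⁻¹) := by
  have e : ∀ a : ℂ, qPow logq (2 * a) = qPow logq a ^ 2 := fun a => by
    rw [← qPow_natCast_mul]; simp
  rw [bracket, F.X_neg, e, e, neg_sub, neg_add, sub_eq_add_neg a c, sub_eq_add_neg c a]
  simp only [qPow_add, qPow_neg, Algebra.smul_def, map_inv₀, mul_inv, map_mul, map_sub, map_pow]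
  have h1 : algebraMap ℂ L (qPow logq a) ≠ 0 := by simpa using qPow_ne_zero logq a
  have h2 : algebraMap ℂ L (qPow logq c) ≠ 0 := by simpa using qPow_ne_zero logq c
  have h3 := F.X_ne_zero ((1 / 2 : ℂ) • P.root i)
  field_simp
  ring

end CharacterField

section Edge

variable [Fintype ι] [P.IsCrystallographic] [P.IsReduced] {b : P.Base} {m : ι → ℕ} {F}

/-- The number `[a]`. -/
def intBracket (logq : ℂ) (a : ℤ) : ℂ := qPow logq (a : ℂ) - qPow logq (-(a : ℂ))

theorem intBracket_neg (a : ℤ) : intBracket logq (-a) = -intBracket logq a := by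
  simp [intBracket]

theorem intBracket_ne_zero (hq : ∀ n : ℤ, qPow logq n = 1 → n = 0) {a : ℤ} (ha : a ≠ 0) :
    intBracket logq a ≠ 0 := by
  intro h
  rw [intBracket, sub_eq_zero, qPow_neg] at h
  have h2 : qPow logq ((2 * a : ℤ) : ℂ) = 1 := by
    rw [two_mul, Int.cast_add, qPow_add]
    nth_rewrite 2 [h]
    exact mul_inv_cancel₀ (qPow_ne_zero _ _)
  have := hq _ h2
  omega

/-- The string through ρᵛ in a simple direction meets the support only in the m + 1 points of an
edge, since `edgeHeight` is constant on the string and maximal on the polytope there. -/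
theorem IsBakerAkhiezer.moments_edge (hq : ∀ n : ℤ, qPow logq n = 1 → n = 0)
    {c : N →₀ L} (hc : IsBakerAkhiezer F b m c) {i : ι} (hi : i ∈ b.support) {j : ℕ} (hj : j < m i) :
    ∑ k ∈ Finset.range (m i + 1), c (rhoCheck b m - k • P.coroot i) *
      (F.Y i (rhoCheck b m - k • P.coroot i) - (F.Y i (rhoCheck b m - k • P.coroot i))⁻¹) *
      (F.Y i (rhoCheck b m - k • P.coroot i) + (F.Y i (rhoCheck b m - k • P.coroot i))⁻¹) ^ j
      = 0 := by
  classical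
  have h := moments_of_brackets (fun μ => F.Y_ne_zero i μ)
    (fun s h1 h2 => (F.quasiInvariant_ev_iff hq m c).1 hc.quasiInvariant i s h1 h2
      (rhoCheck b m)) j hj
  rw [← h]
  symm
  have hinj : Function.Injective fun k : ℕ => rhoCheck b m - k • P.coroot i := by
    intro k l hkl
    have h1 := congrArg (height b) hkl
    simp only [map_sub, map_nsmul, height_coroot_of_mem_support b hi] at h1
    simpa using h1
  rw [← Finset.sum_image (s := Finset.range (m i + 1))
    (f := fun μ => c μ * (F.Y i μ - (F.Y i μ)⁻¹) * (F.Y i μ + (F.Y i μ)⁻¹) ^ j)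
    (fun _ _ _ _ h => hinj h)]
  refine Finset.sum_subset (fun μ hμ => ?_) fun μ hμ hμ' => ?_
  · rw [Finset.mem_filter] at hμ
    obtain ⟨n, hn⟩ := AddSubgroup.mem_zmultiples_iff.1 hμ.2
    have e : μ = rhoCheck b m + n • P.coroot i := by rw [hn]; abel
    obtain ⟨k, hk, hk'⟩ := eq_sub_nsmul_of_mem_polytope hi (hc.supp μ hμ.1).2
      (by rw [e, map_add, map_zsmul, edgeHeight_self, smul_zero, add_zero])
      (by rw [← hn]; exact zsmul_mem (coroot_mem_corootLattice i) n)
    exact Finset.mem_image.2 ⟨k, Finset.mem_range.2 (by omega), hk'.symm⟩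
  · obtain ⟨k, hk, rfl⟩ := Finset.mem_image.1 hμ
    by_cases h0 : rhoCheck b m - k • P.coroot i ∈ c.support
    · exfalso
      refine hμ' (Finset.mem_filter.2 ⟨h0, ?_⟩)
      rw [sub_sub_cancel_left]
      exact neg_mem (nsmul_mem (AddSubgroup.mem_zmultiples _) k)
    · rw [Finsupp.notMem_support_iff.1 h0, zero_mul, zero_mul]

theorem Y_rhoCheck_sub (hm : ∀ i j, m (P.reflectionPerm i j) = m j) {i : ι} (hi : i ∈ b.support)
    (k : ℕ) : F.Y i (rhoCheck b m - k • P.coroot i) =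
      qPow logq (2 * ((m i : ℂ) / 2 - k)) • F.X ((1 / 2 : ℂ) • P.root i) := by
  rw [Y, map_sub, root_rhoCheck b hm hi, map_nsmul, P.root_coroot_two]
  congr 2
  simp
  ring

/-- The coefficients at the vertices and the inner points of an edge. -/
theorem IsBakerAkhiezer.edge (hq : ∀ n : ℤ, qPow logq n = 1 → n = 0)
    (hm : ∀ i j, m (P.reflectionPerm i j) = m j) {c : N →₀ L}
    (hc : IsBakerAkhiezer F b m c) {i : ι} (hi : i ∈ b.support) {k r : ℕ} (hk : 0 < k)
    (hkr : m i = k + r) :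
    c (rhoCheck b m) * (∏ l ∈ Finset.range k, F.bracket i (((k + r : ℕ) : ℂ) - (l : ℂ))) *
        algebraMap ℂ L (∏ l ∈ ((Finset.range (k + r + 1)).erase 0).erase k, intBracket logq l) +
      c (rhoCheck b m - k • P.coroot i) *
        (∏ l ∈ Finset.range k, F.bracket i (-1 - (l : ℂ))) *
        algebraMap ℂ L (∏ l ∈ ((Finset.range (k + r + 1)).erase 0).erase k,
          intBracket logq (l - k)) = 0 := by
  have h0 := moments_two_term (T := Finset.range (m i + 1)) (m := m i)
    (fun j hj => hc.moments_edge hq hi hj) (μ := 0) (μ' := k) (by simp)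
    (Finset.mem_range.2 (by omega)) hk.ne (by simp)
  have hu : ∀ k l : ℕ, (F.Y i (rhoCheck b m - k • P.coroot i) +
      (F.Y i (rhoCheck b m - k • P.coroot i))⁻¹) - (F.Y i (rhoCheck b m - l • P.coroot i) +
      (F.Y i (rhoCheck b m - l • P.coroot i))⁻¹) =
      F.bracket i ((m i : ℂ) - k - l) * algebraMap ℂ L (intBracket logq (l - k)) := by
    intro k l
    rw [Y_rhoCheck_sub hm hi, Y_rhoCheck_sub hm hi, ← F.qPow_mul_inv_eq_bracket_mul, intBracket]
    congr 3
    · ring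
    · congr 1
      push_cast
      ring
    · congr 1
      push_cast
      ring
  simp_rw [hu, Finset.prod_mul_distrib, bracket_sub_inv, map_sub, root_rhoCheck b hm hi, map_nsmul,
    P.root_coroot_two] at h0
  rw [hkr] at h0
  set D := ((Finset.range (k + r + 1)).erase 0).erase k with hD
  have h0D : (0 : ℕ) ∈ (Finset.range (k + r + 1)).erase k :=
    Finset.mem_erase.2 ⟨hk.ne, by simp⟩
  have hkD : k ∈ (Finset.range (k + r + 1)).erase 0 :=
    Finset.mem_erase.2 ⟨hk.ne', Finset.mem_range.2 (by omega)⟩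
  -- The brackets common to the two terms of the relation; they are cancelled at the end.
  set A := ∏ l ∈ Finset.range r, F.bracket i ((r : ℂ) - 1 - l) with hA
  have hA0 : A ≠ 0 := Finset.prod_ne_zero_iff.2 fun l _ => F.bracket_ne_zero hq _ _
  have hP1 : F.bracket i ((k + r : ℕ) : ℂ) * ∏ l ∈ D, F.bracket i (((k + r : ℕ) : ℂ) - l) =
      (∏ l ∈ Finset.range k, F.bracket i (((k + r : ℕ) : ℂ) - (l : ℂ))) * A := by
    refine mul_left_cancel₀ (F.bracket_ne_zero hq i (((k + r : ℕ) : ℂ) - (k : ℕ))) ?_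
    have e1 := Finset.mul_prod_erase _ (fun l : ℕ => F.bracket i (((k + r : ℕ) : ℂ) - l)) h0D
    rw [Finset.erase_right_comm, ← hD] at e1
    rw [Nat.cast_zero, sub_zero] at e1
    rw [e1, Finset.mul_prod_erase (Finset.range (k + r + 1))
      (fun l : ℕ => F.bracket i (((k + r : ℕ) : ℂ) - l)) (Finset.mem_range.2 (by omega)),
      add_assoc, Finset.prod_range_add, Finset.prod_range_succ']
    have e2 : ∀ l : ℕ, F.bracket i (((k + r : ℕ) : ℂ) - ((k + (l + 1) : ℕ) : ℂ)) =
        F.bracket i ((r : ℂ) - 1 - l) := fun l => by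
      congr 1
      push_cast
      ring
    simp_rw [e2]
    rw [← hA, add_zero]
    ring
  have hP2 : F.bracket i (((k + r : ℕ) : ℂ) - k • 2) *
      ∏ l ∈ D, F.bracket i (((k + r : ℕ) : ℂ) - k - l) =
      (∏ l ∈ Finset.range k, F.bracket i (-1 - (l : ℂ))) * A := by
    have e1 := Finset.mul_prod_erase _ (fun l : ℕ => F.bracket i (((k + r : ℕ) : ℂ) - k - l)) hkD
    rw [← hD] at e1
    have e3 : ((k + r : ℕ) : ℂ) - k • 2 = ((k + r : ℕ) : ℂ) - k - k := by
      rw [nsmul_eq_mul]; ring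
    rw [e3, e1]
    refine mul_left_cancel₀ (F.bracket_ne_zero hq i (((k + r : ℕ) : ℂ) - k - (0 : ℕ))) ?_
    rw [Finset.mul_prod_erase (Finset.range (k + r + 1))
      (fun l : ℕ => F.bracket i (((k + r : ℕ) : ℂ) - k - l)) (by simp), Finset.prod_range_succ',
      add_comm k r, Finset.prod_range_add]
    have e2 : ∀ l : ℕ, F.bracket i (((r + k : ℕ) : ℂ) - k - ((l + 1 : ℕ) : ℂ)) =
        F.bracket i ((r : ℂ) - 1 - l) := fun l => by
      congr 1
      push_cast
      ring
    have e4 : ∀ l : ℕ, F.bracket i ((r : ℂ) - 1 - ((r + l : ℕ) : ℂ)) =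
        F.bracket i (-1 - l) := fun l => by
      congr 1
      push_cast
      ring
    simp_rw [e2, e4]
    rw [← hA]
    ring
  refine mul_right_cancel₀ hA0 ?_
  rw [map_prod, map_prod]
  have hdec : (fun a c : ℕ => Classical.propDecidable (a = c)) = instDecidableEqNat :=
    Subsingleton.elim _ _
  simp only [zero_smul, sub_zero, Nat.cast_zero] at h0
  rw [hdec] at h0
  linear_combination h0 - c (rhoCheck b m) * (∏ l ∈ D, algebraMap ℂ L (intBracket logq l)) * hP1 -
    c (rhoCheck b m - k • P.coroot i) *
      (∏ l ∈ D, algebraMap ℂ L (intBracket logq (l - k))) * hP2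

variable (F b m) in
/-- The product of the factors of the leading coefficient at the other positive roots. -/
def otherFactors [DecidableEq ι] (i : ι) : L :=
  ∏ j ∈ (posRoots b).erase i, ∏ s ∈ Finset.Icc 1 (m j), F.bracket (P.reflectionPerm j j) (s : ℂ)

theorem leadingCoeff_eq_mul [DecidableEq ι] {i : ι} (hi : i ∈ b.support) :
    F.leadingCoeff b m = (-1) ^ m i * (∏ l ∈ Finset.range (m i), F.bracket i (-1 - (l : ℂ))) *
      otherFactors F b m i := by
  rw [leadingCoeff, ← Finset.mul_prod_erase _ _ (mem_posRoots_of_mem_support b hi), otherFactors]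
  congr 1
  have : (-1 : L) ^ m i = ∏ l ∈ Finset.range (m i), (-1 : L) := by simp
  rw [this, ← Finset.prod_mul_distrib, ← Finset.Ico_add_one_right_eq_Icc,
    Finset.prod_Ico_eq_prod_range, Nat.add_sub_cancel]
  refine Finset.prod_congr rfl fun l _ => ?_
  rw [bracket_neg, neg_one_mul]
  congr 2
  push_cast
  ring

/-- For k = m_i the relation between the two ends of the edge replaces the brackets of the simple
root in the leading coefficient by their reflections; the reflection permutes the factors of the
other positive roots. -/
theorem IsBakerAkhiezer.edge_end (hq : ∀ n : ℤ, qPow logq n = 1 → n = 0)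
    (hm : ∀ i j, m (P.reflectionPerm i j) = m j) {c : N →₀ L}
    (hc : IsBakerAkhiezer F b m c) (hcρ : c (rhoCheck b m) = F.leadingCoeff b m) {i : ι}
    (hi : i ∈ b.support) :
    c (rhoCheck b m - m i • P.coroot i) = F.σ i (F.leadingCoeff b m) := by
  classical
  have hσ : F.σ i (F.leadingCoeff b m) =
      (∏ l ∈ Finset.range (m i), F.bracket i ((m i : ℂ) - (l : ℂ))) * otherFactors F b m i := by
    rw [leadingCoeff_eq_mul hi, map_mul, map_mul, map_pow, map_neg, map_one, map_prod,
      ← Finset.prod_range_reflect, otherFactors, map_prod]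
    have h1 : ∏ j ∈ (posRoots b).erase i, F.σ i (∏ s ∈ Finset.Icc 1 (m j),
        F.bracket (P.reflectionPerm j j) (s : ℂ)) = ∏ j ∈ (posRoots b).erase i,
        ∏ s ∈ Finset.Icc 1 (m j), F.bracket (P.reflectionPerm j j) (s : ℂ) := by
      rw [← prod_posRoots_erase_reflectionPerm b hi]
      refine Finset.prod_congr rfl fun j _ => ?_
      rw [map_prod, hm]
      refine Finset.prod_congr rfl fun s _ => ?_
      rw [σ_bracket]
      congr 1
      apply P.root.injective
      rw [P.root_reflectionPerm, root_reflectionPerm_self, root_reflectionPerm_self, map_neg,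
        ← P.root_reflectionPerm, P.reflectionPerm_self]
    rw [h1]
    congr 1
    have : (-1 : L) ^ m i = ∏ l ∈ Finset.range (m i), (-1 : L) := by simp
    rw [this, ← Finset.prod_mul_distrib]
    refine Finset.prod_congr rfl fun l hl => ?_
    rw [σ_bracket, bracket_neg, neg_one_mul, neg_neg]
    congr 1
    have := Finset.mem_range.1 hl
    rw [Nat.sub_sub, Nat.cast_sub (by omega)]
    push_cast
    ring
  rcases Nat.eq_zero_or_pos (m i) with h0 | h0
  · rw [hσ, h0, zero_smul, sub_zero, hcρ, leadingCoeff_eq_mul hi, h0]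
    simp
  have he := hc.edge hq hm hi h0 (add_zero (m i)).symm
  rw [add_zero] at he
  set D := ((Finset.range (m i + 1)).erase 0).erase (m i) with hD
  have hD' : D = Finset.Ico 1 (m i) := by
    ext l
    simp only [hD, Finset.mem_erase, Finset.mem_range, Finset.mem_Ico]
    omega
  have hK : ∏ l ∈ D, intBracket logq (l - m i) = (-1) ^ (m i - 1) * ∏ l ∈ D, intBracket logq l := by
    rw [hD', Finset.prod_Ico_eq_prod_range, Finset.prod_Ico_eq_prod_range,
      ← Finset.prod_range_reflect (fun l => intBracket logq ((1 + l : ℕ) : ℤ))]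
    have : (-1 : ℂ) ^ (m i - 1) = ∏ l ∈ Finset.range (m i - 1), (-1 : ℂ) := by simp
    rw [this, ← Finset.prod_mul_distrib]
    refine Finset.prod_congr rfl fun l hl => ?_
    have := Finset.mem_range.1 hl
    rw [neg_one_mul, ← intBracket_neg]
    congr 1
    omega
  have hK0 : algebraMap ℂ L (∏ l ∈ D, intBracket logq l) ≠ 0 := by
    rw [map_ne_zero, Finset.prod_ne_zero_iff]
    intro l hl
    refine intBracket_ne_zero hq ?_
    rw [hD', Finset.mem_Ico] at hl
    omega
  have hP : ∏ l ∈ Finset.range (m i), F.bracket i (-1 - (l : ℂ)) ≠ 0 :=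
    Finset.prod_ne_zero_iff.2 fun l _ => F.bracket_ne_zero hq _ _
  rw [hK, hcρ, leadingCoeff_eq_mul hi, map_mul, map_pow, map_neg, map_one] at he
  have hs : (-1 : L) ^ m i = -(-1) ^ (m i - 1) := by
    obtain ⟨n, hn⟩ : ∃ n, m i = n + 1 := ⟨m i - 1, by omega⟩
    rw [hn, Nat.add_sub_cancel, pow_succ]
    ring
  rw [hs] at he
  have hs0 : (-1 : L) ^ (m i - 1) ≠ 0 := pow_ne_zero _ (by simp)
  rw [hσ]
  refine mul_left_cancel₀ hs0 (mul_right_cancel₀ hP (mul_right_cancel₀ hK0 ?_))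
  linear_combination he

/-- The points of the edges from the vertex `ρᵛ`. -/
theorem IsBakerAkhiezer.exists_edge_eq [DecidableEq ι] (hq : ∀ n : ℤ, qPow logq n = 1 → n = 0)
    (hm : ∀ i j, m (P.reflectionPerm i j) = m j) {c : N →₀ L}
    (hc : IsBakerAkhiezer F b m c) (hcρ : c (rhoCheck b m) = F.leadingCoeff b m) {i : ι}
    (hi : i ∈ b.support) {k : ℕ} (hk : k ≤ m i) : ∃ (a : ℂ) (s : Multiset ℂ),
      c (rhoCheck b m - k • P.coroot i) =
        algebraMap ℂ L a * (s.map (F.bracket i)).prod * otherFactors F b m i := by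
  rcases Nat.eq_zero_or_pos k with rfl | h0
  · refine ⟨(-1) ^ m i, (Finset.range (m i)).val.map fun l : ℕ => -1 - (l : ℂ), ?_⟩
    rw [zero_smul, sub_zero, hcρ, leadingCoeff_eq_mul hi]
    simp [Finset.prod]
  obtain ⟨r, hr⟩ := Nat.exists_eq_add_of_le hk
  have he := hc.edge hq hm hi h0 hr
  set D := ((Finset.range (k + r + 1)).erase 0).erase k with hD
  set K := ∏ l ∈ D, intBracket logq ((l : ℤ) - k) with hKdef
  have hK0 : algebraMap ℂ L K ≠ 0 := by
    rw [map_ne_zero, Finset.prod_ne_zero_iff]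
    intro l hl
    refine intBracket_ne_zero hq ?_
    have := (Finset.mem_erase.1 hl).1
    omega
  have hP : ∏ l ∈ Finset.range k, F.bracket i (-1 - (l : ℂ)) ≠ 0 :=
    Finset.prod_ne_zero_iff.2 fun l _ => F.bracket_ne_zero hq _ _
  refine ⟨-(-1) ^ m i * (∏ l ∈ D, intBracket logq l) * K⁻¹,
    (Finset.range k).val.map (fun l : ℕ => ((k + r : ℕ) : ℂ) - (l : ℂ)) +
      (Finset.range r).val.map fun l : ℕ => -1 - ((k + l : ℕ) : ℂ), ?_⟩
  have hs : (((Finset.range k).val.map (fun l : ℕ => ((k + r : ℕ) : ℂ) - (l : ℂ)) +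
      (Finset.range r).val.map fun l : ℕ => -1 - ((k + l : ℕ) : ℂ)).map (F.bracket i)).prod =
      (∏ l ∈ Finset.range k, F.bracket i (((k + r : ℕ) : ℂ) - (l : ℂ))) *
        ∏ l ∈ Finset.range r, F.bracket i (-1 - ((k + l : ℕ) : ℂ)) := by
    rw [Multiset.map_add, Multiset.prod_add, Multiset.map_map, Multiset.map_map]
    rfl
  rw [hcρ, leadingCoeff_eq_mul hi] at he
  nth_rewrite 2 [hr] at he
  rw [Finset.prod_range_add] at he
  rw [hs]
  refine mul_right_cancel₀ hP (mul_right_cancel₀ hK0 ?_)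
  simp only [map_mul, map_neg, map_pow, map_one, map_inv₀]
  have hKK : (algebraMap ℂ L K)⁻¹ * algebraMap ℂ L K = 1 := inv_mul_cancel₀ hK0
  set A := algebraMap ℂ L (∏ l ∈ D, intBracket logq l)
  set P1 := ∏ l ∈ Finset.range k, F.bracket i (((k + r : ℕ) : ℂ) - (l : ℂ))
  set P2 := ∏ l ∈ Finset.range k, F.bracket i (-1 - (l : ℂ))
  set P3 := ∏ l ∈ Finset.range r, F.bracket i (-1 - ((k + l : ℕ) : ℂ))
  linear_combination he + (-1) ^ m i * A * P1 * P3 * otherFactors F b m i * P2 * hKK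

end Edge

section Symmetry

variable [Fintype ι] [P.IsCrystallographic] [P.IsReduced] {b : P.Base} {m : ι → ℕ} {F}

theorem zExp_reflection (i : ι) (ν : N) (z : M) :
    zExp P logq ν (P.reflection i z) = zExp P logq (P.coreflection i ν) z := by
  rw [zExp, zExp]
  congr 2
  rw [P.reflection_apply, P.coreflection_apply]
  simp only [map_sub, map_smul, LinearMap.sub_apply, LinearMap.smul_apply, smul_eq_mul]
  rw [mul_comm]
  rfl

variable (F) in
theorem exists_ev_eq_σ (i : ι) (c : N →₀ L) :
    ∃ c' : N →₀ L, F.ev c' = (fun z => F.σ i (F.ev c (P.reflection i z))) ∧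
      ∀ ν, c' ν = F.σ i (c (P.coreflection i ν)) := by
  classical
  refine ⟨(c.mapRange (F.σ i) (map_zero _)).equivMapDomain (P.coreflection i).toEquiv, ?_,
    fun ν => ?_⟩
  · funext z
    rw [ev, Finsupp.equivMapDomain_eq_mapDomain, Finsupp.sum_mapDomain_index (by simp)
      (by simp [smul_add]), Finsupp.sum_mapRange_index (by simp), ev, map_mul, F.σ_X,
      P.reflection_same, Finsupp.sum, Finsupp.sum, map_sum]
    congr 1
    refine Finset.sum_congr rfl fun ν _ => ?_
    rw [map_smul, zExp_reflection]
    rfl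
  · rw [Finsupp.equivMapDomain_apply, Finsupp.mapRange_apply]
    congr 2

theorem QuasiInvariant.σ (hm : ∀ i j, m (P.reflectionPerm i j) = m j) {φ : M → L}
    (h : QuasiInvariant P logq m φ) (i : ι) :
    QuasiInvariant P logq m fun z => F.σ i (φ (P.reflection i z)) := by
  intro j s h1 h2 z hz
  simp only [map_add, map_sub, map_smul]
  rw [← P.root_reflectionPerm, h (P.reflectionPerm i j) s h1 (by rwa [hm])]
  have := zExp_reflection (P := P) (logq := logq) i (P.coroot (P.reflectionPerm i j)) z
  rw [← P.coroot_reflectionPerm, P.reflectionPerm_self] at this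
  exact this.trans hz

/-- Reflecting x and z together preserves the support and quasi-invariance. By uniqueness it
suffices to compare the coefficients at ρᵛ, and this comparison is `edge_end`. -/
theorem IsBakerAkhiezer.σ_apply (hq : ∀ n : ℤ, qPow logq n = 1 → n = 0)
    (hm : ∀ i j, m (P.reflectionPerm i j) = m j) {c : N →₀ L}
    (hc : IsBakerAkhiezer F b m c) (hcρ : c (rhoCheck b m) = F.leadingCoeff b m) {i : ι}
    (hi : i ∈ b.support) (z : M) : F.σ i (F.ev c (P.reflection i z)) = F.ev c z := by
  obtain ⟨c', h1, h2⟩ := exists_ev_eq_σ F i c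
  have hc' : IsBakerAkhiezer F b m c' := by
    refine ⟨fun ν hν => ?_, ?_⟩
    · rw [Finsupp.mem_support_iff, h2] at hν
      have h3 := hc.supp _ (Finsupp.mem_support_iff.2 fun h => hν (by rw [h, map_zero]))
      have e : ν = P.coreflection i (P.coreflection i ν) := (P.coreflection_same i ν).symm
      refine ⟨?_, e ▸ coreflection_mem_polytope hm hi h3.2⟩
      rw [e, P.coreflection_apply]
      obtain ⟨n, hn⟩ := h3.1 i
      refine sub_mem h3.1 ?_
      change P.toLinearMap (P.root i) (P.coreflection i ν) • P.coroot i ∈ _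
      rw [hn, Int.cast_smul_eq_zsmul]
      exact zsmul_mem (coroot_mem_coweightLattice i) n
    · rw [h1]
      exact hc.quasiInvariant.σ hm i
  have : c' = c := by
    refine hc'.eq hq hc ?_
    rw [h2, coreflection_rhoCheck b hm hi, Nat.cast_smul_eq_nsmul, hc.edge_end hq hm hcρ hi,
      F.σ_σ, hcρ]
  rw [← congrFun h1 z, this]

end Symmetry

end BakerAkhiezer

end

/-! ### Reduction of the coefficients at a valuation. -/

noncomputable section

namespace BakerAkhiezer

open Module

variable {ι M N L : Type*} [AddCommGroup M] [Module ℂ M] [NormedAddCommGroup N] [NormedSpace ℂ N]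
  {P : RootPairing ι ℂ M N} {logq : ℂ} [Field L] [Algebra ℂ L] {F : CharacterField P logq L}

open CharacterField IsLocalRing

section Specialization

variable {O : ValuationSubring L}

/-- `γ` is the reduction of the vector `c`, divided by one of its largest components. -/
structure IsReduction (O : ValuationSubring L) (c : N →₀ L) (γ : N →₀ ResidueField O) : Prop where
  ne_zero : γ ≠ 0
  support_subset : γ.support ⊆ c.support
  valuation_le : ∀ ν, γ ν ≠ 0 → ∀ μ, O.valuation (c μ) ≤ O.valuation (c ν)
  sum_eq_zero : ∀ (T : Finset N) (w : N → O), ∑ μ ∈ T, c μ * (w μ : L) = 0 →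
    ∑ μ ∈ T, γ μ * residue O (w μ) = 0

/-- Divide by a component of maximal valuation: all quotients lie in O and one of them is 1, so the
residues are not all zero and every relation with coefficients in O survives. -/
theorem exists_isReduction (O : ValuationSubring L) {c : N →₀ L} (hc : c ≠ 0) :
    ∃ γ, IsReduction O c γ := by
  classical
  obtain ⟨ν₀, h0, hmax⟩ := c.support.exists_max_image (fun ν => O.valuation (c ν))
    (Finsupp.support_nonempty_iff.2 hc)
  have h0' : c ν₀ ≠ 0 := Finsupp.mem_support_iff.1 h0
  have hv0 : O.valuation (c ν₀) ≠ 0 := by simpa using h0'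
  have hle : ∀ ν, O.valuation (c ν) ≤ O.valuation (c ν₀) := by
    intro ν
    by_cases h : ν ∈ c.support
    · exact hmax ν h
    · rw [Finsupp.notMem_support_iff.1 h, map_zero]
      exact zero_le
  have hmem : ∀ ν, c ν / c ν₀ ∈ O := fun ν => by
    rw [← O.valuation_le_one_iff, map_div₀]
    exact div_le_one_of_le₀ (hle ν) zero_le
  let p : N → O := fun ν => ⟨c ν / c ν₀, hmem ν⟩
  have hp : ∀ ν, c ν = 0 → p ν = 0 := fun ν h => Subtype.ext (by simp [p, h])
  let γ : N →₀ ResidueField O := Finsupp.onFinset c.support (fun ν => residue O (p ν)) fun ν h => by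
    rw [Finsupp.mem_support_iff]
    intro h1
    exact h (by rw [hp ν h1, map_zero])
  have hγ : ∀ ν, γ ν = residue O (p ν) := fun ν => rfl
  refine ⟨γ, fun h => ?_, Finsupp.support_onFinset_subset, fun ν hν μ => ?_, fun T w hw => ?_⟩
  · have h1 : p ν₀ = 1 := Subtype.ext (div_self h0')
    have h2 := DFunLike.congr_fun h ν₀
    rw [hγ, h1, map_one, Finsupp.zero_apply] at h2
    exact one_ne_zero h2
  · have h1 := (O.valuation_eq_one_iff (p ν)).1 ((residue_ne_zero_iff_isUnit (p ν)).1 hν)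
    simp only [p, map_div₀] at h1
    rw [div_eq_one_iff_eq hv0] at h1
    rw [h1]
    exact hle μ
  · have h1 : ∑ μ ∈ T, p μ * w μ = 0 := by
      apply Subtype.ext
      have : ((∑ μ ∈ T, p μ * w μ : O) : L) = (∑ μ ∈ T, c μ * (w μ : L)) / c ν₀ := by
        rw [Finset.sum_div]
        push_cast
        refine Finset.sum_congr rfl fun μ _ => ?_
        simp only [p]
        ring
      rw [this, hw, zero_div]
      rfl
    have h2 := congrArg (residue O) h1
    rw [map_sum, map_zero] at h2
    simpa [hγ] using h2

theorem IsReduction.sum_support_filter {c : N →₀ L} {γ : N →₀ ResidueField O}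
    (h : IsReduction O c γ) (p : N → Prop) [DecidablePred p] (w : N → ResidueField O) :
    ∑ μ ∈ γ.support.filter p, γ μ * w μ = ∑ μ ∈ c.support.filter p, γ μ * w μ := by
  refine Finset.sum_subset (Finset.filter_subset_filter _ h.support_subset) fun μ hμ hμ' => ?_
  rw [Finset.mem_filter] at hμ hμ'
  rw [Finsupp.notMem_support_iff.1 fun h1 => hμ' ⟨h1, hμ.2⟩, zero_mul]

/-- The constants in a valuation ring. -/
def constants (hO : ∀ a : ℂ, algebraMap ℂ L a ∈ O) : ℂ →+* O :=
  (algebraMap ℂ L).codRestrict O.toSubring hO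

theorem coe_constants (hO : ∀ a : ℂ, algebraMap ℂ L a ∈ O) (a : ℂ) :
    (constants hO a : L) = algebraMap ℂ L a := rfl

theorem valuation_algebraMap (hO : ∀ a : ℂ, algebraMap ℂ L a ∈ O) {a : ℂ} (ha : a ≠ 0) :
    O.valuation (algebraMap ℂ L a) = 1 := by
  have : IsUnit (constants hO a) := (Ne.isUnit ha).map (constants hO)
  exact (O.valuation_eq_one_iff _).1 this

theorem residue_ne_zero_of_valuation_eq_one {x : O} (h : O.valuation (x : L) = 1) :
    residue O x ≠ 0 :=
  residue_ne_zero_iff_isUnit x |>.2 ((O.valuation_eq_one_iff x).2 h)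

variable [P.IsCrystallographic]

/-- If X(α) is a unit that is not congruent to any q^(2n), the nodes Y + Y⁻¹ of a string stay
distinct and the weights Y - Y⁻¹ stay nonzero in the residue field. -/
theorem IsReduction.stringCondition_of_units (hq : ∀ n : ℤ, qPow logq n = 1 → n = 0)
    (hO : ∀ a : ℂ, algebraMap ℂ L a ∈ O) {m : ι → ℕ} {c : N →₀ L} {γ : N →₀ ResidueField O}
    (h : IsReduction O c γ) (hc : QuasiInvariant P logq m (F.ev c))
    (hs : ∀ ν ∈ c.support, ν ∈ coweightLattice P) {i : ι}
    (hX : O.valuation (F.X ((1 / 2 : ℂ) • P.root i)) = 1)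
    (hgood : ∀ n : ℤ, O.valuation (F.X (P.root i) - algebraMap ℂ L (qPow logq ((2 * n : ℤ) : ℂ))) = 1) :
    StringCondition P (m i) i γ := by
  classical
  have hY : ∀ μ, O.valuation (F.Y i μ) = 1 := fun μ => by
    rw [Y, Algebra.smul_def, map_mul, valuation_algebraMap hO (qPow_ne_zero _ _), hX, one_mul]
  have hY' : ∀ μ, O.valuation (F.Y i μ)⁻¹ = 1 := fun μ => by rw [map_inv₀, hY, inv_one]
  let y : N → O := fun μ => ⟨F.Y i μ, (O.valuation_le_one_iff _).1 (hY μ).le⟩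
  let y' : N → O := fun μ => ⟨(F.Y i μ)⁻¹, (O.valuation_le_one_iff _).1 (hY' μ).le⟩
  let r : N → ResidueField O := fun μ => residue O (y μ)
  have hyy : ∀ μ, residue O (y' μ) = (r μ)⁻¹ := fun μ => by
    refine eq_inv_of_mul_eq_one_right ?_
    rw [← map_mul, ← map_one (residue O)]
    congr 1
    exact Subtype.ext (mul_inv_cancel₀ (F.Y_ne_zero i μ))
  have hr0 : ∀ μ, r μ ≠ 0 := fun μ => residue_ne_zero_of_valuation_eq_one (hY μ)
  let φ : ℂ →+* ResidueField O := (residue O).comp (constants hO)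
  have hsq : ∀ μ ∈ coweightLattice P, ∀ k : ℤ, φ (qPow logq ((2 * k : ℤ) : ℂ)) * r μ ^ 2 ≠ 1 := by
    intro μ hμ k
    obtain ⟨n, hn⟩ := hμ i
    have h1 : O.valuation ((constants hO (qPow logq ((2 * k : ℤ) : ℂ)) * y μ ^ 2 - 1 : O) : L)
        = 1 := by
      have e : ((constants hO (qPow logq ((2 * k : ℤ) : ℂ)) * y μ ^ 2 - 1 : O) : L) =
          algebraMap ℂ L (qPow logq ((2 * (k + n) : ℤ) : ℂ)) *
            (F.X (P.root i) - algebraMap ℂ L (qPow logq ((2 * (-(k + n)) : ℤ) : ℂ))) := by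
        change algebraMap ℂ L _ * F.Y i μ ^ 2 - 1 = _
        rw [F.Y_sq, hn, mul_sub, ← map_mul (algebraMap ℂ L), ← qPow_add, Algebra.smul_def,
          ← mul_assoc, ← map_mul, ← qPow_add]
        congr 1
        · congr 2
          push_cast
          ring_nf
        · rw [← map_one (algebraMap ℂ L), ← qPow_zero logq]
          congr 2
          push_cast
          ring
      rw [e, map_mul, valuation_algebraMap hO (qPow_ne_zero _ _), hgood, one_mul]
    have h2 := residue_ne_zero_of_valuation_eq_one h1
    rw [map_sub, map_one, map_mul, map_pow, sub_ne_zero] at h2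
    exact h2
  have hinj : ∀ a b : ℂ, φ a = φ b → a = b := fun a b hab => φ.injective hab
  have hstep : ∀ μ (k : ℤ), r (μ + k • P.coroot i) = φ (qPow logq ((2 * k : ℤ) : ℂ)) * r μ := by
    intro μ k
    change residue O _ = residue O _ * residue O _
    rw [← map_mul]
    congr 1
    refine Subtype.ext ?_
    change F.Y i _ = algebraMap ℂ L _ * F.Y i μ
    rw [F.Y_add_zsmul, Algebra.smul_def]
  -- The assumption on X(α) concerns integral pairings only. Off the coweight lattice, where c has
  -- no support, harmless nonzero weights and distinct nodes are chosen.
  refine ⟨fun μ => if μ ∈ coweightLattice P then r μ - (r μ)⁻¹ else 1,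
    fun μ => if μ ∈ coweightLattice P then r μ + (r μ)⁻¹ else r μ, fun μ => ?_, ?_, ?_⟩
  · simp only
    split_ifs with hμ
    · intro h0
      refine hsq μ hμ 0 ?_
      rw [sub_eq_zero] at h0
      rw [mul_zero, Int.cast_zero, qPow_zero, map_one, one_mul, sq]
      nth_rewrite 2 [h0]
      exact mul_inv_cancel₀ (hr0 μ)
    · exact one_ne_zero
  · intro μ μ' hμ hu
    obtain ⟨k, hk⟩ := AddSubgroup.mem_zmultiples_iff.1 hμ
    have e : μ = μ' + k • P.coroot i := by rw [hk]; abel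
    have hk0 : φ (qPow logq ((2 * k : ℤ) : ℂ)) = 1 → μ = μ' := by
      intro h1
      have := hq _ (hinj _ 1 (by rw [h1, map_one]))
      have hk0 : k = 0 := by omega
      rw [e, hk0, zero_smul, add_zero]
    have hiff : μ ∈ coweightLattice P ↔ μ' ∈ coweightLattice P := by
      rw [e]
      exact AddSubgroup.add_mem_cancel_right _ (zsmul_mem (coroot_mem_coweightLattice i) k)
    by_cases hμ' : μ' ∈ coweightLattice P
    · simp only [if_pos hμ', if_pos (hiff.2 hμ')] at hu
      have h2 := hsq μ' hμ' k
      rw [e, hstep] at hu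
      have ha0 : φ (qPow logq ((2 * k : ℤ) : ℂ)) ≠ 0 := by
        rw [map_ne_zero]
        exact qPow_ne_zero _ _
      have hr := hr0 μ'
      generalize φ (qPow logq ((2 * k : ℤ) : ℂ)) = a at *
      generalize r μ' = y at *
      have h1 : (a - 1) * (a * y ^ 2 - 1) = 0 := by
        field_simp at hu
        linear_combination hu
      exact hk0 (sub_eq_zero.1 ((mul_eq_zero.1 h1).resolve_right (sub_ne_zero.2 h2)))
    · simp only [if_neg hμ', if_neg (mt hiff.1 hμ')] at hu
      rw [e, hstep] at hu
      exact hk0 (mul_right_cancel₀ (hr0 μ') (by rw [hu, one_mul]))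
  · intro ν
    have h1 : ∀ s, 1 ≤ s → s ≤ m i → ∑ μ ∈ c.support.filter
        (fun μ => μ - ν ∈ AddSubgroup.zmultiples (P.coroot i)),
        γ μ * (r μ ^ s - (r μ)⁻¹ ^ s) = 0 := by
      intro s hs1 hs2
      have := h.sum_eq_zero _ (fun μ => y μ ^ s - y' μ ^ s)
        ((F.quasiInvariant_ev_iff hq m c).1 hc i s hs1 hs2 ν)
      simpa only [map_sub, map_pow, hyy] using this
    intro j hj
    rw [← moments_of_brackets hr0 h1 j hj]
    simp only [mul_assoc]
    rw [h.sum_support_filter]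
    refine Finset.sum_congr rfl fun μ hμ => ?_
    have := hs μ (Finset.mem_filter.1 hμ).1
    simp only [if_pos this]

/-- After the common factor of `Y_pow_sub` is removed, the terms with X(α)ˢ reduce to zero and only
the negative powers remain. -/
theorem IsReduction.string_sums_of_lt (hq : ∀ n : ℤ, qPow logq n = 1 → n = 0)
    (hO : ∀ a : ℂ, algebraMap ℂ L a ∈ O) {m : ι → ℕ} {c : N →₀ L} {γ : N →₀ ResidueField O}
    (h : IsReduction O c γ) (hc : QuasiInvariant P logq m (F.ev c)) {i : ι}
    (hX : O.valuation (F.X (P.root i)) < 1) {s : ℕ} (hs1 : 1 ≤ s) (hs2 : s ≤ m i) (ν : N)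
    [DecidablePred fun μ => μ - ν ∈ AddSubgroup.zmultiples (P.coroot i)] :
    ∑ μ ∈ γ.support.filter (fun μ => μ - ν ∈ AddSubgroup.zmultiples (P.coroot i)),
      γ μ * residue O (constants hO (qPow logq (-P.toLinearMap (P.root i) μ))) ^ s = 0 := by
  let x : O := ⟨F.X (P.root i), (O.valuation_le_one_iff _).1 hX.le⟩
  have hx : residue O x = 0 := by
    rw [residue_eq_zero_iff, O.valuation_lt_one_iff]
    exact hX
  have h1 := h.sum_eq_zero (c.support.filter fun μ => μ - ν ∈ AddSubgroup.zmultiples (P.coroot i))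
    (fun μ => constants hO (qPow logq (P.toLinearMap (P.root i) μ)) ^ s * x ^ s -
      constants hO (qPow logq (-P.toLinearMap (P.root i) μ)) ^ s) (by
      have h2 := (F.quasiInvariant_ev_iff hq m c).1 hc i s hs1 hs2 ν
      simp_rw [Y_pow_sub, mul_left_comm (_ : L) (F.X ((1 / 2 : ℂ) • P.root i) ^ s)⁻¹,
        ← Finset.mul_sum, mul_eq_zero] at h2
      replace h2 := h2.resolve_left (inv_ne_zero (pow_ne_zero _ (F.X_ne_zero _)))
      rw [← h2]
      refine Finset.sum_congr (by congr) fun μ _ => ?_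
      push_cast
      rw [coe_constants, coe_constants, qPow_neg]
      simp only [Algebra.smul_def, map_pow, map_inv₀, inv_pow, mul_one]
      rfl)
  rw [h.sum_support_filter, ← neg_eq_zero, ← h1, ← Finset.sum_neg_distrib]
  refine Finset.sum_congr rfl fun μ _ => ?_
  rw [map_sub, map_mul, map_pow, map_pow, map_pow, hx, zero_pow (by omega)]
  ring

theorem stringCondition_of_sums_eq_zero (hq : ∀ n : ℤ, qPow logq n = 1 → n = 0) {k : Type*}
    [Field k] (φ : ℂ →+* k) {n : ℕ} {i : ι} {γ : N →₀ k}
    (h : ∀ s, 1 ≤ s → s ≤ n → ∀ ν, ∀ [DecidablePred fun μ => μ - ν ∈ AddSubgroup.zmultiples (P.coroot i)],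
      ∑ μ ∈ γ.support.filter (fun μ => μ - ν ∈ AddSubgroup.zmultiples (P.coroot i)),
        γ μ * φ (qPow logq (-P.toLinearMap (P.root i) μ)) ^ s = 0) :
    StringCondition P n i γ := by
  refine ⟨fun μ => φ (qPow logq (-P.toLinearMap (P.root i) μ)),
    fun μ => φ (qPow logq (-P.toLinearMap (P.root i) μ)), fun μ => ?_, fun μ μ' hμ hu => ?_,
    fun ν j hj => ?_⟩
  · rw [map_ne_zero]
    exact qPow_ne_zero _ _
  · obtain ⟨k, hk⟩ := AddSubgroup.mem_zmultiples_iff.1 hμ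
    have e : μ = μ' + k • P.coroot i := by rw [hk]; abel
    have h1 := φ.injective hu
    have h2 : -P.toLinearMap (P.root i) μ = ((-(2 * k) : ℤ) : ℂ) + -P.toLinearMap (P.root i) μ' := by
      rw [e, map_add, map_zsmul, P.root_coroot_two]
      push_cast
      rw [zsmul_eq_mul]
      ring
    rw [h2, qPow_add] at h1
    have := hq _ (mul_right_cancel₀ (qPow_ne_zero logq _) (h1.trans (one_mul _).symm))
    have hk0 : k = 0 := by omega
    rw [e, hk0, zero_smul, add_zero]
  · rw [← h (j + 1) (by omega) (by omega) ν]
    refine Finset.sum_congr rfl fun μ _ => ?_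
    ring

end Specialization

section Regularity

variable [P.IsCrystallographic] {O : ValuationSubring L} [Fintype ι] [P.IsReduced] {b : P.Base}
  {m : ι → ℕ}

theorem smul_mem_of_forall_mem (hO : ∀ a : ℂ, algebraMap ℂ L a ∈ O) {x : L} (hx : x ∈ O) (a : ℂ) :
    a • x ∈ O := by
  rw [Algebra.smul_def]
  exact O.mul_mem _ _ (hO a) hx

theorem ev_mem_of_forall_mem (hO : ∀ a : ℂ, algebraMap ℂ L a ∈ O) {c : N →₀ L} {z : M}
    (h : ∀ ν, F.X z * c ν ∈ O) : F.ev c z ∈ O := by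
  rw [ev, Finsupp.sum, Finset.mul_sum]
  refine sum_mem fun ν _ => ?_
  rw [mul_smul_comm]
  exact smul_mem_of_forall_mem hO (h ν) _

/-- Reductions attain their maximal height on the edge in the direction of a simple root. -/
theorem IsReduction.exists_mem_edge {c : N →₀ L} {γ : N →₀ ResidueField O} (h : IsReduction O c γ)
    (hc : ∀ ν ∈ c.support, ν ∈ polytope b m) {g : N →ₗ[ℝ] ℝ}
    (hg : ∀ j ∈ posRoots b, 0 ≤ g (P.coroot j))
    (hstr : ∀ j ∈ posRoots b, 0 < g (P.coroot j) → StringCondition P (m j) j γ) :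
    ∃ p ∈ c.support, g (rhoCheck b m) ≤ g p ∧ γ p ≠ 0 ∧
      ∀ μ, O.valuation (c μ) ≤ O.valuation (c p) := by
  obtain ⟨p₀, h0, p, hp, hle⟩ := exists_width_le b m g hg h.ne_zero hstr
  have h1 := neg_map_le_of_mem_polytope hg (hc _ (h.support_subset h0))
  have hp' := Finsupp.mem_support_iff.1 hp
  exact ⟨p, h.support_subset hp, by linarith, hp', h.valuation_le p hp'⟩

/-- The string conditions survive for all positive roots except possibly the simple root α_i. The
width in the direction `edgeHeight`, which ignores that root, places a coefficient of maximal
valuation on an edge at ρᵛ. Edge coefficients are products of brackets, which lie in O, so all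
coefficients do. -/
theorem IsBakerAkhiezer.ev_rho_mem_of_units [P.IsIrreducible] [Nonempty ι]
    (hq : ∀ n : ℤ, qPow logq n = 1 → n = 0) (hm : ∀ i j, m (P.reflectionPerm i j) = m j)
    {c : N →₀ L} (hc : IsBakerAkhiezer F b m c) (hcρ : c (rhoCheck b m) = F.leadingCoeff b m)
    (hO : ∀ a : ℂ, algebraMap ℂ L a ∈ O) {i : ι} (hi : i ∈ b.support)
    (hX : ∀ j, O.valuation (F.X ((1 / 2 : ℂ) • P.root j)) = 1)
    (hgood : ∀ j ∈ posRoots b, j ≠ i → ∀ n : ℤ,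
      O.valuation (F.X (P.root j) - algebraMap ℂ L (qPow logq ((2 * n : ℤ) : ℂ))) = 1) :
    F.ev c (rho b fun i => (m i : ℂ)) ∈ O := by
  classical
  have hne : c ≠ 0 := by
    rintro rfl
    exact F.leadingCoeff_ne_zero b m hq hcρ.symm
  obtain ⟨γ, hγ⟩ := exists_isReduction O hne
  obtain ⟨p, hp, hgp, -, hmax⟩ := hγ.exists_mem_edge (g := edgeHeight b i)
    (fun ν hν => (hc.supp ν hν).2) (fun j hj => edgeHeight_nonneg hi hj) fun j hj hpos =>
      hγ.stringCondition_of_units hq hO hc.quasiInvariant (fun ν hν => (hc.supp ν hν).1) (hX j)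
        (hgood j hj fun h => by rw [h, edgeHeight_self] at hpos; exact lt_irrefl _ hpos)
  obtain ⟨k, hk, rfl⟩ := eq_sub_nsmul_of_mem_polytope hi (hc.supp p hp).2 hgp
    (hc.sub_rhoCheck_mem hq hm hp)
  have hXmem : ∀ j, F.X ((1 / 2 : ℂ) • P.root j) ∈ O := fun j =>
    (O.valuation_le_one_iff _).1 (hX j).le
  have hbr : ∀ j a, F.bracket j a ∈ O := by
    intro j a
    refine sub_mem (smul_mem_of_forall_mem hO (hXmem j) _) (smul_mem_of_forall_mem hO ?_ _)
    rw [F.X_neg, ← O.valuation_le_one_iff, map_inv₀, hX, inv_one]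
  have hcp : c (rhoCheck b m - k • P.coroot i) ∈ O := by
    obtain ⟨a, s, hs⟩ := hc.exists_edge_eq hq hm hcρ hi hk
    rw [hs]
    refine mul_mem (mul_mem (hO a) (multiset_prod_mem _ fun x hx => ?_))
      (prod_mem fun j _ => prod_mem fun s _ => hbr _ _)
    obtain ⟨t, -, rfl⟩ := Multiset.mem_map.1 hx
    exact hbr _ _
  refine ev_mem_of_forall_mem hO fun ν => mul_mem ?_ ?_
  · rw [X_rho]
    exact prod_mem fun j _ => pow_mem (hXmem j) _
  · rw [← O.valuation_le_one_iff] at hcp ⊢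
    exact (hmax ν).trans hcp

/-- Here all positive roots keep their string conditions, and the width in the direction of the
height forces the vertex ρᵛ itself. -/
theorem IsReduction.exists_mem_of_lt (hq : ∀ n : ℤ, qPow logq n = 1 → n = 0)
    {c : N →₀ L} (hc : IsBakerAkhiezer F b m c) {γ : N →₀ ResidueField O} (h : IsReduction O c γ)
    (hO : ∀ a : ℂ, algebraMap ℂ L a ∈ O)
    (hX : ∀ j ∈ posRoots b, O.valuation (F.X (P.root j)) < 1) :
    γ (rhoCheck b m) ≠ 0 ∧ ∀ μ, O.valuation (c μ) ≤ O.valuation (c (rhoCheck b m)) := by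
  obtain ⟨p, hp, hgp, hp0, hmax⟩ := h.exists_mem_edge (g := height b)
    (fun ν hν => (hc.supp ν hν).2) (fun j hj => (height_coroot_pos b hj).le) fun j hj _ =>
      stringCondition_of_sums_eq_zero hq ((residue O).comp (constants hO))
        fun s h1 h2 ν _ => h.string_sums_of_lt hq hO hc.quasiInvariant (hX j hj) h1 h2 ν
  rw [eq_rhoCheck_of_mem_polytope (hc.supp p hp).2 hgp] at hp0 hmax
  exact ⟨hp0, hmax⟩

theorem IsBakerAkhiezer.ev_rho_mem_of_lt (hq : ∀ n : ℤ, qPow logq n = 1 → n = 0)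
    {c : N →₀ L} (hc : IsBakerAkhiezer F b m c) (hcρ : c (rhoCheck b m) = F.leadingCoeff b m)
    (hO : ∀ a : ℂ, algebraMap ℂ L a ∈ O)
    (hX : ∀ j ∈ posRoots b, O.valuation (F.X (P.root j)) < 1) :
    F.ev c (rho b fun i => (m i : ℂ)) ∈ O := by
  have hne : c ≠ 0 := by
    rintro rfl
    exact F.leadingCoeff_ne_zero b m hq hcρ.symm
  obtain ⟨γ, hγ⟩ := exists_isReduction O hne
  have hmax := (hγ.exists_mem_of_lt hq hc hO hX).2
  -- The factor X(ρ) clears the negative powers: the brackets become q^j - q^(-j) X(α).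
  have hmem : F.X (rho b fun i => (m i : ℂ)) * F.leadingCoeff b m ∈ O := by
    rw [leadingCoeff_eq, X_rho, ← mul_assoc, ← Finset.prod_mul_distrib, ← Finset.prod_mul_distrib]
    refine prod_mem fun j hj => ?_
    rw [← mul_pow, ← sq, F.X_half_root_sq]
    nth_rewrite 1 [← Nat.add_sub_cancel (m j) 1]
    rw [← Nat.card_Icc, ← Finset.prod_const, ← Finset.prod_mul_distrib]
    refine prod_mem fun s _ => ?_
    rw [mul_sub, mul_smul_comm, mul_smul_comm, F.X_neg, mul_inv_cancel₀ (F.X_ne_zero _), mul_one]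
    exact sub_mem (smul_mem_of_forall_mem hO (one_mem _) _)
      (smul_mem_of_forall_mem hO ((O.valuation_le_one_iff _).1 (hX j hj).le) _)
  refine ev_mem_of_forall_mem hO fun ν => ?_
  rw [← O.valuation_le_one_iff, ← hcρ, map_mul] at hmem
  rw [← O.valuation_le_one_iff, map_mul]
  exact (mul_le_mul_right (hmax ν) _).trans hmem

end Regularity

end BakerAkhiezer

end

/-! ### The limit at infinity and the transport of valuations by reflections. -/

noncomputable section

namespace BakerAkhiezer

open Module

variable {ι M N L : Type*} [AddCommGroup M] [Module ℂ M] [NormedAddCommGroup N] [NormedSpace ℂ N]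
  {P : RootPairing ι ℂ M N} {logq : ℂ} [Field L] [Algebra ℂ L] {F : CharacterField P logq L}

open CharacterField IsLocalRing

section Limit

variable [P.IsCrystallographic] {O : ValuationSubring L} [Fintype ι] [P.IsReduced] {b : P.Base}
  {m : ι → ℕ}

theorem sum_support_filter_eq {k : Type*} [Field k] {γ : N →₀ k} {S : Finset N}
    (hS : γ.support ⊆ S) (p : N → Prop) [DecidablePred p] (w : N → k) :
    ∑ μ ∈ γ.support.filter p, γ μ * w μ = ∑ μ ∈ S.filter p, γ μ * w μ := by
  refine Finset.sum_subset (Finset.filter_subset_filter _ hS) fun μ hμ hμ' => ?_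
  rw [Finset.mem_filter] at hμ hμ'
  rw [Finsupp.notMem_support_iff.1 fun h1 => hμ' ⟨h1, hμ.2⟩, zero_mul]

theorem exists_nat_toLinearMap_rho_coroot (hm : ∀ i j, m (P.reflectionPerm i j) = m j) {i : ι}
    (hi : i ∈ posRoots b) :
    ∃ n : ℕ, P.toLinearMap (rho b fun i => (m i : ℂ)) (P.coroot i) = n := by
  have h := coroot_mem_closure b hi
  generalize P.coroot i = y at h
  induction h using AddSubmonoid.closure_induction with
  | mem x hx =>
    obtain ⟨j, hj, rfl⟩ := hx
    exact ⟨m j, by rw [rho_coroot b (fun i j => by rw [hm]) hj]⟩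
  | zero => exact ⟨0, by simp⟩
  | add x y _ _ hx hy =>
    obtain ⟨n, hn⟩ := hx
    obtain ⟨n', hn'⟩ := hy
    exact ⟨n + n', by simp [hn, hn']⟩

variable (b m) in
/-- The limit of the Baker–Akhiezer function at infinity. -/
theorem exists_limit (hq : ∀ n : ℤ, qPow logq n = 1 → n = 0)
    (hm : ∀ i j, m (P.reflectionPerm i j) = m j) :
    ∃ γ : N →₀ ℂ, (∀ ν ∈ γ.support, ν ∈ polytope b m) ∧
      (∀ i ∈ posRoots b, ∀ s, 1 ≤ s → s ≤ m i → ∀ ν,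
        ∀ [DecidablePred fun μ => μ - ν ∈ AddSubgroup.zmultiples (P.coroot i)],
        ∑ μ ∈ γ.support.filter (fun μ => μ - ν ∈ AddSubgroup.zmultiples (P.coroot i)),
          γ μ * qPow logq (-P.toLinearMap (P.root i) μ) ^ s = 0) ∧
      ∑ μ ∈ γ.support, γ μ * zExp P logq μ (rho b fun i => (m i : ℂ)) ≠ 0 := by
  classical
  let T : Finset (Σ _ : ι, ℕ) := (posRoots b).sigma fun i => Finset.Icc 1 (m i)
  let a : (Σ _ : ι, ℕ) → ℂ := fun t => qPow logq ((-(2 * t.2) : ℤ) : ℂ)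
  -- The product of q^(2(αᵛ,z)) - q^(-2s) over the positive roots and s ≤ m_α, centred by -ρᵛ. It
  -- vanishes at w - sα/2 on each hypersurface, which gives the string sums, and γ collects its
  -- expansion over subsets of the factors.
  let f : M → ℂ := fun z => zExp P logq (-rhoCheck b m) z *
    ∏ t ∈ T, (zExp P logq (P.coroot t.1) z - a t)
  let γ : N →₀ ℂ := ∑ U ∈ T.powerset,
    Finsupp.single (-rhoCheck b m + ∑ t ∈ U, P.coroot t.1) (∏ t ∈ T \ U, -a t)
  have hf : ∀ z, ∑ μ ∈ γ.support, γ μ * zExp P logq μ z = f z := by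
    intro z
    have hprod : ∀ U : Finset (Σ _ : ι, ℕ), ∏ t ∈ U, zExp P logq (P.coroot t.1) z =
        zExp P logq (∑ t ∈ U, P.coroot t.1) z := by
      intro U
      induction U using Finset.induction_on with
      | empty => simp [zExp_zero]
      | insert t U ht ih =>
        rw [Finset.prod_insert ht, Finset.sum_insert ht, ih, zExp_add_apply]
    have h1 : γ.sum (fun μ x => x * zExp P logq μ z) = f z := by
      rw [← Finsupp.sum_finsetSum_index (by simp) (by simp [add_mul])]
      simp only [f, sub_eq_add_neg, Finset.prod_add, Finset.mul_sum]
      refine Finset.sum_congr rfl fun U _ => ?_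
      rw [Finsupp.sum_single_index (by simp), zExp_add_apply, hprod]
      ring
    exact h1
  refine ⟨γ, fun ν hν => ?_, ?_, ?_⟩
  · obtain ⟨U, hU, hν'⟩ : ∃ U ∈ T.powerset, ν ∈ (Finsupp.single
        (-rhoCheck b m + ∑ t ∈ U, P.coroot t.1) (∏ t ∈ T \ U, -a t)).support := by
      have := Finsupp.support_finsetSum hν
      simpa using this
    have hνe := Finset.mem_singleton.1 (Finsupp.support_single_subset hν')
    rw [Finset.mem_powerset] at hU
    have hUT : U = (posRoots b).sigma fun i => (Finset.Icc 1 (m i)).filter fun s => ⟨i, s⟩ ∈ U := by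
      ext ⟨i, s⟩
      simp only [Finset.mem_sigma, Finset.mem_filter]
      refine ⟨fun h => ?_, fun h => h.2.2⟩
      have := Finset.mem_sigma.1 (hU h)
      exact ⟨this.1, this.2, h⟩
    -- The parameter l_α counts the factors of α that are not in U.
    refine ⟨fun i => m i - ((Finset.Icc 1 (m i)).filter fun s => ⟨i, s⟩ ∈ U).card, fun i => ?_, ?_⟩
    · have h1 := Finset.card_filter_le (Finset.Icc 1 (m i)) fun s => (⟨i, s⟩ : Σ _ : ι, ℕ) ∈ U
      rw [Nat.card_Icc, Nat.add_sub_cancel] at h1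
      have h2 : (((Finset.Icc 1 (m i)).filter fun s => (⟨i, s⟩ : Σ _ : ι, ℕ) ∈ U).card : ℝ) ≤ m i := by
        exact_mod_cast h1
      exact ⟨by linarith, by simp⟩
    · rw [hνe]
      nth_rewrite 1 [hUT]
      rw [Finset.sum_sigma]
      simp only [Finset.sum_const]
      push_cast
      simp only [sub_smul, Finset.sum_sub_distrib, Nat.cast_smul_eq_nsmul]
      have : ∑ i ∈ posRoots b, m i • P.coroot i = (2 : ℂ) • rhoCheck b m := by
        rw [rhoCheck, smul_smul]
        norm_num [Nat.cast_smul_eq_nsmul]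
      rw [this]
      module
  · intro i hi s h1 h2 ν _
    have h3 := (string_sums_iff (P := P) (L := ℂ) hq i γ.support
      fun μ => γ μ * qPow logq (-P.toLinearMap (P.root i) μ) ^ s).1 (fun w hw => ?_) ν
    · rw [← h3]
      exact Finset.sum_congr (by congr) fun _ _ => rfl
    · have h4 : f (w - ((s : ℂ) / 2) • P.root i) = 0 := by
        refine mul_eq_zero_of_right _ (Finset.prod_eq_zero (i := ⟨i, s⟩)
          (Finset.mem_sigma.2 ⟨hi, Finset.mem_Icc.2 ⟨h1, h2⟩⟩) ?_)
        simp only [a]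
        rw [zExp_apply_sub, hw, zExp_half_smul_root, P.root_coroot_two, one_mul,
          ← qPow_natCast_mul, ← qPow_neg, sub_eq_zero]
        congr 1
        push_cast
        ring
      rw [← hf] at h4
      rw [← h4]
      refine Finset.sum_congr rfl fun μ _ => ?_
      rw [zExp_apply_sub, zExp_half_smul_root, qPow_neg, smul_eq_mul, inv_pow]
      ring
  · rw [hf]
    refine mul_ne_zero (zExp_ne_zero _ _ _ _) (Finset.prod_ne_zero_iff.2 fun t ht => ?_)
    obtain ⟨ht1, ht2⟩ := Finset.mem_sigma.1 ht
    obtain ⟨n, hn⟩ := exists_nat_toLinearMap_rho_coroot hm ht1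
    rw [zExp, hn, sub_ne_zero]
    intro h
    -- A zero at z = ρ would give q^(2n+2s) = 1 with n = (ρ, αᵛ) ≥ 0 and s ≥ 1.
    have h5 : qPow logq ((2 * n + 2 * t.2 : ℤ) : ℂ) = 1 := by
      rw [Int.cast_add, qPow_add]
      have e : ((2 * n : ℤ) : ℂ) = 2 * (n : ℂ) := by push_cast; ring
      rw [e, h, ← qPow_add, ← qPow_zero logq]
      congr 1
      push_cast
      ring
    have h6 := hq _ h5
    have := (Finset.mem_Icc.1 ht2).1
    omega

/-- The reduced coefficients satisfy the same string sums as the explicit limit of `exists_limit`.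
By the width estimate the two are proportional, and the limit does not vanish at z = ρ. -/
theorem IsBakerAkhiezer.ev_rho_ne_zero (hq : ∀ n : ℤ, qPow logq n = 1 → n = 0)
    (hm : ∀ i j, m (P.reflectionPerm i j) = m j)
    {c : N →₀ L} (hc : IsBakerAkhiezer F b m c) (hcne : c ≠ 0)
    (hO : ∀ a : ℂ, algebraMap ℂ L a ∈ O)
    (hX : ∀ j ∈ posRoots b, O.valuation (F.X (P.root j)) < 1) :
    F.ev c (rho b fun i => (m i : ℂ)) ≠ 0 := by
  classical
  intro h0
  obtain ⟨γ, hγ⟩ := exists_isReduction O hcne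
  have hγρ := (hγ.exists_mem_of_lt hq hc hO hX).1
  obtain ⟨g, hg1, hg2, hg3⟩ := exists_limit b m hq hm
  let φ : ℂ →+* ResidueField O := (residue O).comp (constants hO)
  let g' : N →₀ ResidueField O := g.mapRange φ (map_zero φ)
  have hg' : g'.support ⊆ g.support := Finsupp.support_mapRange
  have hsum : ∑ μ ∈ c.support, γ μ * φ (zExp P logq μ (rho b fun i => (m i : ℂ))) = 0 := by
    refine hγ.sum_eq_zero c.support
      (fun μ => constants hO (zExp P logq μ (rho b fun i => (m i : ℂ)))) ?_
    rw [ev, mul_eq_zero, or_iff_right (F.X_ne_zero _)] at h0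
    rw [← h0]
    refine Finset.sum_congr rfl fun μ _ => ?_
    simp only
    rw [coe_constants, Algebra.smul_def, mul_comm]
  -- The combination whose coefficient at ρᵛ cancels; it is too narrow to be nonzero.
  set d := g' (rhoCheck b m) • γ - γ (rhoCheck b m) • g' with hd
  set S := c.support ∪ g.support with hS
  have hγS : γ.support ⊆ S := hγ.support_subset.trans Finset.subset_union_left
  have hgS : g'.support ⊆ S := hg'.trans Finset.subset_union_right
  have hdS : d.support ⊆ S := by
    refine Finsupp.support_sub.trans (Finset.union_subset ?_ ?_)
    · exact Finsupp.support_smul.trans hγS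
    · exact Finsupp.support_smul.trans hgS
  have hdstr : ∀ i ∈ posRoots b, StringCondition P (m i) i d := by
    intro i hi
    refine stringCondition_of_sums_eq_zero hq φ fun s h1 h2 ν _ => ?_
    have e1 := hγ.string_sums_of_lt hq hO hc.quasiInvariant (hX i hi) h1 h2 ν
    have e2 : ∑ μ ∈ g'.support.filter (fun μ => μ - ν ∈ AddSubgroup.zmultiples (P.coroot i)),
        g' μ * φ (qPow logq (-P.toLinearMap (P.root i) μ)) ^ s = 0 := by
      rw [sum_support_filter_eq hg', ← map_zero φ, ← hg2 i hi s h1 h2 ν, map_sum]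
      refine Finset.sum_congr rfl fun μ _ => ?_
      rw [map_mul, map_pow]
      rfl
    rw [sum_support_filter_eq hdS]
    rw [sum_support_filter_eq hγS] at e1
    rw [sum_support_filter_eq hgS] at e2
    calc _ = g' (rhoCheck b m) * ∑ μ ∈ S.filter
          (fun μ => μ - ν ∈ AddSubgroup.zmultiples (P.coroot i)),
            γ μ * φ (qPow logq (-P.toLinearMap (P.root i) μ)) ^ s -
          γ (rhoCheck b m) * ∑ μ ∈ S.filter
          (fun μ => μ - ν ∈ AddSubgroup.zmultiples (P.coroot i)),
            g' μ * φ (qPow logq (-P.toLinearMap (P.root i) μ)) ^ s := by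
          rw [Finset.mul_sum, Finset.mul_sum, ← Finset.sum_sub_distrib]
          refine Finset.sum_congr rfl fun μ _ => ?_
          rw [hd, Finsupp.sub_apply, Finsupp.smul_apply, Finsupp.smul_apply, smul_eq_mul,
            smul_eq_mul]
          ring
      _ = 0 := by
          rw [e2, mul_zero, sub_zero]
          exact mul_eq_zero_of_right _ e1
  have hd0 : d = 0 := by
    by_contra hne
    obtain ⟨p₀, h0, p, hp, hle⟩ := exists_width_le b m (height b)
      (fun i hi => (height_coroot_pos b hi).le) hne fun i hi _ => hdstr i hi
    have hpoly : ∀ ν ∈ d.support, ν ∈ polytope b m := fun ν hν => by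
      rcases Finset.mem_union.1 (hdS hν) with h | h
      · exact (hc.supp ν h).2
      · exact hg1 ν h
    have h1 := neg_height_le_of_mem_polytope (hpoly _ h0)
    have h2 := eq_rhoCheck_of_mem_polytope (hpoly _ hp) (by linarith)
    refine Finsupp.mem_support_iff.1 (h2 ▸ hp) ?_
    rw [hd, Finsupp.sub_apply, Finsupp.smul_apply, Finsupp.smul_apply, smul_eq_mul, smul_eq_mul]
    ring
  have hfin : γ (rhoCheck b m) *
      φ (∑ μ ∈ g.support, g μ * zExp P logq μ (rho b fun i => (m i : ℂ))) = 0 := by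
    have h1 : ∑ μ ∈ S, γ μ * φ (zExp P logq μ (rho b fun i => (m i : ℂ))) = 0 := by
      rw [← hsum]
      symm
      refine Finset.sum_subset Finset.subset_union_left fun μ _ hμ => ?_
      rw [Finsupp.notMem_support_iff.1 fun h => hμ (hγ.support_subset h), zero_mul]
    have h2 : φ (∑ μ ∈ g.support, g μ * zExp P logq μ (rho b fun i => (m i : ℂ))) =
        ∑ μ ∈ S, g' μ * φ (zExp P logq μ (rho b fun i => (m i : ℂ))) := by
      rw [map_sum]
      simp only [map_mul]
      refine Finset.sum_subset Finset.subset_union_right fun μ _ hμ => ?_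
      rw [Finsupp.notMem_support_iff.1 hμ, map_zero, zero_mul]
    have h3 : ∀ μ, γ (rhoCheck b m) * g' μ = g' (rhoCheck b m) * γ μ := fun μ => by
      have := DFunLike.congr_fun hd0 μ
      rw [hd, Finsupp.sub_apply, Finsupp.smul_apply, Finsupp.smul_apply, smul_eq_mul,
        smul_eq_mul, Finsupp.zero_apply, sub_eq_zero] at this
      exact this.symm
    rw [h2, Finset.mul_sum]
    simp_rw [← mul_assoc, h3, mul_assoc]
    rw [← Finset.mul_sum, h1, mul_zero]
  exact hg3 (φ.injective ((mul_eq_zero.1 hfin).resolve_left hγρ |>.trans (map_zero φ).symm))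

end Limit

section Twist

variable {O : ValuationSubring L}

theorem valuation_eq_one_iff_mem {x : L} : O.valuation x = 1 ↔ x ≠ 0 ∧ x ∈ O ∧ x⁻¹ ∈ O := by
  rw [← O.valuation_le_one_iff, ← O.valuation_le_one_iff, map_inv₀]
  constructor
  · intro h
    refine ⟨fun h0 => ?_, h.le, by rw [h, inv_one]⟩
    rw [h0, map_zero] at h
    exact zero_ne_one h
  · rintro ⟨h0, h1, h2⟩
    have hv : O.valuation x ≠ 0 := by simpa using h0
    exact le_antisymm h1 ((inv_le_one₀ (zero_lt_iff.2 hv)).1 h2)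

theorem valuation_comap_eq_one_iff (f : L →+* L) (x : L) :
    (O.comap f).valuation x = 1 ↔ O.valuation (f x) = 1 := by
  rw [valuation_eq_one_iff_mem, valuation_eq_one_iff_mem, ValuationSubring.mem_comap,
    ValuationSubring.mem_comap, map_inv₀, map_ne_zero]

theorem one_lt_valuation_comap_iff (f : L →+* L) (x : L) :
    1 < (O.comap f).valuation x ↔ 1 < O.valuation (f x) := by
  rw [← not_le, ← not_le, ValuationSubring.valuation_le_one_iff,
    ValuationSubring.valuation_le_one_iff, ValuationSubring.mem_comap]

variable [P.IsCrystallographic] [Fintype ι] [P.IsReduced] {b : P.Base} {m : ι → ℕ}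

/-- The points ρ and s_iρ = ρ - m_iα_i are symmetric about a point orthogonal to the simple coroot,
so quasi-invariance gives ψ(x, s_iρ) = ψ(x, ρ). This is combined with the Weyl symmetry of ψ. -/
theorem IsBakerAkhiezer.σ_ev_rho (hq : ∀ n : ℤ, qPow logq n = 1 → n = 0)
    (hm : ∀ i j, m (P.reflectionPerm i j) = m j) {c : N →₀ L}
    (hc : IsBakerAkhiezer F b m c) (hcρ : c (rhoCheck b m) = F.leadingCoeff b m) {i : ι}
    (hi : i ∈ b.support) : F.σ i (F.ev c (rho b fun i => (m i : ℂ))) =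
      F.ev c (rho b fun i => (m i : ℂ)) := by
  have hk : ∀ i j, (m (P.reflectionPerm i j) : ℂ) = m j := fun i j => by rw [hm]
  refine Eq.trans ?_ (hc.σ_apply hq hm hcρ hi (rho b fun i => (m i : ℂ)))
  congr 1
  have h := hc.quasiInvariant.apply_int (i := i) (t := m i)
    (w := rho b (fun i => (m i : ℂ)) - ((m i : ℂ) / 2) • P.root i) (by
      rw [zExp, map_sub, LinearMap.sub_apply, rho_coroot b hk hi, map_smul, LinearMap.smul_apply,
        P.root_coroot_two, ← qPow_zero logq]
      congr 1
      rw [smul_eq_mul]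
      ring) (by simp)
  rw [reflection_rho b hk hi]
  convert h using 2
  · push_cast
    module
  · push_cast
    module

/-- Reflections carry the exceptional root to a simple one. They fix the value at ρ, so the
valuation ring may be replaced by its pullback. -/
theorem IsBakerAkhiezer.ev_rho_mem_of_units' [P.IsIrreducible] [Nonempty ι]
    (hq : ∀ n : ℤ, qPow logq n = 1 → n = 0) (hm : ∀ i j, m (P.reflectionPerm i j) = m j)
    {c : N →₀ L} (hc : IsBakerAkhiezer F b m c) (hcρ : c (rhoCheck b m) = F.leadingCoeff b m)
    (O : ValuationSubring L) (hO : ∀ a : ℂ, algebraMap ℂ L a ∈ O)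
    (hX : ∀ j, O.valuation (F.X ((1 / 2 : ℂ) • P.root j)) = 1) (i : ι)
    (hgood : ∀ j, P.root j ≠ P.root i → P.root j ≠ -P.root i → ∀ n : ℤ,
      O.valuation (F.X (P.root j) - algebraMap ℂ L (qPow logq ((2 * n : ℤ) : ℂ))) = 1) :
    F.ev c (rho b fun i => (m i : ℂ)) ∈ O := by
  induction i using b.induction_reflect generalizing O with
  | h₀ i ih =>
    refine ih O hO hX fun j h1 h2 => hgood j ?_ ?_
    · rwa [root_reflectionPerm_self]
    · rwa [root_reflectionPerm_self, neg_neg]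
  | h₁ i hi =>
    exact hc.ev_rho_mem_of_units hq hm hcρ hO hi hX fun j hj hij => hgood j
      (P.root.injective.ne hij) (root_ne_neg_of_mem_posRoots b hj (mem_posRoots_of_mem_support b hi))
  | h₂ i k ih hk =>
    have h1 := ih (O.comap (F.σ k : L →+* L)) (fun a => ?_) (fun j => ?_) fun j h1 h2 n => ?_
    · rw [ValuationSubring.mem_comap] at h1
      rw [← hc.σ_ev_rho hq hm hcρ hk]
      exact h1
    · rw [ValuationSubring.mem_comap]
      have := hO a
      rwa [← (F.σ k).commutes a] at this
    · rw [valuation_comap_eq_one_iff]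
      have := hX (P.reflectionPerm k j)
      rwa [P.root_reflectionPerm, ← map_smul, ← F.σ_X] at this
    · rw [valuation_comap_eq_one_iff, map_sub]
      have := hgood (P.reflectionPerm k j) (fun h => h1 ?_) (fun h => h2 ?_) n
      · rw [P.root_reflectionPerm, ← F.σ_X] at this
        rw [← this]
        congr 2
        exact (F.σ k).commutes _
      · rw [P.root_reflectionPerm, P.root_reflectionPerm] at h
        exact (P.reflection k).injective h
      · rw [P.root_reflectionPerm, P.root_reflectionPerm, ← map_neg] at h
        exact (P.reflection k).injective h

/-- Induction on the number of positive roots with X(α) outside O: reflecting in a simple root of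
this kind lowers the number by one, until all positive roots have valuation below 1. -/
theorem IsBakerAkhiezer.ev_rho_mem_of_ne
    (hq : ∀ n : ℤ, qPow logq n = 1 → n = 0) (hm : ∀ i j, m (P.reflectionPerm i j) = m j)
    {c : N →₀ L} (hc : IsBakerAkhiezer F b m c) (hcρ : c (rhoCheck b m) = F.leadingCoeff b m)
    (O : ValuationSubring L) (hO : ∀ a : ℂ, algebraMap ℂ L a ∈ O)
    (hX : ∀ j, O.valuation (F.X (P.root j)) ≠ 1) :
    F.ev c (rho b fun i => (m i : ℂ)) ∈ O := by
  classical
  obtain ⟨n, hn⟩ : ∃ n, ∑ j ∈ posRoots b, (if 1 < O.valuation (F.X (P.root j)) then 1 else 0) = n :=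
    ⟨_, rfl⟩
  induction n using Nat.strong_induction_on generalizing O with
  | _ n ih =>
    by_cases h : ∀ i ∈ b.support, O.valuation (F.X (P.root i)) ≤ 1
    · refine hc.ev_rho_mem_of_lt hq hcρ hO fun j hj => lt_of_le_of_ne ?_ (hX j)
      refine ((mem_posRoots b).1 hj).induction_on_add h fun i j k hk h1 h2 => ?_
      rw [hk, F.X_add, map_mul]
      exact mul_le_one' h1 (h j h2)
    · push Not at h
      obtain ⟨i, hi, hlt⟩ := h
      have hip := mem_posRoots_of_mem_support b hi
      have hval : ∀ j, 1 < (O.comap (F.σ i : L →+* L)).valuation (F.X (P.root j)) ↔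
          1 < O.valuation (F.X (P.root (P.reflectionPerm i j))) := fun j => by
        rw [one_lt_valuation_comap_iff, P.root_reflectionPerm, ← F.σ_X]
        rfl
      have h1 := ih _ ?_ (O.comap (F.σ i : L →+* L)) (fun a => ?_) (fun j => ?_) rfl
      · rw [ValuationSubring.mem_comap] at h1
        rw [← hc.σ_ev_rho hq hm hcρ hi]
        exact h1
      · rw [← hn]
        simp_rw [hval]
        rw [← Finset.add_sum_erase _ _ hip, ← Finset.add_sum_erase _ _ hip,
          sum_posRoots_erase_reflectionPerm b hi
            fun j => if 1 < O.valuation (F.X (P.root j)) then 1 else 0, if_pos hlt, if_neg]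
        · omega
        · rw [root_reflectionPerm_self, F.X_neg, map_inv₀, not_lt]
          exact inv_le_one_of_one_le₀ hlt.le
      · rw [ValuationSubring.mem_comap]
        have := hO a
        rwa [← (F.σ i).commutes a] at this
      · rw [Ne, valuation_comap_eq_one_iff]
        have := hX (P.reflectionPerm i j)
        rwa [P.root_reflectionPerm, ← F.σ_X] at this

end Twist

end BakerAkhiezer

end

/-! ### Invariance of ψ(x, ρ) under translations. -/

noncomputable section

namespace BakerAkhiezer

open Module

variable {ι M N L : Type*} [AddCommGroup M] [Module ℂ M] [NormedAddCommGroup N] [NormedSpace ℂ N]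
  {P : RootPairing ι ℂ M N} {logq : ℂ} [Field L] [Algebra ℂ L] {F : CharacterField P logq L}

open CharacterField IsLocalRing

section ShiftInvariance

variable (F) in
/-- The elements that are invariant under the translations by all multiples of `ξ`. -/
def shiftInvariants (ξ : N) : Subring L where
  carrier := {f | ∀ t : ℂ, F.T (t • ξ) f = f}
  mul_mem' hf hg t := by rw [map_mul, hf t, hg t]
  add_mem' hf hg t := by rw [map_add, hf t, hg t]
  one_mem' t := map_one _
  zero_mem' t := map_zero _
  neg_mem' hf t := by rw [map_neg, hf t]

theorem algebraMap_mem_shiftInvariants (ξ : N) (a : ℂ) : algebraMap ℂ L a ∈ shiftInvariants F ξ :=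
  fun _ => AlgEquiv.commutes _ a

theorem X_mem_shiftInvariants {ξ : N} {v : M} (h : P.toLinearMap v ξ = 0) :
    F.X v ∈ shiftInvariants F ξ := fun t => by
  rw [F.T_X, zExp, map_smul, h, smul_zero, mul_zero, qPow_zero, one_smul]

/-- The translates of an integral element are roots of one polynomial, so its stabilizer has finite
index in ℂ. As ℂ is divisible, the stabilizer is everything. -/
theorem mem_shiftInvariants_of_isIntegral {ξ : N} {f : L}
    (h : IsIntegral (shiftInvariants F ξ) f) : f ∈ shiftInvariants F ξ := by
  classical
  obtain ⟨p, hp, hpf⟩ := h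
  let H : AddSubgroup ℂ :=
    { carrier := {t | F.T (t • ξ) f = f}
      zero_mem' := by rw [Set.mem_ofPred_eq, zero_smul, F.T_zero]
      add_mem' := fun {s t} hs ht => by
        rw [Set.mem_ofPred_eq] at *
        rw [add_smul, F.T_add, ht, hs]
      neg_mem' := fun {t} ht => by
        rw [Set.mem_ofPred_eq] at *
        nth_rewrite 1 [← ht]
        rw [← F.T_add, ← add_smul, neg_add_cancel, zero_smul, F.T_zero] }
  have hroot : ∀ t : ℂ, F.T (t • ξ) f ∈ (p.map (shiftInvariants F ξ).subtype).roots.toFinset := by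
    intro t
    rw [Multiset.mem_toFinset, Polynomial.mem_roots (hp.map _).ne_zero, Polynomial.IsRoot,
      Polynomial.eval_map]
    have h1 := Polynomial.hom_eval₂ p (shiftInvariants F ξ).subtype
      (F.T (t • ξ) : L →+* L) f
    have h2 : ((F.T (t • ξ) : L →+* L).comp (shiftInvariants F ξ).subtype) =
        (shiftInvariants F ξ).subtype := RingHom.ext fun x => x.2 t
    rw [h2] at h1
    change _ = Polynomial.eval₂ _ (F.T (t • ξ) f) p at h1
    rw [← h1]
    have h3 : Polynomial.eval₂ (shiftInvariants F ξ).subtype f p = 0 := hpf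
    rw [h3, map_zero]
  have hfin : H.FiniteIndex := by
    let g : ℂ ⧸ H → (p.map (shiftInvariants F ξ).subtype).roots.toFinset :=
      Quotient.lift (fun t : ℂ => ⟨F.T (t • ξ) f, hroot t⟩) fun s t hst => by
        have hst' : -s + t ∈ H := QuotientAddGroup.leftRel_apply.1 hst
        refine Subtype.ext ?_
        have h1 : F.T ((-s + t) • ξ) f = f := hst'
        change F.T (s • ξ) f = F.T (t • ξ) f
        nth_rewrite 1 [← h1]
        rw [← F.T_add, ← add_smul, add_neg_cancel_left]
    have hg : Function.Injective g := by
      intro x y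
      induction x using QuotientAddGroup.induction_on with | _ s => ?_
      induction y using QuotientAddGroup.induction_on with | _ t => ?_
      intro hxy
      have h1 : F.T (s • ξ) f = F.T (t • ξ) f := Subtype.ext_iff.1 hxy
      refine QuotientAddGroup.eq.2 ?_
      change F.T ((-s + t) • ξ) f = f
      rw [add_smul, F.T_add, ← h1, ← F.T_add, ← add_smul, neg_add_cancel, zero_smul, F.T_zero]
    have : Finite (ℂ ⧸ H) := Finite.of_injective g hg
    exact AddSubgroup.finiteIndex_of_finite_quotient
  intro t
  have h1 := H.nsmul_index_mem (t / H.index)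
  have h0 : (H.index : ℂ) ≠ 0 := by exact_mod_cast hfin.index_ne_zero
  rw [nsmul_eq_mul, mul_div_cancel₀ _ h0] at h1
  exact h1

/-- The invariants are integrally closed in L, and the integral closure of a subring is the
intersection of the valuation rings containing it. -/
theorem exists_valuationSubring {ξ : N} {f : L} (h : f ∉ shiftInvariants F ξ) :
    ∃ O : ValuationSubring L, (∀ x ∈ shiftInvariants F ξ, x ∈ O) ∧ f ∉ O := by
  have h1 : f ∉ (integralClosure (Subring.closure (shiftInvariants F ξ : Set L)) L).toSubring := by
    intro hf
    refine h (mem_shiftInvariants_of_isIntegral ?_)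
    rw [Subring.closure_eq] at hf
    exact hf
  rw [← iInf_valuationSubring_superset, Subring.mem_iInf] at h1
  push Not at h1
  obtain ⟨⟨O, hO⟩, hf⟩ := h1
  exact ⟨O, fun x hx => hO hx, hf⟩

theorem inv_mem_shiftInvariants {ξ : N} {f : L} (h : f ∈ shiftInvariants F ξ) :
    f⁻¹ ∈ shiftInvariants F ξ := fun t => by rw [map_inv₀, h t]

theorem valuation_eq_one_of_mem_shiftInvariants {ξ : N} {O : ValuationSubring L}
    (hO : ∀ x ∈ shiftInvariants F ξ, x ∈ O) {f : L} (h : f ∈ shiftInvariants F ξ) (hf : f ≠ 0) :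
    O.valuation f = 1 :=
  valuation_eq_one_iff_mem.2 ⟨hf, hO _ h, hO _ (inv_mem_shiftInvariants h)⟩

variable [P.IsCrystallographic] [Fintype ι] [P.IsReduced] {b : P.Base} {m : ι → ℕ}

/-- The half-sum of the positive coroots pairs to 1 with each simple root, so its pairing with a
root is a nonzero integer, positive on positive roots. -/
theorem exists_int_root_rhoCheck_one (b : P.Base) (i : ι) : ∃ n : ℤ, n ≠ 0 ∧
    (i ∈ posRoots b → 0 < n) ∧ P.toLinearMap (P.root i) (rhoCheck b fun _ => 1) = n := by
  have hpos : ∀ i ∈ posRoots b, ∃ n : ℤ, 0 < n ∧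
      P.toLinearMap (P.root i) (rhoCheck b fun _ => 1) = n := by
    intro i hi
    refine ((mem_posRoots b).1 hi).induction_on_add (p := fun i => ∃ n : ℤ, 0 < n ∧
      P.toLinearMap (P.root i) (rhoCheck b fun _ => 1) = n) (fun i hi => ⟨1, one_pos, ?_⟩)
      fun i j k hk h1 hj => ?_
    · rw [root_rhoCheck b (fun _ _ => rfl) hi]
      simp
    · obtain ⟨n, hn, hn'⟩ := h1
      refine ⟨n + 1, by omega, ?_⟩
      rw [hk, map_add, LinearMap.add_apply, hn', root_rhoCheck b (fun _ _ => rfl) hj]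
      simp
  rcases mem_posRoots_or b i with h | h
  · obtain ⟨n, h1, h2⟩ := hpos i h
    exact ⟨n, h1.ne', fun _ => h1, h2⟩
  · obtain ⟨n, h1, h2⟩ := hpos _ h
    refine ⟨-n, by omega, fun h' => absurd h (reflectionPerm_self_notMem_posRoots b h'), ?_⟩
    rw [root_reflectionPerm_self, map_neg, LinearMap.neg_apply] at h2
    rw [Int.cast_neg, ← h2, neg_neg]

/-- The valuations that are trivial on the invariants of the direction `ξ = ρᵛ(1)`. -/
theorem valuation_X_root_eq_zpow {O : ValuationSubring L}
    (hO : ∀ x ∈ shiftInvariants F (rhoCheck b fun _ => 1), x ∈ O) {i j : ι} (hi : i ∈ b.support)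
    {n : ℤ} (hn : P.toLinearMap (P.root j) (rhoCheck b fun _ => 1) = n) :
    O.valuation (F.X (P.root j)) = O.valuation (F.X (P.root i)) ^ n := by
  have h1 : P.toLinearMap (P.root j - n • P.root i) (rhoCheck b fun _ => 1) = 0 := by
    rw [map_sub, map_zsmul, LinearMap.sub_apply, LinearMap.smul_apply, hn,
      root_rhoCheck b (fun _ _ => rfl) hi]
    simp
  have h2 := valuation_eq_one_of_mem_shiftInvariants hO (X_mem_shiftInvariants (F := F) h1)
    (F.X_ne_zero _)
  have h3 : F.X (P.root j) = F.X (P.root j - n • P.root i) * F.X (P.root i) ^ n := by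
    rw [← F.X_zsmul, ← F.X_add, sub_add_cancel]
  rw [h3, map_mul, h2, one_mul, map_zpow₀]

/-- If X(α) and X(β) were both congruent to powers of q, so would be the character of the integral
combination of α and β that is orthogonal to the shift direction. It is invariant, and invariants
embed in the residue field, so that character would be constant although α and β are independent. -/
theorem valuation_sub_eq_one_of_ne (hq : ∀ n : ℤ, qPow logq n = 1 → n = 0)
    {O : ValuationSubring L} (hO : ∀ x ∈ shiftInvariants F (rhoCheck b fun _ => 1), x ∈ O)
    (hX : ∀ j, O.valuation (F.X (P.root j)) = 1) {i j : ι} {n n' : ℤ}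
    (hi : O.valuation (F.X (P.root i) - algebraMap ℂ L (qPow logq ((2 * n : ℤ) : ℂ))) ≠ 1)
    (h1 : P.root j ≠ P.root i) (h2 : P.root j ≠ -P.root i) :
    O.valuation (F.X (P.root j) - algebraMap ℂ L (qPow logq ((2 * n' : ℤ) : ℂ))) = 1 := by
  by_contra hj
  have hC : ∀ a : ℂ, algebraMap ℂ L a ∈ O := fun a => hO _ (algebraMap_mem_shiftInvariants _ a)
  have hu : ∀ (i : ι) (n : ℤ),
      O.valuation (F.X (P.root i) - algebraMap ℂ L (qPow logq ((2 * n : ℤ) : ℂ))) ≠ 1 →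
      ∃ u ∈ O.principalUnitGroup, (u : L) =
        F.X (P.root i) * algebraMap ℂ L (qPow logq ((-(2 * n) : ℤ) : ℂ)) := by
    intro i n h
    have h0 : F.X (P.root i) * algebraMap ℂ L (qPow logq ((-(2 * n) : ℤ) : ℂ)) ≠ 0 :=
      mul_ne_zero (F.X_ne_zero _) (by simpa using qPow_ne_zero logq _)
    refine ⟨Units.mk0 _ h0, ?_, rfl⟩
    rw [ValuationSubring.mem_principalUnitGroup_iff, Units.val_mk0]
    have e : F.X (P.root i) * algebraMap ℂ L (qPow logq ((-(2 * n) : ℤ) : ℂ)) - 1 =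
        (F.X (P.root i) - algebraMap ℂ L (qPow logq ((2 * n : ℤ) : ℂ))) *
          algebraMap ℂ L (qPow logq ((-(2 * n) : ℤ) : ℂ)) := by
      rw [sub_mul, ← map_mul (algebraMap ℂ L), ← qPow_add, Int.cast_neg, add_neg_cancel, qPow_zero,
        map_one]
    rw [e, map_mul, valuation_algebraMap hC (qPow_ne_zero _ _), mul_one]
    refine lt_of_le_of_ne ?_ h
    rw [O.valuation_le_one_iff]
    exact sub_mem ((O.valuation_le_one_iff _).1 (hX i).le) (hC _)
  obtain ⟨u, hu1, hu2⟩ := hu i n hi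
  obtain ⟨u', hu1', hu2'⟩ := hu j n' hj
  obtain ⟨k, hk0, -, hk⟩ := exists_int_root_rhoCheck_one b i
  obtain ⟨l, hl0, -, hl⟩ := exists_int_root_rhoCheck_one b j
  have h3 : u ^ l * u' ^ (-k) ∈ O.principalUnitGroup :=
    mul_mem (zpow_mem hu1 l) (zpow_mem hu1' (-k))
  rw [ValuationSubring.mem_principalUnitGroup_iff] at h3
  have h4 : ((u ^ l * u' ^ (-k) : Lˣ) : L) = F.X (l • P.root i - k • P.root j) *
      algebraMap ℂ L (qPow logq ((-(2 * n) : ℤ) : ℂ) ^ l * qPow logq ((-(2 * n') : ℤ) : ℂ) ^ (-k)) := by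
    rw [Units.val_mul, Units.val_zpow_eq_zpow_val, Units.val_zpow_eq_zpow_val, hu2, hu2', mul_zpow,
      mul_zpow, sub_eq_add_neg, ← neg_smul, F.X_add, F.X_zsmul, F.X_zsmul, map_mul, map_zpow₀,
      map_zpow₀]
    ring
  set a := qPow logq ((-(2 * n) : ℤ) : ℂ) ^ l * qPow logq ((-(2 * n') : ℤ) : ℂ) ^ (-k) with ha
  have ha0 : a ≠ 0 := mul_ne_zero (zpow_ne_zero _ (qPow_ne_zero _ _))
    (zpow_ne_zero _ (qPow_ne_zero _ _))
  have h5 : F.X (l • P.root i - k • P.root j) * algebraMap ℂ L a - 1 ∈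
      shiftInvariants F (rhoCheck b fun _ => 1) := by
    refine sub_mem (mul_mem (X_mem_shiftInvariants ?_) (algebraMap_mem_shiftInvariants _ _))
      (one_mem _)
    rw [map_sub, map_zsmul, map_zsmul, LinearMap.sub_apply, LinearMap.smul_apply,
      LinearMap.smul_apply, hk, hl, zsmul_eq_mul, zsmul_eq_mul]
    ring
  have h6 : F.X (l • P.root i - k • P.root j) * algebraMap ℂ L a - 1 = 0 := by
    by_contra hne
    rw [h4, valuation_eq_one_of_mem_shiftInvariants hO h5 hne] at h3
    exact lt_irrefl _ h3
  refine F.X_ne_algebraMap hq (v := l • P.root i - k • P.root j) (fun h0 => ?_) a⁻¹ ?_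
  · have hli : LinearIndependent ℂ ![P.root i, P.root j] :=
      RootPairing.IsReduced.linearIndependent P (fun h => h1 (by rw [h])) fun h => h2 (by
        rw [h, neg_neg])
    rw [LinearIndependent.pair_iff] at hli
    have := (hli l (-k) (by
      rw [neg_smul, ← sub_eq_add_neg, Int.cast_smul_eq_zsmul, Int.cast_smul_eq_zsmul, h0])).1
    exact hl0 (by exact_mod_cast this)
  · rw [map_inv₀]
    exact eq_inv_of_mul_eq_one_left (sub_eq_zero.1 h6)

variable [P.IsIrreducible] [Nonempty ι]

/-- Otherwise some valuation ring contains the invariants but not ψ(x, ρ). The valuations of the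
X(α) are nonzero powers of a single one: either all are 1, and then at most one pair ±α is
exceptional, or none is 1. In both cases ψ(x, ρ) was shown to lie in the ring. -/
theorem IsBakerAkhiezer.ev_rho_mem_shiftInvariants
    (hq : ∀ n : ℤ, qPow logq n = 1 → n = 0) (hm : ∀ i j, m (P.reflectionPerm i j) = m j)
    {c : N →₀ L} (hc : IsBakerAkhiezer F b m c) (hcρ : c (rhoCheck b m) = F.leadingCoeff b m) :
    F.ev c (rho b fun i => (m i : ℂ)) ∈ shiftInvariants F (rhoCheck b fun _ => 1) := by
  by_contra hr
  obtain ⟨O, hO, hrO⟩ := exists_valuationSubring hr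
  have hC : ∀ a : ℂ, algebraMap ℂ L a ∈ O := fun a => hO _ (algebraMap_mem_shiftInvariants _ a)
  obtain ⟨i₀, hi₀⟩ : ∃ i, i ∈ b.support := b.support_nonempty
  refine hrO ?_
  by_cases hv : O.valuation (F.X (P.root i₀)) = 1
  · have hX : ∀ j, O.valuation (F.X (P.root j)) = 1 := fun j => by
      obtain ⟨n, -, -, hn⟩ := exists_int_root_rhoCheck_one b j
      rw [valuation_X_root_eq_zpow hO hi₀ hn, hv, one_zpow]
    have hX' : ∀ j, O.valuation (F.X ((1 / 2 : ℂ) • P.root j)) = 1 := fun j => by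
      have := hX j
      rw [← F.X_half_root_sq, map_pow] at this
      exact (pow_eq_one_iff.1 this).resolve_right two_ne_zero
    by_cases hbad : ∃ i, ∃ n : ℤ,
        O.valuation (F.X (P.root i) - algebraMap ℂ L (qPow logq ((2 * n : ℤ) : ℂ))) ≠ 1
    · obtain ⟨i, n, hi⟩ := hbad
      exact hc.ev_rho_mem_of_units' hq hm hcρ O hC hX' i fun j h1 h2 n' =>
        valuation_sub_eq_one_of_ne hq hO hX hi h1 h2
    · push Not at hbad
      exact hc.ev_rho_mem_of_units' hq hm hcρ O hC hX' i₀ fun j _ _ n => hbad j n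
  · refine hc.ev_rho_mem_of_ne hq hm hcρ O hC fun j h1 => ?_
    obtain ⟨n, hn0, -, hn⟩ := exists_int_root_rhoCheck_one b j
    rw [valuation_X_root_eq_zpow hO hi₀ hn] at h1
    exact hn0 ((zpow_eq_one_iff_right₀ zero_le hv).1 h1)

/-- The value at `ρ` is invariant under the translations by the coroot lattice. -/
theorem IsBakerAkhiezer.T_ev_rho
    (hq : ∀ n : ℤ, qPow logq n = 1 → n = 0) (hm : ∀ i j, m (P.reflectionPerm i j) = m j)
    {c : N →₀ L} (hc : IsBakerAkhiezer F b m c) (hcρ : c (rhoCheck b m) = F.leadingCoeff b m)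
    (i : ι) : F.T (P.coroot i) (F.ev c (rho b fun i => (m i : ℂ))) =
      F.ev c (rho b fun i => (m i : ℂ)) := by
  set r := F.ev c (rho b fun i => (m i : ℂ)) with hr
  have h0 : F.T (rhoCheck b fun _ => 1) r = r := by
    have := hc.ev_rho_mem_shiftInvariants hq hm hcρ 1
    rwa [one_smul] at this
  have hneg : ∀ u, F.T u r = r → F.T (-u) r = r := fun u hu => by
    nth_rewrite 1 [← hu]
    rw [← F.T_add, neg_add_cancel, F.T_zero]
  have h1 : ∀ i ∈ b.support, F.T (P.coroot i) r = r := by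
    intro i hi
    -- The value is fixed by the translation by ρᵛ(1) and by the simple reflections, hence by the
    -- translation by s_i ρᵛ(1) = ρᵛ(1) - α_iᵛ and by the difference of the two.
    have h2 : F.T (P.coreflection i (rhoCheck b fun _ => 1)) r = r := by
      have hσ : F.σ i r = r := hc.σ_ev_rho hq hm hcρ hi
      nth_rewrite 1 [← hσ]
      rw [← F.σ_T, h0, hσ]
    rw [coreflection_rhoCheck b (fun _ _ => rfl) hi, Nat.cast_one, one_smul] at h2
    have h3 : P.coroot i = rhoCheck b (fun _ => 1) + -(rhoCheck b (fun _ => 1) - P.coroot i) := by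
      abel
    rw [h3, F.T_add, hneg _ h2, h0]
  have h := b.coroot_mem_span_int i
  generalize P.coroot i = y at h
  let H : AddSubgroup N :=
    { carrier := {u | F.T u r = r}
      zero_mem' := F.T_zero r
      add_mem' := fun {u v} hu hv => by
        rw [Set.mem_ofPred_eq] at *
        rw [F.T_add, hv, hu]
      neg_mem' := fun {u} hu => hneg u hu }
  have hle : Submodule.span ℤ (P.coroot '' b.support) ≤ AddSubgroup.toIntSubmodule H := by
    rw [Submodule.span_le]
    rintro _ ⟨j, hj, rfl⟩
    exact h1 j hj
  exact hle h

/-- A valuation ring that contains the invariants but not X(-α) for one simple root α makes all X of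
positive roots smaller than 1, so the limit at infinity applies. -/
theorem IsBakerAkhiezer.ev_rho_ne_zero_of_leadingCoeff
    (hq : ∀ n : ℤ, qPow logq n = 1 → n = 0) (hm : ∀ i j, m (P.reflectionPerm i j) = m j)
    {c : N →₀ L} (hc : IsBakerAkhiezer F b m c) (hcne : c ≠ 0) :
    F.ev c (rho b fun i => (m i : ℂ)) ≠ 0 := by
  obtain ⟨i₀, hi₀⟩ : ∃ i, i ∈ b.support := b.support_nonempty
  have h0 : F.X (-P.root i₀) ∉ shiftInvariants F (rhoCheck b fun _ => 1) := by
    intro h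
    obtain ⟨t, ht⟩ := exists_qPow_ne_one hq (a := 1) one_ne_zero
    have h1 := h (-t / 2)
    rw [F.T_X, Algebra.smul_def] at h1
    have h2 := mul_right_cancel₀ (F.X_ne_zero _) (h1.trans (one_mul _).symm)
    rw [← map_one (algebraMap ℂ L)] at h2
    have h3 := (algebraMap ℂ L).injective h2
    rw [zExp, map_smul, map_neg, LinearMap.neg_apply, root_rhoCheck b (fun _ _ => rfl) hi₀] at h3
    refine ht (Eq.trans ?_ h3)
    congr 1
    simp
    ring
  obtain ⟨O, hO, hrO⟩ := exists_valuationSubring h0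
  have hC : ∀ a : ℂ, algebraMap ℂ L a ∈ O := fun a => hO _ (algebraMap_mem_shiftInvariants _ a)
  have hlt : O.valuation (F.X (P.root i₀)) < 1 := by
    rw [← O.valuation_le_one_iff, F.X_neg, map_inv₀, not_le] at hrO
    exact (one_lt_inv₀ (zero_lt_iff.2 (by simpa using F.X_ne_zero _))).1 hrO
  refine hc.ev_rho_ne_zero hq hm hcne hC fun j hj => ?_
  obtain ⟨n, -, hpos, hn⟩ := exists_int_root_rhoCheck_one b j
  rw [valuation_X_root_eq_zpow hO hi₀ hn]
  obtain ⟨k, rfl⟩ := Int.eq_ofNat_of_zero_le (hpos hj).le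
  rw [zpow_natCast]
  have := hpos hj
  exact pow_lt_one₀ zero_le hlt (by omega)

end ShiftInvariance

end BakerAkhiezer

end

/-! ### Weyl orbits and minimality of minuscule and quasiminuscule coweights. -/

noncomputable section

namespace BakerAkhiezer

open Module

variable {ι M N : Type*} [Fintype ι] [AddCommGroup M] [Module ℂ M] [NormedAddCommGroup N]
  [NormedSpace ℂ N] {P : RootPairing ι ℂ M N} {logq : ℂ}

section WeylOrbit

variable [P.IsRootSystem] [P.IsCrystallographic] [P.IsReduced]

theorem mem_weylOrbit {π τ : N} : τ ∈ weylOrbit P π ↔ ∃ w ∈ coWeyl P, w π = τ := by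
  rw [weylOrbit, Set.Finite.mem_toFinset, MulAction.mem_orbit_iff]
  exact ⟨fun ⟨w, h⟩ => ⟨w.1, w.2, h⟩, fun ⟨w, hw, h⟩ => ⟨⟨w, hw⟩, h⟩⟩

theorem self_mem_weylOrbit (π : N) : π ∈ weylOrbit P π := mem_weylOrbit.2 ⟨1, one_mem _, rfl⟩

theorem coreflection_mem_coWeyl (i : ι) : P.coreflection i ∈ coWeyl P :=
  Subgroup.subset_closure ⟨i, rfl⟩

theorem apply_mem_weylOrbit {w : N ≃ₗ[ℂ] N} (hw : w ∈ coWeyl P) {π τ : N}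
    (h : τ ∈ weylOrbit P π) : w τ ∈ weylOrbit P π := by
  obtain ⟨u, hu, rfl⟩ := mem_weylOrbit.1 h
  exact mem_weylOrbit.2 ⟨w * u, mul_mem hw hu, rfl⟩

theorem coreflection_mem_weylOrbit (i : ι) {π τ : N} (h : τ ∈ weylOrbit P π) :
    P.coreflection i τ ∈ weylOrbit P π :=
  apply_mem_weylOrbit (coreflection_mem_coWeyl i) h

theorem exists_apply_eq_of_mem_weylOrbit {π τ τ' : N} (h : τ ∈ weylOrbit P π)
    (h' : τ' ∈ weylOrbit P π) : ∃ w ∈ coWeyl P, w τ = τ' := by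
  obtain ⟨u, hu, rfl⟩ := mem_weylOrbit.1 h
  obtain ⟨v, hv, rfl⟩ := mem_weylOrbit.1 h'
  refine ⟨v * u⁻¹, mul_mem hv (inv_mem hu), ?_⟩
  change v (u.symm (u π)) = v π
  rw [u.symm_apply_apply]

theorem sum_weylOrbit_coreflection {A : Type*} [AddCommMonoid A] (i : ι) (π : N) (f : N → A) :
    ∑ τ ∈ weylOrbit P π, f (P.coreflection i τ) = ∑ τ ∈ weylOrbit P π, f τ := by
  refine Finset.sum_nbij' (P.coreflection i) (P.coreflection i)
    (fun τ hτ => coreflection_mem_weylOrbit i hτ) (fun τ hτ => coreflection_mem_weylOrbit i hτ)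
    (fun τ _ => P.coreflection_same i τ) (fun τ _ => P.coreflection_same i τ) fun τ _ => rfl

theorem exists_root_apply_of_mem_weylOrbit {π τ : N} {K : ℤ}
    (hπ : ∀ i, ∃ n : ℤ, P.toLinearMap (P.root i) π = n ∧ -K ≤ n ∧ n ≤ K) (h : τ ∈ weylOrbit P π) :
    ∀ i, ∃ n : ℤ, P.toLinearMap (P.root i) τ = n ∧ -K ≤ n ∧ n ≤ K := by
  obtain ⟨w, hw, rfl⟩ := mem_weylOrbit.1 h
  clear h
  induction hw using Subgroup.closure_induction'' generalizing π with
  | one => exact hπ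
  | mem w hw =>
    obtain ⟨j, rfl⟩ := hw
    intro i
    obtain ⟨n, h1, h2⟩ := hπ (P.reflectionPerm j i)
    refine ⟨n, ?_, h2⟩
    rw [← h1, P.root_reflectionPerm, P.coreflection_apply, P.reflection_apply]
    simp only [map_sub, map_smul, LinearMap.sub_apply, LinearMap.smul_apply, smul_eq_mul]
    rw [mul_comm]
    rfl
  | inv_mem w hw =>
    obtain ⟨j, rfl⟩ := hw
    intro i
    obtain ⟨n, h1, h2⟩ := hπ (P.reflectionPerm j i)
    refine ⟨n, ?_, h2⟩
    rw [P.coreflection_inv, ← h1, P.root_reflectionPerm, P.coreflection_apply, P.reflection_apply]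
    simp only [map_sub, map_smul, LinearMap.sub_apply, LinearMap.smul_apply, smul_eq_mul]
    rw [mul_comm]
    rfl
  | mul u v _ _ hu hv => exact hu (hv hπ)

theorem exists_root_apply_of_isQuasiminuscule {j : ι}
    (hj : ∀ i, P.root i ≠ P.root j → P.root i ≠ -P.root j →
      ∃ n : ℤ, P.toLinearMap (P.root i) (P.coroot j) = n ∧ -1 ≤ n ∧ n ≤ 1) (i : ι) :
    ∃ n : ℤ, P.toLinearMap (P.root i) (P.coroot j) = n ∧ -2 ≤ n ∧ n ≤ 2 := by
  by_cases h1 : P.root i = P.root j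
  · exact ⟨2, by rw [h1, P.root_coroot_two]; simp, by norm_num, by norm_num⟩
  by_cases h2 : P.root i = -P.root j
  · exact ⟨-2, by rw [h2, map_neg, LinearMap.neg_apply, P.root_coroot_two]; simp, by norm_num,
      by norm_num⟩
  obtain ⟨n, h3, h4, h5⟩ := hj i h1 h2
  exact ⟨n, h3, by omega, by omega⟩

theorem orbitSum_reflection (i : ι) (π : N) (z : M) :
    orbitSum P logq π (P.reflection i z) = orbitSum P logq π z := by
  rw [orbitSum, Finset.sum_apply, Finset.sum_apply,
    ← sum_weylOrbit_coreflection i π fun τ => zExp P logq τ z]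
  exact Finset.sum_congr rfl fun τ _ => zExp_reflection i τ z

/-- The orbit sum is W-invariant. The reflection of z - jα/2 is z + jα/2 up to the shift by (z,
αᵛ)α, which is invisible to exponents with integral pairings when q^(2(αᵛ,z)) = 1. -/
theorem orbitSum_mem_quasiInvariants (m : ι → ℕ) {π : N} {K : ℤ}
    (hπ : ∀ i, ∃ n : ℤ, P.toLinearMap (P.root i) π = n ∧ -K ≤ n ∧ n ≤ K) :
    orbitSum P logq π ∈ quasiInvariants P logq m := by
  refine ⟨sum_mem fun τ hτ => Submodule.subset_span ⟨τ, fun i => ?_, rfl⟩,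
    fun i j _ _ z hz => ?_⟩
  · obtain ⟨n, hn, -⟩ := exists_root_apply_of_mem_weylOrbit hπ hτ i
    exact ⟨n, hn⟩
  · rw [← orbitSum_reflection i π (z - _), orbitSum, Finset.sum_apply, Finset.sum_apply]
    refine Finset.sum_congr rfl fun τ hτ => ?_
    obtain ⟨n, hn, -⟩ := exists_root_apply_of_mem_weylOrbit hπ hτ i
    have e : P.reflection i (z - ((j : ℂ) / 2) • P.root i) =
        z + ((j : ℂ) / 2) • P.root i - P.toLinearMap z (P.coroot i) • P.root i := by
      rw [map_sub, map_smul, P.reflection_apply_self, P.reflection_apply, smul_neg, sub_neg_eq_add]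
      change z - P.toLinearMap z (P.coroot i) • P.root i + _ = _
      abel
    rw [e, zExp_apply_sub]
    have h1 : zExp P logq τ (P.toLinearMap z (P.coroot i) • P.root i) = 1 := by
      rw [zExp, map_smul, LinearMap.smul_apply, hn, smul_eq_mul, ← mul_assoc, mul_comm,
        qPow_intCast_mul, hz, one_zpow]
    rw [h1]
    simp

end WeylOrbit

section Descent

variable [P.IsCrystallographic] [P.IsReduced] {b : P.Base}

variable (b) in
/-- The vectors whose Weyl group orbit lies below the height `t`. -/
def lowSet (t : ℝ) : Set N := {ν | ∀ w ∈ coWeyl P, height b (w ν) < t}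

variable {t : ℝ}

theorem coreflection_mem_lowSet (i : ι) {ν : N} (h : ν ∈ lowSet b t) :
    P.coreflection i ν ∈ lowSet b t := fun w hw =>
  h (w * P.coreflection i) (mul_mem hw (Subgroup.subset_closure ⟨i, rfl⟩))

/-- The point lies on the segment from ν to its reflection, and the condition defining `lowSet` is
convex and W-stable. -/
theorem sub_coroot_mem_lowSet {ν : N} (h : ν ∈ lowSet b t) {i : ι} {n : ℤ}
    (hn : P.toLinearMap (P.root i) ν = n) (hpos : 1 ≤ n) : ν - P.coroot i ∈ lowSet b t := by
  intro w hw
  have h1 := h w hw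
  have h2 := coreflection_mem_lowSet i h w hw
  have e : P.coreflection i ν = ν - n • P.coroot i := by
    rw [P.coreflection_apply, ← Int.cast_smul_eq_zsmul ℂ, ← hn]
  rw [e, map_sub, map_zsmul, map_sub, map_zsmul, zsmul_eq_mul] at h2
  rw [map_sub, map_sub]
  have h3 : (1 : ℝ) ≤ n := by exact_mod_cast hpos
  nlinarith

theorem add_coroot_mem_lowSet {ν : N} (h : ν ∈ lowSet b t) {i : ι} {n : ℤ}
    (hn : P.toLinearMap (P.root i) ν = n) (hneg : n ≤ -1) : ν + P.coroot i ∈ lowSet b t := by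
  have := sub_coroot_mem_lowSet (i := P.reflectionPerm i i) (n := -n) h (by
    rw [root_reflectionPerm_self, map_neg, LinearMap.neg_apply, hn, Int.cast_neg]) (by omega)
  rwa [coroot_reflectionPerm_self, sub_neg_eq_add] at this

theorem exists_multiset_of_mem_corootLattice {κ : N} (h : κ ∈ corootLattice P) :
    ∃ s : Multiset ι, κ = (s.map P.coroot).sum := by
  induction h using AddSubgroup.closure_induction'' with
  | zero => exact ⟨0, by simp⟩
  | mem x hx =>
    obtain ⟨i, rfl⟩ := hx
    exact ⟨{i}, by simp⟩
  | neg_mem x hx =>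
    obtain ⟨i, rfl⟩ := hx
    exact ⟨{P.reflectionPerm i i}, by simp⟩
  | add x y _ _ hx hy =>
    obtain ⟨s, rfl⟩ := hx
    obtain ⟨s', rfl⟩ := hy
    exact ⟨s + s', by simp⟩

/-- A sum of coroots that contains two coroots at an obtuse angle is a shorter sum; otherwise its
values at the roots of the summands are at least `2`. -/
theorem exists_shorter_or_two_le (j : ι) (s : Multiset ι) :
    (∃ s' : Multiset ι, s'.card < (j ::ₘ s).card ∧
      (s'.map P.coroot).sum = ((j ::ₘ s).map P.coroot).sum) ∨
    ∃ n : ℤ, 2 ≤ n ∧ P.toLinearMap (P.root j) ((j ::ₘ s).map P.coroot).sum = n := by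
  classical
  by_cases h : ∃ l ∈ s, P.pairingIn ℤ j l < 0
  · left
    obtain ⟨l, hl, hneg⟩ := h
    obtain ⟨s, rfl⟩ := Multiset.exists_cons_of_mem hl
    by_cases h' : P.coroot l = -P.coroot j
    · exact ⟨s, by simp, by simp [h']⟩
    · have := P.flip.root_add_root_mem_of_pairingIn_neg (i := l) (j := j)
        (by rwa [show P.flip.pairingIn ℤ l j = P.pairingIn ℤ j l from
          (FaithfulSMul.algebraMap_injective ℤ ℂ) (by
            rw [P.algebraMap_pairingIn, P.flip.algebraMap_pairingIn]; rfl)]) h'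
      obtain ⟨k, hk⟩ := this
      have hk' : P.coroot k = P.coroot l + P.coroot j := hk
      refine ⟨k ::ₘ s, by simp, ?_⟩
      simp only [Multiset.map_cons, Multiset.sum_cons, hk']
      abel
  · right
    push Not at h
    have h1 : ∀ s : Multiset ι, (∀ l ∈ s, 0 ≤ P.pairingIn ℤ j l) →
        ∃ n : ℤ, 0 ≤ n ∧ P.toLinearMap (P.root j) (s.map P.coroot).sum = n := by
      intro s
      induction s using Multiset.induction_on with
      | empty => exact fun _ => ⟨0, le_rfl, by simp⟩
      | cons l s ih =>
        intro hs
        obtain ⟨n, hn, hn'⟩ := ih fun l hl => hs l (Multiset.mem_cons_of_mem hl)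
        refine ⟨P.pairingIn ℤ j l + n, by have := hs l (Multiset.mem_cons_self l s); omega, ?_⟩
        rw [Multiset.map_cons, Multiset.sum_cons, map_add, hn', toLinearMap_root_coroot,
          Int.cast_add]
    obtain ⟨n, hn, hn'⟩ := h1 s h
    refine ⟨2 + n, by omega, ?_⟩
    rw [Multiset.map_cons, Multiset.sum_cons, map_add, hn', P.root_coroot_two]
    simp

variable [P.IsRootSystem]

theorem notMem_lowSet_of_mem_weylOrbit {π τ τ₀ : N} (h₀ : τ₀ ∈ weylOrbit P π)
    (h : τ ∈ weylOrbit P π) (ht : height b τ₀ = t) : τ ∉ lowSet b t := by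
  intro hτ
  obtain ⟨w, hw, rfl⟩ := exists_apply_eq_of_mem_weylOrbit h h₀
  exact (hτ w hw).ne ht

/-- The weights of the coset of a minuscule coweight are not lower than this coweight. -/
theorem notMem_lowSet_of_isMinuscule {π τ₀ : N} (hπ : IsMinuscule P π) (h₀ : τ₀ ∈ weylOrbit P π)
    (ht : height b τ₀ = t) {ν : N} (hν : ν - π ∈ corootLattice P) : ν ∉ lowSet b t := by
  have key : ∀ (k : ℕ) (s : Multiset ι), s.card = k → ∀ τ ∈ weylOrbit P π,
      τ - (s.map P.coroot).sum ∉ lowSet b t := by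
    intro k
    induction k using Nat.strong_induction_on with
    | _ k ih =>
      intro s hs τ hτ hlow
      induction s using Multiset.induction_on with
      | empty => exact notMem_lowSet_of_mem_weylOrbit h₀ hτ ht (by simpa using hlow)
      | cons j s _ =>
        rcases exists_shorter_or_two_le (P := P) j s with ⟨s', h1, h2⟩ | ⟨n, h1, h2⟩
        · exact ih _ (hs ▸ h1) s' rfl τ hτ (by rwa [h2])
        · obtain ⟨l, hl, -, hl1⟩ := exists_root_apply_of_mem_weylOrbit (K := 1) hπ hτ j
          have hlt : s.card < k := by rw [← hs]; simp
          rcases eq_or_lt_of_le hl1 with rfl | hl1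
          · refine ih _ hlt s rfl _ (coreflection_mem_weylOrbit j hτ) ?_
            have e : P.coreflection j τ = τ - P.coroot j := by
              rw [P.coreflection_apply]
              change τ - P.toLinearMap (P.root j) τ • _ = _
              rw [hl, Int.cast_one, one_smul]
            rwa [Multiset.map_cons, Multiset.sum_cons, ← sub_sub, ← e] at hlow
          · have h3 := add_coroot_mem_lowSet (i := j) (n := l - n) hlow
              (by rw [map_sub, hl, h2, Int.cast_sub]) (by omega)
            refine ih _ hlt s rfl τ hτ ?_
            rw [Multiset.map_cons, Multiset.sum_cons] at h3
            convert h3 using 1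
            abel
  intro hlow
  obtain ⟨s, hs⟩ := exists_multiset_of_mem_corootLattice (neg_mem hν)
  refine key _ s rfl π (self_mem_weylOrbit π) ?_
  rw [← hs]
  simpa using hlow

variable [P.IsIrreducible]

/-- The coroots in `lowSet` form a W-stable set, so by irreducibility a nonempty set contains some
γᵛ with (γ, βᵛ) > 0, β being the root of the quasiminuscule coroot. If γ = β this contradicts the
choice of t; otherwise the pairing is 1, and γᵛ - βᵛ, which is s_γ(-βᵛ), is an element of the orbit
in `lowSet`. -/
theorem coroot_notMem_lowSet_of_isQuasiminuscule {j : ι} {τ₀ : N}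
    (hπ : ∀ i, P.root i ≠ P.root j → P.root i ≠ -P.root j →
      ∃ n : ℤ, P.toLinearMap (P.root i) (P.coroot j) = n ∧ -1 ≤ n ∧ n ≤ 1)
    (h₀ : τ₀ ∈ weylOrbit P (P.coroot j)) (ht : height b τ₀ = t) (i : ι) :
    P.coroot i ∉ lowSet b t := by
  intro hi
  let A : Set ι := {i | P.coroot i ∈ lowSet b t}
  have hA : ∀ k, ∀ i ∈ A, P.reflectionPerm k i ∈ A := fun k i hi => by
    change P.coroot _ ∈ lowSet b t
    rw [P.coroot_reflectionPerm]
    exact coreflection_mem_lowSet k hi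
  have hspan : Submodule.span ℂ (P.root '' A) = ⊤ := by
    refine RootPairing.IsIrreducible.eq_top_of_invtSubmodule_reflection (P := P) _ (fun k => ?_) ?_
    · rw [Module.End.mem_invtSubmodule, Submodule.span_le]
      rintro _ ⟨β, hβ, rfl⟩
      refine Submodule.subset_span ⟨P.reflectionPerm k β, hA k β hβ, ?_⟩
      rw [P.root_reflectionPerm]
      rfl
    · intro h
      rw [Submodule.span_eq_bot] at h
      exact P.ne_zero i (h _ ⟨i, hi, rfl⟩)
  obtain ⟨k, hk, hkj⟩ : ∃ k ∈ A, P.pairingIn ℤ k j ≠ 0 := by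
    by_contra! hc
    have : (⊤ : Submodule ℂ M) ≤ LinearMap.ker (P.coroot' j) := by
      rw [← hspan, Submodule.span_le]
      rintro _ ⟨k, hk, rfl⟩
      have := toLinearMap_root_coroot (P := P) k j
      rw [hc k hk, Int.cast_zero] at this
      exact this
    have h2 : P.toLinearMap (P.root j) (P.coroot j) = 0 := this trivial
    rw [P.root_coroot_two] at h2
    exact two_ne_zero h2
  obtain ⟨k, hk, hkj⟩ : ∃ k ∈ A, 0 < P.pairingIn ℤ k j := by
    rcases lt_or_gt_of_ne hkj with h | h
    · refine ⟨P.reflectionPerm k k, hA k k hk, ?_⟩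
      have h1 := toLinearMap_root_coroot (P := P) (P.reflectionPerm k k) j
      rw [root_reflectionPerm_self, map_neg, LinearMap.neg_apply, toLinearMap_root_coroot] at h1
      have : -P.pairingIn ℤ k j = P.pairingIn ℤ (P.reflectionPerm k k) j := by exact_mod_cast h1
      omega
    · exact ⟨k, hk, h⟩
  have hjj : -P.coroot j ∈ weylOrbit P (P.coroot j) := by
    rw [← P.coreflection_apply_self]
    exact coreflection_mem_weylOrbit j (self_mem_weylOrbit _)
  by_cases h1 : P.root k = P.root j
  · rw [P.root.injective h1] at hk
    exact notMem_lowSet_of_mem_weylOrbit h₀ (self_mem_weylOrbit _) ht hk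
  by_cases h2 : P.root k = -P.root j
  · rw [← root_reflectionPerm_self] at h2
    rw [P.root.injective h2, Set.mem_ofPred_eq, coroot_reflectionPerm_self] at hk
    exact notMem_lowSet_of_mem_weylOrbit h₀ hjj ht hk
  obtain ⟨n, h3, -, h4⟩ := hπ k h1 h2
  have h5 : P.pairingIn ℤ k j = n := by
    rw [toLinearMap_root_coroot] at h3
    exact_mod_cast h3
  have h6 : n = 1 := by omega
  have h7 : 1 ≤ P.pairingIn ℤ j k := by
    have := P.zero_lt_pairingIn_iff' (S := ℤ) (i := k) (j := j)
    omega
  have h8 := sub_coroot_mem_lowSet (i := j) hk (toLinearMap_root_coroot j k) h7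
  refine notMem_lowSet_of_mem_weylOrbit h₀ (coreflection_mem_weylOrbit k hjj) ht ?_
  have e : P.coreflection k (-P.coroot j) = P.coroot k - P.coroot j := by
    rw [P.coreflection_apply]
    change -P.coroot j - P.toLinearMap (P.root k) (-P.coroot j) • _ = _
    rw [map_neg, h3, h6, Int.cast_one, neg_one_smul]
    abel
  rwa [e]

/-- The only element of the coroot lattice below a quasiminuscule coweight is zero. -/
theorem eq_zero_of_mem_lowSet {j : ι} {τ₀ : N}
    (hπ : ∀ i, P.root i ≠ P.root j → P.root i ≠ -P.root j →
      ∃ n : ℤ, P.toLinearMap (P.root i) (P.coroot j) = n ∧ -1 ≤ n ∧ n ≤ 1)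
    (h₀ : τ₀ ∈ weylOrbit P (P.coroot j)) (ht : height b τ₀ = t) {ν : N}
    (hν : ν ∈ corootLattice P) (hlow : ν ∈ lowSet b t) : ν = 0 := by
  have key : ∀ (k : ℕ) (s : Multiset ι), s.card = k → (s.map P.coroot).sum ∈ lowSet b t →
      (s.map P.coroot).sum = 0 := by
    intro k
    induction k using Nat.strong_induction_on with
    | _ k ih =>
      intro s hs hlow
      induction s using Multiset.induction_on with
      | empty => simp
      | cons j s _ =>
        rcases exists_shorter_or_two_le (P := P) j s with ⟨s', h1, h2⟩ | ⟨n, h1, h2⟩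
        · rw [← h2] at hlow ⊢
          exact ih _ (hs ▸ h1) s' rfl hlow
        · have hlt : s.card < k := by rw [← hs]; simp
          have h3 := sub_coroot_mem_lowSet hlow h2 (by omega)
          rw [Multiset.map_cons, Multiset.sum_cons, add_sub_cancel_left] at h3
          rw [Multiset.map_cons, Multiset.sum_cons, ih _ hlt s rfl h3, add_zero] at hlow
          exact absurd hlow (coroot_notMem_lowSet_of_isQuasiminuscule hπ h₀ ht j)
  obtain ⟨s, rfl⟩ := exists_multiset_of_mem_corootLattice hν
  exact key _ s rfl hlow

end Descent

end BakerAkhiezer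

end

/-! ### Identification of the Macdonald operators. -/

noncomputable section

namespace BakerAkhiezer

open Module

variable {ι M N L : Type*} [Fintype ι] [AddCommGroup M] [Module ℂ M] [NormedAddCommGroup N]
  [NormedSpace ℂ N] {P : RootPairing ι ℂ M N} {logq : ℂ} [Field L] [Algebra ℂ L]
  {F : CharacterField P logq L}

open CharacterField

section Macdonald

variable (F) in
open Classical in
/-- The coefficients of the Macdonald operators. -/
def macdonaldCoeff (k : ι → ℂ) (τ : N) : L :=
  (∏ i with ∃ n : ℕ, 0 < n ∧ P.root' i τ = n, F.bracket i (k i) / F.bracket i 0) *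
    ∏ i with P.root' i τ = 2, F.bracket i (k i + 1) / F.bracket i 1

theorem prod_sub_one_mul {R : Type*} [CommMonoid R] (g : ℂ → R) (m : ℕ) :
    (∏ j ∈ Finset.Icc 1 m, g ((j : ℂ) - 1)) * g m = (∏ j ∈ Finset.Icc 1 m, g (j : ℂ)) * g 0 := by
  induction m with
  | zero => simp
  | succ m ih =>
    rw [Finset.prod_Icc_succ_top (by omega), Finset.prod_Icc_succ_top (by omega), Nat.cast_add,
      Nat.cast_one, add_sub_cancel_right, ih]
    ac_rfl

variable [P.IsCrystallographic]

theorem root_coreflection (i j : ι) (ν : N) :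
    P.toLinearMap (P.root (P.reflectionPerm j i)) (P.coreflection j ν) =
      P.toLinearMap (P.root i) ν := by
  have e : P.toLinearMap (P.root i) ν =
      P.toLinearMap (P.root i) (P.coreflection j (P.coreflection j ν)) := by
    rw [P.coreflection_same]
  rw [e, P.root_reflectionPerm, P.coreflection_apply j (P.coreflection j ν), P.reflection_apply]
  simp only [map_sub, map_smul, LinearMap.sub_apply, LinearMap.smul_apply, smul_eq_mul]
  rw [mul_comm]
  rfl

theorem σ_macdonaldCoeff {k : ι → ℂ} (hk : ∀ i j, k (P.reflectionPerm i j) = k j) (j : ι) (τ : N) :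
    F.σ j (macdonaldCoeff F k τ) = macdonaldCoeff F k (P.coreflection j τ) := by
  have h : ∀ i, P.root' (P.reflectionPerm j i) (P.coreflection j τ) = P.root' i τ :=
    fun i => root_coreflection i j τ
  rw [macdonaldCoeff, macdonaldCoeff, map_mul, map_prod, map_prod]
  congr 1
  · refine Finset.prod_equiv (P.reflectionPerm j) (fun i => ?_) fun i _ => ?_
    · simp [h]
    · rw [map_div₀, σ_bracket, σ_bracket, hk]
  · refine Finset.prod_equiv (P.reflectionPerm j) (fun i => ?_) fun i _ => ?_
    · simp [h]
    · rw [map_div₀, σ_bracket, σ_bracket, hk]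

variable [P.IsReduced] {b : P.Base} {m : ι → ℕ}

/-- For dominant τ with pairings 0, 1, 2 the translation shifts the brackets [j - (α, x)] by the
pairing. The products telescope, and the Macdonald coefficient at k = -m is the resulting quotient,
so a_τT^τψ and q^(2(τ,z))ψ agree at the exponent τ + ρᵛ. -/
theorem macdonaldCoeff_mul_T_leadingCoeff (hq : ∀ n : ℤ, qPow logq n = 1 → n = 0) {τ : N}
    (hτ : ∀ i ∈ posRoots b, ∃ n : ℤ, P.toLinearMap (P.root i) τ = n ∧ 0 ≤ n ∧ n ≤ 2) :
    macdonaldCoeff F (fun i => -(m i : ℂ)) τ * F.T τ (F.leadingCoeff b m) =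
      F.leadingCoeff b m := by
  classical
  have hpos : ∀ i, (∃ n : ℕ, 0 < n ∧ P.toLinearMap (P.root i) τ = n) → i ∈ posRoots b := by
    rintro i ⟨n, hn, hn'⟩
    refine (mem_posRoots_or b i).resolve_right fun h => ?_
    obtain ⟨l, h1, h2, -⟩ := hτ _ h
    rw [root_reflectionPerm_self, map_neg, LinearMap.neg_apply, hn'] at h1
    have : -(n : ℤ) = l := by exact_mod_cast h1
    omega
  have e1 : (Finset.univ.filter fun i => ∃ n : ℕ, 0 < n ∧ P.root' i τ = n) =
      (posRoots b).filter fun i => ∃ n : ℕ, 0 < n ∧ P.toLinearMap (P.root i) τ = n := by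
    ext i
    simp only [Finset.mem_filter, Finset.mem_univ, true_and]
    exact ⟨fun h => ⟨hpos i h, h⟩, fun h => h.2⟩
  have e2 : (Finset.univ.filter fun i => P.root' i τ = 2) =
      (posRoots b).filter fun i => P.toLinearMap (P.root i) τ = 2 := by
    ext i
    simp only [Finset.mem_filter, Finset.mem_univ, true_and]
    exact ⟨fun h => ⟨hpos i ⟨2, two_pos, by simpa using h⟩, h⟩, fun h => h.2⟩
  have e3 : macdonaldCoeff F (fun i => -(m i : ℂ)) τ =
      (∏ i ∈ (posRoots b).filter fun i => ∃ n : ℕ, 0 < n ∧ P.toLinearMap (P.root i) τ = n,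
        F.bracket i (-(m i : ℂ)) / F.bracket i 0) *
      ∏ i ∈ (posRoots b).filter fun i => P.toLinearMap (P.root i) τ = 2,
        F.bracket i (-(m i : ℂ) + 1) / F.bracket i 1 := by
    rw [← e1, ← e2, macdonaldCoeff]
  rw [e3, Finset.prod_filter, Finset.prod_filter, leadingCoeff, map_prod, ← Finset.prod_mul_distrib,
    ← Finset.prod_mul_distrib]
  refine Finset.prod_congr rfl fun i hi => ?_
  set g : ℂ → L := fun c => F.bracket (P.reflectionPerm i i) c with hg
  have hgb : ∀ c, F.bracket i c = -g (-c) := fun c => by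
    simp only [hg]
    rw [bracket_neg, neg_neg, neg_neg]
  have hg0 : ∀ c, g c ≠ 0 := fun c => F.bracket_ne_zero hq _ _
  obtain ⟨n, hn, h0, h2⟩ := hτ i hi
  have hT : F.T τ (∏ j ∈ Finset.Icc 1 (m i), F.bracket (P.reflectionPerm i i) (j : ℂ)) =
      ∏ j ∈ Finset.Icc 1 (m i), g ((j : ℂ) - n) := by
    rw [map_prod]
    refine Finset.prod_congr rfl fun j _ => ?_
    rw [T_bracket, root_reflectionPerm_self, map_neg, LinearMap.neg_apply, hn, ← sub_eq_add_neg]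
  rw [hT, hn]
  have hm1 := prod_sub_one_mul g (m i)
  have hm2 := prod_sub_one_mul (fun c => g (c - 1)) (m i)
  have hA : F.bracket i (-(m i : ℂ)) / F.bracket i 0 = g (m i) / g 0 := by
    rw [hgb, hgb, neg_neg, neg_zero, neg_div_neg_eq]
  have hB : F.bracket i (-(m i : ℂ) + 1) / F.bracket i 1 = g ((m i : ℂ) - 1) / g (-1) := by
    rw [hgb, hgb, neg_div_neg_eq, neg_add, neg_neg, ← sub_eq_add_neg]
  have hi0 : n = 0 ∨ n = 1 ∨ n = 2 := by omega
  rcases hi0 with rfl | rfl | rfl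
  · rw [if_neg, if_neg]
    · simp [hg]
    · simp
    · rintro ⟨n, hn, h⟩
      have : (0 : ℤ) = n := by exact_mod_cast h
      omega
  · rw [if_pos ⟨1, one_pos, by simp⟩, if_neg (by norm_num), hA, mul_one, Int.cast_one,
      div_mul_eq_mul_div, mul_comm, hm1, mul_div_assoc, div_self (hg0 0), mul_one]
  · rw [if_pos ⟨2, two_pos, by simp⟩, if_pos (by norm_num), hA, hB]
    have e : ∀ j : ℕ, g ((j : ℂ) - (2 : ℤ)) = g ((j : ℂ) - 1 - 1) := fun j => by
      congr 1
      push_cast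
      ring
    simp only [e]
    simp only [zero_sub] at hm2
    have h3 := hg0 0
    have h4 := hg0 (-1)
    rw [div_mul_div_comm, div_mul_eq_mul_div, div_eq_iff (mul_ne_zero h3 h4)]
    calc g (m i) * g ((m i : ℂ) - 1) * ∏ j ∈ Finset.Icc 1 (m i), g ((j : ℂ) - 1 - 1)
        = ((∏ j ∈ Finset.Icc 1 (m i), g ((j : ℂ) - 1 - 1)) * g ((m i : ℂ) - 1)) * g (m i) := by ring
      _ = ((∏ j ∈ Finset.Icc 1 (m i), g ((j : ℂ) - 1)) * g (m i)) * g (-1) := by rw [hm2]; ring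
      _ = _ := by rw [hm1]; ring

variable [P.IsRootSystem]

theorem sub_mem_corootLattice_of_mem_weylOrbit {π τ : N} (hπ : π ∈ coweightLattice P)
    (h : τ ∈ weylOrbit P π) : τ - π ∈ corootLattice P := by
  obtain ⟨w, hw, rfl⟩ := mem_weylOrbit.1 h
  clear h
  have key : ∀ j, ∀ π ∈ coweightLattice P, P.coreflection j π - π ∈ corootLattice P := by
    intro j π hπ
    obtain ⟨n, hn⟩ := hπ j
    rw [P.coreflection_apply, sub_sub_cancel_left]
    change -(P.toLinearMap (P.root j) π • _) ∈ _
    rw [hn, Int.cast_smul_eq_zsmul]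
    exact neg_mem (zsmul_mem (coroot_mem_corootLattice j) n)
  induction hw using Subgroup.closure_induction'' generalizing π with
  | one => simp
  | mem w hw =>
    obtain ⟨j, rfl⟩ := hw
    exact key j π hπ
  | inv_mem w hw =>
    obtain ⟨j, rfl⟩ := hw
    rw [P.coreflection_inv]
    exact key j π hπ
  | mul u v _ _ hu hv =>
    have h1 := hv hπ
    have h2 : v π ∈ coweightLattice P := by
      have := add_mem (corootLattice_le h1) hπ
      rwa [sub_add_cancel] at this
    have h3 := add_mem (hu h2) h1
    rwa [sub_add_sub_cancel] at h3

theorem root_apply_nonneg_of_height_le {π τ₀ : N} (h₀ : τ₀ ∈ weylOrbit P π)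
    (hmax : ∀ τ ∈ weylOrbit P π, height b τ ≤ height b τ₀) {i : ι} (hi : i ∈ posRoots b) {n : ℤ}
    (hn : P.toLinearMap (P.root i) τ₀ = n) : 0 ≤ n := by
  have h1 := hmax _ (coreflection_mem_weylOrbit i h₀)
  rw [P.coreflection_apply] at h1
  change height b (τ₀ - P.toLinearMap (P.root i) τ₀ • P.coroot i) ≤ _ at h1
  rw [hn, Int.cast_smul_eq_zsmul, map_sub, map_zsmul, sub_le_self_iff, zsmul_eq_mul] at h1
  have := nonneg_of_mul_nonneg_left h1 (height_coroot_pos b hi)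
  exact_mod_cast this

variable [P.IsIrreducible] [Nonempty ι]

/-- The difference of a Macdonald operator and the operator of the orbit sum has lower order. -/
theorem IsBakerAkhiezer.exists_remainder (hq : ∀ n : ℤ, qPow logq n = 1 → n = 0)
    (hm : ∀ i j, m (P.reflectionPerm i j) = m j) {c : N →₀ L}
    (hc : IsBakerAkhiezer F b m c) (hcρ : c (rhoCheck b m) = F.leadingCoeff b m) {π τ₀ : N}
    (hπ : ∀ i, ∃ n : ℤ, P.toLinearMap (P.root i) π = n ∧ -2 ≤ n ∧ n ≤ 2)
    (hmax : ∀ τ ∈ weylOrbit P π, height b τ ≤ height b τ₀) {e : L}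
    (he : e = 0 ∨ (0 < height b τ₀ ∧ π ∈ corootLattice P)) :
    ∃ d : N →₀ L, (∀ ν ∈ d.support, ν - π ∈ corootLattice P ∧ height b ν < height b τ₀) ∧
      ∀ z, F.diffOp d (F.ev c z) =
        ∑ τ ∈ weylOrbit P π, macdonaldCoeff F (fun i => -(m i : ℂ)) τ * F.T τ (F.ev c z) +
          e * F.ev c z - orbitSum P logq π z • F.ev c z := by
  classical
  set a := macdonaldCoeff F (fun i => -(m i : ℂ)) with ha
  have hne : c ≠ 0 := by
    rintro rfl
    exact F.leadingCoeff_ne_zero b m hq hcρ.symm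
  have hπP : π ∈ coweightLattice P := fun i => let ⟨n, hn, _⟩ := hπ i; ⟨n, hn⟩
  have hterm : ∀ τ : N, ∃ γ : N →₀ L,
      F.ev γ = (fun z => a τ * F.T τ (F.ev c z) - zExp P logq τ z • F.ev c z) ∧
      ∀ μ, γ μ = a τ * F.T τ (c (μ - τ)) - c (μ - τ) := by
    intro τ
    obtain ⟨γ₁, h1, h2⟩ := F.exists_ev_eq_diffOp c (Finsupp.single τ (a τ))
    obtain ⟨γ₂, h3, h4⟩ := F.exists_ev_eq_affine_smul τ 1 0 c
    refine ⟨γ₁ - γ₂, ?_, fun μ => ?_⟩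
    · rw [ev_sub, h1, h3]
      funext z
      simp [diffOp_single]
    · rw [Finsupp.sub_apply, h2, h4, Finsupp.sum_single_index (by simp)]
      simp
  choose γ hγ hγ' using hterm
  set Γ : N →₀ L := ∑ τ ∈ weylOrbit P π, γ τ + e • c with hΓ
  have hev : F.ev Γ = fun z => ∑ τ ∈ weylOrbit P π, a τ * F.T τ (F.ev c z) + e * F.ev c z -
      orbitSum P logq π z • F.ev c z := by
    funext z
    rw [hΓ, ev_add, Pi.add_apply, ev_smul, ← evLin_apply, map_sum, Finset.sum_apply, orbitSum,
      Finset.sum_apply, Finset.sum_smul, add_sub_right_comm, ← Finset.sum_sub_distrib]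
    simp only [evLin_apply, hγ]
  have hQ : QuasiInvariant P logq m (F.ev Γ) := by
    intro i s h1 h2 z hz
    rw [hev]
    simp only
    rw [hc.quasiInvariant i s h1 h2 z hz,
      (orbitSum_mem_quasiInvariants (logq := logq) m hπ).2 i s h1 h2 z hz]
  have hsupp : ∀ μ ∈ Γ.support, μ - rhoCheck b m - π ∈ corootLattice P ∧
      height b μ < height b τ₀ + height b (rhoCheck b m) := by
    intro μ hμ
    rcases Finset.mem_union.1 (Finsupp.support_add hμ) with h | h
    · rw [Finsupp.mem_support_iff, Finsupp.finsetSum_apply] at h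
      obtain ⟨τ, hτ, h⟩ := Finset.exists_ne_zero_of_sum_ne_zero h
      rw [hγ'] at h
      have h1 : c (μ - τ) ≠ 0 := fun h0 => h (by rw [h0, map_zero, mul_zero, sub_zero])
      have h2 := Finsupp.mem_support_iff.2 h1
      refine ⟨?_, ?_⟩
      · have := add_mem (hc.sub_rhoCheck_mem hq hm h2)
          (sub_mem_corootLattice_of_mem_weylOrbit hπP hτ)
        convert this using 1
        abel
      · by_contra hle
        have h3 := (hc.supp _ h2).2
        have h4 := height_le_of_mem_polytope h3
        have h5 := hmax τ hτ
        rw [map_sub] at h4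
        -- A term of the top height comes only from the vertex ρᵛ and a τ of maximal height; such a
        -- τ is dominant, and the two contributions cancel.
        have h6 := eq_rhoCheck_of_mem_polytope h3 (by rw [map_sub]; linarith)
        have h7 : height b τ = height b τ₀ := by linarith
        rw [h6, hcρ, macdonaldCoeff_mul_T_leadingCoeff hq, sub_self] at h
        · exact h rfl
        · intro i hi
          obtain ⟨n, hn, -, hn2⟩ := exists_root_apply_of_mem_weylOrbit (K := 2) hπ hτ i
          exact ⟨n, hn, root_apply_nonneg_of_height_le hτ (h7 ▸ hmax) hi hn, hn2⟩
    · have h1 := Finsupp.support_smul h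
      rw [Finsupp.mem_support_iff, Finsupp.smul_apply, smul_eq_mul] at h
      obtain ⟨h2, h3⟩ := he.resolve_left (left_ne_zero_of_mul h)
      exact ⟨sub_mem (hc.sub_rhoCheck_mem hq hm h1) h3, by
        linarith [height_le_of_mem_polytope (hc.supp _ h1).2]⟩
  obtain ⟨t, ht, ht'⟩ : ∃ t, t < height b τ₀ ∧
      ∀ μ ∈ Γ.support, height b μ ≤ t + height b (rhoCheck b m) := by
    rcases Γ.support.eq_empty_or_nonempty with h | h
    · exact ⟨height b τ₀ - 1, by linarith, by simp [h]⟩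
    · obtain ⟨μ, hμ, hmx⟩ := Finset.exists_max_image _ (height b) h
      exact ⟨height b μ - height b (rhoCheck b m), by linarith [(hsupp μ hμ).2], fun ν hν => by
        linarith [hmx ν hν]⟩
  obtain ⟨d, hd, hd'⟩ := hc.exists_diffOp_eq hq hm hne (S := {ν | ν - π ∈ corootLattice P})
    (fun ν hν => by
      have := add_mem (corootLattice_le hν) hπP
      rwa [sub_add_cancel] at this)
    (fun μ hμ κ hκ => by
      rw [Set.mem_ofPred_eq] at *
      have := add_mem hμ hκ
      convert this using 1
      abel) (fun μ hμ => (hsupp μ hμ).1) hQ ht'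
  exact ⟨d, fun ν hν => ⟨(hd ν hν).1, (hd ν hν).2.trans_lt ht⟩, fun z => by rw [hd', hev]⟩

theorem CharacterField.exists_diffOp_σ (F : CharacterField P logq L) (i : ι) (d : N →₀ L) :
    ∃ d' : N →₀ L, (∀ f, F.diffOp d' (F.σ i f) = F.σ i (F.diffOp d f)) ∧
      ∀ ν, d' ν = F.σ i (d (P.coreflection i ν)) := by
  classical
  refine ⟨(d.mapRange (F.σ i) (map_zero _)).equivMapDomain (P.coreflection i).toEquiv, fun f => ?_,
    fun ν => ?_⟩
  · rw [diffOp_apply, diffOp_apply, Finsupp.equivMapDomain_eq_mapDomain,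
      Finsupp.sum_mapDomain_index (by simp) (by simp [add_mul]),
      Finsupp.sum_mapRange_index (by simp), Finsupp.sum, Finsupp.sum, map_sum]
    refine Finset.sum_congr rfl fun ν _ => ?_
    rw [map_mul, F.σ_T]
    rfl
  · rw [Finsupp.equivMapDomain_apply, Finsupp.mapRange_apply]
    congr 2

/-- Conjugating the remainder by a reflection leaves the Macdonald sum and the orbit sum unchanged
and replaces e by its image. The support away from 0 is therefore W-stable, and the bound on heights
holds on whole orbits. -/
theorem IsBakerAkhiezer.mem_lowSet_of_mem_support (hq : ∀ n : ℤ, qPow logq n = 1 → n = 0)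
    (hm : ∀ i j, m (P.reflectionPerm i j) = m j) {c : N →₀ L}
    (hc : IsBakerAkhiezer F b m c) (hcρ : c (rhoCheck b m) = F.leadingCoeff b m) {π : N} {t : ℝ}
    {e : L} {d : N →₀ L} (ht : ∀ ν ∈ d.support, height b ν < t)
    (hd : ∀ z, F.diffOp d (F.ev c z) =
        ∑ τ ∈ weylOrbit P π, macdonaldCoeff F (fun i => -(m i : ℂ)) τ * F.T τ (F.ev c z) +
          e * F.ev c z - orbitSum P logq π z • F.ev c z) :
    ∀ ν ∈ d.support, ν ∈ lowSet b t := by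
  have hne : c ≠ 0 := by
    rintro rfl
    exact F.leadingCoeff_ne_zero b m hq hcρ.symm
  have hsimple : ∀ i ∈ b.support, ∀ ν ∈ d.support, P.coreflection i ν ∈ d.support := by
    intro i hi ν hν
    rcases eq_or_ne ν 0 with rfl | h0
    · rwa [map_zero]
    obtain ⟨d', h1, h2⟩ := F.exists_diffOp_σ i d
    have h3 : ∀ z, F.σ i (F.ev c (P.reflection i z)) = F.ev c z := hc.σ_apply hq hm hcρ hi
    -- On ψ the conjugated operator differs from the original only by multiplication with σ_i(e) -
    -- e, and operators are determined by their action on ψ.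
    have h4 : d' - d - Finsupp.single 0 (F.σ i e - e) = 0 :=
      hc.diffOp_injective hq hne fun z => by
        rw [diffOp_sub, diffOp_sub, LinearMap.sub_apply, LinearMap.sub_apply, hd]
        nth_rewrite 1 [← h3 z]
        rw [h1, hd, map_sub, map_add, map_sum, map_mul, map_smul, h3, orbitSum_reflection,
          diffOp_single, ← sum_weylOrbit_coreflection i π fun τ =>
            macdonaldCoeff F (fun i => -(m i : ℂ)) τ * F.T τ (F.ev c z)]
        have h5 : ∀ τ, F.σ i (macdonaldCoeff F (fun i => -(m i : ℂ)) τ *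
            F.T τ (F.ev c (P.reflection i z))) =
            macdonaldCoeff F (fun i => -(m i : ℂ)) (P.coreflection i τ) *
              F.T (P.coreflection i τ) (F.ev c z) := fun τ => by
          rw [map_mul, σ_macdonaldCoeff (fun i j => by rw [hm]), F.σ_T, h3]
        simp only [h5, LinearMap.comp_apply, AlgEquiv.toLinearMap_apply, F.T_zero,
          LinearMap.mulLeft_apply]
        ring
    have h5 := DFunLike.congr_fun h4 ν
    rw [Finsupp.sub_apply, Finsupp.sub_apply, Finsupp.single_eq_of_ne h0, sub_zero,
      Finsupp.zero_apply, h2, sub_eq_zero] at h5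
    rw [Finsupp.mem_support_iff] at hν ⊢
    intro h6
    rw [h6, map_zero] at h5
    exact hν h5.symm
  have hall : ∀ i, ∀ ν ∈ d.support, P.coreflection i ν ∈ d.support := by
    intro i
    induction i using b.induction_reflect with
    | h₀ i ih =>
      intro ν hν
      have e : P.coreflection (P.reflectionPerm i i) ν = P.coreflection i ν := by
        rw [P.coreflection_apply, P.coreflection_apply, coroot_reflectionPerm_self, smul_neg,
          ← neg_smul]
        change ν - (-P.toLinearMap (P.root (P.reflectionPerm i i)) ν) • _ = _
        rw [root_reflectionPerm_self, map_neg, LinearMap.neg_apply, neg_neg]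
      rw [e]
      exact ih ν hν
    | h₁ i hi => exact hsimple i hi
    | h₂ i k ih hk =>
      intro ν hν
      have := hsimple k hk _ (ih _ (hsimple k hk ν hν))
      have e : P.coreflection (P.reflectionPerm k i) ν =
          P.coreflection k (P.coreflection i (P.coreflection k ν)) := by
        have h1 := root_coreflection (P := P) i k (P.coreflection k ν)
        rw [P.coreflection_same] at h1
        rw [P.coreflection_apply (P.reflectionPerm k i), P.coreflection_apply i, map_sub, map_smul,
          P.coreflection_same, P.coroot_reflectionPerm]
        change ν - P.toLinearMap (P.root (P.reflectionPerm k i)) ν • _ = _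
        rw [h1]
      rw [e]
      exact this
  intro ν hν w hw
  refine ht _ ?_
  induction hw using Subgroup.closure_induction'' generalizing ν with
  | one => exact hν
  | mem w hw =>
    obtain ⟨j, rfl⟩ := hw
    exact hall j ν hν
  | inv_mem w hw =>
    obtain ⟨j, rfl⟩ := hw
    rw [P.coreflection_inv]
    exact hall j ν hν
  | mul u v _ _ hu hv => exact hu _ (hv ν hν)

/-- The support of the remainder would lie in the coset of π and have all its orbits strictly below
that of π; there are no such elements. -/
theorem IsBakerAkhiezer.sum_macdonaldCoeff_of_isMinuscule
    (hq : ∀ n : ℤ, qPow logq n = 1 → n = 0) (hm : ∀ i j, m (P.reflectionPerm i j) = m j)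
    {c : N →₀ L} (hc : IsBakerAkhiezer F b m c) (hcρ : c (rhoCheck b m) = F.leadingCoeff b m)
    {π : N} (hπ : IsMinuscule P π) (z : M) :
    ∑ τ ∈ weylOrbit P π, macdonaldCoeff F (fun i => -(m i : ℂ)) τ * F.T τ (F.ev c z) =
      orbitSum P logq π z • F.ev c z := by
  obtain ⟨τ₀, h₀, hmax⟩ := Finset.exists_max_image (weylOrbit P π) (height b)
    ⟨π, self_mem_weylOrbit π⟩
  obtain ⟨d, hd, hd'⟩ := hc.exists_remainder hq hm hcρ (fun i => by
    obtain ⟨n, h1, h2, h3⟩ := hπ i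
    exact ⟨n, h1, by omega, by omega⟩) hmax (e := 0) (.inl rfl)
  have h1 := hc.mem_lowSet_of_mem_support hq hm hcρ (fun ν hν => (hd ν hν).2) hd'
  have h2 : d = 0 := by
    rw [← Finsupp.support_eq_empty, Finset.eq_empty_iff_forall_notMem]
    exact fun ν hν => notMem_lowSet_of_isMinuscule hπ h₀ rfl (hd ν hν).1 (h1 ν hν)
  have h3 := hd' z
  rw [h2, diffOp_zero, LinearMap.zero_apply, zero_mul, add_zero] at h3
  exact (sub_eq_zero.1 h3.symm)

/-- Only the shift 0 is left, so the remainder is multiplication by d 0. At z = ρ every T^τ - 1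
kills the nonzero value ψ(x, ρ), and the constant term of the operator equals the orbit sum at ρ;
hence d 0 = 0. -/
theorem IsBakerAkhiezer.sum_macdonaldCoeff_of_isQuasiminuscule
    (hq : ∀ n : ℤ, qPow logq n = 1 → n = 0) (hm : ∀ i j, m (P.reflectionPerm i j) = m j)
    {c : N →₀ L} (hc : IsBakerAkhiezer F b m c) (hcρ : c (rhoCheck b m) = F.leadingCoeff b m)
    {π : N} (hπ : IsQuasiminuscule P π) (z : M) :
    ∑ τ ∈ weylOrbit P π, macdonaldCoeff F (fun i => -(m i : ℂ)) τ *
        (F.T τ (F.ev c z) - F.ev c z) +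
      (∑ τ ∈ weylOrbit P π, qPow logq (-2 * P.toLinearMap (rho b fun i => -(m i : ℂ)) τ)) •
        F.ev c z = orbitSum P logq π z • F.ev c z := by
  obtain ⟨j, rfl, hj⟩ := hπ
  set a := macdonaldCoeff F (fun i => -(m i : ℂ)) with ha
  set s := ∑ τ ∈ weylOrbit P (P.coroot j),
    qPow logq (-2 * P.toLinearMap (rho b fun i => -(m i : ℂ)) τ) with hs
  obtain ⟨τ₀, h₀, hmax⟩ := Finset.exists_max_image (weylOrbit P (P.coroot j)) (height b)
    ⟨_, self_mem_weylOrbit _⟩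
  have hpos : 0 < height b τ₀ := by
    have h1 := hmax _ (self_mem_weylOrbit _)
    have h2 := hmax _ (coreflection_mem_weylOrbit j (self_mem_weylOrbit _))
    rw [P.coreflection_apply_self, map_neg] at h2
    have h3 := height_coroot_ne_zero (b := b) j
    rcases lt_or_gt_of_ne h3 with h | h <;> linarith
  obtain ⟨d, hd, hd'⟩ := hc.exists_remainder hq hm hcρ
    (exists_root_apply_of_isQuasiminuscule hj) hmax (e := algebraMap ℂ L s - ∑ τ ∈ weylOrbit P (P.coroot j), a τ)
    (.inr ⟨hpos, coroot_mem_corootLattice j⟩)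
  have h1 := hc.mem_lowSet_of_mem_support hq hm hcρ (fun ν hν => (hd ν hν).2) hd'
  have h2 : d = Finsupp.single 0 (d 0) := by
    rw [Finsupp.eq_single_iff]
    refine ⟨fun ν hν => ?_, rfl⟩
    rw [Finset.mem_singleton]
    have := add_mem (hd ν hν).1 (coroot_mem_corootLattice j)
    rw [sub_add_cancel] at this
    exact eq_zero_of_mem_lowSet hj h₀ rfl this (h1 ν hν)
  have hdz : ∀ f, F.diffOp d f = d 0 * f := fun f => by
    rw [h2, diffOp_single]
    simp [F.T_zero]
  have key : ∀ z, d 0 * F.ev c z = ∑ τ ∈ weylOrbit P (P.coroot j), a τ *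
      (F.T τ (F.ev c z) - F.ev c z) + s • F.ev c z -
        orbitSum P logq (P.coroot j) z • F.ev c z := by
    intro z
    rw [← hdz, hd', sub_mul, Finset.sum_mul]
    simp only [mul_sub, Finset.sum_sub_distrib, Algebra.smul_def]
    ring
  have hd0 : d 0 = 0 := by
    have hne : c ≠ 0 := by
      rintro rfl
      exact F.leadingCoeff_ne_zero b m hq hcρ.symm
    have h3 := key (rho b fun i => (m i : ℂ))
    rw [Finset.sum_eq_zero, zero_add] at h3
    · have h4 : s = orbitSum P logq (P.coroot j) (rho b fun i => (m i : ℂ)) := by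
        rw [hs, orbitSum, Finset.sum_apply]
        refine Finset.sum_congr rfl fun τ _ => ?_
        have : rho b (fun i => -(m i : ℂ)) = -rho b fun i => (m i : ℂ) := by
          simp [rho]
        rw [this, zExp]
        simp
      rw [h4, sub_self] at h3
      exact (mul_eq_zero.1 h3).resolve_right (hc.ev_rho_ne_zero_of_leadingCoeff hq hm hne)
    · intro τ hτ
      obtain ⟨i, rfl⟩ : ∃ i, τ = P.coroot i := by
        obtain ⟨w, hw, rfl⟩ := mem_weylOrbit.1 hτ
        clear hτ
        clear_value s a
        generalize j = k
        induction hw using Subgroup.closure_induction'' generalizing k with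
        | one => exact ⟨k, rfl⟩
        | mem w hw =>
          obtain ⟨l, rfl⟩ := hw
          exact ⟨_, (P.coroot_reflectionPerm l k).symm⟩
        | inv_mem w hw =>
          obtain ⟨l, rfl⟩ := hw
          rw [P.coreflection_inv]
          exact ⟨_, (P.coroot_reflectionPerm l k).symm⟩
        | mul u v _ _ hu hv =>
          obtain ⟨k', hk'⟩ := hv k
          obtain ⟨l, hl⟩ := hu k'
          exact ⟨l, by rw [← hl, ← hk']; rfl⟩
      rw [hc.T_ev_rho hq hm hcρ i, sub_self, mul_zero]
  have h3 := key z
  rw [hd0, zero_mul] at h3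
  exact sub_eq_zero.1 h3.symm

end Macdonald

end BakerAkhiezer

end

/-! ### The field of meromorphic functions and the main theorem. -/

noncomputable section

namespace BakerAkhiezer

open Module

section MeromorphicFunctions

variable {E : Type*} [NormedAddCommGroup E] [NormedSpace ℂ E]

/-- The composition of entire functions with an invertible linear map. -/
def compEntire [FiniteDimensional ℂ E] (e : E ≃ₗ[ℂ] E) : Entire E ≃ₐ[ℂ] Entire E where
  toFun f := ⟨fun x => f.1 (e x), f.2.comp (LinearMap.toContinuousLinearMap
    (e : E →ₗ[ℂ] E)).differentiable⟩
  invFun f := ⟨fun x => f.1 (e.symm x), f.2.comp (LinearMap.toContinuousLinearMap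
    (e.symm : E →ₗ[ℂ] E)).differentiable⟩
  left_inv f := Subtype.ext (funext fun x => by simp)
  right_inv f := Subtype.ext (funext fun x => by simp)
  map_mul' _ _ := rfl
  map_add' _ _ := rfl
  commutes' _ := rfl

/-- The composition of meromorphic functions with an invertible linear map. -/
def compMero [FiniteDimensional ℂ E] (e : E ≃ₗ[ℂ] E) : Mero E ≃ₐ[ℂ] Mero E :=
  IsFractionRing.algEquivOfAlgEquiv (compEntire e)

theorem shift_algebraMap (v : E) (f : Entire E) :
    shift v (algebraMap (Entire E) (Mero E) f) = algebraMap (Entire E) (Mero E) (shiftEntire v f) :=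
  IsFractionRing.algEquivOfAlgEquiv_algebraMap _ f

theorem compMero_algebraMap [FiniteDimensional ℂ E] (e : E ≃ₗ[ℂ] E) (f : Entire E) :
    compMero e (algebraMap (Entire E) (Mero E) f) =
      algebraMap (Entire E) (Mero E) (compEntire e f) :=
  IsFractionRing.algEquivOfAlgEquiv_algebraMap _ f

theorem Mero.algEquiv_ext {φ φ' : Mero E ≃ₐ[ℂ] Mero E}
    (h : ∀ f : Entire E, φ (algebraMap (Entire E) (Mero E) f) =
      φ' (algebraMap (Entire E) (Mero E) f)) : φ = φ' := by
  refine AlgEquiv.ext fun f => ?_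
  obtain ⟨x, y, _, rfl⟩ := IsFractionRing.div_surjective (A := Entire E) f
  rw [map_div₀, map_div₀, h, h]

theorem shift_zero : shift (0 : E) = AlgEquiv.refl := Mero.algEquiv_ext fun f => by
  rw [shift_algebraMap]
  exact congrArg _ (Subtype.ext (funext fun x => congrArg f.1 (add_zero x)))

theorem shift_add (u v : E) : shift (u + v) = (shift v).trans (shift u) :=
  Mero.algEquiv_ext fun f => by
    rw [AlgEquiv.trans_apply, shift_algebraMap, shift_algebraMap, shift_algebraMap]
    exact congrArg _ (Subtype.ext (funext fun x => congrArg f.1 (add_assoc x u v).symm))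

theorem Mero.smul_algebraMap (a : ℂ) (f : Entire E) :
    a • algebraMap (Entire E) (Mero E) f = algebraMap (Entire E) (Mero E) (a • f) := by
  rw [Algebra.smul_def a f, map_mul, Algebra.smul_def,
    IsScalarTower.algebraMap_apply ℂ (Entire E) (Mero E)]

variable [FiniteDimensional ℂ E]

theorem shift_trans_compMero (e : E ≃ₗ[ℂ] E) (v : E) :
    (shift (e v)).trans (compMero e) = (compMero e).trans (shift v) :=
  Mero.algEquiv_ext fun f => by
    rw [AlgEquiv.trans_apply, AlgEquiv.trans_apply, shift_algebraMap, compMero_algebraMap,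
      compMero_algebraMap, shift_algebraMap]
    exact congrArg _ (Subtype.ext (funext fun x => congrArg f.1 (map_add e x v).symm))

theorem compMero_trans_self {e : E ≃ₗ[ℂ] E} (he : ∀ x, e (e x) = x) :
    (compMero e).trans (compMero e) = AlgEquiv.refl :=
  Mero.algEquiv_ext fun f => by
    rw [AlgEquiv.trans_apply, compMero_algebraMap, compMero_algebraMap]
    exact congrArg _ (Subtype.ext (funext fun x => congrArg f.1 (he x)))

theorem qExp_add (logq c c' : ℂ) (ℓ ℓ' : Dual ℂ E) :
    qExp logq (c + c') (ℓ + ℓ') = qExp logq c ℓ * qExp logq c' ℓ' := by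
  rw [qExp, qExp, qExp, ← map_mul]
  congr 1
  refine Subtype.ext (funext fun x => ?_)
  change Complex.exp _ = Complex.exp _ * Complex.exp _
  rw [← Complex.exp_add, LinearMap.add_apply]
  congr 1
  ring

theorem qExp_zero (logq : ℂ) : qExp logq 0 (0 : Dual ℂ E) = 1 := by
  rw [qExp, ← map_one (algebraMap (Entire E) (Mero E))]
  congr 1
  refine Subtype.ext (funext fun x => ?_)
  change Complex.exp _ = 1
  simp

theorem qExp_eq_smul (logq c : ℂ) (ℓ : Dual ℂ E) :
    qExp logq c ℓ = qPow logq c • qExp logq 0 ℓ := by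
  rw [qExp, qExp, Mero.smul_algebraMap]
  congr 1
  refine Subtype.ext (funext fun x => ?_)
  change Complex.exp _ = Complex.exp _ * Complex.exp _
  rw [← Complex.exp_add]
  congr 1
  ring

theorem shift_qExp (logq : ℂ) (v : E) (ℓ : Dual ℂ E) :
    shift v (qExp logq 0 ℓ) = qPow logq (ℓ v) • qExp logq 0 ℓ := by
  rw [← qExp_eq_smul, qExp, qExp, shift_algebraMap]
  congr 1
  refine Subtype.ext (funext fun x => ?_)
  change Complex.exp _ = Complex.exp _
  rw [map_add]
  congr 1
  ring

theorem compMero_qExp (logq : ℂ) (e : E ≃ₗ[ℂ] E) (ℓ : Dual ℂ E) :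
    compMero e (qExp logq 0 ℓ) = qExp logq 0 (ℓ ∘ₗ e) := by
  rw [qExp, qExp, compMero_algebraMap]
  rfl

end MeromorphicFunctions

section Specialization

variable {ι M N : Type*} [AddCommGroup M] [Module ℂ M] [NormedAddCommGroup N] [NormedSpace ℂ N]
  [FiniteDimensional ℂ N]

/-- The field of meromorphic functions of `x`. -/
def meroCharacterField (P : RootPairing ι ℂ M N) (logq : ℂ) :
    CharacterField P logq (Mero N) where
  X v := qExp logq 0 (2 • P.toLinearMap v)
  X_zero := by rw [map_zero, smul_zero, qExp_zero]
  X_add u v := by rw [map_add, smul_add, ← qExp_add, add_zero]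
  T := shift
  T_zero f := by rw [shift_zero]; rfl
  T_add u v f := by rw [shift_add]; rfl
  T_X v u := by
    rw [shift_qExp, zExp]
    congr 2
    simp
  σ i := compMero (P.coreflection i)
  σ_X i v := by
    rw [compMero_qExp]
    congr 1
    ext x
    have := P.reflection_dualMap_eq_coreflection (i := i)
    have h := LinearMap.congr_fun (LinearMap.congr_fun this x) v
    simp only [LinearMap.comp_apply, LinearMap.smul_apply]
    exact congrArg _ h.symm
  σ_T i v f := by
    have := AlgEquiv.congr_fun (shift_trans_compMero (P.coreflection i) (P.coreflection i v)) f
    rwa [P.coreflection_same] at this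
  σ_σ i f := AlgEquiv.congr_fun (compMero_trans_self (P.coreflection_same i)) f

variable {P : RootPairing ι ℂ M N} {logq : ℂ}

theorem meroCharacterField_X (v : M) :
    (meroCharacterField P logq).X v = qExp logq 0 (2 • P.toLinearMap v) := rfl

theorem qBracket_root (i : ι) (c : ℂ) :
    qBracket logq c (P.root' i) = (meroCharacterField P logq).bracket i c := by
  have h : 2 • P.toLinearMap ((1 / 2 : ℂ) • P.root i) = P.root' i := by
    rw [← map_nsmul, two_nsmul, ← add_smul, add_halves, one_smul]
  rw [qBracket, CharacterField.bracket, qExp_eq_smul, qExp_eq_smul logq (-c), meroCharacterField_X,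
    meroCharacterField_X, map_neg, smul_neg, h]

theorem qBracket_neg_root (i : ι) (c : ℂ) :
    qBracket logq c (-P.root' i) =
      (meroCharacterField P logq).bracket (P.reflectionPerm i i) c := by
  rw [← qBracket_root]
  congr 1
  ext x
  change -P.toLinearMap (P.root i) x = P.toLinearMap (P.root (P.reflectionPerm i i)) x
  rw [root_reflectionPerm_self, map_neg, LinearMap.neg_apply]

theorem isRational_of_mem_rationals {r : Mero N} (h : r ∈ (meroCharacterField P logq).rationals) :
    IsRational P logq r := by
  have hspan : ∀ g ∈ Algebra.adjoin ℂ ((meroCharacterField P logq).X '' (weightLattice P : Set M)),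
      g ∈ xPolynomials P logq := by
    intro g hg
    rw [← Subalgebra.mem_toSubmodule, Algebra.adjoin_eq_span] at hg
    refine Submodule.span_mono (fun f hf => ?_) hg
    induction hf using Submonoid.closure_induction with
    | mem f hf => exact hf
    | one => exact ⟨0, zero_mem _, (meroCharacterField P logq).X_zero⟩
    | mul f f' _ _ hf hf' =>
      obtain ⟨u, hu, rfl⟩ := hf
      obtain ⟨v, hv, rfl⟩ := hf'
      exact ⟨u + v, add_mem hu hv, (meroCharacterField P logq).X_add u v⟩
  obtain ⟨g, hg, g', hg', rfl⟩ := IntermediateField.mem_adjoin_iff_div.1 h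
  rcases eq_or_ne g' 0 with rfl | h0
  · exact ⟨0, zero_mem _, 1, hspan _ (one_mem _), one_ne_zero, by simp⟩
  · exact ⟨g, hspan _ hg, g', hspan _ hg', h0, rfl⟩

variable [Fintype ι] [P.IsReduced]

theorem coeffQuasiminuscule_eq (k : ι → ℂ) (τ : N) :
    coeffQuasiminuscule P logq k τ = macdonaldCoeff (meroCharacterField P logq) k τ := by
  simp only [coeffQuasiminuscule, coeffMinuscule, macdonaldCoeff, qBracket_root]

theorem coeffMinuscule_eq {k : ι → ℂ} {τ : N} (h : ∀ i, P.root' i τ ≠ 2) :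
    coeffMinuscule P logq k τ = macdonaldCoeff (meroCharacterField P logq) k τ := by
  rw [← coeffQuasiminuscule_eq, coeffQuasiminuscule, Finset.filter_false_of_mem fun i _ => h i,
    Finset.prod_empty, mul_one]

variable {b : P.Base} {m : ι → ℕ}

theorem isNormalizedBakerAkhiezer_iff {ψ : M → Mero N} :
    IsNormalizedBakerAkhiezer b logq m ψ ↔ ∃ c : N →₀ Mero N,
      IsBakerAkhiezer (meroCharacterField P logq) b m c ∧
      c (rhoCheck b m) = (meroCharacterField P logq).leadingCoeff b m ∧
      ψ = (meroCharacterField P logq).ev c := by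
  simp only [IsNormalizedBakerAkhiezer, qBracket_neg_root]
  constructor
  · rintro ⟨⟨c, h1, h2, h3⟩, h4⟩
    have h5 : ψ = (meroCharacterField P logq).ev c := funext h2
    subst h5
    exact ⟨c, ⟨h1, h4⟩, h3, rfl⟩
  · rintro ⟨c, ⟨h1, h4⟩, h3, rfl⟩
    exact ⟨⟨c, h1, fun z => rfl, h3⟩, h4⟩

end Specialization

end BakerAkhiezer

end

theorem mainTheorem3 {ι M N : Type*} [Fintype ι] [AddCommGroup M] [Module ℂ M]
    [NormedAddCommGroup N] [NormedSpace ℂ N] [FiniteDimensional ℂ N]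
    (P : RootPairing ι ℂ M N) [P.IsRootSystem] [P.IsCrystallographic] [P.IsReduced]
    [P.IsIrreducible] (b : P.Base)
    (m : ι → ℕ) (hm : ∀ i j, m (P.reflectionPerm i j) = m j)
    (q logq : ℂ) (hlogq : Complex.exp logq = q) (hq : ∀ n : ℕ, 0 < n → q ^ n ≠ 1) :
    ∃ ψ : M → BakerAkhiezer.Mero N,
      BakerAkhiezer.IsNormalizedBakerAkhiezer b logq m ψ ∧
      (∀ φ, BakerAkhiezer.IsNormalizedBakerAkhiezer b logq m φ → φ = ψ) ∧
      ∃ D : BakerAkhiezer.quasiInvariants P logq m → Module.End ℂ (BakerAkhiezer.Mero N),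
        (∀ f, BakerAkhiezer.IsDifferenceOperator P logq (D f) ∧
          (∀ z, D f (ψ z) = f.1 z • ψ z) ∧
          ∀ E, BakerAkhiezer.IsDifferenceOperator P logq E → (∀ z, E (ψ z) = f.1 z • ψ z) →
            E = D f) ∧
        (∀ f g, D f * D g = D g * D f) ∧
        (∀ π, BakerAkhiezer.IsMinuscule P π →
          ∃ h : BakerAkhiezer.orbitSum P logq π ∈ BakerAkhiezer.quasiInvariants P logq m,
            D ⟨_, h⟩ = BakerAkhiezer.macdonaldMinuscule P logq (fun i => -(m i : ℂ)) π) ∧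
        (∀ π, BakerAkhiezer.IsQuasiminuscule P π →
          ∃ h : BakerAkhiezer.orbitSum P logq π ∈ BakerAkhiezer.quasiInvariants P logq m,
            D ⟨_, h⟩ = BakerAkhiezer.macdonaldQuasiminuscule b logq (fun i => -(m i : ℂ)) π) := by
  have hq' : ∀ n : ℤ, BakerAkhiezer.qPow logq n = 1 → n = 0 := by
    intro n hn
    rw [BakerAkhiezer.qPow, Complex.exp_int_mul, hlogq] at hn
    obtain ⟨n, rfl | rfl⟩ := n.eq_nat_or_neg
    · rw [zpow_natCast] at hn
      by_contra h
      exact hq n (by omega) hn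
    · rw [zpow_neg, zpow_natCast, inv_eq_one] at hn
      by_contra h
      exact hq n (by omega) hn
  have hne : Nonempty ι := by
    by_contra h
    rw [not_nonempty_iff] at h
    have := RootPairing.IsIrreducible.nontrivial P
    have h1 := RootPairing.IsRootSystem.span_root_eq_top (P := P)
    rw [Set.range_eq_empty, Submodule.span_empty] at h1
    exact bot_ne_top h1
  set F := BakerAkhiezer.meroCharacterField P logq with hF
  obtain ⟨c, h1, hQ, hcρ⟩ := BakerAkhiezer.exists_bakerAkhiezer F b hq' hm (F.leadingCoeff b m)
  have hc : BakerAkhiezer.IsBakerAkhiezer F b m c := ⟨fun ν hν => ⟨by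
    have := add_mem (BakerAkhiezer.corootLattice_le (h1 ν hν).1)
      (BakerAkhiezer.rhoCheck_mem_coweightLattice b hm)
    rwa [sub_add_cancel] at this, (h1 ν hν).2⟩, hQ⟩
  have hc0 : c ≠ 0 := by
    rintro rfl
    exact F.leadingCoeff_ne_zero b m hq' hcρ.symm
  -- Operators that agree on ψ are equal; every equality of operators below follows from this.
  have huniq : ∀ d d' : N →₀ BakerAkhiezer.Mero N,
      (∀ z, F.diffOp d (F.ev c z) = F.diffOp d' (F.ev c z)) → F.diffOp d = F.diffOp d' := by
    intro d d' h
    rw [sub_eq_zero.1 (hc.diffOp_injective hq' hc0 (d := d - d') fun z => by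
      rw [F.diffOp_sub, LinearMap.sub_apply, h, sub_self])]
  choose d hd hd' using fun f : BakerAkhiezer.quasiInvariants P logq m =>
    hc.exists_diffOp hq' hm hcρ f.2
  refine ⟨F.ev c, BakerAkhiezer.isNormalizedBakerAkhiezer_iff.2 ⟨c, hc, hcρ, rfl⟩, fun φ hφ => ?_,
    fun f => F.diffOp (d f), fun f => ⟨⟨d f, fun ν hν => ⟨(hd f ν hν).1,
      BakerAkhiezer.isRational_of_mem_rationals (hd f ν hν).2⟩, rfl⟩, hd' f, fun E hE hE' => ?_⟩,
    fun f g => ?_, fun π hπ => ?_, fun π hπ => ?_⟩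
  · obtain ⟨c', hc', hc'ρ, rfl⟩ := BakerAkhiezer.isNormalizedBakerAkhiezer_iff.1 hφ
    rw [hc'.eq hq' hc (hc'ρ.trans hcρ.symm)]
  · obtain ⟨d', -, rfl⟩ := hE
    exact huniq d' (d f) fun z => (hE' z).trans (hd' f z).symm
  -- Both products are difference operators and multiply ψ by f(z)g(z).
  · obtain ⟨e, he⟩ := F.exists_diffOp_eq_mul (d f) (d g)
    obtain ⟨e', he'⟩ := F.exists_diffOp_eq_mul (d g) (d f)
    simp only
    rw [← he, ← he']
    refine huniq e e' fun z => ?_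
    rw [he, he', Module.End.mul_apply, Module.End.mul_apply, hd', hd', map_smul, map_smul, hd', hd',
      smul_comm]
  · have hπ2 : ∀ i, ∃ n : ℤ, P.toLinearMap (P.root i) π = n ∧ -1 ≤ n ∧ n ≤ 1 := hπ
    refine ⟨BakerAkhiezer.orbitSum_mem_quasiInvariants m hπ2, ?_⟩
    have hE : BakerAkhiezer.macdonaldMinuscule P logq (fun i => -(m i : ℂ)) π =
        F.diffOp (∑ τ ∈ BakerAkhiezer.weylOrbit P π, Finsupp.single τ
          (BakerAkhiezer.macdonaldCoeff F (fun i => -(m i : ℂ)) τ)) := by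
      rw [F.diffOp_sum, BakerAkhiezer.macdonaldMinuscule]
      refine Finset.sum_congr rfl fun τ hτ => ?_
      rw [F.diffOp_single, BakerAkhiezer.coeffMinuscule_eq]
      · rfl
      -- On a minuscule orbit no pairing equals 2, so the second product in `macdonaldCoeff` is
      -- empty.
      · intro i hi
        obtain ⟨n, hn, -, hn1⟩ := BakerAkhiezer.exists_root_apply_of_mem_weylOrbit hπ2 hτ i
        have h3 : (n : ℂ) = 2 := hn.symm.trans hi
        have h4 : n = 2 := by exact_mod_cast h3
        omega
    rw [hE]
    refine huniq _ _ fun z => ?_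
    rw [hd', ← hc.sum_macdonaldCoeff_of_isMinuscule hq' hm hcρ hπ z, F.diffOp_sum,
      LinearMap.sum_apply]
    exact Finset.sum_congr rfl fun τ _ => by rw [F.diffOp_single]; rfl
  · obtain ⟨j, hj, hj'⟩ := id hπ
    have hπ2 : ∀ i, ∃ n : ℤ, P.toLinearMap (P.root i) π = n ∧ -2 ≤ n ∧ n ≤ 2 := by
      rw [hj]
      exact BakerAkhiezer.exists_root_apply_of_isQuasiminuscule (hj ▸ hj')
    refine ⟨BakerAkhiezer.orbitSum_mem_quasiInvariants m hπ2, ?_⟩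
    obtain ⟨e, he⟩ : ∃ e, BakerAkhiezer.macdonaldQuasiminuscule b logq (fun i => -(m i : ℂ)) π =
        F.diffOp e := by
      refine ⟨∑ τ ∈ BakerAkhiezer.weylOrbit P π, (Finsupp.single τ
          (BakerAkhiezer.coeffQuasiminuscule P logq (fun i => -(m i : ℂ)) τ) - Finsupp.single 0
          (BakerAkhiezer.coeffQuasiminuscule P logq (fun i => -(m i : ℂ)) τ)) +
        Finsupp.single 0 (algebraMap ℂ _ (∑ τ ∈ BakerAkhiezer.weylOrbit P π,
          BakerAkhiezer.qPow logq
            (-2 * P.toLinearMap (BakerAkhiezer.rho b fun i => -(m i : ℂ)) τ))), ?_⟩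
      rw [F.diffOp_add, F.diffOp_sum, BakerAkhiezer.macdonaldQuasiminuscule]
      congr 1
      · refine Finset.sum_congr rfl fun τ _ => ?_
        rw [F.diffOp_sub, F.diffOp_single, F.diffOp_single]
        rfl
      · refine LinearMap.ext fun f => ?_
        rw [F.diffOp_single, LinearMap.comp_apply, AlgEquiv.toLinearMap_apply, F.T_zero,
          LinearMap.mulLeft_apply, ← Algebra.smul_def]
        rfl
    have hz : ∀ z, BakerAkhiezer.macdonaldQuasiminuscule b logq (fun i => -(m i : ℂ)) π (F.ev c z) =
        BakerAkhiezer.orbitSum P logq π z • F.ev c z := by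
      intro z
      rw [← hc.sum_macdonaldCoeff_of_isQuasiminuscule hq' hm hcρ hπ z,
        BakerAkhiezer.macdonaldQuasiminuscule, LinearMap.add_apply, LinearMap.sum_apply]
      refine congrArg₂ _ (Finset.sum_congr rfl fun τ _ => ?_) rfl
      rw [BakerAkhiezer.coeffQuasiminuscule_eq, mul_sub]
      nth_rewrite 3 [← F.T_zero (F.ev c z)]
      rfl
    rw [he]
    refine huniq _ _ fun z => ?_
    rw [hd', ← he, hz]
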